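/- Setting. Let $\mathbb K$ be $\mathbb R$ or $\mathbb C$. A \emph{foliated sub-ring sheaf} $(M,\theta,\mathcal R,E)$ consists of an analytic manifold $M$ of dimension $m$ over $\mathbb K$; a finite ordered list $E$ of closed smooth hypersurfaces of $M$ with simple normal crossings (SNC); a coherent sub-sheaf $\theta\subset Der_M$ with stalks closed under the Lie bracket, of constant generic rank $d$, tangent to $E$ (that is, $\theta\subset Der_M(-\log E)$); and a locally finitely generated sheaf of sub-algebras $\mathcal R\subset\mathcal O_M$ such that each stalk has generators $f_1,\dots,f_n$ with $df_1\wedge\dots\wedge df_n\not\equiv0$ and $df_1\wedge\dots\wedge df_n\wedge dg\equiv 0$ for every $g$ in the stalk. A germ $g$ is a \emph{first integral} of $\theta$ if $X(g)=0$ for all $X\in\theta_p$. Monomial coordinates. Coordinates $(\mathbf u,\mathbf w)=(u_1,\dots,u_k,w_{k+1},\dots,w_m)$ centred at $p$ are \emph{monomial} if, near $p$ and up to re-indexing, $E=\{u_1\cdots u_l=0\}$ for some $l\le k$; $\theta_p\subset Der_p(-\log E)$; $\theta_p$ is generated by $d$ vector fields, namely $\partial_{w_{k+1}},\dots,\partial_{w_m}$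 and $d-(m-k)$ fields $\sum_{j\le k}\alpha_{i,j}u_j\partial_{u_j}$ with $\alpha_{i,j}\in\mathbb Q$; and every involutive $\omega\subset Der_p(-\log E)$ of rank $d$ with $\theta_p\subset\omega$ equals $\theta_p$. Invariant. For generators $f_1,\dots,f_n$ of $\mathcal R_p$ and monomial coordinates, write $f_i=g_i+\mathbf u^{\delta}T_i$, where the $g_i$ are first integrals, no monomial in the Taylor expansions of the $\mathbf u^\delta T_i$ is a first integral, and the multi-index $\delta$ is the largest possible. The tangency order $\nu(p,\theta,\mathcal R)\in\mathbb N\cup\{\infty\}$ is the minimum of the $|\lambda|$ such that $\partial_{\mathbf w}^\lambda T_i$ is a unit for some $i$, taken over all monomial coordinate systems and systems of generators at $p$ ($\infty$ if there is none). Prepared Normal Form. It holds at $p$ if $\nu=\nu(p,\theta,\mathcal R)<\infty$ and there are generators $f_1,\dots,f_n$ of $\mathcal R_p$ and monomial coordinates $(\mathbf u,v,\mathbf w)$ with $\partial_v\in\theta_p$ (the regular coordinates being $v$ and $\mathbf w$) such that $$T_1=v^\nu U+\sum_{j=1}^{\nu-2}v^j\mathbf u^{\mathbf r_{1,j}}b_{1,j}(\mathbf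 u,\mathbf w)+b_{1,0}(\mathbf u,\mathbf w),\qquad T_i=v^\nu\bar T_i+\sum_{j=1}^{\nu-1}v^j\mathbf u^{\mathbf r_{i,j}}b_{i,j}(\mathbf u,\mathbf w)+b_{i,0}(\mathbf u,\mathbf w)\quad(i\ge2),$$ where $U$ is a unit; for $0<j<\nu$ each $b_{i,j}$ is either zero or a unit, with $\mathbf r_{i,j}\ne0$ in the latter case; and either all $b_{i,0}$ vanish, or $b_{i_0,0}=\mathbf u^\beta w_1^\epsilon$ for some index $i_0$ and some $\epsilon\in\{0,1\}$, where $w_1$ is one of the coordinates $\mathbf w$ and $\mathbf u^\beta$ divides every $b_{i,0}$. Blowings-up. A closed submanifold $C$ of positive codimension, having SNC with $E$, is a \emph{$\theta$-admissible centre} if there is $0\le d_0\le d$ such that at the points of $C$ the ideals $\Gamma_{\theta,k}(\mathcal I_C)$ generated by the determinants $\det[X_i(f_j)]_{i,j\le k}$, $X_i\in\theta$, $f_j\in\mathcal I_C$, are equal to the whole ring for $k\le d_0$ and contained in $\mathcal I_C$ for $d_0<k\le d$. The transform of $(M,\theta,\mathcal R,E)$ under the blowing-up $\sigma:\widetilde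 M\to M$ of $C$ is $(\widetilde M,\widetilde\theta,\widetilde{\mathcal R},\widetilde E)$, where $\widetilde E$ consists of the strict transforms of the components of $E$ followed by $\sigma^{-1}(C)$; $\widetilde\theta$ consists of the germs in $Der_{\widetilde M}(-\log\widetilde E)$ that belong to the $\mathcal O_{\widetilde M}$-module generated by $\sigma^*\theta$ (analytic strict transform); and $\widetilde{\mathcal R}$ is generated by the $f\circ\sigma$, $f\in\mathcal R$. A sequence of blowings-up is \emph{combinatorial} with respect to a divisor $F$ if the centres are strata (intersections of components) of $F$ and of its successive total transforms. Lemma. Let $(M,\theta,\mathcal R,E)$ be a foliated sub-ring sheaf that satisfies the Prepared Normal Form at a point $p$, in coordinates $(\mathbf u,v,\mathbf w)$ as above, with $1<\nu(p,\theta,\mathcal R)<\infty$. Then, for every sufficiently small open neighbourhood $M_0$ of $p$, there exists a finite sequence of $\theta$-admissible blowings-up $$\tau:(M_r,\theta_r,\mathcal R_r,E_r)\to(M_0,\theta_0,\mathcal R_0,E_0)$$ starting at the restriction of $(M,\theta,\mathcal R,E)$ to $M_0$, which is combinatorial with respect to $F=\{u_1\cdots u_k\,v=0\}$, such that (1) if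 $\mathcal J$ denotes the ideal sheaf on $M_0$ generated by $v^\nu$, by the $v^j\mathbf u^{\mathbf r_{i,j}}$ with $0<j<\nu$ and $b_{i,j}\neq0$, and by $\mathbf u^\beta$ if the $b_{i,0}$ are not all zero, then $\mathcal J\cdot\mathcal O_{M_r}$ is principal with support contained in $E_r$; (2) $\nu(q,\theta_r,\mathcal R_r)<\nu(p,\theta,\mathcal R)$ for every $q\in\tau^{-1}(p)$. -/

import Mathlib

open Set Filter Topology
open scoped Manifold ContDiff

universe u

/-! ## Analytic manifolds and germs of analytic functions -/

/-- Germs of `𝕜`-valued functions form a `𝕜`-algebra (with the scalar action of Mathlib). -/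
noncomputable instance germAlgebra {𝕜 : Type} [RCLike 𝕜] {α : Type u} (l : Filter α) :
    Algebra 𝕜 (Germ l 𝕜) :=
  Algebra.ofModule
    (fun r x y => by
      induction x using Germ.inductionOn
      induction y using Germ.inductionOn
      simp only [← Germ.coe_smul, ← Germ.coe_mul, smul_mul_assoc])
    (fun r x y => by
      induction x using Germ.inductionOn
      induction y using Germ.inductionOn
      simp only [← Germ.coe_smul, ← Germ.coe_mul, mul_smul_comm])

/-- A (Hausdorff) analytic manifold of dimension `m` over `𝕜`. -/
structure AnMfd (𝕜 : Type) [RCLike 𝕜] (m : ℕ) : Type (u + 1) where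
  carrier : Type u
  [top : TopologicalSpace carrier]
  [charted : ChartedSpace (Fin m → 𝕜) carrier]
  [mfd : IsManifold 𝓘(𝕜, Fin m → 𝕜) ω carrier]
  [t2 : T2Space carrier]

namespace AnMfd

instance {𝕜 : Type} [RCLike 𝕜] {m : ℕ} : CoeSort (AnMfd.{u} 𝕜 m) (Type u) := ⟨AnMfd.carrier⟩

attribute [instance] AnMfd.top AnMfd.charted AnMfd.mfd AnMfd.t2

end AnMfd

section Basic

variable {𝕜 : Type} [RCLike 𝕜] {m : ℕ}

/-- Analyticity at a point of a `𝕜`-valued function. -/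
def IsAnAt {M : AnMfd.{u} 𝕜 m} (f : M → 𝕜) (p : M) : Prop :=
  ContMDiffAt 𝓘(𝕜, Fin m → 𝕜) 𝓘(𝕜, 𝕜) ω f p

theorem IsAnAt.add {M : AnMfd.{u} 𝕜 m} {f g : M → 𝕜} {p : M} (hf : IsAnAt f p)
    (hg : IsAnAt g p) : IsAnAt (f + g) p :=
  ContMDiffAt.add hf hg

theorem IsAnAt.mul {M : AnMfd.{u} 𝕜 m} {f g : M → 𝕜} {p : M} (hf : IsAnAt f p)
    (hg : IsAnAt g p) : IsAnAt (f * g) p :=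
  ContMDiffAt.smul hf hg

theorem IsAnAt.const_smul {M : AnMfd.{u} 𝕜 m} {f : M → 𝕜} {p : M} (r : 𝕜)
    (hf : IsAnAt f p) : IsAnAt (r • f) p :=
  ContMDiffAt.smul (contMDiffAt_const :
    ContMDiffAt 𝓘(𝕜, Fin m → 𝕜) 𝓘(𝕜, 𝕜) ω (fun _ : M => r) p) hf

/-- The local ring `𝒪_p` of germs at `p` of analytic functions. -/
noncomputable def AnGerm {M : AnMfd.{u} 𝕜 m} (p : M) : Subalgebra 𝕜 (Germ (𝓝 p) 𝕜) where
  carrier := {g | ∃ f : M → 𝕜, IsAnAt f p ∧ (f : Germ (𝓝 p) 𝕜) = g}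
  mul_mem' := by
    rintro _ _ ⟨f, hf, rfl⟩ ⟨g, hg, rfl⟩
    exact ⟨f * g, hf.mul hg, rfl⟩
  add_mem' := by
    rintro _ _ ⟨f, hf, rfl⟩ ⟨g, hg, rfl⟩
    exact ⟨f + g, hf.add hg, rfl⟩
  algebraMap_mem' := by
    intro r
    refine ⟨fun _ => r, contMDiffAt_const, ?_⟩
    rw [Algebra.algebraMap_eq_smul_one]
    change ((fun _ => r : M → 𝕜) : Germ (𝓝 p) 𝕜) = ((r • (1 : M → 𝕜) : M → 𝕜) : Germ (𝓝 p) 𝕜)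
    congr 1
    ext x
    simp

/-- The germ at `p` of a function analytic at `p`. -/
noncomputable def toGerm {M : AnMfd.{u} 𝕜 m} {p : M} (f : M → 𝕜) (hf : IsAnAt f p) : AnGerm p :=
  ⟨(f : Germ (𝓝 p) 𝕜), f, hf, rfl⟩

/-- The value at `p` of a germ. -/
noncomputable def germVal {M : AnMfd.{u} 𝕜 m} {p : M} (g : AnGerm p) : 𝕜 := Germ.value g.1

/-- Germs at `p` of analytic vector fields: the derivations of `𝒪_p`. -/
abbrev VField {M : AnMfd.{u} 𝕜 m} (p : M) : Type u := Derivation 𝕜 (AnGerm p) (AnGerm p)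

/-- The ideal in `𝒪_p` of the germs that vanish on the set `S`. -/
noncomputable def vanIdeal {M : AnMfd.{u} 𝕜 m} (S : Set M) (p : M) : Ideal (AnGerm p) where
  carrier := {g | ∃ f : M → 𝕜, (f : Germ (𝓝 p) 𝕜) = g.1 ∧ ∀ᶠ x in 𝓝 p, x ∈ S → f x = 0}
  add_mem' := by
    rintro ⟨_, _⟩ ⟨_, _⟩ ⟨f, rfl, hf⟩ ⟨g, rfl, hg⟩
    refine ⟨f + g, rfl, ?_⟩
    filter_upwards [hf, hg] with x h1 h2 hx
    simp [h1 hx, h2 hx]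
  zero_mem' := ⟨0, rfl, by simp⟩
  smul_mem' := by
    rintro ⟨_, c, _, rfl⟩ ⟨_, _⟩ ⟨g, rfl, hg⟩
    refine ⟨c * g, rfl, ?_⟩
    filter_upwards [hg] with x h1 hx
    simp [h1 hx]

/-- `Der_p(-log E)`: the germs of vector fields that are tangent to every component of `E`. -/
noncomputable def derLog {M : AnMfd.{u} 𝕜 m} (E : List (Set M)) (p : M) :
    Submodule (AnGerm p) (VField p) where
  carrier := {D | ∀ H ∈ E, ∀ g ∈ vanIdeal H p, D g ∈ vanIdeal H p}
  add_mem' := by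
    intro D D' h h' H hH g hg
    exact add_mem (h H hH g hg) (h' H hH g hg)
  zero_mem' := by
    intro H hH g hg
    exact zero_mem _
  smul_mem' := by
    intro c D h H hH g hg
    exact Ideal.mul_mem_left _ c (h H hH g hg)

/-! ## Analytic maps and pull-back -/

/-- Analytic maps. -/
abbrev AnMap (N M : AnMfd.{u} 𝕜 m) : Type u :=
  ContMDiffMap 𝓘(𝕜, Fin m → 𝕜) 𝓘(𝕜, Fin m → 𝕜) N M ω

/-- The pull-back `σ^* : 𝒪_{σ(q)} → 𝒪_q`. -/
noncomputable def pull {N M : AnMfd.{u} 𝕜 m} (σ : AnMap N M) (q : N) : AnGerm (σ q) →ₐ[𝕜] AnGerm q where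
  toFun g := ⟨g.1.compTendsto σ σ.contMDiff.continuous.continuousAt, by
    obtain ⟨_, f, hf, rfl⟩ := g
    exact ⟨f ∘ σ, ContMDiffAt.comp q hf σ.contMDiff.contMDiffAt, rfl⟩⟩
  map_one' := rfl
  map_mul' := by
    rintro ⟨_, f, _, rfl⟩ ⟨_, g, _, rfl⟩
    rfl
  map_zero' := rfl
  map_add' := by
    rintro ⟨_, f, _, rfl⟩ ⟨_, g, _, rfl⟩
    rfl
  commutes' := by
    intro r
    apply Subtype.ext
    simp only [Algebra.algebraMap_eq_smul_one]
    rfl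

/-! ## Charts and coordinate vector fields -/

/-- An analytic coordinate system `(x_1, …, x_m)` centred at `p`. -/
structure CenteredChart {M : AnMfd.{u} 𝕜 m} (p : M) where
  e : OpenPartialHomeomorph M (Fin m → 𝕜)
  mem_atlas : e ∈ IsManifold.maximalAtlas 𝓘(𝕜, Fin m → 𝕜) ω M
  mem_source : p ∈ e.source
  map_center : e p = 0

/-- The function `∂f/∂x_j` in the chart `e`. -/
noncomputable def partialFun {M : AnMfd.{u} 𝕜 m} (e : OpenPartialHomeomorph M (Fin m → 𝕜))
    (j : Fin m) (f : M → 𝕜) : M → 𝕜 :=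
  fun x => fderiv 𝕜 (f ∘ e.symm) (e x) (Pi.single j 1)

theorem IsAnAt.contDiffAt_symm {M : AnMfd.{u} 𝕜 m} {p : M} (c : CenteredChart p)
    {f : M → 𝕜} (hf : IsAnAt f p) : ContDiffAt 𝕜 ω (f ∘ c.e.symm) (c.e p) := by
  rw [← contMDiffAt_iff_contDiffAt]
  refine ContMDiffAt.comp (c.e p) (I' := 𝓘(𝕜, Fin m → 𝕜)) ?_
    (contMDiffAt_symm_of_mem_maximalAtlas c.mem_atlas (c.e.map_source c.mem_source))
  rw [c.e.left_inv c.mem_source]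
  exact hf

theorem isAnAt_partialFun {M : AnMfd.{u} 𝕜 m} {p : M} (c : CenteredChart p) (j : Fin m)
    {f : M → 𝕜} (hf : IsAnAt f p) : IsAnAt (partialFun c.e j f) p := by
  have h2 : ContDiffAt 𝕜 ω
      (fun y => fderiv 𝕜 (f ∘ c.e.symm) y (Pi.single j (1 : 𝕜))) (c.e p) :=
    ((hf.contDiffAt_symm c).fderiv_right (m := ω) le_rfl).clm_apply contDiffAt_const
  exact ContMDiffAt.comp p h2.contMDiffAt
    (contMDiffAt_of_mem_maximalAtlas c.mem_atlas c.mem_source)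

theorem partialFun_congr {M : AnMfd.{u} 𝕜 m} {p : M} (c : CenteredChart p) (j : Fin m)
    {f g : M → 𝕜} (h : f =ᶠ[𝓝 p] g) : partialFun c.e j f =ᶠ[𝓝 p] partialFun c.e j g := by
  have h1 : ∀ᶠ x in 𝓝 p, f =ᶠ[𝓝 x] g := eventually_eventually_nhds.2 h
  filter_upwards [h1, c.e.open_source.mem_nhds c.mem_source] with x hx hxs
  have h2 : f ∘ c.e.symm =ᶠ[𝓝 (c.e x)] g ∘ c.e.symm := by
    have ht : Tendsto c.e.symm (𝓝 (c.e x)) (𝓝 x) := by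
      have := c.e.continuousAt_symm (c.e.map_source hxs)
      rwa [ContinuousAt, c.e.left_inv hxs] at this
    exact ht.eventually hx
  simp only [partialFun]
  rw [h2.fderiv_eq]

theorem eventually_differentiableAt_symm {M : AnMfd.{u} 𝕜 m} {p : M} (c : CenteredChart p)
    {f : M → 𝕜} (hf : IsAnAt f p) :
    ∀ᶠ x in 𝓝 p, DifferentiableAt 𝕜 (f ∘ c.e.symm) (c.e x) := by
  have h : ∀ᶠ y in 𝓝 (c.e p), ContDiffAt 𝕜 1 (f ∘ c.e.symm) y :=
    ((hf.contDiffAt_symm c).of_le (by simp)).eventually (by simp)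
  filter_upwards [(c.e.continuousAt c.mem_source).eventually h] with x hx
  exact hx.differentiableAt (by simp)

/-- The germ `∂g/∂x_j`, computed with any representative of `g`. -/
noncomputable def partialGerm {M : AnMfd.{u} 𝕜 m} {p : M} (c : CenteredChart p) (j : Fin m)
    (g : AnGerm p) : AnGerm p :=
  toGerm (partialFun c.e j g.2.choose) (isAnAt_partialFun c j g.2.choose_spec.1)

theorem partialGerm_toGerm {M : AnMfd.{u} 𝕜 m} {p : M} (c : CenteredChart p) (j : Fin m)
    (f : M → 𝕜) (hf : IsAnAt f p) :
    partialGerm c j (toGerm f hf) = toGerm (partialFun c.e j f) (isAnAt_partialFun c j hf) := by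
  apply Subtype.ext
  exact Germ.coe_eq.2 (partialFun_congr c j (Germ.coe_eq.1 (toGerm f hf).2.choose_spec.2))

/-- The coordinate vector field `∂/∂x_j`. -/
noncomputable def coordDer {M : AnMfd.{u} 𝕜 m} {p : M} (c : CenteredChart p) (j : Fin m) :
    VField p :=
  Derivation.mk'
    { toFun := partialGerm c j
      map_add' := by
        rintro ⟨_, f, hf, rfl⟩ ⟨_, g, hg, rfl⟩
        change partialGerm c j (toGerm (f + g) (hf.add hg)) =
          partialGerm c j (toGerm f hf) + partialGerm c j (toGerm g hg)
        rw [partialGerm_toGerm, partialGerm_toGerm, partialGerm_toGerm]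
        apply Subtype.ext
        refine Germ.coe_eq.2 ?_
        filter_upwards [eventually_differentiableAt_symm c hf,
          eventually_differentiableAt_symm c hg] with x h1 h2
        change fderiv 𝕜 (f ∘ c.e.symm + g ∘ c.e.symm) (c.e x) _ = _
        rw [fderiv_add h1 h2]
        rfl
      map_smul' := by
        rintro r ⟨_, f, hf, rfl⟩
        change partialGerm c j (toGerm (r • f) (hf.const_smul r)) = r • partialGerm c j (toGerm f hf)
        rw [partialGerm_toGerm, partialGerm_toGerm]
        apply Subtype.ext
        refine Germ.coe_eq.2 ?_
        filter_upwards [eventually_differentiableAt_symm c hf] with x h1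
        change fderiv 𝕜 (r • (f ∘ c.e.symm)) (c.e x) _ = _
        rw [fderiv_const_smul h1]
        rfl }
    (by
      rintro ⟨_, f, hf, rfl⟩ ⟨_, g, hg, rfl⟩
      change partialGerm c j (toGerm (f * g) (hf.mul hg)) =
        toGerm f hf * partialGerm c j (toGerm g hg) + toGerm g hg * partialGerm c j (toGerm f hf)
      rw [partialGerm_toGerm, partialGerm_toGerm, partialGerm_toGerm]
      apply Subtype.ext
      refine Germ.coe_eq.2 ?_
      filter_upwards [eventually_differentiableAt_symm c hf,
        eventually_differentiableAt_symm c hg,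
        c.e.open_source.mem_nhds c.mem_source] with x h1 h2 hx
      change fderiv 𝕜 ((f ∘ c.e.symm) * (g ∘ c.e.symm)) (c.e x) _ = _
      rw [fderiv_mul h1 h2]
      simp [partialFun, c.e.left_inv hx])

theorem isAnAt_coord {M : AnMfd.{u} 𝕜 m} {p : M} (c : CenteredChart p) (j : Fin m) :
    IsAnAt (fun x => c.e x j) p := by
  have h := contMDiffAt_of_mem_maximalAtlas c.mem_atlas c.mem_source
  exact contMDiffAt_pi_space.1 h j

/-- The germ of the coordinate function `x_j`. -/
noncomputable def coordGerm {M : AnMfd.{u} 𝕜 m} {p : M} (c : CenteredChart p) (j : Fin m) :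
    AnGerm p :=
  toGerm (fun x => c.e x j) (isAnAt_coord c j)

/-- The monomial `x^a = ∏ x_j^{a_j}`. -/
noncomputable def mono {M : AnMfd.{u} 𝕜 m} {p : M} (c : CenteredChart p) (a : Fin m → ℕ) :
    AnGerm p :=
  ∏ j, coordGerm c j ^ a j

/-- The iterated derivative `∂^a = ∂_1^{a_1} ⋯ ∂_m^{a_m}`. -/
noncomputable def iterDer {M : AnMfd.{u} 𝕜 m} {p : M} (c : CenteredChart p) (a : Fin m → ℕ) :
    Module.End 𝕜 (AnGerm p) :=
  (List.ofFn fun j => ((coordDer c j : VField p) : Module.End 𝕜 (AnGerm p)) ^ a j).prod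

/-- The monomial `x^a` occurs (with non-zero coefficient) in the Taylor expansion of `g`. -/
def Occurs {M : AnMfd.{u} 𝕜 m} {p : M} (c : CenteredChart p) (a : Fin m → ℕ)
    (g : AnGerm p) : Prop :=
  germVal (iterDer c a g) ≠ 0

/-! ## Foliated sub-ring sheaves -/

/-- The data of a foliated sub-ring sheaf `(M, θ, R, E)`: the manifold, the leaf dimension `d`
of `θ`, the ordered list of the components of the divisor `E`, and the stalks of `θ ⊆ Der_M`
and of `R ⊆ 𝒪_M`. The axioms are in `FolSub.IsFoliatedSubring`. -/
structure FolSub (𝕜 : Type) [RCLike 𝕜] (m : ℕ) : Type (u + 1) where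
  M : AnMfd.{u} 𝕜 m
  leafDim : ℕ
  E : List (Set M)
  θ : ∀ p : M, Submodule (AnGerm p) (VField p)
  R : ∀ p : M, Subalgebra 𝕜 (AnGerm p)

/-- The family of germs `D` is an analytic vector field on the open set `U`. -/
def IsFieldOn {M : AnMfd.{u} 𝕜 m} (U : Set M) (D : ∀ q : M, VField q) : Prop :=
  ∀ V : Set M, IsOpen V → V ⊆ U → ∀ (f : M → 𝕜) (hf : ∀ q ∈ V, IsAnAt f q),
    ∃ (g : M → 𝕜) (hg : ∀ q ∈ V, IsAnAt g q),
      ∀ q (hq : q ∈ V), D q (toGerm f (hf q hq)) = toGerm g (hg q hq)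

/-- Stability under the Lie bracket. -/
def IsInvolutive {M : AnMfd.{u} 𝕜 m} {p : M} (Θ : Submodule (AnGerm p) (VField p)) : Prop :=
  ∀ D ∈ Θ, ∀ D' ∈ Θ, ⁅D, D'⁆ ∈ Θ

/-- In the coordinates `c` centred at `p`, the components `E^{(i)}` of `E` through `p` are pairwise
distinct coordinate hyperplanes `{x_{j(i)} = 0}`. -/
def IsSNCChart {M : AnMfd.{u} 𝕜 m} {p : M} (E : List (Set M)) (c : CenteredChart p)
    (j : Fin E.length → Fin m) : Prop :=
  (∀ i i', p ∈ E.get i → p ∈ E.get i' → j i = j i' → i = i') ∧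
  ∀ i, p ∈ E.get i → ∀ x ∈ c.e.source, x ∈ E.get i ↔ c.e x (j i) = 0

/-- `f` is a (finite) system of generators of the stalk of `R` at `p`. -/
def FolSub.IsGenSystem (X : FolSub.{u} 𝕜 m) {p : X.M} {n : ℕ} (f : Fin n → AnGerm p) : Prop :=
  Algebra.adjoin 𝕜 (Set.range f) = X.R p

/-- `(M, θ, R, E)` is a foliated sub-ring sheaf. -/
structure FolSub.IsFoliatedSubring (X : FolSub.{u} 𝕜 m) : Prop where
  /-- `E` consists of closed smooth hypersurfaces with simple normal crossings. -/
  closed : ∀ H ∈ X.E, IsClosed H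
  snc : ∀ p : X.M, ∃ (c : CenteredChart p) (j : Fin X.E.length → Fin m), IsSNCChart X.E c j
  /-- `θ` is a coherent (that is, locally finitely generated) sub-sheaf of `Der_M`. -/
  coherent : ∀ p : X.M, ∃ U : Set X.M, IsOpen U ∧ p ∈ U ∧
    ∃ (s : ℕ) (D : Fin s → ∀ q : X.M, VField q), (∀ i, IsFieldOn U (D i)) ∧
      ∀ q ∈ U, X.θ q = Submodule.span (AnGerm q) (Set.range fun i => D i q)
  involutive : ∀ p : X.M, IsInvolutive (X.θ p)
  /-- the leaf dimension, that is the generic rank of `θ` -/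
  rank : ∀ p : X.M, Module.finrank (AnGerm p) (X.θ p) = X.leafDim
  tangent : ∀ p : X.M, X.θ p ≤ derLog X.E p
  /-- `R` is locally finitely generated. -/
  ring_coherent : ∀ p : X.M, ∃ U : Set X.M, IsOpen U ∧ p ∈ U ∧
    ∃ (n : ℕ) (f : Fin n → X.M → 𝕜) (hf : ∀ i, ∀ q ∈ U, IsAnAt (f i) q),
      ∀ q (hq : q ∈ U), X.IsGenSystem fun i => toGerm (f i) (hf i q hq)
  /-- `R_p` has generators with `df_1 ∧ ⋯ ∧ df_n ≢ 0` and `df_1 ∧ ⋯ ∧ df_n ∧ dg ≡ 0` for all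
  `g ∈ R_p`; both conditions are tested on tuples of vector fields. -/
  ring_independent : ∀ p : X.M, ∃ (n : ℕ) (f : Fin n → AnGerm p), X.IsGenSystem f ∧
    (∃ D : Fin n → VField p, Matrix.det (Matrix.of fun i j => D i (f j)) ≠ 0) ∧
    ∀ g ∈ X.R p, ∀ D : Fin (n + 1) → VField p,
      Matrix.det (Matrix.of fun i j : Fin (n + 1) =>
        D i ((Fin.snoc f g : Fin (n + 1) → AnGerm p) j)) = 0

/-! ## Transforms and blowings-up -/

/-- The stalk at `q` of the analytic strict transform of `θ` under `σ`: the germs `D` of vector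
fields tangent to `E'` that lie in the `𝒪_q`-module generated by the meromorphic lifts `σ^*X`,
`X ∈ θ_{σ(q)}`. Since `σ^*X (f ∘ σ) = X(f) ∘ σ`, and `σ` is an isomorphism over a dense
open set, this is tested on the pulled back germs. -/
noncomputable def strictField {N M : AnMfd.{u} 𝕜 m} (σ : AnMap N M) (E' : List (Set N)) (q : N)
    (Θ : Submodule (AnGerm (σ q)) (VField (σ q))) : Submodule (AnGerm q) (VField q) :=
  derLog E' q ⊓
    Submodule.comap
      ({ toFun := fun D f => D (pull σ q f)
         map_add' := fun _ _ => rfl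
         map_smul' := fun _ _ => rfl } :
        VField q →ₗ[AnGerm q] (AnGerm (σ q) → AnGerm q))
      (Submodule.span (AnGerm q)
        {φ : AnGerm (σ q) → AnGerm q | ∃ D ∈ Θ, φ = fun f => pull σ q (D f)})

/-- The transform of `(M, θ, R, E)` under `σ : N → M`, with new divisor `E'`: the analytic strict
transform of `θ`, and the sub-ring generated by the pull-backs of the elements of `R`. -/
noncomputable def FolSub.transform (X : FolSub.{u} 𝕜 m) (N : AnMfd.{u} 𝕜 m) (σ : AnMap N X.M)
    (E' : List (Set N)) : FolSub.{u} 𝕜 m where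
  M := N
  leafDim := X.leafDim
  E := E'
  θ := fun q => strictField σ E' q (X.θ (σ q))
  R := fun q => (X.R (σ q)).map (pull σ q)

/-- An open subset as a manifold. -/
noncomputable def AnMfd.openSub (M : AnMfd.{u} 𝕜 m) (U : TopologicalSpace.Opens M) : AnMfd.{u} 𝕜 m where
  carrier := U

/-- The inclusion of an open subset. -/
noncomputable def AnMfd.incl (M : AnMfd.{u} 𝕜 m) (U : TopologicalSpace.Opens M) : AnMap (M.openSub U) M :=
  ⟨fun x => x.1, contMDiff_subtype_val⟩

/-- The restriction of `(M, θ, R, E)` to an open subset. -/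
noncomputable def FolSub.restrict (X : FolSub.{u} 𝕜 m) (U : TopologicalSpace.Opens X.M) : FolSub.{u} 𝕜 m :=
  X.transform (X.M.openSub U) (X.M.incl U) (X.E.map fun H => X.M.incl U ⁻¹' H)

/-- The `i`-th affine chart of the blowing-up of `{x_j = 0, j ∈ S}`:
`x_i = y_i`, `x_j = y_i y_j` for `j ∈ S`, `j ≠ i`, and `x_j = y_j` for `j ∉ S`. -/
def blowMap (S : Finset (Fin m)) (i : Fin m) (y : Fin m → 𝕜) : Fin m → 𝕜 :=
  fun j => if j ∈ S ∧ j ≠ i then y i * y j else y j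

/-- `σ : N → M` is the blowing-up of the closed submanifold `C`: an isomorphism over `M \ C`,
and over a neighbourhood of each point of `C`, in coordinates where `C = {x_j = 0, j ∈ S}`,
the union of the standard affine charts. -/
structure IsBlowup {N M : AnMfd.{u} 𝕜 m} (σ : AnMap N M) (C : Set M) : Prop where
  off : ∀ p ∉ C, ∃ U : Set M, IsOpen U ∧ p ∈ U ∧ ∃ s : M → N,
    ContMDiffOn 𝓘(𝕜, Fin m → 𝕜) 𝓘(𝕜, Fin m → 𝕜) ω s U ∧
    (∀ x ∈ U, σ (s x) = x) ∧ ∀ y, σ y ∈ U → s (σ y) = y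
  on : ∀ p ∈ C, ∃ e ∈ IsManifold.maximalAtlas 𝓘(𝕜, Fin m → 𝕜) ω M, p ∈ e.source ∧
    ∃ S : Finset (Fin m), S.Nonempty ∧ (∀ x ∈ e.source, x ∈ C ↔ ∀ j ∈ S, e x j = 0) ∧
    ∃ ψ : Fin m → OpenPartialHomeomorph N (Fin m → 𝕜),
      (∀ i ∈ S, ψ i ∈ IsManifold.maximalAtlas 𝓘(𝕜, Fin m → 𝕜) ω N ∧
        (∀ y ∈ (ψ i).source, σ y ∈ e.source ∧ e (σ y) = blowMap S i (ψ i y)) ∧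
        (ψ i).target = blowMap S i ⁻¹' e.target) ∧
      ∀ y, σ y ∈ e.source → ∃ i ∈ S, y ∈ (ψ i).source

/-- The strict transform of a hypersurface `H` under the blowing-up `σ` of `C`. -/
def strictSet {N M : AnMfd.{u} 𝕜 m} (σ : AnMap N M) (C H : Set M) : Set N :=
  closure (σ ⁻¹' (H \ C))

/-- The transform of `(M, θ, R, E)` under the blowing-up `σ` of `C`; the components of the new
divisor are the strict transforms of those of `E`, and the exceptional divisor `σ⁻¹(C)`. -/
noncomputable def FolSub.blowTransform (X : FolSub.{u} 𝕜 m) (N : AnMfd.{u} 𝕜 m) (σ : AnMap N X.M)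
    (C : Set X.M) : FolSub.{u} 𝕜 m :=
  X.transform N σ (X.E.map (strictSet σ C) ++ [σ ⁻¹' C])

/-- The stalk of the generalized Fitting ideal `Γ_{θ,k}(I)`. -/
noncomputable def fitting {M : AnMfd.{u} 𝕜 m} {p : M} (Θ : Submodule (AnGerm p) (VField p)) (k : ℕ)
    (I : Ideal (AnGerm p)) : Ideal (AnGerm p) :=
  Ideal.span {h | ∃ (D : Fin k → VField p) (f : Fin k → AnGerm p),
    (∀ i, D i ∈ Θ) ∧ (∀ j, f j ∈ I) ∧ h = Matrix.det (Matrix.of fun i j => D i (f j))}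

/-- `C` is a `θ`-admissible centre: a closed submanifold (of positive codimension) with simple
normal crossings with `E`, such that for some `d₀ ≤ d`, at the points of `C`, the ideal
`Γ_{θ,k}(I_C)` is trivial for `k ≤ d₀` and is contained in `I_C` for `d₀ < k ≤ d`. -/
structure FolSub.IsAdmissibleCenter (X : FolSub.{u} 𝕜 m) (C : Set X.M) : Prop where
  closed : IsClosed C
  snc : ∀ p ∈ C, ∃ (c : CenteredChart p) (S : Finset (Fin m)) (j : Fin X.E.length → Fin m),
    S.Nonempty ∧ (∀ x ∈ c.e.source, x ∈ C ↔ ∀ s ∈ S, c.e x s = 0) ∧ IsSNCChart X.E c j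
  admissible : ∃ d₀ ≤ X.leafDim, ∀ p ∈ C, ∀ k ≤ X.leafDim,
    (k ≤ d₀ → fitting (X.θ p) k (vanIdeal C p) = ⊤) ∧
    (d₀ < k → fitting (X.θ p) k (vanIdeal C p) ≤ vanIdeal C p)

/-- `C` is a stratum of the divisor with set of components `F`. -/
def IsStratum {M : AnMfd.{u} 𝕜 m} (F : Set (Set M)) (C : Set M) : Prop :=
  ∃ S ⊆ F, S.Finite ∧ S.Nonempty ∧ C = ⋂₀ S

/-- `CombSeq X F Y τ`: the map `τ` is a finite composition of `θ`-admissible blowings-up from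
`(M, θ, R, E) = X` to its transform `Y`, and the centres are strata of the divisor with set of
components `F` and of its successive total transforms. -/
inductive CombSeq : (X : FolSub.{u} 𝕜 m) → Set (Set X.M) → (Y : FolSub.{u} 𝕜 m) →
    (Y.M → X.M) → Prop
  | refl (X : FolSub.{u} 𝕜 m) (F : Set (Set X.M)) : CombSeq X F X id
  | step (X : FolSub.{u} 𝕜 m) (F : Set (Set X.M)) (C : Set X.M) (N : AnMfd.{u} 𝕜 m)
      (σ : AnMap N X.M) (Y : FolSub.{u} 𝕜 m) (τ : Y.M → N)
      (stratum : IsStratum F C) (admissible : X.IsAdmissibleCenter C) (blowup : IsBlowup σ C)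
      (tail : CombSeq (X.blowTransform N σ C) (strictSet σ C '' F ∪ {σ ⁻¹' C}) Y τ) :
      CombSeq X F Y (fun y => σ (τ y))

/-! ## Monomial distributions and the main invariant -/

namespace FolSub

/-- `g` is a first integral of `θ_p`. -/
def IsFirstIntegral (X : FolSub.{u} 𝕜 m) {p : X.M} (g : AnGerm p) : Prop :=
  ∀ D ∈ X.θ p, D g = 0

/-- `c` is a monomial coordinate system `(u, w)` at `p`, where `w` is formed by the coordinates
with index in `reg` and `u` by the others. -/
structure IsMonomialCoord (X : FolSub.{u} 𝕜 m) {p : X.M} (c : CenteredChart p)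
    (reg : Finset (Fin m)) : Prop where
  divisor : ∃ exc ⊆ regᶜ, ∀ᶠ x in 𝓝 p, (∃ H ∈ X.E, x ∈ H) ↔ ∃ j ∈ exc, c.e x j = 0
  tangent : X.θ p ≤ derLog X.E p
  basis : ∃ (s : ℕ) (α : Fin s → Fin m → ℚ), reg.card + s = X.leafDim ∧
    X.θ p = Submodule.span (AnGerm p)
      ((fun j => coordDer c j) '' (reg : Set (Fin m)) ∪
        Set.range fun i => ∑ j ∈ regᶜ, (α i j : 𝕜) • coordGerm c j • coordDer c j)
  maximal : ∀ Θ : Submodule (AnGerm p) (VField p), Θ ≤ derLog X.E p → IsInvolutive Θ →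
    Module.finrank (AnGerm p) Θ = X.leafDim → X.θ p ≤ Θ → X.θ p = Θ

/-- `f_i = g_i + u^δ T_i`, where the `g_i` are first integrals, no monomial of the Taylor expansion
of `u^δ T_i` is a first integral, and the multi-index `δ` is the largest possible. -/
structure IsDecomp (X : FolSub.{u} 𝕜 m) {p : X.M} (c : CenteredChart p)
    (reg : Finset (Fin m)) {n : ℕ} (f g T : Fin n → AnGerm p) (δ : Fin m → ℕ) : Prop where
  supp : ∀ j ∈ reg, δ j = 0
  eq : ∀ i, f i = g i + mono c δ * T i
  integral : ∀ i, X.IsFirstIntegral (g i)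
  not_integral : ∀ i a, Occurs c a (mono c δ * T i) → ¬ X.IsFirstIntegral (mono c a)
  maximal : ∀ δ' : Fin m → ℕ, (∀ j ∈ reg, δ' j = 0) → (∀ i, mono c δ' ∣ f i - g i) → δ' ≤ δ

/-- The tangency order `ν(p, θ, R) ∈ ℕ ∪ {∞}`: the least `|λ|` such that, in some monomial
coordinate system and for some system of generators, `∂_w^λ T_i` is a unit for some `i`. -/
noncomputable def nu (X : FolSub.{u} 𝕜 m) (p : X.M) : ℕ∞ :=
  sInf {N | ∃ (c : CenteredChart p) (reg : Finset (Fin m)), X.IsMonomialCoord c reg ∧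
    ∃ (n : ℕ) (f g T : Fin n → AnGerm p) (δ : Fin m → ℕ),
      X.IsGenSystem f ∧ X.IsDecomp c reg f g T δ ∧
      ∃ (i : Fin n) (lam : Fin m → ℕ), (∀ j ∉ reg, lam j = 0) ∧
        IsUnit (iterDer c lam (T i)) ∧ N = ((∑ j, lam j : ℕ) : ℕ∞)}

/-- The data of a Prepared Normal Form at `p` with finite invariant `ν`:
`T_i = v^ν V_i + ∑_{0 < k < ν} v^k u^{r_{i,k}} b_{i,k}(u, w) + b_{i,0}(u, w)`,
where `v` is the coordinate with index `v ∈ reg`. -/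
structure PreparedForm (X : FolSub.{u} 𝕜 m) (p : X.M) (ν : ℕ) where
  nu_eq : X.nu p = ν
  c : CenteredChart p
  reg : Finset (Fin m)
  monomial : X.IsMonomialCoord c reg
  v : Fin m
  v_mem : v ∈ reg
  n : ℕ
  f : Fin n → AnGerm p
  g : Fin n → AnGerm p
  T : Fin n → AnGerm p
  δ : Fin m → ℕ
  gen : X.IsGenSystem f
  decomp : X.IsDecomp c reg f g T δ
  V : Fin n → AnGerm p
  r : Fin n → ℕ → Fin m → ℕ
  b : Fin n → ℕ → AnGerm p
  r_supp : ∀ i k, ∀ j ∈ reg, r i k j = 0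
  b_indep : ∀ i k, coordDer c v (b i k) = 0
  form : ∀ i, T i = coordGerm c v ^ ν * V i +
    ∑ k ∈ Finset.Ico 1 ν, coordGerm c v ^ k * mono c (r i k) * b i k + b i 0
  /-- the index of the distinguished function, called `T_1` in the normal form: `V` is a unit and
  there is no term with `v^{ν-1}` -/
  i₁ : Fin n
  isUnit : IsUnit (V i₁)
  no_term : ∀ k, 1 ≤ k → k + 1 = ν → b i₁ k = 0
  coeff : ∀ i k, 1 ≤ k → k < ν → b i k = 0 ∨ (IsUnit (b i k) ∧ r i k ≠ 0)
  /-- either all `b_{i,0}` vanish, or some `b_{i₀,0}` is `u^β w_1^ε` with `ε ∈ {0, 1}`, where `w_1`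
  is a coordinate of `w` other than `v` and `u^β` divides all `b_{i,0}` -/
  tail : (∀ i, b i 0 = 0) ∨ ∃ β : Fin m → ℕ, (∀ j ∈ reg, β j = 0) ∧
    (∃ i₀, b i₀ 0 = mono c β ∨ ∃ w ∈ reg, w ≠ v ∧ b i₀ 0 = mono c β * coordGerm c w) ∧
    ∀ i, mono c β ∣ b i 0

namespace PreparedForm

variable {X : FolSub.{u} 𝕜 m} {p : X.M} {ν : ℕ}

/-- The exponents of the monomials `v^ν`, `v^k u^{r_{i,k}}` (`0 < k < ν`, `b_{i,k} ≠ 0`), and `u^β`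
(if the `b_{i,0}` are not all zero; then `β` is unique). -/
def exponents (P : PreparedForm X p ν) : Set (Fin m → ℕ) :=
  {Pi.single P.v ν} ∪
  {a | ∃ i k, 1 ≤ k ∧ k < ν ∧ P.b i k ≠ 0 ∧ a = Pi.single P.v k + P.r i k} ∪
  {β | (∀ j ∈ P.reg, β j = 0) ∧
    (∃ i₀, P.b i₀ 0 = mono P.c β ∨
      ∃ w ∈ P.reg, w ≠ P.v ∧ P.b i₀ 0 = mono P.c β * coordGerm P.c w) ∧
    ∀ i, mono P.c β ∣ P.b i 0}

/-- The stalk at `q` of the total transform, under a map `τ` into the domain of the chart, of the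
ideal generated by the monomials with exponents in `exponents`. -/
noncomputable def pulledIdeal (P : PreparedForm X p ν) {N : AnMfd.{u} 𝕜 m} (τ : N → X.M) (q : N) :
    Ideal (AnGerm q) :=
  Ideal.span {h | ∃ a ∈ P.exponents,
    h.1 = ((fun y => ∏ j, P.c.e (τ y) j ^ a j : N → 𝕜) : Germ (𝓝 q) 𝕜)}

/-- The components `{u_j = 0}`, `{v = 0}` of the divisor `{u_1 ⋯ u_k v = 0}` on the open set `U`. -/
noncomputable def components (P : PreparedForm X p ν) (U : TopologicalSpace.Opens X.M) :
    Set (Set (X.restrict U).M) :=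
  {H | ∃ j, (j ∉ P.reg ∨ j = P.v) ∧ H = {x | P.c.e x.1 j = 0}}

end PreparedForm

end FolSub

end Basic

section Series

variable {𝕜 : Type} [RCLike 𝕜] {m : ℕ}

/-- The value of the monomial with exponent `a` at `x`. -/
def monoEval (a : Fin m →₀ ℕ) (x : Fin m → 𝕜) : 𝕜 := ∏ j, x j ^ a j

theorem norm_monoEval_le (a : Fin m →₀ ℕ) (x : Fin m → 𝕜) {r : ℝ} (hx : ∀ j, ‖x j‖ ≤ r) :
    ‖monoEval a x‖ ≤ r ^ a.degree := by
  rw [monoEval, norm_prod, Finsupp.degree_eq_sum, ← Finset.prod_pow_eq_pow_sum]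
  refine Finset.prod_le_prod (fun _ _ => norm_nonneg _) fun j _ => ?_
  rw [norm_pow]
  exact pow_le_pow_left₀ (norm_nonneg _) (hx j) _

theorem monoEval_add (a b : Fin m →₀ ℕ) (x : Fin m → 𝕜) :
    monoEval (a + b) x = monoEval a x * monoEval b x := by
  simp [monoEval, pow_add, Finset.prod_mul_distrib]

theorem monoEval_zero_right (a : Fin m →₀ ℕ) :
    monoEval a (0 : Fin m → 𝕜) = if a = 0 then 1 else 0 := by
  split_ifs with h
  · simp [monoEval, h]
  · obtain ⟨j, hj⟩ := Finsupp.ne_iff.1 h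
    exact Finset.prod_eq_zero (Finset.mem_univ j) (by simpa using hj)

/-- The function `F` is, near the origin, the sum of the absolutely convergent power series `φ`. -/
def HasSeries (F : (Fin m → 𝕜) → 𝕜) (φ : MvPowerSeries (Fin m) 𝕜) : Prop :=
  ∃ r > (0 : ℝ), Summable (fun a : Fin m →₀ ℕ => ‖φ.coeff a‖ * r ^ a.degree) ∧
    ∀ x, ‖x‖ ≤ r → F x = ∑' a, φ.coeff a * monoEval a x

theorem summable_weight_mono {c : (Fin m →₀ ℕ) → 𝕜} {r s : ℝ} (hs : 0 ≤ s) (hsr : s ≤ r)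
    (h : Summable fun a => ‖c a‖ * r ^ a.degree) : Summable fun a => ‖c a‖ * s ^ a.degree :=
  Summable.of_nonneg_of_le (fun a => by positivity)
    (fun a => mul_le_mul_of_nonneg_left (pow_le_pow_left₀ hs hsr _) (norm_nonneg _)) h

theorem summable_norm_series {c : (Fin m →₀ ℕ) → 𝕜} {r : ℝ}
    (h : Summable fun a => ‖c a‖ * r ^ a.degree) {x : Fin m → 𝕜} (hx : ‖x‖ ≤ r) :
    Summable fun a => ‖c a * monoEval a x‖ := by
  refine Summable.of_nonneg_of_le (fun a => norm_nonneg _) (fun a => ?_) h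
  rw [norm_mul]
  exact mul_le_mul_of_nonneg_left
    (norm_monoEval_le a x fun j => (norm_le_pi_norm x j).trans hx) (norm_nonneg _)

theorem HasSeries.shrink {F : (Fin m → 𝕜) → 𝕜} {φ : MvPowerSeries (Fin m) 𝕜}
    (h : HasSeries F φ) {R : ℝ} (hR : 0 < R) :
    ∃ r > (0 : ℝ), r ≤ R ∧ Summable (fun a : Fin m →₀ ℕ => ‖φ.coeff a‖ * r ^ a.degree) ∧
      ∀ x, ‖x‖ ≤ r → F x = ∑' a, φ.coeff a * monoEval a x := by
  obtain ⟨r, hr, hs, hF⟩ := h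
  exact ⟨min r R, lt_min hr hR, min_le_right _ _,
    summable_weight_mono (lt_min hr hR).le (min_le_left _ _) hs,
    fun x hx => hF x (hx.trans (min_le_left _ _))⟩

theorem HasSeries.congr {F G : (Fin m → 𝕜) → 𝕜} {φ : MvPowerSeries (Fin m) 𝕜}
    (h : HasSeries F φ) (hFG : F =ᶠ[𝓝 0] G) : HasSeries G φ := by
  obtain ⟨ε, hε, hb⟩ := Metric.eventually_nhds_iff_ball.1 hFG
  obtain ⟨r, hr, hrε, hs, hF⟩ := h.shrink (half_pos hε)
  refine ⟨r, hr, hs, fun x hx => ?_⟩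
  rw [← hb x (by rw [mem_ball_zero_iff]; linarith), hF x hx]

theorem HasSeries.add {F G : (Fin m → 𝕜) → 𝕜} {φ ψ : MvPowerSeries (Fin m) 𝕜}
    (hF : HasSeries F φ) (hG : HasSeries G ψ) : HasSeries (F + G) (φ + ψ) := by
  obtain ⟨R, hR, hs, hF⟩ := hF
  obtain ⟨r, hr, hrR, hs', hG⟩ := hG.shrink hR
  have hs1 := summable_weight_mono hr.le hrR hs
  refine ⟨r, hr, Summable.of_nonneg_of_le (fun a => by positivity) (fun a => ?_) (hs1.add hs'),
    fun x hx => ?_⟩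
  · rw [← add_mul, map_add]
    exact mul_le_mul_of_nonneg_right (norm_add_le _ _) (by positivity)
  · rw [Pi.add_apply, hF x (hx.trans hrR), hG x hx, ← Summable.tsum_add
      (summable_norm_series hs1 hx).of_norm (summable_norm_series hs' hx).of_norm]
    simp [add_mul]

theorem HasSeries.const (c : 𝕜) : HasSeries (fun _ : Fin m → 𝕜 => c) (MvPowerSeries.C c) := by
  classical
  refine ⟨1, one_pos, summable_of_ne_finset_zero (s := {0}) fun a ha => ?_, fun x _ => ?_⟩
  · rw [Finset.mem_singleton] at ha
    simp [MvPowerSeries.coeff_C, ha]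
  · rw [tsum_eq_single 0]
    · simp [monoEval]
    · intro a ha
      simp [MvPowerSeries.coeff_C, ha]

theorem coeff_mul_monoEval (φ ψ : MvPowerSeries (Fin m) 𝕜) (a : Fin m →₀ ℕ) (x : Fin m → 𝕜) :
    (φ * ψ).coeff a * monoEval a x = ∑ kl ∈ Finset.HasAntidiagonal.antidiagonal a,
      (φ.coeff kl.1 * monoEval kl.1 x) * (ψ.coeff kl.2 * monoEval kl.2 x) := by
  rw [MvPowerSeries.coeff_mul, Finset.sum_mul]
  refine Finset.sum_congr rfl fun kl hkl => ?_
  have h := Finset.HasAntidiagonal.mem_antidiagonal.1 hkl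
  rw [← h, monoEval_add]
  ring

theorem norm_coeff_mul_le (φ ψ : MvPowerSeries (Fin m) 𝕜) (a : Fin m →₀ ℕ) {r : ℝ} (hr : 0 ≤ r) :
    ‖(φ * ψ).coeff a‖ * r ^ a.degree ≤ ∑ kl ∈ Finset.HasAntidiagonal.antidiagonal a,
      (‖φ.coeff kl.1‖ * r ^ kl.1.degree) * (‖ψ.coeff kl.2‖ * r ^ kl.2.degree) := by
  rw [MvPowerSeries.coeff_mul]
  refine (mul_le_mul_of_nonneg_right (norm_sum_le _ _) (by positivity)).trans ?_
  rw [Finset.sum_mul]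
  refine Finset.sum_le_sum fun kl hkl => ?_
  have h := Finset.HasAntidiagonal.mem_antidiagonal.1 hkl
  rw [← h, map_add, pow_add, norm_mul]
  exact le_of_eq (by ring)

theorem HasSeries.mul {F G : (Fin m → 𝕜) → 𝕜} {φ ψ : MvPowerSeries (Fin m) 𝕜}
    (hF : HasSeries F φ) (hG : HasSeries G ψ) : HasSeries (F * G) (φ * ψ) := by
  obtain ⟨R, hR, hs, hF⟩ := hF
  obtain ⟨r, hr, hrR, hs', hG⟩ := hG.shrink hR
  have hs1 := summable_weight_mono hr.le hrR hs
  have hmul : Summable fun x : (Fin m →₀ ℕ) × (Fin m →₀ ℕ) =>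
      (‖φ.coeff x.1‖ * r ^ x.1.degree) * (‖ψ.coeff x.2‖ * r ^ x.2.degree) :=
    Summable.mul_of_nonneg (f := fun a => ‖φ.coeff a‖ * r ^ a.degree)
      (g := fun a => ‖ψ.coeff a‖ * r ^ a.degree) hs1 hs' (fun a => by positivity) fun a => by positivity
  have key := summable_sum_mul_antidiagonal_of_summable_mul (A := Fin m →₀ ℕ)
    (f := fun a => ‖φ.coeff a‖ * r ^ a.degree) (g := fun a => ‖ψ.coeff a‖ * r ^ a.degree) hmul
  have hsum : Summable fun a => ‖(φ * ψ).coeff a‖ * r ^ a.degree :=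
    Summable.of_nonneg_of_le (fun a => by positivity)
      (fun a => norm_coeff_mul_le φ ψ a hr.le) key
  refine ⟨r, hr, hsum, fun x hx => ?_⟩
  have h1 := summable_norm_series hs1 hx
  have h2 := summable_norm_series hs' hx
  have h3 : Summable fun y : (Fin m →₀ ℕ) × (Fin m →₀ ℕ) =>
    (φ.coeff y.1 * monoEval y.1 x) * (ψ.coeff y.2 * monoEval y.2 x) :=
      summable_mul_of_summable_norm (f := fun a => φ.coeff a * monoEval a x)
        (g := fun a => ψ.coeff a * monoEval a x) h1 h2
  have h4 := Summable.tsum_mul_tsum_eq_tsum_sum_antidiagonal (A := Fin m →₀ ℕ)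
    (f := fun a => φ.coeff a * monoEval a x) (g := fun a => ψ.coeff a * monoEval a x)
    h1.of_norm h2.of_norm h3
  have h5 : (F * G) x = (∑' a, φ.coeff a * monoEval a x) * ∑' a, ψ.coeff a * monoEval a x := by
    rw [Pi.mul_apply, hF x (hx.trans hrR), hG x hx]
  rw [h5, h4]
  exact tsum_congr fun a => (coeff_mul_monoEval φ ψ a x).symm

theorem HasSeries.eval_zero {F : (Fin m → 𝕜) → 𝕜} {φ : MvPowerSeries (Fin m) 𝕜}
    (h : HasSeries F φ) : F 0 = φ.constantCoeff := by
  obtain ⟨r, hr, -, hF⟩ := h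
  rw [hF 0 (by simpa using hr.le), tsum_eq_single 0]
  · simp [monoEval]
  · intro a ha
    simp [monoEval_zero_right, ha]

theorem exists_multilinear_monoEval (a : Fin m →₀ ℕ) (n : ℕ) (h : a.degree = n) :
    ∃ M : ContinuousMultilinearMap 𝕜 (fun _ : Fin n => Fin m → 𝕜) 𝕜,
      (∀ x, M (fun _ => x) = monoEval a x) ∧ ‖M‖ ≤ 1 := by
  classical
  set l := (Finsupp.toMultiset a).toList with hl
  have hlen : l.length = n := by
    rw [hl, Multiset.length_toList, Finsupp.card_toMultiset, ← h]
    rw [Finsupp.degree_apply]; rfl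
  subst hlen
  refine ⟨(ContinuousMultilinearMap.mkPiAlgebra 𝕜 (Fin l.length) 𝕜).compContinuousLinearMap
    fun k => ContinuousLinearMap.proj (l.get k), fun x => ?_, ?_⟩
  · simp only [ContinuousMultilinearMap.compContinuousLinearMap_apply,
      ContinuousLinearMap.proj_apply, ContinuousMultilinearMap.mkPiAlgebra_apply]
    have h1 : ∏ k : Fin l.length, x (l.get k) = (l.map x).prod := by
      rw [← List.prod_ofFn]
      congr 1
      rw [← List.ofFn_get (l := l.map x)]
      simp [List.ofFn_eq_map]
    rw [h1, ← Multiset.prod_coe, ← Multiset.map_coe, hl, Multiset.coe_toList, monoEval,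
      Finsupp.toMultiset_map, Finsupp.prod_toMultiset]
    rw [Finsupp.prod_mapDomain_index (by simp) (by intros; rw [pow_add]), Finsupp.prod_fintype]
    simp
  · refine ContinuousMultilinearMap.opNorm_le_bound zero_le_one fun y => ?_
    simp only [ContinuousMultilinearMap.compContinuousLinearMap_apply,
      ContinuousLinearMap.proj_apply, ContinuousMultilinearMap.mkPiAlgebra_apply, one_mul,
      norm_prod]
    exact Finset.prod_le_prod (fun _ _ => norm_nonneg _) fun k _ => norm_le_pi_norm _ _

theorem HasSeries.analyticAt {F : (Fin m → 𝕜) → 𝕜} {φ : MvPowerSeries (Fin m) 𝕜}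
    (h : HasSeries F φ) : AnalyticAt 𝕜 F 0 := by
  classical
  obtain ⟨r, hr, hs, hF⟩ := h
  choose M hM hMn using fun (a : Fin m →₀ ℕ) => exists_multilinear_monoEval (𝕜 := 𝕜) a _ rfl
  let e : (Σ n : ℕ, {a : Fin m →₀ ℕ // a.degree = n}) ≃ (Fin m →₀ ℕ) :=
    Equiv.sigmaFiberEquiv fun a : Fin m →₀ ℕ => a.degree
  have hfin : ∀ n : ℕ, Finite {a : Fin m →₀ ℕ // a.degree = n} := fun n => by
    refine Set.Finite.subset (Finset.finite_toSet (Finset.finsuppAntidiag Finset.univ n)) ?_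
    intro a ha
    rw [Finset.mem_coe, Finset.mem_finsuppAntidiag]
    exact ⟨by rw [← ha, Finsupp.degree_eq_sum], Finset.subset_univ _⟩
  have hft : ∀ n : ℕ, Fintype {a : Fin m →₀ ℕ // a.degree = n} := fun n => Fintype.ofFinite _
  let p : FormalMultilinearSeries 𝕜 (Fin m → 𝕜) 𝕜 := fun n =>
    ∑ a : {a : Fin m →₀ ℕ // a.degree = n}, φ.coeff a.1 • a.2 ▸ M a.1
  have hcast : ∀ (a : Fin m →₀ ℕ) (n : ℕ) (h : a.degree = n),
      (∀ x, (h ▸ M a : ContinuousMultilinearMap 𝕜 (fun _ : Fin n => Fin m → 𝕜) 𝕜) (fun _ => x)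
        = monoEval a x) ∧
      ‖(h ▸ M a : ContinuousMultilinearMap 𝕜 (fun _ : Fin n => Fin m → 𝕜) 𝕜)‖ ≤ 1 := by
    rintro a n rfl
    exact ⟨hM a, hMn a⟩
  have hs' : Summable fun n => ∑ a : {a : Fin m →₀ ℕ // a.degree = n},
      ‖φ.coeff a.1‖ * r ^ n := by
    have h1 := (e.summable_iff (f := fun a : Fin m →₀ ℕ => ‖φ.coeff a‖ * r ^ a.degree)).2 hs
    have h2 := h1.sigma
    refine h2.congr fun n => ?_
    rw [tsum_fintype]
    refine Finset.sum_congr rfl fun a _ => ?_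
    simp [e, a.2]
  have hrad : (r.toNNReal : ENNReal) ≤ p.radius := by
    refine p.le_radius_of_summable_norm (Summable.of_nonneg_of_le (fun n => by positivity)
      (fun n => ?_) hs')
    rw [Real.coe_toNNReal r hr.le]
    refine (mul_le_mul_of_nonneg_right (norm_sum_le _ _) (by positivity)).trans ?_
    rw [Finset.sum_mul]
    refine Finset.sum_le_sum fun a _ => ?_
    refine mul_le_mul_of_nonneg_right ?_ (by positivity)
    rw [norm_smul]
    exact mul_le_of_le_one_right (norm_nonneg _) (hcast a.1 n a.2).2
  refine HasFPowerSeriesAt.analyticAt (p := p) ⟨(r.toNNReal : ENNReal), hrad, ?_, ?_⟩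
  · simpa using hr
  · intro y hy
    have hy' : ‖y‖ ≤ r := by
      rw [Metric.mem_eball, edist_zero_right] at hy
      have h3 : ‖y‖₊ < r.toNNReal := by exact_mod_cast hy
      have h4 : ‖y‖ < (r.toNNReal : ℝ) := by exact_mod_cast h3
      rw [Real.coe_toNNReal r hr.le] at h4
      exact h4.le
    rw [zero_add, hF y hy']
    have h1 := (summable_norm_series hs hy').of_norm.hasSum
    have h2 := (e.hasSum_iff).2 h1
    have h3 := h2.sigma fun n => hasSum_fintype _
    refine h3.congr_fun fun n => ?_
    rw [sum_apply]
    refine Finset.sum_congr rfl fun a _ => ?_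
    rw [smul_apply, (hcast a.1 n a.2).1, smul_eq_mul]
    rfl

theorem exists_hasSeries {F : (Fin m → 𝕜) → 𝕜} (h : AnalyticAt 𝕜 F 0) :
    ∃ φ : MvPowerSeries (Fin m) 𝕜, HasSeries F φ := by
  classical
  obtain ⟨p, R, hp⟩ := h
  let W := Σ n : ℕ, (Fin n → Fin m)
  let d : W → 𝕜 := fun w => p w.1 fun k => Pi.single (w.2 k) 1
  let cnt : W → (Fin m →₀ ℕ) := fun w => ∑ k, Finsupp.single (w.2 k) 1
  have hdeg : ∀ w, (cnt w).degree = w.1 := fun w => by simp [cnt, map_sum]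
  have hmono : ∀ w (x : Fin m → 𝕜), monoEval (cnt w) x = ∏ k, x (w.2 k) := fun w x => by
    simp only [monoEval, cnt, Finsupp.coe_finsetSum, Finset.sum_apply,
      ← Finset.prod_pow_eq_pow_sum]
    rw [Finset.prod_comm]
    refine Finset.prod_congr rfl fun k _ => ?_
    rw [Finset.prod_eq_single (w.2 k)]
    · simp
    · intro j _ hj
      simp [hj.symm]
    · simp
  have hexp : ∀ n (x : Fin m → 𝕜), p n (fun _ => x) =
      ∑ s : Fin n → Fin m, d ⟨n, s⟩ * monoEval (cnt ⟨n, s⟩) x := fun n x => by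
    have hx : x = ∑ j, x j • (Pi.single j (1 : 𝕜) : Fin m → 𝕜) := by
      ext i
      simp [Finset.sum_apply, Pi.single_apply]
    conv_lhs => rw [hx]
    rw [ContinuousMultilinearMap.map_sum]
    refine Finset.sum_congr rfl fun s _ => ?_
    rw [(p n).map_smul_univ (fun k => x (s k)), hmono, smul_eq_mul, mul_comm]
  obtain ⟨ρ, hρ0, hρR⟩ : ∃ ρ : NNReal, 0 < ρ ∧ (ρ : ENNReal) < R := by
    obtain ⟨ρ, h1, h2⟩ := ENNReal.lt_iff_exists_nnreal_btwn.1 hp.r_pos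
    exact ⟨ρ, by exact_mod_cast h1, h2⟩
  have hsum := p.summable_norm_mul_pow (lt_of_lt_of_le hρR hp.r_le)
  set r : ℝ := ρ / (m + 1) with hr
  have hr0 : 0 < r := by positivity
  have hrρ : r ≤ ρ := div_le_self ρ.2 (by linarith [(Nat.cast_nonneg m : (0 : ℝ) ≤ m)])
  have hmr : m * r ≤ ρ := by
    rw [hr, mul_div_assoc', div_le_iff₀ (by positivity)]
    nlinarith [ρ.2, (Nat.cast_nonneg m : (0 : ℝ) ≤ m)]
  have hdle : ∀ w, ‖d w‖ ≤ ‖p w.1‖ := fun w => by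
    refine ((p w.1).le_opNorm _).trans ?_
    refine mul_le_of_le_one_right (norm_nonneg _) (Finset.prod_le_one (fun _ _ => norm_nonneg _)
      fun k _ => ?_)
    rw [Pi.norm_single, norm_one]
  have hW : Summable fun w : W => ‖d w‖ * r ^ w.1 := by
    refine (summable_sigma_of_nonneg fun w => by positivity).2
      ⟨fun n => Summable.of_finite, Summable.of_nonneg_of_le (fun n => tsum_nonneg fun s => by
        positivity) (fun n => ?_) hsum⟩
    rw [tsum_fintype]
    calc ∑ s : Fin n → Fin m, ‖d ⟨n, s⟩‖ * r ^ n
        ≤ ∑ _s : Fin n → Fin m, ‖p n‖ * r ^ n := Finset.sum_le_sum fun s _ =>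
          mul_le_mul_of_nonneg_right (hdle ⟨n, s⟩) (by positivity)
      _ = ‖p n‖ * (m * r) ^ n := by
          simp [mul_pow]
          ring
      _ ≤ ‖p n‖ * ρ ^ n := by gcongr
  let e : (Σ a : Fin m →₀ ℕ, {w : W // cnt w = a}) ≃ W := Equiv.sigmaFiberEquiv cnt
  have hWe : Summable fun y : Σ a : Fin m →₀ ℕ, {w : W // cnt w = a} =>
      ‖d y.2.1‖ * r ^ y.1.degree := by
    refine ((e.summable_iff).2 hW).congr fun y => ?_
    obtain ⟨a, w, rfl⟩ := y
    simp [e, hdeg]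
  obtain ⟨φ, hφ⟩ : ∃ φ : MvPowerSeries (Fin m) 𝕜,
      ∀ a, φ.coeff a = ∑' w : {w : W // cnt w = a}, d w.1 :=
    ⟨fun a => ∑' w : {w : W // cnt w = a}, d w.1, fun a => rfl⟩
  have hfib : ∀ a, Summable fun w : {w : W // cnt w = a} => ‖d w.1‖ := fun a => by
    have h1 : Summable fun w : {w : W // cnt w = a} => ‖d w.1‖ * r ^ a.degree :=
      hWe.sigma_factor a
    have h2 := h1.mul_right (r ^ a.degree)⁻¹
    refine h2.congr fun w => ?_
    rw [mul_assoc, mul_inv_cancel₀ (pow_pos hr0 _).ne', mul_one]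
  refine ⟨φ, r, hr0, ?_, fun x hx => ?_⟩
  · have hle : ∀ a, ‖φ.coeff a‖ * r ^ a.degree ≤
        ∑' w : {w : W // cnt w = a}, ‖d w.1‖ * r ^ a.degree := fun a => by
      rw [tsum_mul_right, hφ]
      exact mul_le_mul_of_nonneg_right (norm_tsum_le_tsum_norm (hfib a)) (by positivity)
    exact Summable.of_nonneg_of_le (fun a => by positivity) hle hWe.sigma
  · have hx' : x ∈ Metric.eball (0 : Fin m → 𝕜) R := by
      rw [Metric.mem_eball, edist_zero_right]
      refine lt_of_le_of_lt ?_ hρR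
      have : ‖x‖₊ ≤ ρ := hx.trans hrρ
      exact_mod_cast this
    have hs : Summable fun w : W => ‖d w * monoEval (cnt w) x‖ := by
      refine Summable.of_nonneg_of_le (fun _ => norm_nonneg _) (fun w => ?_) hW
      rw [norm_mul]
      refine mul_le_mul_of_nonneg_left ?_ (norm_nonneg _)
      rw [← hdeg w]
      exact norm_monoEval_le _ _ fun j => (norm_le_pi_norm x j).trans hx
    have h1 : HasSum (fun n => p n fun _ => x) (F x) := by simpa using hp.hasSum hx'
    have h2 : F x = ∑' w : W, d w * monoEval (cnt w) x := by
      rw [hs.of_norm.tsum_sigma, ← h1.tsum_eq]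
      refine tsum_congr fun n => ?_
      rw [hexp, tsum_fintype]
    have h3 : Summable fun y => d (e y) * monoEval (cnt (e y)) x :=
      (e.summable_iff (f := fun w : W => d w * monoEval (cnt w) x)).2 hs.of_norm
    rw [h2, ← e.tsum_eq, h3.tsum_sigma]
    refine tsum_congr fun a => ?_
    rw [hφ, ← tsum_mul_right]
    refine tsum_congr fun w => ?_
    obtain ⟨w, rfl⟩ := w
    rfl

theorem HasSeries.eventually_differentiableAt {F : (Fin m → 𝕜) → 𝕜} {φ : MvPowerSeries (Fin m) 𝕜}
    (h : HasSeries F φ) : ∃ ε > (0 : ℝ), ∀ x, ‖x‖ < ε → DifferentiableAt 𝕜 F x := by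
  have h1 : ∀ᶠ x in 𝓝 (0 : Fin m → 𝕜), AnalyticAt 𝕜 F x := h.analyticAt.eventually_analyticAt
  obtain ⟨ε, hε, hb⟩ := Metric.eventually_nhds_iff_ball.1 h1
  exact ⟨ε, hε, fun x hx => (hb x (by simpa using hx)).differentiableAt⟩

theorem hasDerivAt_monoEval (a : Fin m →₀ ℕ) (j : Fin m) (x : Fin m → 𝕜) (t : 𝕜) :
    HasDerivAt (fun t : 𝕜 => monoEval a (x + t • Pi.single j (1 : 𝕜)))
      ((a j : 𝕜) * monoEval (a - Finsupp.single j 1) (x + t • Pi.single j (1 : 𝕜))) t := by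
  have h1 : ∀ (b : Fin m →₀ ℕ) (s : 𝕜), monoEval b (x + s • Pi.single j (1 : 𝕜)) =
      (x j + s) ^ b j * ∏ i ∈ Finset.univ.erase j, x i ^ b i := fun b s => by
    rw [monoEval, ← Finset.mul_prod_erase _ _ (Finset.mem_univ j)]
    congr 1
    · simp
    · refine Finset.prod_congr rfl fun i hi => ?_
      simp [(Finset.ne_of_mem_erase hi)]
  have h2 : HasDerivAt (fun s : 𝕜 => (x j + s) ^ a j * ∏ i ∈ Finset.univ.erase j, x i ^ a i)
      ((a j * (x j + t) ^ (a j - 1)) * ∏ i ∈ Finset.univ.erase j, x i ^ a i) t := by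
    have := ((hasDerivAt_id t).const_add (x j)).pow (a j)
    simpa using this.mul_const (∏ i ∈ Finset.univ.erase j, x i ^ a i)
  refine (h2.congr_of_eventuallyEq (Eventually.of_forall fun s => h1 a s)).congr_deriv ?_
  rw [h1, mul_assoc]
  congr 2
  · simp
  · refine Finset.prod_congr rfl fun i hi => ?_
    simp [(Finset.ne_of_mem_erase hi).symm]

theorem summable_weight_deriv {c : (Fin m →₀ ℕ) → 𝕜} {r : ℝ} (hr : 0 < r) (j : Fin m)
    (h : Summable fun a => ‖c a‖ * r ^ a.degree) :
    Summable fun a : Fin m →₀ ℕ => ‖c a‖ * (a j * (r / 2) ^ (a - Finsupp.single j 1).degree) := by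
  refine Summable.of_nonneg_of_le (fun a => by positivity) (fun a => ?_) (h.mul_left (2 / r))
  have h1 : (a j : ℝ) * (r / 2) ^ (a - Finsupp.single j 1).degree ≤ 2 / r * r ^ a.degree := by
    rcases Nat.eq_zero_or_pos (a j) with h0 | h0
    · rw [h0, Nat.cast_zero, zero_mul]
      positivity
    · have hle : Finsupp.single j 1 ≤ a := by
        rw [Finsupp.single_le_iff]
        exact h0
      have hd : a.degree = (a - Finsupp.single j 1).degree + 1 := by
        conv_lhs => rw [← tsub_add_cancel_of_le hle]
        rw [map_add, Finsupp.degree_single]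
      have hj : a j ≤ (a - Finsupp.single j 1).degree + 1 := by
        rw [← hd]
        exact Finsupp.le_degree j a
      set n := (a - Finsupp.single j 1).degree
      rw [hd]
      have h2 : (n + 1 : ℝ) ≤ 2 * 2 ^ n := by
        have := Nat.lt_two_pow_self (n := n)
        have h3 : n + 1 ≤ 2 * 2 ^ n := by omega
        exact_mod_cast h3
      have h4 : (a j : ℝ) ≤ n + 1 := by exact_mod_cast hj
      calc (a j : ℝ) * (r / 2) ^ n ≤ (2 * 2 ^ n) * (r / 2) ^ n := by
            gcongr
            exact h4.trans h2
        _ = 2 / r * r ^ (n + 1) := by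
            rw [div_pow]
            field_simp
            ring
  calc ‖c a‖ * (a j * (r / 2) ^ (a - Finsupp.single j 1).degree)
      ≤ ‖c a‖ * (2 / r * r ^ a.degree) := by gcongr
    _ = 2 / r * (‖c a‖ * r ^ a.degree) := by ring

theorem tsum_shift (c : (Fin m →₀ ℕ) → 𝕜) (j : Fin m) (x : Fin m → 𝕜) :
    ∑' a, c a * (a j * monoEval (a - Finsupp.single j 1) x) =
      ∑' b, (c (b + Finsupp.single j 1) * (b j + 1)) * monoEval b x := by
  have hinj : Function.Injective fun b : Fin m →₀ ℕ => b + Finsupp.single j 1 :=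
    add_left_injective _
  rw [← hinj.tsum_eq]
  · refine tsum_congr fun b => ?_
    simp [mul_assoc]
  · intro a ha
    have h0 : a j ≠ 0 := fun h => ha (by simp [h])
    refine ⟨a - Finsupp.single j 1, tsub_add_cancel_of_le ?_⟩
    rw [Finsupp.single_le_iff]
    omega

theorem HasSeries.pderiv {F : (Fin m → 𝕜) → 𝕜} {φ : MvPowerSeries (Fin m) 𝕜}
    (h : HasSeries F φ) (j : Fin m) :
    HasSeries (fun x => fderiv 𝕜 F x (Pi.single j 1)) (MvPowerSeries.pderiv 𝕜 j φ) := by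
  obtain ⟨ε, hε, hdiff⟩ := h.eventually_differentiableAt
  obtain ⟨r, hr, hrε, hs, hF⟩ := h.shrink hε
  have hD := summable_weight_deriv hr j hs
  have hsmall : ∀ x : Fin m → 𝕜, ‖x‖ ≤ r / 4 → ∀ t : 𝕜, t ∈ Metric.ball (0 : 𝕜) (r / 4) →
      ‖x + t • (Pi.single j (1 : 𝕜) : Fin m → 𝕜)‖ ≤ r / 2 := fun x hx t ht => by
    refine (norm_add_le _ _).trans ?_
    rw [norm_smul, Pi.norm_single, norm_one, mul_one]
    rw [mem_ball_zero_iff] at ht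
    linarith
  refine ⟨r / 4, by positivity, ?_, fun x hx => ?_⟩
  · have hinj : Function.Injective fun b : Fin m →₀ ℕ => b + Finsupp.single j 1 :=
      add_left_injective _
    have h1 := summable_weight_mono (c := fun b => (MvPowerSeries.pderiv 𝕜 j φ).coeff b)
      (r := r / 2) (s := r / 4) (by positivity) (by linarith)
    refine h1 ((hD.comp_injective hinj).congr fun b => ?_)
    simp only [Function.comp, MvPowerSeries.coeff_pderiv, norm_mul, add_tsub_cancel_right,
      Finsupp.add_apply, Finsupp.single_eq_same]
    have : ‖(b j : 𝕜) + 1‖ = (b j : ℝ) + 1 := by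
      have := RCLike.norm_natCast (K := 𝕜) (b j + 1)
      push_cast at this
      exact this
    rw [this]
    push_cast
    ring
  · have hder : HasDerivAt (fun t : 𝕜 => ∑' a, φ.coeff a *
        monoEval a (x + t • (Pi.single j (1 : 𝕜) : Fin m → 𝕜)))
        (∑' a : Fin m →₀ ℕ, φ.coeff a * (a j * monoEval (a - Finsupp.single j 1)
          (x + (0 : 𝕜) • (Pi.single j (1 : 𝕜) : Fin m → 𝕜)))) 0 := by
      refine hasDerivAt_tsum_of_isPreconnected (t := Metric.ball (0 : 𝕜) (r / 4)) (y₀ := 0)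
        (g := fun a t => φ.coeff a * monoEval a (x + t • (Pi.single j (1 : 𝕜) : Fin m → 𝕜)))
        (g' := fun a t => φ.coeff a * (a j * monoEval (a - Finsupp.single j 1)
          (x + t • (Pi.single j (1 : 𝕜) : Fin m → 𝕜))))
        hD Metric.isOpen_ball
        (convex_ball (0 : 𝕜) (r / 4)).isPreconnected (fun a t _ =>
          (hasDerivAt_monoEval a j x t).const_mul _) (fun a t ht => ?_)
        (Metric.mem_ball_self (by positivity)) ?_ (Metric.mem_ball_self (by positivity))
      · rw [norm_mul, norm_mul, RCLike.norm_natCast]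
        gcongr
        exact norm_monoEval_le _ _ fun i => (norm_le_pi_norm _ i).trans (hsmall x hx t ht)
      · refine (summable_norm_series hs ?_).of_norm
        rw [zero_smul, add_zero]
        linarith
    have h2 : HasDerivAt (fun t : 𝕜 => F (x + t • (Pi.single j (1 : 𝕜) : Fin m → 𝕜)))
        (fderiv 𝕜 F x (Pi.single j 1)) 0 := by
      have h3 : HasFDerivAt F (fderiv 𝕜 F x) (x + (0 : 𝕜) • (Pi.single j (1 : 𝕜) : Fin m → 𝕜)) := by
        rw [zero_smul, add_zero]
        exact (hdiff x (by linarith)).hasFDerivAt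
      have h4 : HasDerivAt (fun t : 𝕜 => x + t • (Pi.single j (1 : 𝕜) : Fin m → 𝕜))
          (Pi.single j 1) 0 := by
        simpa using ((hasDerivAt_id (0 : 𝕜)).smul_const (Pi.single j (1 : 𝕜) : Fin m → 𝕜)).const_add x
      exact h3.comp_hasDerivAt 0 h4
    have h5 := h2.congr_of_eventuallyEq (f₁ := fun t : 𝕜 => ∑' a, φ.coeff a *
        monoEval a (x + t • (Pi.single j (1 : 𝕜) : Fin m → 𝕜))) (by
      filter_upwards [Metric.ball_mem_nhds (0 : 𝕜) (show 0 < r / 4 by positivity)] with t ht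
      exact (hF _ ((hsmall x hx t ht).trans (by linarith))).symm)
    beta_reduce
    rw [h5.unique hder, zero_smul, add_zero, tsum_shift]
    exact tsum_congr fun b => by rw [MvPowerSeries.coeff_pderiv]

/-- The part of a power series whose exponents lie in `A`. -/
noncomputable def restrictSeries (A : Set (Fin m →₀ ℕ)) (φ : MvPowerSeries (Fin m) 𝕜) :
    MvPowerSeries (Fin m) 𝕜 :=
  open scoped Classical in fun a => if a ∈ A then φ.coeff a else 0

open scoped Classical in
theorem coeff_restrictSeries (A : Set (Fin m →₀ ℕ)) (φ : MvPowerSeries (Fin m) 𝕜)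
    (a : Fin m →₀ ℕ) : (restrictSeries A φ).coeff a = if a ∈ A then φ.coeff a else 0 := rfl

/-- The power series with coefficients `φ (a + x_j)`. -/
noncomputable def shiftSeries (j : Fin m) (φ : MvPowerSeries (Fin m) 𝕜) :
    MvPowerSeries (Fin m) 𝕜 :=
  fun a => φ.coeff (a + Finsupp.single j 1)

theorem coeff_shiftSeries (j : Fin m) (φ : MvPowerSeries (Fin m) 𝕜) (a : Fin m →₀ ℕ) :
    (shiftSeries j φ).coeff a = φ.coeff (a + Finsupp.single j 1) := rfl

theorem exists_hasSeries_of_summable {φ : MvPowerSeries (Fin m) 𝕜} {r : ℝ} (hr : 0 < r)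
    (h : Summable fun a : Fin m →₀ ℕ => ‖φ.coeff a‖ * r ^ a.degree) :
    HasSeries (fun x => ∑' a, φ.coeff a * monoEval a x) φ :=
  ⟨r, hr, h, fun _ _ => rfl⟩

theorem HasSeries.restrict {F : (Fin m → 𝕜) → 𝕜} {φ : MvPowerSeries (Fin m) 𝕜}
    (h : HasSeries F φ) (A : Set (Fin m →₀ ℕ)) : ∃ G, HasSeries G (restrictSeries A φ) := by
  obtain ⟨r, hr, hs, -⟩ := h
  refine ⟨_, exists_hasSeries_of_summable hr
    (Summable.of_nonneg_of_le (fun a => by positivity) (fun a => ?_) hs)⟩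
  rw [coeff_restrictSeries]
  split_ifs
  · exact le_rfl
  · rw [norm_zero, zero_mul]
    positivity

theorem HasSeries.shift {F : (Fin m → 𝕜) → 𝕜} {φ : MvPowerSeries (Fin m) 𝕜}
    (h : HasSeries F φ) (j : Fin m) : ∃ G, HasSeries G (shiftSeries j φ) := by
  obtain ⟨r, hr, hs, -⟩ := h
  have hinj : Function.Injective fun b : Fin m →₀ ℕ => b + Finsupp.single j 1 :=
    add_left_injective _
  refine ⟨_, exists_hasSeries_of_summable hr
    (Summable.of_nonneg_of_le (fun a => by positivity) (fun a => ?_)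
      ((hs.comp_injective hinj).mul_left r⁻¹))⟩
  rw [coeff_shiftSeries]
  simp only [Function.comp, map_add, Finsupp.degree_single, pow_succ]
  exact le_of_eq (by field_simp)

end Series

section Germs

variable {𝕜 : Type} [RCLike 𝕜] {m : ℕ}

theorem HasSeries.unique {F : (Fin m → 𝕜) → 𝕜} {φ ψ : MvPowerSeries (Fin m) 𝕜}
    (hφ : HasSeries F φ) (hψ : HasSeries F ψ) : φ = ψ := by
  ext a
  induction hn : a.degree generalizing a F φ ψ with
  | zero =>
    rw [Finsupp.degree_eq_zero_iff] at hn
    subst hn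
    exact (hφ.eval_zero.symm.trans hψ.eval_zero :)
  | succ n ih =>
    obtain ⟨j, hj⟩ : ∃ j, a j ≠ 0 := by
      by_contra! h
      have : a = 0 := Finsupp.ext h
      rw [this, map_zero] at hn
      omega
    have hle : Finsupp.single j 1 ≤ a := by
      rw [Finsupp.single_le_iff]
      omega
    have hd : (a - Finsupp.single j 1).degree = n := by
      have h1 : a.degree = (a - Finsupp.single j 1).degree + 1 := by
        conv_lhs => rw [← tsub_add_cancel_of_le hle]
        rw [map_add, Finsupp.degree_single]
      omega
    have h2 := ih (hφ.pderiv j) (hψ.pderiv j) (a - Finsupp.single j 1) hd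
    rw [MvPowerSeries.coeff_pderiv, MvPowerSeries.coeff_pderiv, tsub_add_cancel_of_le hle] at h2
    exact mul_right_cancel₀ (Nat.cast_add_one_ne_zero _) h2

theorem HasSeries.coord (j : Fin m) :
    HasSeries (fun x : Fin m → 𝕜 => x j) (MvPowerSeries.X j) := by
  classical
  refine ⟨1, one_pos, summable_of_ne_finset_zero (s := {Finsupp.single j 1}) fun a ha => ?_,
    fun x _ => ?_⟩
  · rw [Finset.mem_singleton] at ha
    simp [MvPowerSeries.coeff_X, ha]
  · rw [tsum_eq_single (Finsupp.single j 1)]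
    · rw [monoEval, Finset.prod_eq_single j]
      · simp
      · intro i _ hi
        simp [hi]
      · simp
    · intro a ha
      simp [MvPowerSeries.coeff_X, ha]

theorem isAnAt_const {M : AnMfd.{u} 𝕜 m} {p : M} (r : 𝕜) : IsAnAt (fun _ : M => r) p :=
  contMDiffAt_const

theorem germ_induction {M : AnMfd.{u} 𝕜 m} {p : M} {motive : AnGerm p → Prop}
    (h : ∀ (f : M → 𝕜) (hf : IsAnAt f p), motive (toGerm f hf)) (g : AnGerm p) : motive g := by
  obtain ⟨_, f, hf, rfl⟩ := g
  exact h f hf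

theorem toGerm_eq_iff {M : AnMfd.{u} 𝕜 m} {p : M} {f g : M → 𝕜} {hf : IsAnAt f p}
    {hg : IsAnAt g p} : toGerm f hf = toGerm g hg ↔ f =ᶠ[𝓝 p] g :=
  Subtype.ext_iff.trans Germ.coe_eq

theorem toGerm_add {M : AnMfd.{u} 𝕜 m} {p : M} {f g : M → 𝕜} (hf : IsAnAt f p)
    (hg : IsAnAt g p) : toGerm f hf + toGerm g hg = toGerm (f + g) (hf.add hg) := rfl

theorem toGerm_mul {M : AnMfd.{u} 𝕜 m} {p : M} {f g : M → 𝕜} (hf : IsAnAt f p)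
    (hg : IsAnAt g p) : toGerm f hf * toGerm g hg = toGerm (f * g) (hf.mul hg) := rfl

theorem algebraMap_germ {M : AnMfd.{u} 𝕜 m} {p : M} (r : 𝕜) :
    algebraMap 𝕜 (AnGerm p) r = toGerm (fun _ => r) (isAnAt_const r) := by
  apply Subtype.ext
  change algebraMap 𝕜 (Germ (𝓝 p) 𝕜) r = _
  rw [Algebra.algebraMap_eq_smul_one]
  change ((r • (1 : M → 𝕜) : M → 𝕜) : Germ (𝓝 p) 𝕜) = ((fun _ => r : M → 𝕜) : Germ (𝓝 p) 𝕜)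
  congr 1
  ext x
  simp

/-- The value at `p`, as a homomorphism of algebras. -/
noncomputable def germEval {M : AnMfd.{u} 𝕜 m} (p : M) : AnGerm p →ₐ[𝕜] 𝕜 where
  toFun := germVal
  map_one' := rfl
  map_mul' := by
    rintro ⟨_, f, _, rfl⟩ ⟨_, g, _, rfl⟩
    rfl
  map_zero' := rfl
  map_add' := by
    rintro ⟨_, f, _, rfl⟩ ⟨_, g, _, rfl⟩
    rfl
  commutes' := fun r => by
    rw [algebraMap_germ]
    rfl

theorem germEval_apply {M : AnMfd.{u} 𝕜 m} {p : M} (g : AnGerm p) : germEval p g = germVal g := rfl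

theorem germEval_toGerm {M : AnMfd.{u} 𝕜 m} {p : M} (f : M → 𝕜) (hf : IsAnAt f p) :
    germEval p (toGerm f hf) = f p := rfl

theorem isUnit_germ_iff {M : AnMfd.{u} 𝕜 m} {p : M} (g : AnGerm p) :
    IsUnit g ↔ germEval p g ≠ 0 := by
  refine ⟨fun h => (h.map (germEval p)).ne_zero, ?_⟩
  induction g using germ_induction with
  | h f hf =>
  intro h0
  rw [germEval_toGerm] at h0
  have hinv : IsAnAt (fun x => (f x)⁻¹) p := by
    have h1 : ContDiffAt 𝕜 ω (fun y : 𝕜 => y⁻¹) (f p) := contDiffAt_inv 𝕜 h0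
    exact ContMDiffAt.comp p h1.contMDiffAt hf
  refine IsUnit.of_mul_eq_one (toGerm _ hinv) ?_
  rw [toGerm_mul]
  refine (toGerm_eq_iff (hg := isAnAt_const 1)).2 ?_
  filter_upwards [hf.continuousAt.eventually_ne h0] with x hx
  exact mul_inv_cancel₀ hx

theorem analyticAt_symm {M : AnMfd.{u} 𝕜 m} {p : M} (c : CenteredChart p) {f : M → 𝕜}
    (hf : IsAnAt f p) : AnalyticAt 𝕜 (f ∘ c.e.symm) 0 := by
  rw [← c.map_center]
  exact (hf.contDiffAt_symm c).analyticAt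

theorem eventually_symm {M : AnMfd.{u} 𝕜 m} {p : M} (c : CenteredChart p) {q : M → Prop}
    (h : ∀ᶠ x in 𝓝 p, q x) : ∀ᶠ y in 𝓝 0, q (c.e.symm y) := by
  have h1 := c.e.continuousAt_symm (c.e.map_source c.mem_source)
  rw [ContinuousAt, c.e.left_inv c.mem_source, c.map_center] at h1
  exact h1.eventually h

theorem eventually_chart {M : AnMfd.{u} 𝕜 m} {p : M} (c : CenteredChart p)
    {q : (Fin m → 𝕜) → Prop} (h : ∀ᶠ y in 𝓝 0, q y) : ∀ᶠ x in 𝓝 p, q (c.e x) := by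
  have h1 := c.e.continuousAt c.mem_source
  rw [ContinuousAt, c.map_center] at h1
  exact h1.eventually h

/-- The Taylor expansion of a germ in the coordinates `c`. -/
noncomputable def taylorFun {M : AnMfd.{u} 𝕜 m} {p : M} (c : CenteredChart p) (g : AnGerm p) :
    MvPowerSeries (Fin m) 𝕜 :=
  (exists_hasSeries (analyticAt_symm c g.2.choose_spec.1)).choose

theorem hasSeries_taylorFun {M : AnMfd.{u} 𝕜 m} {p : M} (c : CenteredChart p) (f : M → 𝕜)
    (hf : IsAnAt f p) : HasSeries (f ∘ c.e.symm) (taylorFun c (toGerm f hf)) := by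
  refine (exists_hasSeries (analyticAt_symm c (toGerm f hf).2.choose_spec.1)).choose_spec.congr ?_
  have h1 := Germ.coe_eq.1 (toGerm f hf).2.choose_spec.2
  exact eventually_symm c h1

/-- The Taylor expansion, as a homomorphism of algebras. -/
noncomputable def taylor {M : AnMfd.{u} 𝕜 m} {p : M} (c : CenteredChart p) :
    AnGerm p →ₐ[𝕜] MvPowerSeries (Fin m) 𝕜 where
  toFun := taylorFun c
  map_one' := (hasSeries_taylorFun c 1 (isAnAt_const 1)).unique (by
    have h := HasSeries.const (m := m) (1 : 𝕜)
    rw [map_one] at h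
    exact h)
  map_mul' := by
    rintro ⟨_, f, hf, rfl⟩ ⟨_, g, hg, rfl⟩
    exact (hasSeries_taylorFun c (f * g) (hf.mul hg)).unique
      ((hasSeries_taylorFun c f hf).mul (hasSeries_taylorFun c g hg))
  map_zero' := (hasSeries_taylorFun c 0 (isAnAt_const 0)).unique (by
    have h := HasSeries.const (m := m) (0 : 𝕜)
    rw [map_zero] at h
    exact h)
  map_add' := by
    rintro ⟨_, f, hf, rfl⟩ ⟨_, g, hg, rfl⟩
    exact (hasSeries_taylorFun c (f + g) (hf.add hg)).unique
      ((hasSeries_taylorFun c f hf).add (hasSeries_taylorFun c g hg))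
  commutes' := fun r => by
    rw [algebraMap_germ]
    exact (hasSeries_taylorFun c _ (isAnAt_const r)).unique (HasSeries.const r)

theorem hasSeries_taylor {M : AnMfd.{u} 𝕜 m} {p : M} (c : CenteredChart p) (f : M → 𝕜)
    (hf : IsAnAt f p) : HasSeries (f ∘ c.e.symm) (taylor c (toGerm f hf)) :=
  hasSeries_taylorFun c f hf

theorem taylor_injective {M : AnMfd.{u} 𝕜 m} {p : M} (c : CenteredChart p) :
    Function.Injective (taylor c) := by
  rw [injective_iff_map_eq_zero]
  intro g
  induction g using germ_induction with
  | h f hf =>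
  intro h0
  have h1 := hasSeries_taylor c f hf
  rw [h0] at h1
  obtain ⟨r, hr, -, hF⟩ := h1
  refine (toGerm_eq_iff (g := fun _ => 0) (hg := isAnAt_const 0)).2 ?_
  filter_upwards [eventually_chart c (Metric.ball_mem_nhds 0 hr),
    c.e.open_source.mem_nhds c.mem_source] with x hx hxs
  have := hF (c.e x) (by simpa using (mem_ball_zero_iff.1 hx).le)
  simpa [c.e.left_inv hxs] using this

theorem exists_taylor_eq {M : AnMfd.{u} 𝕜 m} {p : M} (c : CenteredChart p)
    {G : (Fin m → 𝕜) → 𝕜} {φ : MvPowerSeries (Fin m) 𝕜} (h : HasSeries G φ) :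
    ∃ g : AnGerm p, taylor c g = φ := by
  have han : IsAnAt (G ∘ c.e) p := by
    have h1 : ContDiffAt 𝕜 ω G (c.e p) := by
      rw [c.map_center]
      exact h.analyticAt.contDiffAt
    exact ContMDiffAt.comp p h1.contMDiffAt
      (contMDiffAt_of_mem_maximalAtlas c.mem_atlas c.mem_source)
  refine ⟨toGerm _ han, (hasSeries_taylor c _ han).unique (h.congr ?_)⟩
  have h2 : ∀ᶠ y in 𝓝 (0 : Fin m → 𝕜), y ∈ c.e.target := by
    rw [← c.map_center]
    exact c.e.open_target.mem_nhds (c.e.map_source c.mem_source)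
  filter_upwards [h2] with y hy
  simp [c.e.right_inv hy]

theorem hasSeries_taylor' {M : AnMfd.{u} 𝕜 m} {p : M} (c : CenteredChart p) (g : AnGerm p) :
    ∃ F, HasSeries F (taylor c g) := by
  induction g using germ_induction with
  | h f hf => exact ⟨_, hasSeries_taylor c f hf⟩

theorem constantCoeff_taylor {M : AnMfd.{u} 𝕜 m} {p : M} (c : CenteredChart p) (g : AnGerm p) :
    (taylor c g).constantCoeff = germEval p g := by
  induction g using germ_induction with
  | h f hf =>
  rw [← (hasSeries_taylor c f hf).eval_zero, germEval_toGerm, Function.comp, ← c.map_center,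
    c.e.left_inv c.mem_source]

theorem taylor_coordGerm {M : AnMfd.{u} 𝕜 m} {p : M} (c : CenteredChart p) (j : Fin m) :
    taylor c (coordGerm c j) = MvPowerSeries.X j := by
  refine (hasSeries_taylor c _ (isAnAt_coord c j)).unique ((HasSeries.coord j).congr ?_)
  have h2 : ∀ᶠ y in 𝓝 (0 : Fin m → 𝕜), y ∈ c.e.target := by
    rw [← c.map_center]
    exact c.e.open_target.mem_nhds (c.e.map_source c.mem_source)
  filter_upwards [h2] with y hy
  simp [c.e.right_inv hy]

theorem coordDer_toGerm {M : AnMfd.{u} 𝕜 m} {p : M} (c : CenteredChart p) (j : Fin m)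
    (f : M → 𝕜) (hf : IsAnAt f p) :
    coordDer c j (toGerm f hf) = toGerm (partialFun c.e j f) (isAnAt_partialFun c j hf) :=
  partialGerm_toGerm c j f hf

theorem taylor_coordDer {M : AnMfd.{u} 𝕜 m} {p : M} (c : CenteredChart p) (j : Fin m)
    (g : AnGerm p) : taylor c (coordDer c j g) = MvPowerSeries.pderiv 𝕜 j (taylor c g) := by
  induction g using germ_induction with
  | h f hf =>
  rw [coordDer_toGerm]
  refine (hasSeries_taylor c _ _).unique (((hasSeries_taylor c f hf).pderiv j).congr ?_)
  have h2 : ∀ᶠ y in 𝓝 (0 : Fin m → 𝕜), y ∈ c.e.target := by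
    rw [← c.map_center]
    exact c.e.open_target.mem_nhds (c.e.map_source c.mem_source)
  filter_upwards [h2] with y hy
  simp [partialFun, c.e.right_inv hy]

theorem coordDer_coordGerm {M : AnMfd.{u} 𝕜 m} {p : M} (c : CenteredChart p) (j k : Fin m) :
    coordDer c j (coordGerm c k) = if k = j then 1 else 0 := by
  classical
  apply taylor_injective c
  rw [taylor_coordDer, taylor_coordGerm]
  split_ifs with h
  · subst h
    rw [MvPowerSeries.pderiv_X_self, map_one]
  · rw [MvPowerSeries.pderiv_X_of_ne (by tauto), map_zero]

theorem germEval_coordGerm {M : AnMfd.{u} 𝕜 m} {p : M} (c : CenteredChart p) (j : Fin m) :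
    germEval p (coordGerm c j) = 0 := by
  rw [coordGerm, germEval_toGerm, c.map_center]
  rfl

theorem exists_coeff_pderiv_pow (j : Fin m) (n : ℕ) (b : Fin m →₀ ℕ) : ∃ C : 𝕜, C ≠ 0 ∧
    ∀ φ : MvPowerSeries (Fin m) 𝕜,
      ((((MvPowerSeries.pderiv 𝕜 j : Derivation 𝕜 (MvPowerSeries (Fin m) 𝕜) _) :
        Module.End 𝕜 (MvPowerSeries (Fin m) 𝕜)) ^ n) φ).coeff b =
        C * φ.coeff (b + Finsupp.single j n) := by
  induction n generalizing b with
  | zero => exact ⟨1, one_ne_zero, fun φ => by simp⟩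
  | succ n ih =>
    obtain ⟨C, hC, h⟩ := ih (b + Finsupp.single j 1)
    refine ⟨C * (b j + 1), mul_ne_zero hC (Nat.cast_add_one_ne_zero _), fun φ => ?_⟩
    rw [pow_succ', Module.End.mul_apply]
    change (MvPowerSeries.pderiv 𝕜 j _).coeff b = _
    rw [MvPowerSeries.coeff_pderiv, h, add_assoc, ← Finsupp.single_add, add_comm 1 n]
    ring

theorem exists_coeff_pderiv_list (l : List (Fin m × ℕ)) (b : Fin m →₀ ℕ) : ∃ C : 𝕜, C ≠ 0 ∧
    ∀ φ : MvPowerSeries (Fin m) 𝕜,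
      ((l.map fun x => ((MvPowerSeries.pderiv 𝕜 x.1 : Derivation 𝕜 (MvPowerSeries (Fin m) 𝕜) _) :
        Module.End 𝕜 (MvPowerSeries (Fin m) 𝕜)) ^ x.2).prod φ).coeff b =
        C * φ.coeff (b + (l.map fun x => Finsupp.single x.1 x.2).sum) := by
  induction l generalizing b with
  | nil => exact ⟨1, one_ne_zero, fun φ => by simp⟩
  | cons x l ih =>
    obtain ⟨C, hC, h⟩ := exists_coeff_pderiv_pow (𝕜 := 𝕜) x.1 x.2 b
    obtain ⟨C', hC', h'⟩ := ih (b + Finsupp.single x.1 x.2)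
    refine ⟨C * C', mul_ne_zero hC hC', fun φ => ?_⟩
    rw [List.map_cons, List.prod_cons, Module.End.mul_apply, h, h', List.map_cons, List.sum_cons,
      add_assoc, mul_assoc]

theorem taylor_list {M : AnMfd.{u} 𝕜 m} {p : M} (c : CenteredChart p) (l : List (Fin m × ℕ))
    (g : AnGerm p) :
    taylor c ((l.map fun x => ((coordDer c x.1 : VField p) : Module.End 𝕜 (AnGerm p)) ^ x.2).prod g)
      = (l.map fun x => ((MvPowerSeries.pderiv 𝕜 x.1 : Derivation 𝕜 (MvPowerSeries (Fin m) 𝕜) _) :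
        Module.End 𝕜 (MvPowerSeries (Fin m) 𝕜)) ^ x.2).prod (taylor c g) := by
  have hpow : ∀ (j : Fin m) (n : ℕ) (g : AnGerm p),
      taylor c ((((coordDer c j : VField p) : Module.End 𝕜 (AnGerm p)) ^ n) g) =
      (((MvPowerSeries.pderiv 𝕜 j : Derivation 𝕜 (MvPowerSeries (Fin m) 𝕜) _) :
        Module.End 𝕜 (MvPowerSeries (Fin m) 𝕜)) ^ n) (taylor c g) := by
    intro j n
    induction n with
    | zero => intro g; rfl
    | succ n ih =>
      intro g
      rw [pow_succ', pow_succ', Module.End.mul_apply, Module.End.mul_apply, ← ih]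
      exact taylor_coordDer c j _
  induction l with
  | nil => rfl
  | cons x l ih =>
    rw [List.map_cons, List.prod_cons, Module.End.mul_apply, hpow, ih, List.map_cons,
      List.prod_cons, Module.End.mul_apply]

/-- The exponent `a` as a finitely supported function. -/
noncomputable def toFs (a : Fin m → ℕ) : Fin m →₀ ℕ := Finsupp.equivFunOnFinite.symm a

@[simp] theorem toFs_apply (a : Fin m → ℕ) (j : Fin m) : toFs a j = a j := rfl

@[simp] theorem toFs_coe (a : Fin m →₀ ℕ) : toFs (fun j => a j) = a := Finsupp.ext fun _ => rfl

theorem germVal_iterDer_ne_zero_iff {M : AnMfd.{u} 𝕜 m} {p : M} (c : CenteredChart p)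
    (a : Fin m → ℕ) (g : AnGerm p) :
    germVal (iterDer c a g) ≠ 0 ↔ (taylor c g).coeff (toFs a) ≠ 0 := by
  obtain ⟨C, hC, h⟩ := exists_coeff_pderiv_list (𝕜 := 𝕜) (List.ofFn fun j : Fin m => (j, a j)) 0
  have h1 : iterDer c a = ((List.ofFn fun j : Fin m => (j, a j)).map fun x =>
      ((coordDer c x.1 : VField p) : Module.End 𝕜 (AnGerm p)) ^ x.2).prod := by
    rw [List.map_ofFn]
    rfl
  have h2 : (0 : Fin m →₀ ℕ) + ((List.ofFn fun j : Fin m => (j, a j)).map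
      fun x => Finsupp.single x.1 x.2).sum = toFs a := by
    classical
    rw [List.map_ofFn, List.sum_ofFn, zero_add]
    ext i
    simp [Finsupp.single_apply]
  rw [← germEval_apply, ← constantCoeff_taylor c, h1, taylor_list,
    ← MvPowerSeries.coeff_zero_eq_constantCoeff_apply, h, h2]
  simp [hC]

theorem occurs_iff {M : AnMfd.{u} 𝕜 m} {p : M} (c : CenteredChart p) (a : Fin m → ℕ)
    (g : AnGerm p) : Occurs c a g ↔ (taylor c g).coeff (toFs a) ≠ 0 :=
  germVal_iterDer_ne_zero_iff c a g

theorem isUnit_iterDer_iff {M : AnMfd.{u} 𝕜 m} {p : M} (c : CenteredChart p)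
    (a : Fin m → ℕ) (g : AnGerm p) :
    IsUnit (iterDer c a g) ↔ (taylor c g).coeff (toFs a) ≠ 0 :=
  (isUnit_germ_iff _).trans (germVal_iterDer_ne_zero_iff c a g)

theorem taylor_mono {M : AnMfd.{u} 𝕜 m} {p : M} (c : CenteredChart p) (a : Fin m → ℕ) :
    taylor c (mono c a) = MvPowerSeries.monomial (toFs a) 1 := by
  classical
  rw [mono, map_prod]
  have hX : ∀ j, taylor c (coordGerm c j ^ a j) =
      MvPowerSeries.monomial (Finsupp.single j (a j)) 1 := fun j => by
    rw [map_pow, taylor_coordGerm, MvPowerSeries.X_pow_eq]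
  rw [Finset.prod_congr rfl fun j _ => hX j]
  have : ∀ s : Finset (Fin m), ∏ j ∈ s, MvPowerSeries.monomial (R := 𝕜) (Finsupp.single j (a j)) 1 =
      MvPowerSeries.monomial (∑ j ∈ s, Finsupp.single j (a j)) 1 := by
    intro s
    induction s using Finset.induction_on with
    | empty => simp [MvPowerSeries.monomial_zero_one]
    | insert j s hj ih =>
      rw [Finset.prod_insert hj, ih, MvPowerSeries.monomial_mul_monomial, Finset.sum_insert hj,
        one_mul]
  have hsum : ∑ j, Finsupp.single j (a j) = toFs a := by
    ext i
    simp [Finsupp.single_apply]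
  rw [this, hsum]

theorem exists_taylor_restrict {M : AnMfd.{u} 𝕜 m} {p : M} (c : CenteredChart p) (g : AnGerm p)
    (A : Set (Fin m →₀ ℕ)) : ∃ h : AnGerm p, taylor c h = restrictSeries A (taylor c g) := by
  obtain ⟨F, hF⟩ := hasSeries_taylor' c g
  obtain ⟨G, hG⟩ := hF.restrict A
  exact exists_taylor_eq c hG

theorem coordGerm_dvd_iff {M : AnMfd.{u} 𝕜 m} {p : M} (c : CenteredChart p) (j : Fin m)
    (g : AnGerm p) : coordGerm c j ∣ g ↔ ∀ a : Fin m →₀ ℕ, a j = 0 → (taylor c g).coeff a = 0 := by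
  classical
  rw [← MvPowerSeries.X_dvd_iff]
  constructor
  · rintro ⟨h, rfl⟩
    rw [map_mul, taylor_coordGerm]
    exact dvd_mul_right _ _
  · intro hd
    obtain ⟨F, hF⟩ := hasSeries_taylor' c g
    obtain ⟨G, hG⟩ := hF.shift j
    obtain ⟨h, hh⟩ := exists_taylor_eq c hG
    refine ⟨h, taylor_injective c ?_⟩
    obtain ⟨ψ, hψ⟩ := hd
    rw [map_mul, taylor_coordGerm, hh, hψ]
    congr 1
    refine MvPowerSeries.ext fun a => ?_
    rw [coeff_shiftSeries, MvPowerSeries.X, add_comm, MvPowerSeries.coeff_add_monomial_mul,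
      one_mul]

instance {M : AnMfd.{u} 𝕜 m} {p : M} : Nontrivial (AnGerm p) :=
  (germEval p : AnGerm p →+* 𝕜).domain_nontrivial

theorem exists_translate {M : AnMfd.{u} 𝕜 m} {e : OpenPartialHomeomorph M (Fin m → 𝕜)}
    (he : e ∈ IsManifold.maximalAtlas 𝓘(𝕜, Fin m → 𝕜) ω M) (v : Fin m → 𝕜) :
    ∃ e' ∈ IsManifold.maximalAtlas 𝓘(𝕜, Fin m → 𝕜) ω M, e'.source = e.source ∧
      ∀ y, e' y = e y + v := by
  let t : OpenPartialHomeomorph (Fin m → 𝕜) (Fin m → 𝕜) :=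
    (Homeomorph.addRight v).toOpenPartialHomeomorph
  have h1 := (IsManifold.mem_maximalAtlas_iff_contMDiffOn e).1 he
  refine ⟨e.trans t, ?_, by simp [t], fun y => by simp [t]⟩
  rw [IsManifold.mem_maximalAtlas_iff_contMDiffOn]
  have ht : ContMDiff 𝓘(𝕜, Fin m → 𝕜) 𝓘(𝕜, Fin m → 𝕜) ω t := by
    rw [contMDiff_iff_contDiff]
    exact contDiff_id.add contDiff_const
  have ht' : ContMDiff 𝓘(𝕜, Fin m → 𝕜) 𝓘(𝕜, Fin m → 𝕜) ω t.symm := by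
    rw [contMDiff_iff_contDiff]
    change ContDiff 𝕜 ω fun y => y + -v
    exact contDiff_id.add contDiff_const
  constructor
  · refine ht.comp_contMDiffOn (h1.1.mono ?_)
    simp [t]
  · refine h1.2.comp ht'.contMDiffOn ?_
    intro y hy
    simpa [t] using hy

/-- Every point has centred charts. -/
theorem exists_centeredChart {M : AnMfd.{u} 𝕜 m} {e : OpenPartialHomeomorph M (Fin m → 𝕜)}
    (he : e ∈ IsManifold.maximalAtlas 𝓘(𝕜, Fin m → 𝕜) ω M) {x : M} (hx : x ∈ e.source) :
    ∃ c : CenteredChart x, c.e.source = e.source ∧ ∀ y, c.e y = e y - e x := by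
  obtain ⟨e', h1, h2, h3⟩ := exists_translate he (-e x)
  exact ⟨⟨e', h1, h2 ▸ hx, by simp [h3]⟩, h2, fun y => by rw [h3, sub_eq_add_neg]⟩

/-- Restriction of a chart to an open set. -/
theorem exists_restrict {M : AnMfd.{u} 𝕜 m} {e : OpenPartialHomeomorph M (Fin m → 𝕜)}
    (he : e ∈ IsManifold.maximalAtlas 𝓘(𝕜, Fin m → 𝕜) ω M) {U : Set M} (hU : IsOpen U) :
    ∃ e' ∈ IsManifold.maximalAtlas 𝓘(𝕜, Fin m → 𝕜) ω M, e'.source = e.source ∩ U ∧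
      ∀ y, e' y = e y :=
  ⟨e.restr U, restr_mem_maximalAtlas _ he hU, by rw [e.restr_source, hU.interior_eq],
    fun _ => rfl⟩

theorem exists_chart {M : AnMfd.{u} 𝕜 m} (x : M) : Nonempty (CenteredChart x) := by
  obtain ⟨c, -⟩ := exists_centeredChart (IsManifold.chart_mem_maximalAtlas
    (I := 𝓘(𝕜, Fin m → 𝕜)) (n := ω) x) (mem_chart_source _ x)
  exact ⟨c⟩

instance {M : AnMfd.{u} 𝕜 m} {p : M} : IsDomain (AnGerm p) :=
  haveI : IsDomain (MvPowerSeries (Fin m) 𝕜) := NoZeroDivisors.to_isDomain _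
  (taylor_injective (exists_chart p).some).isDomain (taylor (exists_chart p).some).toRingHom

theorem coordGerm_ne_zero {M : AnMfd.{u} 𝕜 m} {p : M} (c : CenteredChart p) (j : Fin m) :
    coordGerm c j ≠ 0 := by
  intro h
  have := congrArg (coordDer c j) h
  rw [coordDer_coordGerm, if_pos rfl, map_zero] at this
  exact one_ne_zero this

end Germs

section Derivations

variable {𝕜 : Type} [RCLike 𝕜] {m : ℕ}

theorem mem_span_coordGerm {M : AnMfd.{u} 𝕜 m} {p : M} (c : CenteredChart p) (S : Finset (Fin m))
    (g : AnGerm p) (h : ∀ a : Fin m →₀ ℕ, (∀ s ∈ S, a s = 0) → (taylor c g).coeff a = 0) :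
    g ∈ Ideal.span (coordGerm c '' (S : Set (Fin m))) := by
  classical
  induction S using Finset.induction_on generalizing g with
  | empty =>
    have : g = 0 := taylor_injective c (by
      rw [map_zero]
      exact MvPowerSeries.ext fun a => h a (by simp))
    rw [this]
    exact zero_mem _
  | insert s S hs ih =>
    obtain ⟨g₁, h₁⟩ := exists_taylor_restrict c g {a | a s ≠ 0}
    have hd : coordGerm c s ∣ g₁ := (coordGerm_dvd_iff c s g₁).2 fun a ha => by
      rw [h₁, coeff_restrictSeries, if_neg]
      simpa using ha
    have h₂ : g - g₁ ∈ Ideal.span (coordGerm c '' (S : Set (Fin m))) := by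
      refine ih _ fun a ha => ?_
      rw [map_sub, map_sub, h₁, coeff_restrictSeries]
      split_ifs with hc
      · exact sub_self _
      · rw [sub_zero]
        refine h a fun t ht => ?_
        rcases Finset.mem_insert.1 ht with rfl | ht
        · simpa using hc
        · exact ha t ht
    rw [← sub_add_cancel g g₁]
    refine add_mem (Ideal.span_mono (Set.image_mono (by simp)) h₂) ?_
    exact Ideal.mem_of_dvd _ hd (Ideal.subset_span ⟨s, by simp, rfl⟩)

open scoped Classical in
theorem HasSeries.comp_proj {F : (Fin m → 𝕜) → 𝕜} {φ : MvPowerSeries (Fin m) 𝕜}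
    (h : HasSeries F φ) (S : Finset (Fin m)) :
    HasSeries (fun x => F fun j => if j ∈ S then 0 else x j)
      (restrictSeries {a | ∀ s ∈ S, a s = 0} φ) := by
  obtain ⟨r, hr, hs, hF⟩ := h
  refine ⟨r, hr, Summable.of_nonneg_of_le (fun a => by positivity) (fun a => ?_) hs,
    fun x hx => ?_⟩
  · rw [coeff_restrictSeries]
    split_ifs
    · exact le_rfl
    · rw [norm_zero, zero_mul]
      positivity
  · beta_reduce
    rw [hF]
    · refine tsum_congr fun a => ?_
      rw [coeff_restrictSeries]
      split_ifs with ha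
      · congr 1
        refine Finset.prod_congr rfl fun j _ => ?_
        by_cases hj : j ∈ S
        · rw [ha j hj, pow_zero, pow_zero]
        · beta_reduce
          rw [if_neg hj]
      · rw [zero_mul]
        simp only [mem_ofPred_eq, not_forall] at ha
        obtain ⟨s, hs, ha⟩ := ha
        rw [monoEval, Finset.prod_eq_zero (Finset.mem_univ s), mul_zero]
        rw [if_pos hs]
        exact zero_pow ha
    · refine (pi_norm_le_iff_of_nonneg hr.le).2 fun j => ?_
      split_ifs
      · simpa using hr.le
      · exact (norm_le_pi_norm x j).trans hx

theorem toGerm_mem_vanIdeal {M : AnMfd.{u} 𝕜 m} {p : M} {S : Set M} {f : M → 𝕜}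
    (hf : IsAnAt f p) : toGerm f hf ∈ vanIdeal S p ↔ ∀ᶠ x in 𝓝 p, x ∈ S → f x = 0 := by
  constructor
  · rintro ⟨f', h1, h2⟩
    filter_upwards [Germ.coe_eq.1 h1, h2] with x hx hx2 hxS
    exact hx.symm.trans (hx2 hxS)
  · exact fun h => ⟨f, rfl, h⟩

theorem vanIdeal_eq_span_coord {M : AnMfd.{u} 𝕜 m} {p : M} (c : CenteredChart p)
    (S : Finset (Fin m)) {C : Set M} (hC : ∀ᶠ x in 𝓝 p, x ∈ C ↔ ∀ s ∈ S, c.e x s = 0) :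
    vanIdeal C p = Ideal.span (coordGerm c '' (S : Set (Fin m))) := by
  classical
  apply le_antisymm
  · intro g
    induction g using germ_induction with
    | h f hf =>
    intro hg
    rw [toGerm_mem_vanIdeal] at hg
    refine mem_span_coordGerm c S _ fun a ha => ?_
    have h1 := (hasSeries_taylor c f hf).comp_proj S
    have h2 : ∀ᶠ y in 𝓝 (0 : Fin m → 𝕜), (∀ s ∈ S, y s = 0) → f (c.e.symm y) = 0 := by
      have ht : ∀ᶠ y in 𝓝 (0 : Fin m → 𝕜), y ∈ c.e.target := by
        rw [← c.map_center]
        exact c.e.open_target.mem_nhds (c.e.map_source c.mem_source)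
      filter_upwards [eventually_symm c (hC.and hg), ht] with y hy hyt hyS
      refine hy.2 (hy.1.2 fun s hs => ?_)
      rw [c.e.right_inv hyt]
      exact hyS s hs
    have hcont : Tendsto (fun (x : Fin m → 𝕜) (j : Fin m) => if j ∈ S then 0 else x j)
        (𝓝 0) (𝓝 0) := by
      have : Continuous fun (x : Fin m → 𝕜) (j : Fin m) => if j ∈ S then (0 : 𝕜) else x j := by
        refine continuous_pi fun j => ?_
        split_ifs <;> fun_prop
      have h3 := this.tendsto 0
      convert! h3 using 2
      ext j
      simp
    have h4 := (h1.congr (G := fun _ => (0 : 𝕜)) (by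
      filter_upwards [hcont.eventually h2] with y hy
      exact hy fun s hs => if_pos hs)).unique (HasSeries.const 0)
    have h5 := congrArg (MvPowerSeries.coeff a) h4
    rw [coeff_restrictSeries, if_pos (by exact ha), map_zero, map_zero] at h5
    exact h5
  · rw [Ideal.span_le]
    rintro _ ⟨s, hs, rfl⟩
    refine (toGerm_mem_vanIdeal _).2 ?_
    filter_upwards [hC] with x hx hxC
    exact hx.1 hxC s hs

/-- The germ at `x` of the `j`-th coordinate function of a chart. -/
noncomputable def chartGerm {M : AnMfd.{u} 𝕜 m} {e : OpenPartialHomeomorph M (Fin m → 𝕜)}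
    (he : e ∈ IsManifold.maximalAtlas 𝓘(𝕜, Fin m → 𝕜) ω M) {x : M} (hx : x ∈ e.source)
    (j : Fin m) : AnGerm x :=
  toGerm (fun y => e y j) (contMDiffAt_pi_space.1 (contMDiffAt_of_mem_maximalAtlas he hx) j)

theorem germEval_chartGerm {M : AnMfd.{u} 𝕜 m} {e : OpenPartialHomeomorph M (Fin m → 𝕜)}
    (he : e ∈ IsManifold.maximalAtlas 𝓘(𝕜, Fin m → 𝕜) ω M) {x : M} (hx : x ∈ e.source)
    (j : Fin m) : germEval x (chartGerm he hx j) = e x j := rfl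

theorem chartGerm_eq {M : AnMfd.{u} 𝕜 m} {e : OpenPartialHomeomorph M (Fin m → 𝕜)}
    (he : e ∈ IsManifold.maximalAtlas 𝓘(𝕜, Fin m → 𝕜) ω M) {x : M} (hx : x ∈ e.source)
    (c : CenteredChart x) (hc : ∀ y, c.e y = e y - e x) (j : Fin m) :
    chartGerm he hx j = coordGerm c j + algebraMap 𝕜 (AnGerm x) (e x j) := by
  rw [algebraMap_germ, coordGerm, toGerm_add]
  refine toGerm_eq_iff.2 (Eventually.of_forall fun y => ?_)
  simp [hc]

theorem chartGerm_centered {M : AnMfd.{u} 𝕜 m} {p : M} (c : CenteredChart p) (j : Fin m) :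
    chartGerm c.mem_atlas c.mem_source j = coordGerm c j := rfl

theorem vanIdeal_eq_span {M : AnMfd.{u} 𝕜 m} {e : OpenPartialHomeomorph M (Fin m → 𝕜)}
    (he : e ∈ IsManifold.maximalAtlas 𝓘(𝕜, Fin m → 𝕜) ω M) {x : M} (hx : x ∈ e.source)
    (S : Finset (Fin m)) {C : Set M} (hC : ∀ᶠ y in 𝓝 x, y ∈ C ↔ ∀ s ∈ S, e y s = 0) :
    vanIdeal C x = Ideal.span (chartGerm he hx '' (S : Set (Fin m))) := by
  by_cases h0 : ∀ s ∈ S, e x s = 0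
  · obtain ⟨c, -, hc⟩ := exists_centeredChart he hx
    have h1 : ∀ s ∈ S, chartGerm he hx s = coordGerm c s := fun s hs => by
      rw [chartGerm_eq he hx c hc, h0 s hs, map_zero, add_zero]
    rw [vanIdeal_eq_span_coord c S]
    · rw [Set.image_congr fun s hs => (h1 s hs)]
    · filter_upwards [hC] with y hy
      rw [hy]
      refine forall₂_congr fun s hs => ?_
      rw [hc, Pi.sub_apply, h0 s hs, sub_zero]
  · push Not at h0
    obtain ⟨s, hs, h0⟩ := h0
    have h1 : Ideal.span (chartGerm he hx '' (S : Set (Fin m))) = ⊤ :=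
      Ideal.eq_top_of_isUnit_mem _ (Ideal.subset_span ⟨s, hs, rfl⟩)
        ((isUnit_germ_iff _).2 (by rwa [germEval_chartGerm]))
    rw [h1, Ideal.eq_top_iff_one]
    refine (toGerm_mem_vanIdeal (f := fun _ => 1) (isAnAt_const 1)).2 ?_
    have hcont : ContinuousAt (fun y => e y s) x :=
      (continuous_apply s).continuousAt.comp (e.continuousAt hx)
    filter_upwards [hC, hcont.eventually_ne h0] with y hy hy2 hyC
    exact absurd (hy.1 hyC s hs) hy2

theorem le_order_taylor_of_dvd {M : AnMfd.{u} 𝕜 m} {p : M} (c : CenteredChart p) {g h : AnGerm p}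
    {n : ℕ} (hg : germEval p g = 0) (hh : (n : ℕ∞) ≤ (taylor c h).order) :
    ((n + 1 : ℕ) : ℕ∞) ≤ (taylor c (g * h)).order := by
  rw [map_mul]
  refine le_trans ?_ MvPowerSeries.le_order_mul
  rw [Nat.cast_add, Nat.cast_one, add_comm]
  refine add_le_add ?_ hh
  rw [MvPowerSeries.one_le_order_iff_constCoeff_eq_zero, constantCoeff_taylor, hg]

theorem sub_eval_mem_span {M : AnMfd.{u} 𝕜 m} {p : M} (c : CenteredChart p) (g : AnGerm p) :
    g - algebraMap 𝕜 _ (germEval p g) ∈ Ideal.span (Set.range (coordGerm c)) := by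
  have h := mem_span_coordGerm c Finset.univ (g - algebraMap 𝕜 _ (germEval p g)) (fun a ha => by
    have : a = 0 := Finsupp.ext fun j => ha j (Finset.mem_univ j)
    rw [this, MvPowerSeries.coeff_zero_eq_constantCoeff_apply, constantCoeff_taylor, map_sub,
      AlgHom.commutes]
    exact sub_self _)
  rwa [Finset.coe_univ, Set.image_univ] at h

/-- A derivation along a local homomorphism is determined by its values on coordinates. -/
theorem derivation_along_eq_zero {N M : AnMfd.{u} 𝕜 m} {q : N} {p : M}
    (ψ : AnGerm p →ₐ[𝕜] AnGerm q) (hψ : ∀ g, germEval q (ψ g) = germEval p g)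
    (d : AnGerm p →+ AnGerm q) (hmul : ∀ f g, d (f * g) = ψ f * d g + ψ g * d f)
    (hconst : ∀ r : 𝕜, d (algebraMap 𝕜 _ r) = 0) (c : CenteredChart p)
    (h : ∀ j, d (coordGerm c j) = 0) (g : AnGerm p) : d g = 0 := by
  obtain ⟨c'⟩ := exists_chart q
  have key : ∀ n : ℕ, ∀ g, (n : ℕ∞) ≤ (taylor c' (d g)).order := by
    intro n
    induction n with
    | zero => intro g; simp
    | succ n ih =>
      intro g
      have h1 := sub_eval_mem_span c g
      have h2 : d g = d (g - algebraMap 𝕜 _ (germEval p g)) := by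
        rw [map_sub, hconst, sub_zero]
      rw [h2]
      generalize g - algebraMap 𝕜 _ (germEval p g) = k at h1
      induction h1 using Submodule.span_induction with
      | mem x hx =>
        obtain ⟨j, rfl⟩ := hx
        rw [h, map_zero, MvPowerSeries.order_zero]
        exact le_top
      | zero =>
        rw [map_zero, map_zero, MvPowerSeries.order_zero]
        exact le_top
      | add x y _ _ hx hy =>
        rw [map_add, map_add]
        exact (le_min hx hy).trans MvPowerSeries.min_order_le_add
      | smul a x hx' hx =>
        rw [smul_eq_mul, hmul, map_add]
        refine (le_min ?_ ?_).trans MvPowerSeries.min_order_le_add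
        · rw [map_mul]
          exact hx.trans (le_trans (le_add_self) MvPowerSeries.le_order_mul)
        · refine le_order_taylor_of_dvd c' ?_ (ih a)
          rw [hψ]
          have h3 : Ideal.span (Set.range (coordGerm c)) ≤ RingHom.ker (germEval p) := by
            rw [Ideal.span_le]
            rintro _ ⟨j, rfl⟩
            exact germEval_coordGerm c j
          exact h3 hx'
  apply taylor_injective c'
  rw [map_zero, ← MvPowerSeries.order_eq_top_iff]
  exact ENat.eq_top_iff_forall_ge.2 fun n => key n g

theorem germEval_pull {N M : AnMfd.{u} 𝕜 m} (σ : AnMap N M) (q : N) (g : AnGerm (σ q)) :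
    germEval q (pull σ q g) = germEval (σ q) g := by
  induction g using germ_induction with
  | h f hf => rfl

theorem derivation_const {M : AnMfd.{u} 𝕜 m} {p : M} (D : VField p) (r : 𝕜) :
    D (algebraMap 𝕜 _ r) = 0 := D.map_algebraMap r

theorem derivation_chartGerm {M : AnMfd.{u} 𝕜 m} {e : OpenPartialHomeomorph M (Fin m → 𝕜)}
    (he : e ∈ IsManifold.maximalAtlas 𝓘(𝕜, Fin m → 𝕜) ω M) {x : M} (hx : x ∈ e.source)
    (c : CenteredChart x) (hc : ∀ y, c.e y = e y - e x) (D : VField x) (j : Fin m) :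
    D (chartGerm he hx j) = D (coordGerm c j) := by
  rw [chartGerm_eq he hx c hc, map_add, derivation_const, add_zero]

/-- `D'` is a lift of `D` under `σ`. -/
def IsLift {N M : AnMfd.{u} 𝕜 m} (σ : AnMap N M) {q : N} (D' : VField q) (D : VField (σ q)) :
    Prop := ∀ g, D' (pull σ q g) = pull σ q (D g)

theorem isLift_of_chart {N M : AnMfd.{u} 𝕜 m} (σ : AnMap N M) {q : N} {D' : VField q}
    {D : VField (σ q)} {e : OpenPartialHomeomorph M (Fin m → 𝕜)}
    (he : e ∈ IsManifold.maximalAtlas 𝓘(𝕜, Fin m → 𝕜) ω M) (hx : σ q ∈ e.source)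
    (h : ∀ j, D' (pull σ q (chartGerm he hx j)) = pull σ q (D (chartGerm he hx j))) :
    IsLift σ D' D := by
  obtain ⟨c, -, hc⟩ := exists_centeredChart he hx
  intro g
  rw [← sub_eq_zero]
  let d : AnGerm (σ q) →+ AnGerm q :=
    { toFun := fun g => D' (pull σ q g) - pull σ q (D g)
      map_zero' := by simp
      map_add' := fun f g => by simp only [map_add]; ring }
  refine derivation_along_eq_zero (pull σ q) (germEval_pull σ q) d (fun f g => ?_) (fun r => ?_) c
    (fun j => ?_) g
  · change D' (pull σ q (f * g)) - pull σ q (D (f * g)) =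
      pull σ q f * (D' (pull σ q g) - pull σ q (D g)) +
      pull σ q g * (D' (pull σ q f) - pull σ q (D f))
    simp only [map_mul, Derivation.leibniz, smul_eq_mul, map_add]
    ring
  · change D' (pull σ q _) - pull σ q (D _) = 0
    rw [AlgHom.commutes, derivation_const, derivation_const, map_zero, sub_zero]
  · change D' (pull σ q _) - pull σ q (D _) = 0
    have h1 : coordGerm c j = chartGerm he hx j - algebraMap 𝕜 _ (e (σ q) j) := by
      rw [chartGerm_eq he hx c hc]
      ring
    rw [h1, map_sub, map_sub, map_sub, AlgHom.commutes, derivation_const, derivation_const,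
      sub_zero, sub_zero, h j, sub_self]

theorem vfield_ext {M : AnMfd.{u} 𝕜 m} {e : OpenPartialHomeomorph M (Fin m → 𝕜)}
    (he : e ∈ IsManifold.maximalAtlas 𝓘(𝕜, Fin m → 𝕜) ω M) {x : M} (hx : x ∈ e.source)
    {D D' : VField x} (h : ∀ j, D (chartGerm he hx j) = D' (chartGerm he hx j)) : D = D' := by
  obtain ⟨c, -, hc⟩ := exists_centeredChart he hx
  have key := derivation_along_eq_zero (AlgHom.id 𝕜 (AnGerm x)) (fun _ => rfl)
    ((D - D' : VField x) : AnGerm x →+ AnGerm x) (fun f g => (D - D').leibniz f g)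
    (fun r => derivation_const (D - D') r) c (fun j => by
      change (D - D') (coordGerm c j) = 0
      rw [← derivation_chartGerm he hx c hc, Derivation.sub_apply, h, sub_self])
  ext g
  have := key g
  change (D - D') g = 0 at this
  rw [Derivation.sub_apply, sub_eq_zero] at this
  rw [this]

theorem vfield_ext_coord {M : AnMfd.{u} 𝕜 m} {p : M} (c : CenteredChart p)
    {D D' : VField p} (h : ∀ j, D (coordGerm c j) = D' (coordGerm c j)) : D = D' :=
  vfield_ext c.mem_atlas c.mem_source h

theorem sum_smul_coordDer_apply {M : AnMfd.{u} 𝕜 m} {p : M} (c : CenteredChart p)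
    (w : Fin m → AnGerm p) (j : Fin m) : (∑ i, w i • coordDer c i) (coordGerm c j) = w j := by
  have h : (∑ i, w i • coordDer c i) (coordGerm c j) =
      ∑ i, (w i • coordDer c i) (coordGerm c j) := by
    have := map_sum (Derivation.coeFnAddMonoidHom (R := 𝕜) (A := AnGerm p) (M := AnGerm p))
      (fun i => w i • coordDer c i) Finset.univ
    exact (congrFun this _).trans (Finset.sum_apply _ _ _)
  rw [h, Finset.sum_eq_single j]
  · rw [Derivation.smul_apply, coordDer_coordGerm, if_pos rfl, smul_eq_mul, mul_one]
  · intro i _ hi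
    rw [Derivation.smul_apply, coordDer_coordGerm, if_neg hi.symm, smul_zero]
  · simp

theorem exists_vfield {M : AnMfd.{u} 𝕜 m} {e : OpenPartialHomeomorph M (Fin m → 𝕜)}
    (he : e ∈ IsManifold.maximalAtlas 𝓘(𝕜, Fin m → 𝕜) ω M) {x : M} (hx : x ∈ e.source)
    (w : Fin m → AnGerm x) : ∃ D : VField x, ∀ j, D (chartGerm he hx j) = w j := by
  obtain ⟨c, -, hc⟩ := exists_centeredChart he hx
  exact ⟨∑ i, w i • coordDer c i, fun j => by
    rw [derivation_chartGerm he hx c hc, sum_smul_coordDer_apply]⟩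

theorem mem_derLog_of_chart {M : AnMfd.{u} 𝕜 m} {e : OpenPartialHomeomorph M (Fin m → 𝕜)}
    (he : e ∈ IsManifold.maximalAtlas 𝓘(𝕜, Fin m → 𝕜) ω M) {x : M} (hx : x ∈ e.source)
    {E : List (Set M)} {D : VField x}
    (h : ∀ H ∈ E, (∀ᶠ y in 𝓝 x, y ∉ H) ∨ ∃ t, (∀ᶠ y in 𝓝 x, y ∈ H ↔ e y t = 0) ∧
      chartGerm he hx t ∣ D (chartGerm he hx t)) : D ∈ derLog E x := by
  intro H hH g hg
  rcases h H hH with h0 | ⟨t, ht, hd⟩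
  · generalize D g = k
    induction k using germ_induction with
    | h f hf =>
    refine (toGerm_mem_vanIdeal hf).2 ?_
    filter_upwards [h0] with y hy hyH
    exact absurd hyH hy
  · have h1 := vanIdeal_eq_span he hx {t} (C := H) (by simpa using ht)
    rw [Finset.coe_singleton, Set.image_singleton] at h1
    rw [h1, Ideal.mem_span_singleton] at hg ⊢
    obtain ⟨k, rfl⟩ := hg
    rw [Derivation.leibniz, smul_eq_mul, smul_eq_mul]
    exact dvd_add (dvd_mul_right _ _) (hd.mul_left k)

theorem dvd_of_mem_derLog {M : AnMfd.{u} 𝕜 m} {e : OpenPartialHomeomorph M (Fin m → 𝕜)}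
    (he : e ∈ IsManifold.maximalAtlas 𝓘(𝕜, Fin m → 𝕜) ω M) {x : M} (hx : x ∈ e.source)
    {E : List (Set M)} {D : VField x} (hD : D ∈ derLog E x) {H : Set M} (hH : H ∈ E) {t : Fin m}
    (ht : ∀ᶠ y in 𝓝 x, y ∈ H ↔ e y t = 0) : chartGerm he hx t ∣ D (chartGerm he hx t) := by
  have h1 := vanIdeal_eq_span he hx {t} (C := H) (by simpa using ht)
  rw [Finset.coe_singleton, Set.image_singleton] at h1
  have h2 := hD H hH (chartGerm he hx t) (by rw [h1]; exact Ideal.mem_span_singleton_self _)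
  rwa [h1, Ideal.mem_span_singleton] at h2

/-- Computation of the analytic strict transform from lifts of generators. -/
theorem strictField_span {N M : AnMfd.{u} 𝕜 m} (σ : AnMap N M) (E' : List (Set N)) (q : N)
    (G : Set (VField (σ q))) (G' : Set (VField q))
    (h1 : ∀ D ∈ G, ∃ D' ∈ G', IsLift σ D' D) (h2 : ∀ D' ∈ G', ∃ D ∈ G, IsLift σ D' D)
    (hinj : ∀ D' : VField q, (∀ g, D' (pull σ q g) = 0) → D' = 0) (hE : ∀ D' ∈ G', D' ∈ derLog E' q) :
    strictField σ E' q (Submodule.span _ G) = Submodule.span _ G' := by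
  apply le_antisymm
  · rintro D ⟨-, hD⟩
    rw [SetLike.mem_coe, Submodule.mem_comap] at hD
    have key : ∀ φ ∈ Submodule.span (AnGerm q)
        {φ : AnGerm (σ q) → AnGerm q | ∃ D ∈ Submodule.span (AnGerm (σ q)) G, φ = fun f => pull σ q (D f)},
        ∃ D' ∈ Submodule.span (AnGerm q) G', φ = fun f => D' (pull σ q f) := by
      intro φ hφ
      induction hφ using Submodule.span_induction with
      | mem φ hφ =>
        obtain ⟨D, hD, rfl⟩ := hφ
        induction hD using Submodule.span_induction with
        | mem D hD =>
          obtain ⟨D', hD', hl⟩ := h1 D hD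
          exact ⟨D', Submodule.subset_span hD', funext fun f => (hl f).symm⟩
        | zero => exact ⟨0, zero_mem _, funext fun f => by simp⟩
        | add D₁ D₂ _ _ ih₁ ih₂ =>
          obtain ⟨D₁', h₁, e₁⟩ := ih₁
          obtain ⟨D₂', h₂, e₂⟩ := ih₂
          refine ⟨D₁' + D₂', add_mem h₁ h₂, funext fun f => ?_⟩
          rw [Derivation.add_apply, Derivation.add_apply, map_add]
          exact congrArg₂ _ (congrFun e₁ f) (congrFun e₂ f)
        | smul a D _ ih =>
          obtain ⟨D', h, e⟩ := ih
          refine ⟨pull σ q a • D', Submodule.smul_mem _ _ h, funext fun f => ?_⟩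
          rw [Derivation.smul_apply, Derivation.smul_apply, smul_eq_mul, map_mul, smul_eq_mul]
          exact congrArg _ (congrFun e f)
      | zero => exact ⟨0, zero_mem _, funext fun f => by simp⟩
      | add φ₁ φ₂ _ _ ih₁ ih₂ =>
        obtain ⟨D₁', h₁, rfl⟩ := ih₁
        obtain ⟨D₂', h₂, rfl⟩ := ih₂
        exact ⟨D₁' + D₂', add_mem h₁ h₂, rfl⟩
      | smul a φ _ ih =>
        obtain ⟨D', h, rfl⟩ := ih
        exact ⟨a • D', Submodule.smul_mem _ _ h, rfl⟩
    obtain ⟨D', hD', he⟩ := key _ hD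
    have : D = D' := by
      rw [← sub_eq_zero]
      refine hinj _ fun g => ?_
      rw [Derivation.sub_apply, sub_eq_zero]
      exact congrFun he g
    rw [this]
    exact hD'
  · rw [Submodule.span_le]
    intro D' hD'
    refine ⟨hE D' hD', ?_⟩
    obtain ⟨D, hD, hl⟩ := h2 D' hD'
    exact Submodule.subset_span ⟨D, Submodule.subset_span hD, funext hl⟩

end Derivations

section Blowup

variable {𝕜 : Type} [RCLike 𝕜] {m : ℕ}

/-- Coordinates in which `C = {x_s = 0, s ∈ S}`, together with some `i ∈ S`. -/
structure AdaptedChart {N : AnMfd.{u} 𝕜 m} (C : Set N) where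
  e : OpenPartialHomeomorph N (Fin m → 𝕜)
  mem : e ∈ IsManifold.maximalAtlas 𝓘(𝕜, Fin m → 𝕜) ω N
  S : Finset (Fin m)
  i : Fin m
  i_mem : i ∈ S
  adapted : ∀ x ∈ e.source, x ∈ C ↔ ∀ s ∈ S, e x s = 0

/-- `P` is an ideal of colength one in the ideal of `C` at `y`. -/
structure IsBlowPoint {N : AnMfd.{u} 𝕜 m} (C : Set N) (y : N) (P : Ideal (AnGerm y)) : Prop where
  le : P ≤ vanIdeal C y
  ne : ¬ vanIdeal C y ≤ P
  mul : ∀ a, germEval y a = 0 → ∀ f ∈ vanIdeal C y, a * f ∈ P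
  quot : ∀ f ∈ vanIdeal C y, f ∉ P → ∀ g ∈ vanIdeal C y, ∃ c : 𝕜, g - algebraMap 𝕜 _ c * f ∈ P

/-- The points of the blowing-up of `C`. -/
structure BlowPt {N : AnMfd.{u} 𝕜 m} (C : Set N) : Type u where
  pt : N
  P : Ideal (AnGerm pt)
  isPoint : IsBlowPoint C pt P

variable {N : AnMfd.{u} 𝕜 m} {C : Set N}

theorem IsBlowPoint.eval_eq_zero {y : N} {P : Ideal (AnGerm y)} (h : IsBlowPoint C y P)
    {f : AnGerm y} (hf : f ∈ P) : germEval y f = 0 := by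
  by_contra h0
  have : P = ⊤ := Ideal.eq_top_of_isUnit_mem _ hf ((isUnit_germ_iff f).2 h0)
  exact h.ne (this ▸ le_top)

theorem IsBlowPoint.const_eq_zero {y : N} {P : Ideal (AnGerm y)} {f : AnGerm y} (hf : f ∉ P)
    {c : 𝕜} (h : algebraMap 𝕜 _ c * f ∈ P) : c = 0 := by
  by_contra hc
  refine hf ?_
  have := P.mul_mem_left (algebraMap 𝕜 _ c⁻¹) h
  rwa [← mul_assoc, ← map_mul, inv_mul_cancel₀ hc, map_one, one_mul] at this

theorem exists_isBlowPoint {y : N} (l : AnGerm y →+ 𝕜)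
    (hl : ∀ a, ∀ f ∈ vanIdeal C y, l (a * f) = germEval y a * l f)
    (h0 : ∃ f ∈ vanIdeal C y, l f ≠ 0) :
    ∃ P, IsBlowPoint C y P ∧ ∀ f ∈ vanIdeal C y, f ∈ P ↔ l f = 0 := by
  let P : Ideal (AnGerm y) :=
    { carrier := {f | f ∈ vanIdeal C y ∧ l f = 0}
      add_mem' := fun {a b} ha hb => ⟨add_mem ha.1 hb.1, by rw [map_add, ha.2, hb.2, add_zero]⟩
      zero_mem' := ⟨zero_mem _, map_zero _⟩
      smul_mem' := fun c f hf => ⟨Ideal.mul_mem_left _ c hf.1, by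
        rw [smul_eq_mul, hl c f hf.1, hf.2, mul_zero]⟩ }
  have hP : ∀ f, f ∈ P ↔ f ∈ vanIdeal C y ∧ l f = 0 := fun f => Iff.rfl
  refine ⟨P, ⟨fun f hf => hf.1, fun h => ?_, fun a ha f hf => ?_, fun f hf hfP g hg => ?_⟩,
    fun f hf => ⟨fun h => h.2, fun h => ⟨hf, h⟩⟩⟩
  · obtain ⟨f, hf, hne⟩ := h0
    exact hne (h hf).2
  · exact ⟨Ideal.mul_mem_left _ a hf, by rw [hl a f hf, ha, zero_mul]⟩
  · have hne : l f ≠ 0 := fun h => hfP ⟨hf, h⟩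
    refine ⟨l g / l f, sub_mem hg (Ideal.mul_mem_left _ _ hf), ?_⟩
    rw [map_sub, hl _ f hf, AlgHom.commutes]
    change l g - l g / l f * l f = 0
    rw [div_mul_cancel₀ _ hne, sub_self]

namespace AdaptedChart

variable (κ : AdaptedChart C)

theorem span_eq {y : N} (hy : y ∈ κ.e.source) :
    vanIdeal C y = Ideal.span (chartGerm κ.mem hy '' (κ.S : Set (Fin m))) := by
  refine vanIdeal_eq_span κ.mem hy κ.S ?_
  filter_upwards [κ.e.open_source.mem_nhds hy] with x hx
  exact κ.adapted x hx

theorem germ_mem {y : N} (hy : y ∈ κ.e.source) {s : Fin m} (hs : s ∈ κ.S) :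
    chartGerm κ.mem hy s ∈ vanIdeal C y := by
  rw [κ.span_eq hy]
  exact Ideal.subset_span ⟨s, hs, rfl⟩

/-- The domain of the chart of the blowing-up. -/
def dom : Set (BlowPt C) := {z | ∃ hy : z.pt ∈ κ.e.source, chartGerm κ.mem hy κ.i ∉ z.P}

/-- The value of `x_j / x_i` at a point of the blowing-up. -/
noncomputable def ratio (z : BlowPt C) (j : Fin m) : 𝕜 :=
  Classical.epsilon fun c => ∃ hy : z.pt ∈ κ.e.source,
    chartGerm κ.mem hy j - algebraMap 𝕜 _ c * chartGerm κ.mem hy κ.i ∈ z.P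

open scoped Classical in
/-- The chart of the blowing-up. -/
noncomputable def chartFun (z : BlowPt C) : Fin m → 𝕜 :=
  fun j => if j ∈ κ.S ∧ j ≠ κ.i then κ.ratio z j else κ.e z.pt j

theorem ratio_spec {z : BlowPt C} (hy : z.pt ∈ κ.e.source) (hi : chartGerm κ.mem hy κ.i ∉ z.P)
    {j : Fin m} (hj : j ∈ κ.S) :
    chartGerm κ.mem hy j - algebraMap 𝕜 _ (κ.ratio z j) * chartGerm κ.mem hy κ.i ∈ z.P := by
  obtain ⟨c, hc⟩ := z.isPoint.quot _ (κ.germ_mem hy κ.i_mem) hi _ (κ.germ_mem hy hj)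
  obtain ⟨_, h⟩ := Classical.epsilon_spec (p := fun c => ∃ hy : z.pt ∈ κ.e.source,
    chartGerm κ.mem hy j - algebraMap 𝕜 _ c * chartGerm κ.mem hy κ.i ∈ z.P) ⟨c, hy, hc⟩
  exact h

theorem ratio_eq {z : BlowPt C} (hy : z.pt ∈ κ.e.source) (hi : chartGerm κ.mem hy κ.i ∉ z.P)
    {j : Fin m} (hj : j ∈ κ.S) {c : 𝕜}
    (h : chartGerm κ.mem hy j - algebraMap 𝕜 _ c * chartGerm κ.mem hy κ.i ∈ z.P) :
    κ.ratio z j = c := by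
  have h1 := sub_mem h (κ.ratio_spec hy hi hj)
  have h2 : algebraMap 𝕜 _ (κ.ratio z j - c) * chartGerm κ.mem hy κ.i ∈ z.P := by
    rw [map_sub]
    convert! h1 using 1
    ring
  exact sub_eq_zero.1 (IsBlowPoint.const_eq_zero hi h2)

theorem blowMap_chartFun {z : BlowPt C} (hz : z ∈ κ.dom) :
    blowMap κ.S κ.i (κ.chartFun z) = κ.e z.pt := by
  obtain ⟨hy, hi⟩ := hz
  ext j
  simp only [blowMap]
  split_ifs with h
  · have h1 := z.isPoint.eval_eq_zero (κ.ratio_spec hy hi h.1)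
    rw [map_sub, map_mul, AlgHom.commutes, germEval_chartGerm, germEval_chartGerm,
      sub_eq_zero] at h1
    rw [h1, mul_comm]
    simp only [chartFun, if_pos h]
    simp
  · simp only [chartFun, if_neg h]

theorem mem_of_ratio {y : N} (hy : y ∈ κ.e.source) (Q : Ideal (AnGerm y))
    (hQ : ∀ a, germEval y a = 0 → ∀ f ∈ vanIdeal C y, a * f ∈ Q) (c : Fin m → 𝕜)
    (hc : ∀ s ∈ κ.S, chartGerm κ.mem hy s - algebraMap 𝕜 _ (c s) * chartGerm κ.mem hy κ.i ∈ Q)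
    {f : AnGerm y} (hf : f ∈ vanIdeal C y) :
    ∃ d : 𝕜, f - algebraMap 𝕜 _ d * chartGerm κ.mem hy κ.i ∈ Q := by
  have hf' := hf
  rw [κ.span_eq hy] at hf
  induction hf using Submodule.span_induction with
  | mem x hx =>
    obtain ⟨s, hs, rfl⟩ := hx
    exact ⟨c s, hc s hs⟩
  | zero => exact ⟨0, by simp⟩
  | add f g hf hg ihf ihg =>
    obtain ⟨d, hd⟩ := ihf (by rw [κ.span_eq hy]; exact hf)
    obtain ⟨d', hd'⟩ := ihg (by rw [κ.span_eq hy]; exact hg)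
    refine ⟨d + d', ?_⟩
    convert! add_mem hd hd' using 1
    rw [map_add]
    ring
  | smul a f hf ih =>
    obtain ⟨d, hd⟩ := ih (by rw [κ.span_eq hy]; exact hf)
    refine ⟨germEval y a * d, ?_⟩
    have h1 := hQ (a - algebraMap 𝕜 _ (germEval y a)) (by
      rw [map_sub, AlgHom.commutes]
      exact sub_self _) _ (Ideal.mul_mem_left _ (algebraMap 𝕜 _ d) (κ.germ_mem hy κ.i_mem))
    convert! add_mem (Q.mul_mem_left a hd) h1 using 1
    rw [map_mul, smul_eq_mul]
    ring

theorem injOn_chartFun : InjOn κ.chartFun κ.dom := by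
  intro z hz z' hz' h
  have h1 : κ.e z.pt = κ.e z'.pt := by
    rw [← κ.blowMap_chartFun hz, ← κ.blowMap_chartFun hz', h]
  obtain ⟨y, P, hP⟩ := z
  obtain ⟨y', P', hP'⟩ := z'
  obtain ⟨hy, hi⟩ := hz
  obtain ⟨hy', hi'⟩ := hz'
  obtain rfl : y = y' := κ.e.injOn hy hy' h1
  have h2 : ∀ f ∈ vanIdeal C y, ∃ d : 𝕜, f - algebraMap 𝕜 _ d * chartGerm κ.mem hy κ.i ∈ P ⊓ P' := by
    intro f hf
    classical
    refine κ.mem_of_ratio hy (P ⊓ P') (fun a ha f hf => ⟨hP.mul a ha f hf, hP'.mul a ha f hf⟩)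
      (fun s => if s = κ.i then 1 else κ.ratio ⟨y, P, hP⟩ s) (fun s hs => ?_) hf
    by_cases hsi : s = κ.i
    · simp [hsi]
    · rw [if_neg hsi]
      refine ⟨κ.ratio_spec (z := ⟨y, P, hP⟩) hy hi hs, ?_⟩
      have h3 := congrFun h s
      simp only [chartFun, if_pos (And.intro hs hsi)] at h3
      rw [h3]
      exact κ.ratio_spec (z := ⟨y, P', hP'⟩) hy hi' hs
  have h4 : P = P' := by
    apply le_antisymm
    · intro f hf
      obtain ⟨d, hd⟩ := h2 f (hP.le hf)
      have h5 := sub_mem hf hd.1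
      rw [sub_sub_cancel] at h5
      have := hd.2
      rwa [IsBlowPoint.const_eq_zero hi h5, map_zero, zero_mul, sub_zero] at this
    · intro f hf
      obtain ⟨d, hd⟩ := h2 f (hP'.le hf)
      have h5 := sub_mem hf hd.2
      rw [sub_sub_cancel] at h5
      have := hd.1
      rwa [IsBlowPoint.const_eq_zero hi' h5, map_zero, zero_mul, sub_zero] at this
  subst h4
  rfl

theorem surjOn_chartFun : SurjOn κ.chartFun κ.dom (blowMap κ.S κ.i ⁻¹' κ.e.target) := by
  classical
  intro w hw
  set y := κ.e.symm (blowMap κ.S κ.i w) with hydef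
  have hy : y ∈ κ.e.source := κ.e.map_target hw
  have hey : κ.e y = blowMap κ.S κ.i w := κ.e.right_inv hw
  have heyi : κ.e y κ.i = w κ.i := by rw [hey]; simp [blowMap]
  have heyj : ∀ j ∈ κ.S, j ≠ κ.i → κ.e y j = w κ.i * w j := fun j hj hji => by
    rw [hey]
    simp [blowMap, hj, hji]
  obtain ⟨l, hl, hli, hlj⟩ : ∃ l : AnGerm y →+ 𝕜,
      (∀ a, ∀ f ∈ vanIdeal C y, l (a * f) = germEval y a * l f) ∧
      l (chartGerm κ.mem hy κ.i) = 1 ∧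
      ∀ j ∈ κ.S, j ≠ κ.i → l (chartGerm κ.mem hy j) = w j := by
    by_cases h0 : w κ.i = 0
    · obtain ⟨D, hD⟩ := exists_vfield κ.mem hy fun j =>
        algebraMap 𝕜 (AnGerm y) (if j = κ.i then 1 else w j)
      refine ⟨(germEval y : AnGerm y →+ 𝕜).comp (D : AnGerm y →+ AnGerm y), fun a f hf => ?_, ?_,
        fun j hj hji => ?_⟩
      · change germEval y (D (a * f)) = germEval y a * germEval y (D f)
        rw [Derivation.leibniz, smul_eq_mul, smul_eq_mul, map_add, map_mul, map_mul]
        have h1 : germEval y f = 0 := by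
          have h2 : vanIdeal C y ≤ RingHom.ker (germEval y) := by
            rw [κ.span_eq hy, Ideal.span_le]
            rintro _ ⟨s, hs, rfl⟩
            change germEval y (chartGerm κ.mem hy s) = 0
            rw [germEval_chartGerm]
            by_cases hsi : s = κ.i
            · rw [hsi, heyi, h0]
            · rw [heyj s hs hsi, h0, zero_mul]
          exact h2 hf
        rw [h1, zero_mul, add_zero]
      · change germEval y (D _) = 1
        rw [hD, AlgHom.commutes, if_pos rfl]
        rfl
      · change germEval y (D _) = w j
        rw [hD, AlgHom.commutes, if_neg hji]
        rfl
    · refine ⟨(AddMonoidHom.mulRight (w κ.i)⁻¹).comp (germEval y : AnGerm y →+ 𝕜),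
        fun a f hf => ?_, ?_, fun j hj hji => ?_⟩
      · change germEval y (a * f) * (w κ.i)⁻¹ = germEval y a * (germEval y f * (w κ.i)⁻¹)
        rw [map_mul, mul_assoc]
      · change germEval y (chartGerm κ.mem hy κ.i) * (w κ.i)⁻¹ = 1
        rw [germEval_chartGerm, heyi, mul_inv_cancel₀ h0]
      · change germEval y (chartGerm κ.mem hy j) * (w κ.i)⁻¹ = w j
        rw [germEval_chartGerm, heyj j hj hji]
        field_simp
  obtain ⟨P, hP, hPl⟩ := exists_isBlowPoint l hl
    ⟨_, κ.germ_mem hy κ.i_mem, by rw [hli]; exact one_ne_zero⟩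
  have hi : chartGerm κ.mem hy κ.i ∉ P := fun h => by
    rw [hPl _ (κ.germ_mem hy κ.i_mem), hli] at h
    exact one_ne_zero h
  refine ⟨⟨y, P, hP⟩, ⟨hy, hi⟩, ?_⟩
  ext j
  simp only [chartFun]
  split_ifs with h
  · refine κ.ratio_eq (z := ⟨y, P, hP⟩) hy hi h.1 ?_
    rw [hPl _ (sub_mem (κ.germ_mem hy h.1) (Ideal.mul_mem_left _ _ (κ.germ_mem hy κ.i_mem))),
      map_sub, hl _ _ (κ.germ_mem hy κ.i_mem), hlj j h.1 h.2, hli, AlgHom.commutes, mul_one]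
    exact sub_self _
  · rw [hey]
    simp only [blowMap, if_neg h]

theorem bijOn_chartFun : BijOn κ.chartFun κ.dom (blowMap κ.S κ.i ⁻¹' κ.e.target) :=
  ⟨fun z hz => by
    rw [mem_preimage, κ.blowMap_chartFun hz]
    exact κ.e.map_source hz.choose, κ.injOn_chartFun, κ.surjOn_chartFun⟩

theorem contDiff_blowMap : ContDiff 𝕜 ω (blowMap κ.S κ.i : (Fin m → 𝕜) → Fin m → 𝕜) := by
  refine contDiff_pi.2 fun j => ?_
  by_cases h : j ∈ κ.S ∧ j ≠ κ.i
  · simp only [blowMap, if_pos h]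
    exact (contDiff_apply 𝕜 𝕜 κ.i).mul (contDiff_apply 𝕜 𝕜 j)
  · simp only [blowMap, if_neg h]
    exact contDiff_apply 𝕜 𝕜 j

theorem germ_expansion {y : N} (hy : y ∈ κ.e.source) {f : AnGerm y} (hf : f ∈ vanIdeal C y) :
    ∃ h : Fin m → AnGerm y, f = ∑ s ∈ κ.S, h s * chartGerm κ.mem hy s := by
  classical
  rw [κ.span_eq hy] at hf
  induction hf using Submodule.span_induction with
  | mem x hx =>
    obtain ⟨s, hs, rfl⟩ := hx
    refine ⟨fun t => if t = s then 1 else 0, ?_⟩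
    rw [Finset.sum_eq_single_of_mem s hs fun t _ ht => by simp [ht]]
    simp
  | zero => exact ⟨0, by simp⟩
  | add f g _ _ ihf ihg =>
    obtain ⟨h, hf⟩ := ihf
    obtain ⟨h', hg⟩ := ihg
    refine ⟨h + h', ?_⟩
    rw [hf, hg, ← Finset.sum_add_distrib]
    exact Finset.sum_congr rfl fun s _ => by rw [Pi.add_apply, add_mul]
  | smul a f _ ih =>
    obtain ⟨h, hf⟩ := ih
    refine ⟨fun s => a * h s, ?_⟩
    rw [hf, smul_eq_mul, Finset.mul_sum]
    exact Finset.sum_congr rfl fun s _ => (mul_assoc _ _ _).symm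

theorem IsAnAt.eventually {N : AnMfd.{u} 𝕜 m} {f : N → 𝕜} {y : N} (hf : IsAnAt f y) :
    ∀ᶠ x in 𝓝 y, IsAnAt f x := by
  have := (contMDiffAt_iff_contMDiffAt_nhds (by simp)).1 hf
  exact this

/-- The chart of the blowing-up, as a partial equivalence. -/
noncomputable def pe [Nonempty (BlowPt C)] : PartialEquiv (BlowPt C) (Fin m → 𝕜) :=
  κ.bijOn_chartFun.toPartialEquiv _ _ _

variable [Nonempty (BlowPt C)]

theorem pe_apply (z : BlowPt C) : κ.pe z = κ.chartFun z := rfl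

theorem pt_symm {w : Fin m → 𝕜} (hw : w ∈ κ.pe.target) :
    (κ.pe.symm w).pt = κ.e.symm (blowMap κ.S κ.i w) := by
  have h1 := κ.pe.map_target hw
  have h2 := κ.blowMap_chartFun h1
  rw [← pe_apply, κ.pe.right_inv hw] at h2
  rw [h2, κ.e.left_inv h1.choose]

theorem isOpen_target : IsOpen κ.pe.target :=
  κ.e.open_target.preimage κ.contDiff_blowMap.continuous

theorem symm_mem_dom {w : Fin m → 𝕜} (hw : w ∈ κ.pe.target) :
    ∃ hy : (κ.pe.symm w).pt ∈ κ.e.source, chartGerm κ.mem hy κ.i ∉ (κ.pe.symm w).P :=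
  κ.pe.map_target hw

open scoped Classical in
theorem ratio_symm {w : Fin m → 𝕜} (hw : w ∈ κ.pe.target)
    (hy : (κ.pe.symm w).pt ∈ κ.e.source) {s : Fin m} (hs : s ∈ κ.S) :
    chartGerm κ.mem hy s - algebraMap 𝕜 _ (if s = κ.i then 1 else w s) * chartGerm κ.mem hy κ.i ∈
      (κ.pe.symm w).P := by
  by_cases hsi : s = κ.i
  · simp [hsi]
  · obtain ⟨_, hi⟩ := κ.symm_mem_dom hw
    have h1 := κ.ratio_spec hy hi hs
    have h2 := congrFun (κ.pe.right_inv hw) s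
    rw [pe_apply] at h2
    simp only [chartFun, if_pos (And.intro hs hsi)] at h2
    rwa [h2, ← if_neg (c := s = κ.i) (t := (1 : 𝕜)) (e := w s) hsi] at h1

/-- A function vanishing on `C` has, near a point of a chart of the blowing-up, an analytic
quotient by the distinguished coordinate modulo the ideals that are the points. -/
theorem exists_quotient {w₀ : Fin m → 𝕜} (hw₀ : w₀ ∈ κ.pe.target) (f : N → 𝕜)
    (hf : IsAnAt f (κ.e.symm (blowMap κ.S κ.i w₀)))
    (hC : ∀ᶠ x in 𝓝 (κ.e.symm (blowMap κ.S κ.i w₀)), x ∈ C → f x = 0) :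
    ∃ L : (Fin m → 𝕜) → 𝕜, ContDiffAt 𝕜 ω L w₀ ∧ ∀ᶠ w in 𝓝 w₀, w ∈ κ.pe.target ∧
      ∀ (hy : (κ.pe.symm w).pt ∈ κ.e.source) (hf : IsAnAt f (κ.pe.symm w).pt),
        toGerm f hf - algebraMap 𝕜 _ (L w) * chartGerm κ.mem hy κ.i ∈ (κ.pe.symm w).P := by
  classical
  set y₀ := κ.e.symm (blowMap κ.S κ.i w₀) with hy₀def
  have hy₀ : y₀ ∈ κ.e.source := κ.e.map_target hw₀
  obtain ⟨h, hh⟩ := κ.germ_expansion hy₀ ((toGerm_mem_vanIdeal hf).2 hC)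
  choose H hH hHeq using fun s => (h s).2
  have hHeq' : ∀ s, h s = toGerm (H s) (hH s) := fun s => Subtype.ext (hHeq s).symm
  have hlift : ∀ᶠ x in 𝓝 y₀, f x = ∑ s ∈ κ.S, H s x * κ.e x s := by
    have h1 : toGerm f hf = ∑ s ∈ κ.S, toGerm (H s) (hH s) * chartGerm κ.mem hy₀ s := by
      rw [hh]
      exact Finset.sum_congr rfl fun s _ => by rw [hHeq' s]
    have h2 : ∀ T : Finset (Fin m), ((∑ s ∈ T, toGerm (H s) (hH s) * chartGerm κ.mem hy₀ s :
        AnGerm y₀) : Germ (𝓝 y₀) 𝕜) = ((fun x => ∑ s ∈ T, H s x * κ.e x s : N → 𝕜) : Germ (𝓝 y₀) 𝕜) := by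
      intro T
      induction T using Finset.induction_on with
      | empty => rfl
      | insert s T hs ih =>
        rw [Finset.sum_insert hs, Subalgebra.coe_add, ih]
        refine Germ.coe_eq.2 (Eventually.of_forall fun x => ?_)
        simp only [Finset.sum_insert hs]
    exact Germ.coe_eq.1 ((congrArg Subtype.val h1).trans (h2 κ.S))
  have hcont : ContinuousAt (fun w => κ.e.symm (blowMap κ.S κ.i w)) w₀ :=
    ContinuousAt.comp (κ.e.continuousAt_symm hw₀) κ.contDiff_blowMap.continuous.continuousAt
  have hsmooth : ContMDiffAt 𝓘(𝕜, Fin m → 𝕜) 𝓘(𝕜, Fin m → 𝕜) ω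
      (fun w => κ.e.symm (blowMap κ.S κ.i w)) w₀ :=
    ContMDiffAt.comp w₀ (contMDiffAt_symm_of_mem_maximalAtlas κ.mem hw₀)
      κ.contDiff_blowMap.contMDiff.contMDiffAt
  refine ⟨fun w => ∑ s ∈ κ.S, H s (κ.e.symm (blowMap κ.S κ.i w)) *
    (if s = κ.i then 1 else w s), ?_, ?_⟩
  · refine ContDiffAt.sum fun s _ => ContDiffAt.mul ?_ ?_
    · have h1 : ContMDiffAt 𝓘(𝕜, Fin m → 𝕜) 𝓘(𝕜, 𝕜) ω (H s)
          (κ.e.symm (blowMap κ.S κ.i w₀)) := hH s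
      exact (ContMDiffAt.comp w₀ h1 hsmooth).contDiffAt
    · split_ifs
      · exact contDiffAt_const
      · exact (contDiff_apply 𝕜 𝕜 s).contDiffAt
  · have hall : ∀ᶠ x in 𝓝 y₀, ∀ s, IsAnAt (H s) x :=
      eventually_all.2 fun s => IsAnAt.eventually (hH s)
    filter_upwards [κ.isOpen_target.mem_nhds hw₀, hcont.eventually hlift.eventually_nhds,
      hcont.eventually hall] with w hw hwl hwH
    refine ⟨hw, fun hy hf => ?_⟩
    have hpt := κ.pt_symm hw
    rw [← hpt] at hwl hwH ⊢
    generalize hz : κ.pe.symm w = z at *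
    have h1 : ∀ T : Finset (Fin m), ((∑ s ∈ T, toGerm (H s) (hwH s) * chartGerm κ.mem hy s :
        AnGerm z.pt) : Germ (𝓝 z.pt) 𝕜) =
        ((fun x => ∑ s ∈ T, H s x * κ.e x s : N → 𝕜) : Germ (𝓝 z.pt) 𝕜) := by
      intro T
      induction T using Finset.induction_on with
      | empty => rfl
      | insert s T hs ih =>
        rw [Finset.sum_insert hs, Subalgebra.coe_add, ih]
        refine Germ.coe_eq.2 (Eventually.of_forall fun x => ?_)
        simp only [Finset.sum_insert hs]
    have h2 : toGerm f hf = ∑ s ∈ κ.S, toGerm (H s) (hwH s) * chartGerm κ.mem hy s :=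
      Subtype.ext ((Germ.coe_eq.2 hwl).trans (h1 κ.S).symm)
    rw [h2, map_sum, Finset.sum_mul, ← Finset.sum_sub_distrib]
    refine Ideal.sum_mem _ fun s hs => ?_
    have h3 := κ.ratio_symm hw (by rw [hz]; exact hy) hs
    have h3' : chartGerm κ.mem hy s - algebraMap 𝕜 _ (if s = κ.i then 1 else w s) *
        chartGerm κ.mem hy κ.i ∈ z.P := by
      subst hz
      exact h3
    have h4 := z.isPoint.mul (toGerm (H s) (hwH s) - algebraMap 𝕜 _ (H s z.pt)) (by
      rw [map_sub, AlgHom.commutes, germEval_toGerm]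
      exact sub_self _) _ (Ideal.mul_mem_left _ (algebraMap 𝕜 _ (if s = κ.i then 1 else w s))
        (κ.germ_mem hy κ.i_mem))
    convert! add_mem (z.P.mul_mem_left (toGerm (H s) (hwH s)) h3') h4 using 1
    rw [map_mul]
    ring

end AdaptedChart

end Blowup

section BlowupManifold

variable {𝕜 : Type} [RCLike 𝕜] {m : ℕ} {N : AnMfd.{u} 𝕜 m} {C : Set N}

namespace AdaptedChart

theorem exists_mem_dom (κ : AdaptedChart C) {y : N} (hy : y ∈ κ.e.source)
    (h : y ∈ C ∨ κ.e y κ.i ≠ 0) : ∃ z ∈ κ.dom, z.pt = y := by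
  classical
  have h1 : blowMap κ.S κ.i (fun j => if j ∈ κ.S ∧ j ≠ κ.i then κ.e y j / κ.e y κ.i else κ.e y j) =
      κ.e y := by
    ext j
    simp only [blowMap]
    split_ifs with hj h2
    · exact absurd rfl h2.2
    · rcases h with h | h
      · rw [(κ.adapted y hy).1 h _ κ.i_mem, (κ.adapted y hy).1 h _ hj.1, zero_mul]
      · field_simp
    · rfl
  obtain ⟨z, hz, hzw⟩ := κ.surjOn_chartFun (show _ ∈ blowMap κ.S κ.i ⁻¹' κ.e.target by
    rw [mem_preimage, h1]
    exact κ.e.map_source hy)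
  refine ⟨z, hz, ?_⟩
  have h2 := κ.blowMap_chartFun hz
  rw [hzw, h1] at h2
  exact (κ.e.injOn hy hz.choose h2).symm

theorem exists_off (hC : IsClosed C) (i₀ : Fin m) {y : N} (hy : y ∉ C) :
    ∃ κ : AdaptedChart C, κ.S = {κ.i} ∧ y ∈ κ.e.source ∧
      (∀ x ∈ κ.e.source, x ∉ C ∧ κ.e x κ.i ≠ 0) := by
  obtain ⟨c⟩ := exists_chart y
  obtain ⟨e, he, hes, hev⟩ := exists_translate c.mem_atlas (fun _ => (1 : 𝕜))
  have hcont : ContinuousOn (fun x => e x i₀) e.source :=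
    fun x hx => (continuous_apply i₀).continuousAt.comp_continuousWithinAt (e.continuousOn x hx)
  have hO : IsOpen (e.source ∩ (fun x => e x i₀) ⁻¹' {0}ᶜ) :=
    hcont.isOpen_inter_preimage e.open_source isOpen_compl_singleton
  obtain ⟨e', he', hs', hv'⟩ := exists_restrict he (hO.inter hC.isOpen_compl)
  have hx : ∀ x ∈ e'.source, x ∉ C ∧ e' x i₀ ≠ 0 := by
    intro x hx
    rw [hs'] at hx
    exact ⟨hx.2.2, by rw [hv']; exact hx.2.1.2⟩
  refine ⟨⟨e', he', {i₀}, i₀, by simp, fun x hxs => ?_⟩, rfl, ?_, hx⟩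
  · simp [(hx x hxs).1, (hx x hxs).2]
  · change y ∈ e'.source
    rw [hs', hes]
    have : y ∈ c.e.source := c.mem_source
    refine ⟨this, ⟨hes ▸ this, ?_⟩, hy⟩
    simp [hev, c.map_center]

theorem mem_dom_off (κ : AdaptedChart C) {z : BlowPt C} (hz : z.pt ∈ κ.e.source)
    (h : κ.e z.pt κ.i ≠ 0) : z ∈ κ.dom :=
  ⟨hz, fun hP => h (z.isPoint.eval_eq_zero hP)⟩

theorem chartFun_off (κ : AdaptedChart C) (hS : κ.S = {κ.i}) (z : BlowPt C) :
    κ.chartFun z = κ.e z.pt := by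
  ext j
  have : ¬ (j ∈ κ.S ∧ j ≠ κ.i) := by rw [hS]; simp
  simp only [chartFun, if_neg this]

theorem exists_index {e : OpenPartialHomeomorph N (Fin m → 𝕜)}
    (he : e ∈ IsManifold.maximalAtlas 𝓘(𝕜, Fin m → 𝕜) ω N) {S : Finset (Fin m)}
    (h : ∀ x ∈ e.source, x ∈ C ↔ ∀ s ∈ S, e x s = 0) {z : BlowPt C} (hz : z.pt ∈ e.source) :
    ∃ i ∈ S, chartGerm he hz i ∉ z.P := by
  by_contra! hcon
  refine z.isPoint.ne ?_
  rw [vanIdeal_eq_span he hz S (by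
    filter_upwards [e.open_source.mem_nhds hz] with x hx
    exact h x hx), Ideal.span_le]
  rintro _ ⟨s, hs, rfl⟩
  exact hcon s hs

theorem eq_of_pt_eq (hC : IsClosed C) (i₀ : Fin m) {z z' : BlowPt C} (h : z.pt = z'.pt)
    (hz : z.pt ∉ C) : z = z' := by
  obtain ⟨κ, hS, hy, hx⟩ := exists_off hC i₀ hz
  refine κ.injOn_chartFun (κ.mem_dom_off hy (hx _ hy).2)
    (κ.mem_dom_off (h ▸ hy) (h ▸ (hx _ hy).2)) ?_
  rw [κ.chartFun_off hS, κ.chartFun_off hS, h]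

variable [Nonempty (BlowPt C)]

theorem transition (κ κ' : AdaptedChart C) {w₀ : Fin m → 𝕜} (hw₀ : w₀ ∈ κ.pe.target)
    (h : κ.pe.symm w₀ ∈ κ'.dom) :
    ContDiffAt 𝕜 ω (fun w => κ'.pe (κ.pe.symm w)) w₀ ∧
      ∀ᶠ w in 𝓝 w₀, w ∈ κ.pe.target ∧ κ.pe.symm w ∈ κ'.dom := by
  classical
  obtain ⟨hy, hi⟩ := h
  have hcont : ContinuousAt (fun w => κ.e.symm (blowMap κ.S κ.i w)) w₀ :=
    ContinuousAt.comp (κ.e.continuousAt_symm hw₀) κ.contDiff_blowMap.continuous.continuousAt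
  have hsmooth : ContMDiffAt 𝓘(𝕜, Fin m → 𝕜) 𝓘(𝕜, Fin m → 𝕜) ω
      (fun w => κ.e.symm (blowMap κ.S κ.i w)) w₀ :=
    ContMDiffAt.comp w₀ (contMDiffAt_symm_of_mem_maximalAtlas κ.mem hw₀)
      κ.contDiff_blowMap.contMDiff.contMDiffAt
  have hy₀ : κ.e.symm (blowMap κ.S κ.i w₀) ∈ κ'.e.source := κ.pt_symm hw₀ ▸ hy
  have hcoord : ∀ j x, x ∈ κ'.e.source → IsAnAt (fun x => κ'.e x j) x := fun j x hx =>
    contMDiffAt_pi_space.1 (contMDiffAt_of_mem_maximalAtlas κ'.mem hx) j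
  have hL : ∀ j, ∃ L : (Fin m → 𝕜) → 𝕜, j ∈ κ'.S → ContDiffAt 𝕜 ω L w₀ ∧
      ∀ᶠ w in 𝓝 w₀, w ∈ κ.pe.target ∧
      ∀ (hy : (κ.pe.symm w).pt ∈ κ.e.source)
        (hf : IsAnAt (fun x => κ'.e x j) (κ.pe.symm w).pt),
        toGerm _ hf - algebraMap 𝕜 _ (L w) * chartGerm κ.mem hy κ.i ∈ (κ.pe.symm w).P := by
    intro j
    by_cases hj : j ∈ κ'.S
    · obtain ⟨L, hL⟩ := κ.exists_quotient hw₀ (fun x => κ'.e x j) (hcoord j _ hy₀) (by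
        filter_upwards [κ'.e.open_source.mem_nhds hy₀] with x hx hxC
        exact (κ'.adapted x hx).1 hxC j hj)
      exact ⟨L, fun _ => hL⟩
    · exact ⟨0, fun h => absurd h hj⟩
  choose L hL using hL
  have hev : ∀ᶠ w in 𝓝 w₀, w ∈ κ.pe.target ∧ ∃ (hy : (κ.pe.symm w).pt ∈ κ.e.source)
      (hy' : (κ.pe.symm w).pt ∈ κ'.e.source), ∀ j ∈ κ'.S,
        chartGerm κ'.mem hy' j - algebraMap 𝕜 _ (L j w) * chartGerm κ.mem hy κ.i ∈
          (κ.pe.symm w).P := by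
    have h1 : ∀ᶠ w in 𝓝 w₀, ∀ j ∈ κ'.S, ∀ (hy : (κ.pe.symm w).pt ∈ κ.e.source)
        (hf : IsAnAt (fun x => κ'.e x j) (κ.pe.symm w).pt),
        toGerm _ hf - algebraMap 𝕜 _ (L j w) * chartGerm κ.mem hy κ.i ∈ (κ.pe.symm w).P := by
      rw [Filter.eventually_all_finset]
      intro j hj
      filter_upwards [(hL j hj).2] with w hw
      exact hw.2
    filter_upwards [h1, κ.isOpen_target.mem_nhds hw₀,
      hcont.eventually (κ'.e.open_source.mem_nhds hy₀)] with w hw hwt hws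
    refine ⟨hwt, (κ.symm_mem_dom hwt).choose, by rw [κ.pt_symm hwt]; exact hws, fun j hj => ?_⟩
    exact hw j hj _ _
  have hne : ∀ w, w ∈ κ.pe.target → ∀ (hy : (κ.pe.symm w).pt ∈ κ.e.source)
      (hy' : (κ.pe.symm w).pt ∈ κ'.e.source), (∀ j ∈ κ'.S,
        chartGerm κ'.mem hy' j - algebraMap 𝕜 _ (L j w) * chartGerm κ.mem hy κ.i ∈
          (κ.pe.symm w).P) → L κ'.i w ≠ 0 →
      chartGerm κ'.mem hy' κ'.i ∉ (κ.pe.symm w).P := by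
    intro w hw hy hy' h h0 hmem
    have h1 := sub_mem hmem (h _ κ'.i_mem)
    rw [sub_sub_cancel] at h1
    exact h0 (IsBlowPoint.const_eq_zero (κ.symm_mem_dom hw).choose_spec h1)
  have h0 : L κ'.i w₀ ≠ 0 := by
    intro h0
    obtain ⟨_, _, hy', h1⟩ := hev.self_of_nhds
    have h2 := h1 _ κ'.i_mem
    rw [h0, map_zero, zero_mul, sub_zero] at h2
    exact hi h2
  have hev0 : ∀ᶠ w in 𝓝 w₀, L κ'.i w ≠ 0 :=
    (hL κ'.i κ'.i_mem).1.continuousAt.eventually_ne h0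
  refine ⟨contDiffAt_pi.2 fun j => ?_, ?_⟩
  · by_cases hj : j ∈ κ'.S ∧ j ≠ κ'.i
    · refine (((hL j hj.1).1.mul ((hL κ'.i κ'.i_mem).1.inv h0))).congr_of_eventuallyEq ?_
      filter_upwards [hev, hev0] with w hw hw0
      obtain ⟨hwt, hy1, hy', hw1⟩ := hw
      rw [pe_apply]
      simp only [chartFun, if_pos hj]
      refine κ'.ratio_eq hy' (hne w hwt hy1 hy' hw1 hw0) hj.1 ?_
      convert! sub_mem (hw1 j hj.1) (Ideal.mul_mem_left _ (algebraMap 𝕜 _ (L j w * (L κ'.i w)⁻¹))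
        (hw1 _ κ'.i_mem)) using 1
      have h3 : algebraMap 𝕜 (AnGerm (κ.pe.symm w).pt) (L j w) =
          algebraMap 𝕜 _ (L j w * (L κ'.i w)⁻¹) * algebraMap 𝕜 _ (L κ'.i w) := by
        rw [← map_mul, mul_assoc, inv_mul_cancel₀ hw0, mul_one]
      rw [h3]
      simp only [Pi.inv_apply]
      ring
    · have h1 : ContMDiffAt 𝓘(𝕜, Fin m → 𝕜) 𝓘(𝕜, 𝕜) ω (fun x => κ'.e x j)
          (κ.e.symm (blowMap κ.S κ.i w₀)) := hcoord j _ hy₀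
      refine (ContMDiffAt.comp w₀ h1 hsmooth).contDiffAt.congr_of_eventuallyEq ?_
      filter_upwards [hev] with w hw
      rw [pe_apply]
      simp only [chartFun, if_neg hj, Function.comp]
      rw [κ.pt_symm hw.1]
  · filter_upwards [hev, hev0] with w hw hw0
    obtain ⟨hwt, hy1, hy', hw1⟩ := hw
    exact ⟨hwt, hy', hne w hwt hy1 hy' hw1 hw0⟩

theorem transition_source (κ κ' : AdaptedChart C) :
    (κ.pe.symm.trans κ'.pe).source = {w | w ∈ κ.pe.target ∧ κ.pe.symm w ∈ κ'.dom} := rfl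

/-- The charts of the blowing-up. -/
noncomputable def core (h : ∀ z : BlowPt C, ∃ κ : AdaptedChart C, z ∈ κ.dom) :
    ChartedSpaceCore (Fin m → 𝕜) (BlowPt C) where
  atlas := range fun κ : AdaptedChart C => κ.pe
  chartAt z := (h z).choose.pe
  mem_chart_source z := (h z).choose_spec
  chart_mem_atlas z := ⟨_, rfl⟩
  open_source := by
    rintro _ _ ⟨κ, rfl⟩ ⟨κ', rfl⟩
    rw [transition_source, isOpen_iff_mem_nhds]
    rintro w ⟨hw, hw'⟩
    exact (transition κ κ' hw hw').2
  continuousOn_toFun := by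
    rintro _ _ ⟨κ, rfl⟩ ⟨κ', rfl⟩ w ⟨hw, hw'⟩
    exact (transition κ κ' hw hw').1.continuousAt.continuousWithinAt

end AdaptedChart

end BlowupManifold

section BlowupExists

variable {𝕜 : Type} [RCLike 𝕜] {m : ℕ} {N : AnMfd.{u} 𝕜 m} {C : Set N}

namespace AdaptedChart

variable [Nonempty (BlowPt C)]

theorem core_atlas (h : ∀ z : BlowPt C, ∃ κ : AdaptedChart C, z ∈ κ.dom) (κ : AdaptedChart C) :
    κ.pe ∈ (core h).atlas := ⟨κ, rfl⟩

/-- The topology of the blowing-up. -/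
@[reducible]
noncomputable def topology (h : ∀ z : BlowPt C, ∃ κ : AdaptedChart C, z ∈ κ.dom) :
    TopologicalSpace (BlowPt C) := (core h).toTopologicalSpace

/-- The charts of the blowing-up, as local homeomorphisms. -/
noncomputable def oph (h : ∀ z : BlowPt C, ∃ κ : AdaptedChart C, z ∈ κ.dom) (κ : AdaptedChart C) :
    @OpenPartialHomeomorph (BlowPt C) (Fin m → 𝕜) (topology h) _ :=
  (core h).openPartialHomeomorph κ.pe (core_atlas h κ)

theorem mem_atlas_core (h : ∀ z : BlowPt C, ∃ κ : AdaptedChart C, z ∈ κ.dom)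
    (e : @OpenPartialHomeomorph (BlowPt C) (Fin m → 𝕜) (topology h) _) :
    e ∈ @ChartedSpace.atlas (Fin m → 𝕜) _ (BlowPt C) (topology h) (core h).toChartedSpace ↔
      ∃ κ, e = oph h κ := by
  constructor
  · intro he
    obtain ⟨f, hf⟩ := mem_iUnion.1 he
    obtain ⟨⟨κ, rfl⟩, hf⟩ := mem_iUnion.1 hf
    exact ⟨κ, hf⟩
  · rintro ⟨κ, rfl⟩
    exact mem_iUnion.2 ⟨κ.pe, mem_iUnion.2 ⟨⟨κ, rfl⟩, rfl⟩⟩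

theorem isManifold_core (h : ∀ z : BlowPt C, ∃ κ : AdaptedChart C, z ∈ κ.dom) :
    @IsManifold 𝕜 _ (Fin m → 𝕜) _ _ (Fin m → 𝕜) _ 𝓘(𝕜, Fin m → 𝕜) ω (BlowPt C) (topology h)
      (core h).toChartedSpace := by
  let _ := topology h
  let _ := (core h).toChartedSpace
  refine isManifold_of_contDiffOn _ _ _ ?_
  rintro e e' he he'
  obtain ⟨κ, rfl⟩ := (mem_atlas_core h e).1 he
  obtain ⟨κ', rfl⟩ := (mem_atlas_core h e').1 he'
  rintro w ⟨⟨hw, hw'⟩, -⟩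
  exact (transition κ κ' hw hw').1.contDiffWithinAt

theorem t2_core (hC : IsClosed C) (i₀ : Fin m)
    (h : ∀ z : BlowPt C, ∃ κ : AdaptedChart C, z ∈ κ.dom)
    (hcov : ∀ y ∈ C, ∃ e ∈ IsManifold.maximalAtlas 𝓘(𝕜, Fin m → 𝕜) ω N, y ∈ e.source ∧
      ∃ S : Finset (Fin m), ∀ x ∈ e.source, x ∈ C ↔ ∀ s ∈ S, e x s = 0)
    (hpt : @Continuous _ _ (topology h) _ (BlowPt.pt : BlowPt C → N)) :
    @T2Space (BlowPt C) (topology h) := by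
  let _ := topology h
  refine ⟨fun z z' hne => ?_⟩
  by_cases hy : z.pt = z'.pt
  · have hzC : z.pt ∈ C := by
      by_contra hzC
      exact hne (eq_of_pt_eq hC i₀ hy hzC)
    obtain ⟨e, he, hz, S, hS⟩ := hcov _ hzC
    have hz' : z'.pt ∈ e.source := hy ▸ hz
    obtain ⟨i, hi, hiz⟩ := exists_index he hS hz
    obtain ⟨i', hi', hiz'⟩ := exists_index he hS hz'
    have same : ∀ κ : AdaptedChart C, z ∈ κ.dom → z' ∈ κ.dom →
        ∃ u v : Set (BlowPt C), IsOpen u ∧ IsOpen v ∧ z ∈ u ∧ z' ∈ v ∧ Disjoint u v := by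
      intro κ h1 h2
      have h3 : oph h κ z ≠ oph h κ z' := fun h3 => hne (κ.injOn_chartFun h1 h2 h3)
      obtain ⟨u, v, hu, hv, hzu, hzv, huv⟩ := t2_separation h3
      exact ⟨_, _, (oph h κ).isOpen_inter_preimage hu, (oph h κ).isOpen_inter_preimage hv,
        ⟨h1, hzu⟩, ⟨h2, hzv⟩, (huv.preimage _).mono inter_subset_right inter_subset_right⟩
    by_cases h1 : chartGerm he hz' i ∈ z'.P
    · by_cases h2 : chartGerm he hz i' ∈ z.P
      · have hii : i' ≠ i := by
          rintro rfl
          exact hiz h2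
        let κ : AdaptedChart C := ⟨e, he, S, i, hi, hS⟩
        let κ' : AdaptedChart C := ⟨e, he, S, i', hi', hS⟩
        have hκ : ∀ x ∈ κ.dom, κ.pe x i' = κ.ratio x i' := fun x _ => by
          rw [pe_apply]
          exact if_pos ⟨hi', hii⟩
        have hκ' : ∀ x ∈ κ'.dom, κ'.pe x i = κ'.ratio x i := fun x _ => by
          rw [pe_apply]
          exact if_pos ⟨hi, hii.symm⟩
        have hO : ∀ j : Fin m, IsOpen {w : Fin m → 𝕜 | ‖w j‖ < 1} := fun j =>
          isOpen_lt (continuous_norm.comp (continuous_apply j)) continuous_const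
        refine ⟨_, _, (oph h κ).isOpen_inter_preimage (hO i'),
          (oph h κ').isOpen_inter_preimage (hO i), ⟨⟨hz, hiz⟩, ?_⟩, ⟨⟨hz', hiz'⟩, ?_⟩, ?_⟩
        · change ‖κ.pe z i'‖ < 1
          rw [hκ z ⟨hz, hiz⟩, κ.ratio_eq hz hiz hi' (c := 0) (by
            rw [map_zero, zero_mul, sub_zero]
            exact h2), norm_zero]
          exact one_pos
        · change ‖κ'.pe z' i‖ < 1
          rw [hκ' z' ⟨hz', hiz'⟩, κ'.ratio_eq hz' hiz' hi (c := 0) (by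
            rw [map_zero, zero_mul, sub_zero]
            exact h1), norm_zero]
          exact one_pos
        · rw [Set.disjoint_left]
          rintro x ⟨⟨hx, hxi⟩, hxn⟩ ⟨⟨hx', hxi'⟩, hxn'⟩
          change ‖κ.pe x i'‖ < 1 at hxn
          change ‖κ'.pe x i‖ < 1 at hxn'
          rw [hκ x ⟨hx, hxi⟩] at hxn
          rw [hκ' x ⟨hx', hxi'⟩] at hxn'
          have h3 := κ.ratio_spec hx hxi hi'
          have h4 := κ'.ratio_spec hx' hxi' hi
          have h5 : algebraMap 𝕜 _ (1 - κ'.ratio x i * κ.ratio x i') * chartGerm he hx i ∈ x.P := by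
            convert! add_mem h4 (x.P.mul_mem_left (algebraMap 𝕜 _ (κ'.ratio x i)) h3) using 1
            rw [map_sub, map_one, map_mul]
            change _ = chartGerm he hx i - algebraMap 𝕜 _ (κ'.ratio x i) * chartGerm he hx i' +
              algebraMap 𝕜 _ (κ'.ratio x i) * (chartGerm he hx i' -
                algebraMap 𝕜 _ (κ.ratio x i') * chartGerm he hx i)
            ring
          have h6 := sub_eq_zero.1 (IsBlowPoint.const_eq_zero hxi h5)
          have h7 := congrArg norm h6
          rw [norm_one, norm_mul] at h7
          have := mul_lt_one_of_nonneg_of_lt_one_left (norm_nonneg _) hxn' hxn.le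
          linarith
      · exact same ⟨e, he, S, i', hi', hS⟩ ⟨hz, h2⟩ ⟨hz', hiz'⟩
    · exact same ⟨e, he, S, i, hi, hS⟩ ⟨hz, hiz⟩ ⟨hz', h1⟩
  · obtain ⟨u, v, hu, hv, hzu, hzv, huv⟩ := t2_separation hy
    exact ⟨_, _, hu.preimage hpt, hv.preimage hpt, hzu, hzv, huv.preimage _⟩

end AdaptedChart

/-- The blowing-up of a closed submanifold. -/
theorem exists_blowup [Nonempty N] (hC : IsClosed C) (i₀ : Fin m)
    (hcov : ∀ y ∈ C, ∃ e ∈ IsManifold.maximalAtlas 𝓘(𝕜, Fin m → 𝕜) ω N, y ∈ e.source ∧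
      ∃ S : Finset (Fin m), S.Nonempty ∧ ∀ x ∈ e.source, x ∈ C ↔ ∀ s ∈ S, e x s = 0) :
    ∃ (N' : AnMfd.{u} 𝕜 m) (σ : AnMap N' N), Function.Surjective σ ∧
      (∀ e ∈ IsManifold.maximalAtlas 𝓘(𝕜, Fin m → 𝕜) ω N, (∀ x ∈ e.source, x ∉ C) →
        ∃ ψ ∈ IsManifold.maximalAtlas 𝓘(𝕜, Fin m → 𝕜) ω N', ψ.source = σ ⁻¹' e.source ∧
          ∀ y, ψ y = e (σ y)) ∧
      (∀ e ∈ IsManifold.maximalAtlas 𝓘(𝕜, Fin m → 𝕜) ω N, ∀ S : Finset (Fin m),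
        (∀ x ∈ e.source, x ∈ C ↔ ∀ s ∈ S, e x s = 0) →
        ∃ ψ : Fin m → OpenPartialHomeomorph N' (Fin m → 𝕜),
          (∀ i ∈ S, ψ i ∈ IsManifold.maximalAtlas 𝓘(𝕜, Fin m → 𝕜) ω N' ∧
            (∀ y ∈ (ψ i).source, σ y ∈ e.source ∧ e (σ y) = blowMap S i (ψ i y)) ∧
            (ψ i).target = blowMap S i ⁻¹' e.target) ∧
          ∀ y, σ y ∈ e.source → ∃ i ∈ S, y ∈ (ψ i).source) ∧
      IsBlowup σ C := by
  classical
  have hdom : ∀ z : BlowPt C, ∃ κ : AdaptedChart C, z ∈ κ.dom := by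
    intro z
    by_cases hz : z.pt ∈ C
    · obtain ⟨e, he, hze, S, -, hS⟩ := hcov _ hz
      obtain ⟨i, hi, hiz⟩ := AdaptedChart.exists_index he hS hze
      exact ⟨⟨e, he, S, i, hi, hS⟩, hze, hiz⟩
    · obtain ⟨κ, -, hy, hx⟩ := AdaptedChart.exists_off hC i₀ hz
      exact ⟨κ, κ.mem_dom_off hy (hx _ hy).2⟩
  have hsurj : ∀ y : N, ∃ z : BlowPt C, z.pt = y := by
    intro y
    by_cases hy : y ∈ C
    · obtain ⟨e, he, hye, S, ⟨i, hi⟩, hS⟩ := hcov y hy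
      obtain ⟨z, -, hz⟩ := AdaptedChart.exists_mem_dom ⟨e, he, S, i, hi, hS⟩ hye (Or.inl hy)
      exact ⟨z, hz⟩
    · obtain ⟨κ, -, hye, hx⟩ := AdaptedChart.exists_off hC i₀ hy
      obtain ⟨z, -, hz⟩ := κ.exists_mem_dom hye (Or.inr (hx _ hye).2)
      exact ⟨z, hz⟩
  obtain ⟨z₀, -⟩ := hsurj (Classical.arbitrary N)
  have _ : Nonempty (BlowPt C) := ⟨z₀⟩
  let _ := AdaptedChart.topology hdom
  let _ := (AdaptedChart.core hdom).toChartedSpace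
  have _ := AdaptedChart.isManifold_core hdom
  have hmem : ∀ κ : AdaptedChart C, AdaptedChart.oph hdom κ ∈
      IsManifold.maximalAtlas 𝓘(𝕜, Fin m → 𝕜) ω (BlowPt C) := fun κ =>
    IsManifold.subset_maximalAtlas ((AdaptedChart.mem_atlas_core hdom _).2 ⟨κ, rfl⟩)
  have hptm : ContMDiff 𝓘(𝕜, Fin m → 𝕜) 𝓘(𝕜, Fin m → 𝕜) ω (BlowPt.pt : BlowPt C → N) := by
    intro z
    obtain ⟨κ, hz⟩ := hdom z
    have hw : blowMap κ.S κ.i (κ.chartFun z) ∈ κ.e.target := by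
      rw [κ.blowMap_chartFun hz]
      exact κ.e.map_source hz.choose
    have h1 : ContMDiffAt 𝓘(𝕜, Fin m → 𝕜) 𝓘(𝕜, Fin m → 𝕜) ω
        (fun z => κ.e.symm (blowMap κ.S κ.i (AdaptedChart.oph hdom κ z))) z :=
      ContMDiffAt.comp z (g := κ.e.symm) (contMDiffAt_symm_of_mem_maximalAtlas κ.mem hw)
        (ContMDiffAt.comp z (g := blowMap κ.S κ.i) κ.contDiff_blowMap.contMDiff.contMDiffAt
          (contMDiffAt_of_mem_maximalAtlas (hmem κ) hz))
    refine h1.congr_of_eventuallyEq ?_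
    filter_upwards [(AdaptedChart.oph hdom κ).open_source.mem_nhds hz] with x hx
    change x.pt = κ.e.symm (blowMap κ.S κ.i (κ.chartFun x))
    rw [κ.blowMap_chartFun hx, κ.e.left_inv hx.choose]
  have _ := AdaptedChart.t2_core hC i₀ hdom (fun y hy => by
    obtain ⟨e, he, hye, S, -, hS⟩ := hcov y hy
    exact ⟨e, he, hye, S, hS⟩) hptm.continuous
  choose s hs using hsurj
  have hsC : ContMDiffOn 𝓘(𝕜, Fin m → 𝕜) 𝓘(𝕜, Fin m → 𝕜) ω s Cᶜ := by
    intro y hy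
    obtain ⟨κ, hS, hye, hx⟩ := AdaptedChart.exists_off hC i₀ hy
    have htar : ∀ x ∈ κ.e.source, κ.pe (s x) = κ.e x ∧ s x ∈ κ.dom := fun x hxs => by
      refine ⟨?_, κ.mem_dom_off (by rwa [hs]) (by rw [hs]; exact (hx x hxs).2)⟩
      rw [AdaptedChart.pe_apply, κ.chartFun_off hS, hs]
    have h1 : κ.e y ∈ (AdaptedChart.oph hdom κ).target := by
      rw [← (htar y hye).1]
      exact κ.pe.map_source (htar y hye).2
    have h2 : ContMDiffAt 𝓘(𝕜, Fin m → 𝕜) 𝓘(𝕜, Fin m → 𝕜) ω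
        (fun x => (AdaptedChart.oph hdom κ).symm (κ.e x)) y :=
      ContMDiffAt.comp y (g := (AdaptedChart.oph hdom κ).symm)
        (contMDiffAt_symm_of_mem_maximalAtlas (hmem κ) h1)
        (contMDiffAt_of_mem_maximalAtlas κ.mem hye)
    refine (h2.congr_of_eventuallyEq ?_).contMDiffWithinAt
    filter_upwards [κ.e.open_source.mem_nhds hye] with x hxs
    rw [← (htar x hxs).1]
    exact (κ.pe.left_inv (htar x hxs).2).symm
  have hspt : ∀ z : BlowPt C, z.pt ∉ C → s z.pt = z := fun z hz =>
    (AdaptedChart.eq_of_pt_eq hC i₀ (hs z.pt).symm hz).symm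
  have hchart : ∀ e ∈ IsManifold.maximalAtlas 𝓘(𝕜, Fin m → 𝕜) ω N, ∀ S : Finset (Fin m),
        (∀ x ∈ e.source, x ∈ C ↔ ∀ s ∈ S, e x s = 0) →
        ∃ ψ : Fin m → OpenPartialHomeomorph (BlowPt C) (Fin m → 𝕜),
          (∀ i ∈ S, ψ i ∈ IsManifold.maximalAtlas 𝓘(𝕜, Fin m → 𝕜) ω (BlowPt C) ∧
            (∀ y ∈ (ψ i).source, y.pt ∈ e.source ∧ e y.pt = blowMap S i (ψ i y)) ∧
            (ψ i).target = blowMap S i ⁻¹' e.target) ∧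
          ∀ y : BlowPt C, y.pt ∈ e.source → ∃ i ∈ S, y ∈ (ψ i).source := by
    intro e he S hS
    by_cases hSn : S.Nonempty
    · obtain ⟨i₁, hi₁⟩ := hSn
      refine ⟨fun i => if hi : i ∈ S then AdaptedChart.oph hdom ⟨e, he, S, i, hi, hS⟩ else
        AdaptedChart.oph hdom ⟨e, he, S, i₁, hi₁, hS⟩, fun i hi => ?_, fun y hy => ?_⟩
      · simp only [dif_pos hi]
        refine ⟨hmem _, fun y hy => ⟨hy.choose, ?_⟩, rfl⟩
        exact (AdaptedChart.blowMap_chartFun _ hy).symm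
      · obtain ⟨i, hi, hiz⟩ := AdaptedChart.exists_index he hS hy
        refine ⟨i, hi, ?_⟩
        simp only [dif_pos hi]
        exact ⟨hy, hiz⟩
    · rw [Finset.not_nonempty_iff_eq_empty] at hSn
      refine ⟨fun _ => AdaptedChart.oph hdom (hdom z₀).choose, fun i hi => by simp [hSn] at hi,
        fun y hy => ?_⟩
      obtain ⟨i, hi, -⟩ := AdaptedChart.exists_index he hS hy
      exact ⟨i, by simp [hSn] at hi⟩
  refine ⟨{ carrier := BlowPt C }, ⟨BlowPt.pt, hptm⟩, fun y => ⟨s y, hs y⟩, fun e he heC => ?_,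
    hchart, ⟨fun p hp => ⟨Cᶜ, hC.isOpen_compl, hp, s, hsC, fun x _ => hs x, fun y hy => hspt y hy⟩,
      fun p hp => ?_⟩⟩
  · have hO : IsOpen ((BlowPt.pt : BlowPt C → N) ⁻¹' e.source) :=
      e.open_source.preimage hptm.continuous
    have hsub : e.source ⊆ Cᶜ := heC
    let ψ : OpenPartialHomeomorph (BlowPt C) (Fin m → 𝕜) :=
      { toFun := fun z => e z.pt
        invFun := fun w => s (e.symm w)
        source := BlowPt.pt ⁻¹' e.source
        target := e.target
        map_source' := fun z hz => e.map_source hz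
        map_target' := fun w hw => by
          rw [mem_preimage, hs]
          exact e.map_target hw
        left_inv' := fun z hz => by
          rw [e.left_inv hz, hspt z (heC _ hz)]
        right_inv' := fun w hw => by rw [hs, e.right_inv hw]
        open_source := hO
        open_target := e.open_target
        continuousOn_toFun := e.continuousOn.comp hptm.continuous.continuousOn fun z hz => hz
        continuousOn_invFun := hsC.continuousOn.comp e.continuousOn_symm
          fun w hw => hsub (e.map_target hw) }
    have h1 := (IsManifold.mem_maximalAtlas_iff_contMDiffOn e).1 he
    refine ⟨ψ, ψ.mem_maximalAtlas_of_contMDiffOn ?_ ?_, rfl, fun y => rfl⟩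
    · exact h1.1.comp hptm.contMDiffOn fun z hz => hz
    · exact hsC.comp h1.2 fun w hw => hsub (e.map_target hw)
  · obtain ⟨e, he, hpe, S, hSn, hS⟩ := hcov p hp
    obtain ⟨ψ, h1, h2⟩ := hchart e he S hS
    exact ⟨e, he, hpe, S, hSn, hS, ψ, h1, h2⟩

end BlowupExists

section Stage

variable {𝕜 : Type} [RCLike 𝕜] {m : ℕ}

/-- The vector fields that are constant in the coordinates with index outside `Tor`, and
diagonal with exponents in `A` in the others. -/
def toricFields {M : AnMfd.{u} 𝕜 m} {e : OpenPartialHomeomorph M (Fin m → 𝕜)}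
    (he : e ∈ IsManifold.maximalAtlas 𝓘(𝕜, Fin m → 𝕜) ω M) {q : M} (hq : q ∈ e.source)
    (Tor : Finset (Fin m)) (A : Set (Fin m → ℚ)) : Set (VField q) :=
  {D | ∃ w ∈ A, (∀ t ∈ Tor, D (chartGerm he hq t) =
      algebraMap 𝕜 _ (w t : 𝕜) * chartGerm he hq t) ∧
    ∀ t ∉ Tor, ∃ k : 𝕜, D (chartGerm he hq t) = algebraMap 𝕜 _ k}

/-- A ray, with rational entries. -/
def qray (r : Fin m → ℕ) : Fin m → ℚ := fun i => r i

theorem qray_sum {κ : Type*} (S : Finset κ) (r : κ → Fin m → ℕ) :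
    qray (∑ s ∈ S, r s) = ∑ s ∈ S, qray (r s) := by
  ext i
  simp [qray]

/-- Coordinates in which `x` is given by monomials, the hypersurfaces `H` by coordinate
hyperplanes, and `θ` by diagonal vector fields. -/
structure IsToricChart (Y : FolSub.{u} 𝕜 m) (x : Y.M → Fin m → 𝕜) {ι : Type} (H : ι → Set Y.M)
    (ρ : ι → Fin m → ℕ) (Tor : Finset (Fin m)) (W : Submodule ℚ (Fin m → ℚ))
    (e : OpenPartialHomeomorph Y.M (Fin m → 𝕜)) (lab : Fin m → ι) : Prop where
  atlas : e ∈ IsManifold.maximalAtlas 𝓘(𝕜, Fin m → 𝕜) ω Y.M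
  inj : ∀ s ∈ Tor, ∀ t ∈ Tor, lab s = lab t → s = t
  mem : ∀ t ∈ Tor, ∀ y ∈ e.source, y ∈ H (lab t) ↔ e y t = 0
  off : ∀ l, (∀ t ∈ Tor, lab t ≠ l) → ∀ y ∈ e.source, y ∉ H l
  coord : ∀ y ∈ e.source, ∀ i ∈ Tor, x y i = ∏ t ∈ Tor, e y t ^ ρ (lab t) i
  coord' : ∀ y ∈ e.source, ∀ i ∉ Tor, x y i = e y i
  indep : ∀ w : Fin m → ℚ, ∑ t ∈ Tor, w t • qray (ρ (lab t)) = 0 → ∀ t ∈ Tor, w t = 0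
  field : ∀ y (hy : y ∈ e.source), Y.θ y = Submodule.span (AnGerm y)
    (toricFields atlas hy Tor {w | ∑ t ∈ Tor, w t • qray (ρ (lab t)) ∈ W})

/-- A total transform of `X`, described by monomials in local coordinates. -/
structure Stage (X : FolSub.{u} 𝕜 m) (e₀ : OpenPartialHomeomorph X.M (Fin m → 𝕜))
    (Tor : Finset (Fin m)) (W : Submodule ℚ (Fin m → ℚ)) (v : Fin m) where
  Y : FolSub.{u} 𝕜 m
  π : AnMap Y.M X.M
  ne : Nonempty Y.M
  π_mem : ∀ y, π y ∈ e₀.source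
  ι : Type
  finite : Finite ι
  H : ι → Set Y.M
  ρ : ι → Fin m → ℕ
  dim : Y.leafDim = X.leafDim
  ring : ∀ q, Y.R q = (X.R (π q)).map (pull π q)
  L : List (Option ι)
  divisor : Y.E = L.map fun o => o.elim ∅ H
  pairwise : L.Pairwise fun a b => ∀ l, a = some l → b ≠ some l
  closed : ∀ l, IsClosed (H l)
  v_mem : v ∈ Tor
  supp : ∀ l, ∀ i ∉ Tor, ρ l i = 0
  label : ∀ l, (H l).Nonempty → some l ∈ L ∨
    ∃ j ∈ Tor, j ≠ v ∧ ρ l = Pi.single j 1 ∧ Pi.single j 1 ∉ W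
  chart : ∀ q, ∃ e lab, q ∈ e.source ∧ IsToricChart Y (fun y => e₀ (π y)) H ρ Tor W e lab

theorem mem_derLog_of_toricChart {Y : FolSub.{u} 𝕜 m} {ι : Type} {H : ι → Set Y.M}
    {Tor : Finset (Fin m)} {e : OpenPartialHomeomorph Y.M (Fin m → 𝕜)} {lab : Fin m → ι}
    (he : e ∈ IsManifold.maximalAtlas 𝓘(𝕜, Fin m → 𝕜) ω Y.M)
    (mem : ∀ t ∈ Tor, ∀ y ∈ e.source, y ∈ H (lab t) ↔ e y t = 0)
    (off : ∀ l, (∀ t ∈ Tor, lab t ≠ l) → ∀ y ∈ e.source, y ∉ H l)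
    {L : List (Option ι)} {E : List (Set Y.M)} (hE : E = L.map fun o => o.elim ∅ H)
    {q : Y.M} (hq : q ∈ e.source) {A : Set (Fin m → ℚ)} {D : VField q}
    (hD : D ∈ toricFields he hq Tor A) : D ∈ derLog E q := by
  refine mem_derLog_of_chart he hq fun K hK => ?_
  rw [hE, List.mem_map] at hK
  obtain ⟨o, -, rfl⟩ := hK
  cases o with
  | none => exact Or.inl (Eventually.of_forall fun y hy => hy)
  | some l =>
    by_cases h : ∃ t ∈ Tor, lab t = l
    · obtain ⟨t, ht, rfl⟩ := h
      refine Or.inr ⟨t, ?_, ?_⟩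
      · filter_upwards [e.open_source.mem_nhds hq] with y hy
        exact mem t ht y hy
      · obtain ⟨w, -, hw, -⟩ := hD
        rw [hw t ht]
        exact dvd_mul_left _ _
    · push Not at h
      left
      filter_upwards [e.open_source.mem_nhds hq] with y hy
      exact off l h y hy

theorem pull_chartGerm_of_blowMap {N M : AnMfd.{u} 𝕜 m} (σ : AnMap N M)
    {e : OpenPartialHomeomorph M (Fin m → 𝕜)}
    (he : e ∈ IsManifold.maximalAtlas 𝓘(𝕜, Fin m → 𝕜) ω M)
    {ψ : OpenPartialHomeomorph N (Fin m → 𝕜)}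
    (hψ : ψ ∈ IsManifold.maximalAtlas 𝓘(𝕜, Fin m → 𝕜) ω N) {S : Finset (Fin m)} {i : Fin m}
    (h : ∀ y ∈ ψ.source, σ y ∈ e.source ∧ e (σ y) = blowMap S i (ψ y)) {q : N}
    (hq : q ∈ ψ.source) (t : Fin m) :
    pull σ q (chartGerm he (h q hq).1 t) =
      if t ∈ S ∧ t ≠ i then chartGerm hψ hq i * chartGerm hψ hq t else chartGerm hψ hq t := by
  split_ifs with ht
  · refine Subtype.ext (Germ.coe_eq.2 ?_)
    filter_upwards [ψ.open_source.mem_nhds hq] with y hy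
    simp only [Function.comp, (h y hy).2, blowMap, if_pos ht]
  · refine Subtype.ext (Germ.coe_eq.2 ?_)
    filter_upwards [ψ.open_source.mem_nhds hq] with y hy
    simp only [Function.comp, (h y hy).2, blowMap, if_neg ht]

theorem chartGerm_ne_zero {M : AnMfd.{u} 𝕜 m} {e : OpenPartialHomeomorph M (Fin m → 𝕜)}
    (he : e ∈ IsManifold.maximalAtlas 𝓘(𝕜, Fin m → 𝕜) ω M) {x : M} (hx : x ∈ e.source)
    (j : Fin m) : chartGerm he hx j ≠ 0 := by
  intro h0
  obtain ⟨D, hD⟩ := exists_vfield he hx fun _ => 1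
  have := hD j
  rw [h0, map_zero] at this
  exact zero_ne_one this

/-- The effect on toric coordinates of a chart of a blowing-up. -/
theorem IsToricChart.blowup {Y : FolSub.{u} 𝕜 m} {x : Y.M → Fin m → 𝕜} {ι ι' : Type}
    {H : ι → Set Y.M} {ρ : ι → Fin m → ℕ} {Tor : Finset (Fin m)} {W : Submodule ℚ (Fin m → ℚ)}
    {e : OpenPartialHomeomorph Y.M (Fin m → 𝕜)} {lab : Fin m → ι}
    (T : IsToricChart Y x H ρ Tor W e lab) (Y' : FolSub.{u} 𝕜 m) (σ : AnMap Y'.M Y.M)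
    {ψ : OpenPartialHomeomorph Y'.M (Fin m → 𝕜)}
    (hψ : ψ ∈ IsManifold.maximalAtlas 𝓘(𝕜, Fin m → 𝕜) ω Y'.M) {S : Finset (Fin m)} {i : Fin m}
    (hS : S ⊆ Tor) (hi : i ∈ S)
    (h : ∀ y ∈ ψ.source, σ y ∈ e.source ∧ e (σ y) = blowMap S i (ψ y))
    {H' : ι' → Set Y'.M} {ρ' : ι' → Fin m → ℕ} {lab' : Fin m → ι'}
    (hρ : ∀ t ∈ Tor, t ≠ i → ρ' (lab' t) = ρ (lab t))
    (hρi : ρ' (lab' i) = ∑ s ∈ S, ρ (lab s))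
    (inj : ∀ s ∈ Tor, ∀ t ∈ Tor, lab' s = lab' t → s = t)
    (mem : ∀ t ∈ Tor, ∀ y ∈ ψ.source, y ∈ H' (lab' t) ↔ ψ y t = 0)
    (off : ∀ l, (∀ t ∈ Tor, lab' t ≠ l) → ∀ y ∈ ψ.source, y ∉ H' l)
    {L : List (Option ι')} (hE : Y'.E = L.map fun o => o.elim ∅ H')
    (hθ : ∀ q, Y'.θ q = strictField σ Y'.E q (Y.θ (σ q))) :
    IsToricChart Y' (fun y => x (σ y)) H' ρ' Tor W ψ lab' := by
  have hiT : i ∈ Tor := hS hi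
  have hsum : ∀ w : Fin m → ℚ, ∑ t ∈ Tor, w t • qray (ρ' (lab' t)) =
      ∑ t ∈ Tor, (if t ∈ S ∧ t ≠ i then w i + w t else w t) • qray (ρ (lab t)) := by
    intro w
    have h1 : ∑ t ∈ Tor, (if t ∈ S ∧ t ≠ i then w i + w t else w t) • qray (ρ (lab t)) =
        ∑ t ∈ Tor, w t • qray (ρ (lab t)) +
          ∑ t ∈ Tor, (if t ∈ S ∧ t ≠ i then w i else 0) • qray (ρ (lab t)) := by
      rw [← Finset.sum_add_distrib]
      refine Finset.sum_congr rfl fun t _ => ?_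
      rw [← add_smul]
      congr 1
      split_ifs <;> ring
    have h2 : ∑ t ∈ Tor, (if t ∈ S ∧ t ≠ i then w i else 0) • qray (ρ (lab t)) =
        w i • ∑ t ∈ S.erase i, qray (ρ (lab t)) := by
      rw [Finset.smul_sum]
      have hsub : S.erase i ⊆ Tor := (Finset.erase_subset _ _).trans hS
      rw [← Finset.sum_subset hsub]
      · refine Finset.sum_congr rfl fun t ht => ?_
        rw [Finset.mem_erase] at ht
        rw [if_pos ⟨ht.2, ht.1⟩]
      · intro t _ ht
        rw [Finset.mem_erase, not_and'] at ht
        rw [if_neg fun h => ht h.1 h.2, zero_smul]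
    rw [h1, h2, ← Finset.add_sum_erase _ _ hiT, ← Finset.add_sum_erase _ _ hiT, hρi, qray_sum,
      ← Finset.add_sum_erase S _ hi, smul_add]
    have h3 : ∑ t ∈ Tor.erase i, w t • qray (ρ' (lab' t)) =
        ∑ t ∈ Tor.erase i, w t • qray (ρ (lab t)) :=
      Finset.sum_congr rfl fun t ht => by
        rw [hρ t (Finset.mem_of_mem_erase ht) (Finset.ne_of_mem_erase ht)]
    rw [h3]
    abel
  have hne : ∀ t, t ∉ Tor → ¬ (t ∈ S ∧ t ≠ i) := fun t ht h => ht (hS h.1)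
  refine ⟨hψ, inj, mem, off, fun y hy k hk => ?_, fun y hy k hk => ?_, fun w hw t ht => ?_,
    fun q hq => ?_⟩
  · rw [T.coord _ (h y hy).1 k hk, (h y hy).2]
    have h1 : ∀ t ∈ Tor, blowMap S i (ψ y) t ^ ρ (lab t) k =
        ψ y t ^ ρ (lab t) k * (if t ∈ S ∧ t ≠ i then ψ y i ^ ρ (lab t) k else 1) := by
      intro t _
      simp only [blowMap]
      split_ifs
      · rw [mul_pow, mul_comm]
      · rw [mul_one]
    have h2 : ∏ t ∈ Tor, (if t ∈ S ∧ t ≠ i then ψ y i ^ ρ (lab t) k else 1) =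
        ∏ t ∈ S.erase i, ψ y i ^ ρ (lab t) k := by
      rw [← Finset.prod_subset ((Finset.erase_subset i S).trans hS)]
      · refine Finset.prod_congr rfl fun t ht => ?_
        rw [Finset.mem_erase] at ht
        rw [if_pos ⟨ht.2, ht.1⟩]
      · intro t _ ht
        rw [Finset.mem_erase, not_and'] at ht
        rw [if_neg fun h => ht h.1 h.2]
    rw [Finset.prod_congr rfl h1, Finset.prod_mul_distrib, h2, Finset.prod_pow_eq_pow_sum,
      ← Finset.mul_prod_erase _ _ hiT, ← Finset.mul_prod_erase Tor (fun t => ψ y t ^ ρ' (lab' t) k) hiT,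
      hρi, Finset.sum_apply, ← Finset.add_sum_erase S _ hi, pow_add]
    have h3 : ∏ t ∈ Tor.erase i, ψ y t ^ ρ' (lab' t) k = ∏ t ∈ Tor.erase i, ψ y t ^ ρ (lab t) k :=
      Finset.prod_congr rfl fun t ht => by
        rw [hρ t (Finset.mem_of_mem_erase ht) (Finset.ne_of_mem_erase ht)]
    rw [h3]
    ring
  · rw [T.coord' _ (h y hy).1 k hk, (h y hy).2]
    simp only [blowMap, if_neg (hne k hk)]
  · rw [hsum] at hw
    have h1 := T.indep _ hw
    have h2 := h1 i hiT
    rw [if_neg fun h => h.2 rfl] at h2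
    have h3 := h1 t ht
    rw [h2, zero_add, ite_self] at h3
    exact h3
  · rw [hθ, T.field _ (h q hq).1]
    have hp := pull_chartGerm_of_blowMap σ T.atlas hψ h hq
    have hlift : ∀ (w w' : Fin m → ℚ) (D : VField (σ q)) (D' : VField q),
        (∀ t ∈ Tor, w t = if t ∈ S ∧ t ≠ i then w' i + w' t else w' t) →
        (∀ t ∈ Tor, D (chartGerm T.atlas (h q hq).1 t) =
          algebraMap 𝕜 _ (w t : 𝕜) * chartGerm T.atlas (h q hq).1 t) →
        (∀ t ∈ Tor, D' (chartGerm hψ hq t) = algebraMap 𝕜 _ (w' t : 𝕜) * chartGerm hψ hq t) →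
        (∀ t ∉ Tor, ∃ k, D (chartGerm T.atlas (h q hq).1 t) = algebraMap 𝕜 _ k ∧
          D' (chartGerm hψ hq t) = algebraMap 𝕜 _ k) → IsLift σ D' D := by
      intro w w' D D' hw hD hD' hc
      refine isLift_of_chart σ T.atlas (h q hq).1 fun t => ?_
      by_cases ht : t ∈ Tor
      · rw [hD t ht, map_mul, AlgHom.commutes, hp, hw t ht]
        split_ifs with hts
        · rw [Derivation.leibniz, hD' t ht, hD' i hiT, Rat.cast_add, map_add, smul_eq_mul,
            smul_eq_mul]
          ring
        · exact hD' t ht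
      · obtain ⟨k, h1, h2⟩ := hc t ht
        rw [hp, if_neg (hne t ht), h1, h2, AlgHom.commutes]
    refine strictField_span σ _ q _ _ ?_ ?_ ?_ ?_
    · rintro D ⟨w, hw, hD, hD0⟩
      choose k hk using fun t : {t // t ∉ Tor} => hD0 t t.2
      classical
      obtain ⟨D', hD'⟩ := exists_vfield hψ hq fun t => if ht : t ∈ Tor then
        algebraMap 𝕜 _ ((if t ∈ S ∧ t ≠ i then w t - w i else w t : ℚ) : 𝕜) * chartGerm hψ hq t
        else algebraMap 𝕜 _ (k ⟨t, ht⟩)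
      refine ⟨D', ⟨fun t => if t ∈ S ∧ t ≠ i then w t - w i else w t, ?_, fun t ht => ?_,
        fun t ht => ⟨k ⟨t, ht⟩, ?_⟩⟩, ?_⟩
      · refine (congrArg (· ∈ W)
          (hsum (fun t => if t ∈ S ∧ t ≠ i then w t - w i else w t))).mpr ?_
        have h5 : ∀ t ∈ Tor, (if t ∈ S ∧ t ≠ i then (if i ∈ S ∧ i ≠ i then w i - w i else w i) +
            (if t ∈ S ∧ t ≠ i then w t - w i else w t)
            else (if t ∈ S ∧ t ≠ i then w t - w i else w t)) • qray (ρ (lab t)) =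
            w t • qray (ρ (lab t)) := fun t _ => by
          congr 1
          simp only [ne_eq, not_true_eq_false, and_false, if_false]
          split_ifs <;> ring
        exact (congrArg (· ∈ W) (Finset.sum_congr rfl h5)).mpr hw
      · rw [hD', dif_pos ht]
      · rw [hD', dif_neg ht]
      · refine hlift w _ D D' (fun t _ => ?_) hD (fun t ht => by rw [hD', dif_pos ht])
          (fun t ht => ⟨k ⟨t, ht⟩, hk ⟨t, ht⟩, by rw [hD', dif_neg ht]⟩)
        simp only [ne_eq, not_true_eq_false, and_false, if_false]
        split_ifs <;> ring
    · rintro D' ⟨w', hw', hD', hD0⟩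
      choose k hk using fun t : {t // t ∉ Tor} => hD0 t t.2
      classical
      obtain ⟨D, hD⟩ := exists_vfield T.atlas (h q hq).1 fun t => if ht : t ∈ Tor then
        algebraMap 𝕜 _ ((if t ∈ S ∧ t ≠ i then w' i + w' t else w' t : ℚ) : 𝕜) *
          chartGerm T.atlas (h q hq).1 t
        else algebraMap 𝕜 _ (k ⟨t, ht⟩)
      refine ⟨D, ⟨fun t => if t ∈ S ∧ t ≠ i then w' i + w' t else w' t, ?_, fun t ht => ?_,
        fun t ht => ⟨k ⟨t, ht⟩, ?_⟩⟩, ?_⟩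
      · exact (congrArg (· ∈ W) (hsum w')).mp hw'
      · rw [hD, dif_pos ht]
      · rw [hD, dif_neg ht]
      · exact hlift _ w' D D' (fun t _ => rfl) (fun t ht => by rw [hD, dif_pos ht]) hD'
          (fun t ht => ⟨k ⟨t, ht⟩, by rw [hD, dif_neg ht], hk ⟨t, ht⟩⟩)
    · intro D' h0
      refine vfield_ext hψ hq fun t => ?_
      have hi0 : D' (chartGerm hψ hq i) = 0 := by
        have := h0 (chartGerm T.atlas (h q hq).1 i)
        rwa [hp, if_neg fun h => h.2 rfl] at this
      have h1 := h0 (chartGerm T.atlas (h q hq).1 t)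
      rw [hp] at h1
      split_ifs at h1 with ht
      · rw [Derivation.leibniz, hi0, smul_zero, add_zero, smul_eq_mul, mul_eq_zero] at h1
        exact h1.resolve_left (chartGerm_ne_zero hψ hq i)
      · exact h1
    · intro D' hD'
      exact mem_derLog_of_toricChart hψ mem off hE hq hD'

end Stage

section Step

variable {𝕜 : Type} [RCLike 𝕜] {m : ℕ}

theorem mem_strictSet_iff {N M : AnMfd.{u} 𝕜 m} (σ : AnMap N M) {C H : Set M}
    (ψ : OpenPartialHomeomorph N (Fin m → 𝕜)) {i j : Fin m} (hij : j ≠ i)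
    (h : ∀ y ∈ ψ.source, σ y ∈ H \ C ↔ ψ y j = 0 ∧ ψ y i ≠ 0) {y : N} (hy : y ∈ ψ.source) :
    y ∈ strictSet σ C H ↔ ψ y j = 0 := by
  classical
  constructor
  · intro hyc
    by_contra h0
    have hcont : ContinuousAt (fun x => ψ x j) y :=
      (continuous_apply j).continuousAt.comp (ψ.continuousAt hy)
    have hev : ∀ᶠ x in 𝓝 y, x ∈ ψ.source ∧ ψ x j ≠ 0 :=
      (ψ.open_source.eventually_mem hy).and (hcont.eventually_ne h0)
    obtain ⟨x, hx, hx'⟩ := (mem_closure_iff_frequently.1 hyc).and_eventually hev |>.exists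
    exact hx'.2 ((h x hx'.1).1 hx).1
  · intro h0
    by_cases hi : ψ y i = 0
    · have hlim : Tendsto (fun s : 𝕜 => ψ.symm (Function.update (ψ y) i s)) (𝓝[≠] 0) (𝓝 y) := by
        have h1 : Continuous fun s : 𝕜 => Function.update (ψ y) i s :=
          continuous_const.update i continuous_id
        have h2 : Tendsto (fun s : 𝕜 => Function.update (ψ y) i s) (𝓝[≠] 0) (𝓝 (ψ y)) := by
          have h3 := h1.tendsto 0
          rw [← hi, Function.update_eq_self] at h3
          rw [← hi]
          exact h3.mono_left nhdsWithin_le_nhds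
        have h4 := ψ.continuousAt_symm (ψ.map_source hy)
        rw [ContinuousAt, ψ.left_inv hy] at h4
        exact h4.comp h2
      refine mem_closure_of_tendsto hlim ?_
      have h1 : Continuous fun s : 𝕜 => Function.update (ψ y) i s :=
        continuous_const.update i continuous_id
      have h2 : ∀ᶠ s : 𝕜 in 𝓝[≠] 0, Function.update (ψ y) i s ∈ ψ.target := by
        refine Filter.Eventually.filter_mono nhdsWithin_le_nhds (h1.continuousAt.eventually
          (ψ.open_target.mem_nhds ?_))
        rw [← hi]
        beta_reduce
        rw [Function.update_eq_self]
        exact ψ.map_source hy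
      filter_upwards [h2, self_mem_nhdsWithin] with s hs hs0
      rw [mem_preimage, h _ (ψ.map_target hs), ψ.right_inv hs]
      rw [Function.update_of_ne hij, Function.update_self]
      exact ⟨h0, hs0⟩
    · exact subset_closure ((h y hy).2 ⟨h0, hi⟩)

theorem strictSet_subset {N M : AnMfd.{u} 𝕜 m} (σ : AnMap N M) {C H : Set M} (hH : IsClosed H) :
    strictSet σ C H ⊆ σ ⁻¹' H :=
  closure_minimal (preimage_mono sdiff_subset) (hH.preimage σ.contMDiff.continuous)

theorem chartGerm_congr {M : AnMfd.{u} 𝕜 m} {e e' : OpenPartialHomeomorph M (Fin m → 𝕜)}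
    (he : e ∈ IsManifold.maximalAtlas 𝓘(𝕜, Fin m → 𝕜) ω M)
    (he' : e' ∈ IsManifold.maximalAtlas 𝓘(𝕜, Fin m → 𝕜) ω M) {x : M} (hx : x ∈ e.source)
    (hx' : x ∈ e'.source) (h : ∀ y, e' y = e y) (j : Fin m) :
    chartGerm he' hx' j = chartGerm he hx j :=
  Subtype.ext (Germ.coe_eq.2 (Eventually.of_forall fun y => congrFun (h y) j))

theorem IsToricChart.restrict {Y : FolSub.{u} 𝕜 m} {x : Y.M → Fin m → 𝕜} {ι : Type}
    {H : ι → Set Y.M} {ρ : ι → Fin m → ℕ} {Tor : Finset (Fin m)} {W : Submodule ℚ (Fin m → ℚ)}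
    {e : OpenPartialHomeomorph Y.M (Fin m → 𝕜)} {lab : Fin m → ι}
    (T : IsToricChart Y x H ρ Tor W e lab) {e' : OpenPartialHomeomorph Y.M (Fin m → 𝕜)}
    (he' : e' ∈ IsManifold.maximalAtlas 𝓘(𝕜, Fin m → 𝕜) ω Y.M) (hs : e'.source ⊆ e.source)
    (h : ∀ y, e' y = e y) : IsToricChart Y x H ρ Tor W e' lab := by
  refine ⟨he', T.inj, fun t ht y hy => by rw [h]; exact T.mem t ht y (hs hy),
    fun l hl y hy => T.off l hl y (hs hy), fun y hy i hi => ?_, fun y hy i hi => ?_, T.indep,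
    fun y hy => ?_⟩
  · simp only [h]
    exact T.coord y (hs hy) i hi
  · rw [h]
    exact T.coord' y (hs hy) i hi
  · rw [T.field y (hs hy)]
    simp only [toricFields, chartGerm_congr T.atlas he' (hs hy) hy h]

variable {X : FolSub.{u} 𝕜 m} {e₀ : OpenPartialHomeomorph X.M (Fin m → 𝕜)}
    {Tor : Finset (Fin m)} {W : Submodule ℚ (Fin m → ℚ)} {v : Fin m}

namespace Stage

theorem exists_label (S : Stage X e₀ Tor W v) {e : OpenPartialHomeomorph S.Y.M (Fin m → 𝕜)}
    {lab : Fin m → S.ι} (T : IsToricChart S.Y (fun y => e₀ (S.π y)) S.H S.ρ Tor W e lab)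
    {q : S.Y.M} (hq : q ∈ e.source) {l : S.ι} (hl : q ∈ S.H l) : ∃ t ∈ Tor, lab t = l := by
  by_contra! h
  exact T.off l h q hq hl

/-- In toric coordinates, an intersection of two hypersurfaces is adapted. -/
theorem exists_adapted (S : Stage X e₀ Tor W v) {l₁ l₂ : S.ι} (hne : l₁ ≠ l₂) {q : S.Y.M}
    (hq : q ∈ S.H l₁ ∩ S.H l₂) : ∃ e lab, q ∈ e.source ∧
      IsToricChart S.Y (fun y => e₀ (S.π y)) S.H S.ρ Tor W e lab ∧ ∃ t₁ ∈ Tor, ∃ t₂ ∈ Tor,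
        lab t₁ = l₁ ∧ lab t₂ = l₂ ∧ t₁ ≠ t₂ ∧ ∀ x ∈ e.source, x ∈ S.H l₁ ∩ S.H l₂ ↔
          ∀ s ∈ ({t₁, t₂} : Finset (Fin m)), e x s = 0 := by
  obtain ⟨e, lab, hqe, T⟩ := S.chart q
  obtain ⟨t₁, h₁, rfl⟩ := S.exists_label T hqe hq.1
  obtain ⟨t₂, h₂, rfl⟩ := S.exists_label T hqe hq.2
  refine ⟨e, lab, hqe, T, t₁, h₁, t₂, h₂, rfl, rfl, fun h => hne (by rw [h]), fun x hx => ?_⟩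
  rw [mem_inter_iff, T.mem _ h₁ x hx, T.mem _ h₂ x hx]
  simp

theorem mem_span_of_field {M : AnMfd.{u} 𝕜 m} {e : OpenPartialHomeomorph M (Fin m → 𝕜)}
    (he : e ∈ IsManifold.maximalAtlas 𝓘(𝕜, Fin m → 𝕜) ω M) {q : M} (hq : q ∈ e.source)
    {A : Set (Fin m → ℚ)} {D : VField q}
    (hD : D ∈ Submodule.span (AnGerm q) (toricFields he hq Tor A)) {t : Fin m} (ht : t ∈ Tor) :
    chartGerm he hq t ∣ D (chartGerm he hq t) := by
  induction hD using Submodule.span_induction with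
  | mem D hD =>
    obtain ⟨w, -, h, -⟩ := hD
    rw [h t ht]
    exact dvd_mul_left _ _
  | zero => exact dvd_zero _
  | add D D' _ _ h h' => exact dvd_add h h'
  | smul a D _ h => exact h.mul_left a

theorem isAdmissibleCenter (S : Stage X e₀ Tor W v) {l₁ l₂ : S.ι} (hne : l₁ ≠ l₂) :
    S.Y.IsAdmissibleCenter (S.H l₁ ∩ S.H l₂) := by
  classical
  refine ⟨(S.closed l₁).inter (S.closed l₂), fun q hq => ?_, 0, Nat.zero_le _,
    fun q hq k hk => ⟨fun h0 => ?_, fun h0 => ?_⟩⟩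
  · obtain ⟨e, lab, hqe, T, t₁, h₁, t₂, h₂, -, -, -, hC⟩ := S.exists_adapted hne hq
    obtain ⟨c, hcs, hc⟩ := exists_centeredChart T.atlas hqe
    have hz : ∀ t ∈ Tor, e q t = 0 → ∀ x, c.e x t = e x t := fun t _ h0 x => by
      rw [hc]
      simp [h0]
    have hlen : S.Y.E.length = S.L.length := by rw [S.divisor, List.length_map]
    have hget : ∀ a : Fin S.Y.E.length, S.Y.E.get a = (S.L[a.1]'(hlen ▸ a.2)).elim ∅ S.H := by
      intro a
      simp only [List.get_eq_getElem, S.divisor, List.getElem_map]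
    have hl : ∀ a : Fin S.Y.E.length, ∃ t : Fin m, q ∈ S.Y.E.get a →
        t ∈ Tor ∧ S.L[a.1]'(hlen ▸ a.2) = some (lab t) ∧ e q t = 0 := by
      intro a
      by_cases hqa : q ∈ S.Y.E.get a
      · rw [hget] at hqa
        cases hL : S.L[a.1]'(hlen ▸ a.2) with
        | none =>
          rw [hL] at hqa
          exact absurd hqa (by simp)
        | some l =>
          rw [hL] at hqa
          change q ∈ S.H l at hqa
          obtain ⟨t, ht, rfl⟩ := S.exists_label T hqe hqa
          exact ⟨t, fun _ => ⟨ht, rfl, (T.mem t ht q hqe).1 hqa⟩⟩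
      · exact ⟨v, fun h => absurd h hqa⟩
    choose j hj using hl
    refine ⟨c, {t₁, t₂}, j, ⟨t₁, by simp⟩, fun x hx => ?_, fun a a' ha ha' haa => ?_,
      fun a ha x hx => ?_⟩
    · rw [hcs] at hx
      rw [hC x hx]
      have h0 := (hC q hqe).1 hq
      refine forall₂_congr fun s hs => ?_
      have hsT : s ∈ Tor := by
        rw [Finset.mem_insert, Finset.mem_singleton] at hs
        rcases hs with rfl | rfl <;> assumption
      rw [hz s hsT (h0 s hs)]
    · obtain ⟨-, h1, -⟩ := hj a ha
      obtain ⟨-, h2, -⟩ := hj a' ha'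
      rw [haa] at h1
      by_contra hne
      have hp := List.pairwise_iff_getElem.1 S.pairwise
      rcases lt_or_gt_of_ne (fun h => hne (Fin.ext h) : a.1 ≠ a'.1) with hlt | hlt
      · exact hp _ _ (hlen ▸ a.2) (hlen ▸ a'.2) hlt _ h1 h2
      · exact hp _ _ (hlen ▸ a'.2) (hlen ▸ a.2) hlt _ h2 h1
    · rw [hcs] at hx
      obtain ⟨h1, h2, h3⟩ := hj a ha
      rw [hz _ h1 h3, hget, h2]
      exact T.mem _ h1 x hx
  · obtain rfl : k = 0 := Nat.le_zero.1 h0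
    rw [Ideal.eq_top_iff_one]
    refine Ideal.subset_span ⟨Fin.elim0, Fin.elim0, fun i => i.elim0, fun i => i.elim0, ?_⟩
    simp
  · obtain ⟨e, lab, hqe, T, t₁, h₁, t₂, h₂, -, -, -, hC⟩ := S.exists_adapted hne hq
    have hvan := vanIdeal_eq_span T.atlas hqe {t₁, t₂} (C := S.H l₁ ∩ S.H l₂) (by
      filter_upwards [e.open_source.mem_nhds hqe] with x hx
      exact hC x hx)
    have hmem : ∀ s ∈ ({t₁, t₂} : Finset (Fin m)), s ∈ Tor := by
      intro s hs
      rw [Finset.mem_insert, Finset.mem_singleton] at hs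
      rcases hs with rfl | rfl <;> assumption
    have hstab : ∀ D ∈ S.Y.θ q, ∀ g ∈ vanIdeal (S.H l₁ ∩ S.H l₂) q,
        D g ∈ vanIdeal (S.H l₁ ∩ S.H l₂) q := by
      intro D hD g hg
      rw [T.field q hqe] at hD
      rw [hvan] at hg ⊢
      induction hg using Submodule.span_induction with
      | mem x hx =>
        obtain ⟨s, hs, rfl⟩ := hx
        exact Ideal.mem_of_dvd _ (mem_span_of_field T.atlas hqe hD (hmem s hs))
          (Ideal.subset_span ⟨s, hs, rfl⟩)
      | zero => rw [map_zero]; exact zero_mem _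
      | add a b _ _ ha hb => rw [map_add]; exact add_mem ha hb
      | smul a b hb h =>
        rw [smul_eq_mul, Derivation.leibniz]
        refine add_mem (Ideal.mul_mem_left _ _ h) ?_
        rw [smul_eq_mul]
        exact Ideal.mul_mem_right _ _ hb
    rw [fitting, Ideal.span_le]
    rintro _ ⟨D, f, hD, hf, rfl⟩
    rw [SetLike.mem_coe, Matrix.det_apply]
    refine Ideal.sum_mem _ fun p _ => ?_
    rw [Units.smul_def, zsmul_eq_mul]
    refine Ideal.mul_mem_left _ _ ?_
    rw [← Finset.mul_prod_erase _ _ (Finset.mem_univ (⟨0, h0⟩ : Fin k))]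
    exact Ideal.mul_mem_right _ _ (hstab _ (hD _) _ (hf _))

end Stage

end Step

section StepExists

variable {𝕜 : Type} [RCLike 𝕜] {m : ℕ} {X : FolSub.{u} 𝕜 m}
    {e₀ : OpenPartialHomeomorph X.M (Fin m → 𝕜)}
    {Tor : Finset (Fin m)} {W : Submodule ℚ (Fin m → ℚ)} {v : Fin m}

theorem pull_comp {N M K : AnMfd.{u} 𝕜 m} (π : AnMap M K) (σ : AnMap N M) (q : N) :
    (pull (π.comp σ) q : AnGerm (π (σ q)) →ₐ[𝕜] AnGerm q) =
      (pull σ q).comp (pull π (σ q)) := by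
  refine AlgHom.ext fun g => ?_
  induction g using germ_induction with
  | h f hf => rfl

theorem map_pull_comp {N M K : AnMfd.{u} 𝕜 m} (π : AnMap M K) (σ : AnMap N M) (q : N)
    (R : Subalgebra 𝕜 (AnGerm (π (σ q)))) :
    (R.map (pull π (σ q))).map (pull σ q) =
      R.map (pull (π.comp σ) q : AnGerm (π (σ q)) →ₐ[𝕜] AnGerm q) := by
  rw [pull_comp, Subalgebra.map_map]
  rfl

namespace Stage

/-- Toric coordinates at the points of a blowing-up, over the centre. -/
theorem toricChart_over_center (S : Stage X e₀ Tor W v) {l₁ l₂ : S.ι} (hne : l₁ ≠ l₂)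
    {N : AnMfd.{u} 𝕜 m} (σ : AnMap N S.Y.M)
    (hσ : ∀ e ∈ IsManifold.maximalAtlas 𝓘(𝕜, Fin m → 𝕜) ω S.Y.M, ∀ T : Finset (Fin m),
        (∀ x ∈ e.source, x ∈ S.H l₁ ∩ S.H l₂ ↔ ∀ s ∈ T, e x s = 0) →
        ∃ ψ : Fin m → OpenPartialHomeomorph N (Fin m → 𝕜),
          (∀ i ∈ T, ψ i ∈ IsManifold.maximalAtlas 𝓘(𝕜, Fin m → 𝕜) ω N ∧
            (∀ y ∈ (ψ i).source, σ y ∈ e.source ∧ e (σ y) = blowMap T i (ψ i y)) ∧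
            (ψ i).target = blowMap T i ⁻¹' e.target) ∧
          ∀ y, σ y ∈ e.source → ∃ i ∈ T, y ∈ (ψ i).source)
    {H' : Option S.ι → Set N} (hnone : H' none = σ ⁻¹' (S.H l₁ ∩ S.H l₂))
    (hsome : ∀ l, H' (some l) = strictSet σ (S.H l₁ ∩ S.H l₂) (S.H l))
    {ρ' : Option S.ι → Fin m → ℕ} (hρnone : ρ' none = S.ρ l₁ + S.ρ l₂)
    (hρsome : ∀ l, ρ' (some l) = S.ρ l)
    {L : List (Option (Option S.ι))}
    (hE : (S.Y.blowTransform N σ (S.H l₁ ∩ S.H l₂)).E = L.map fun o => o.elim ∅ H')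
    {y : N} (hy : σ y ∈ S.H l₁ ∩ S.H l₂) :
    ∃ e lab, y ∈ e.source ∧ IsToricChart (S.Y.blowTransform N σ (S.H l₁ ∩ S.H l₂))
      (fun y => e₀ (S.π (σ y))) H' ρ' Tor W e lab ∧
      ((∀ t ∈ Tor, lab t ≠ some l₁) ∨ ∀ t ∈ Tor, lab t ≠ some l₂) := by
  classical
  obtain ⟨e, lab, hqe, T, t₁, h₁, t₂, h₂, hl₁, hl₂, ht, hC⟩ := S.exists_adapted hne hy
  obtain ⟨ψ, hψ, hcov⟩ := hσ e T.atlas {t₁, t₂} hC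
  obtain ⟨i, hi, hyi⟩ := hcov y hqe
  obtain ⟨hψa, hψb, -⟩ := hψ i hi
  have hmem : ∀ s ∈ ({t₁, t₂} : Finset (Fin m)), s ∈ Tor := by
    intro s hs
    rw [Finset.mem_insert, Finset.mem_singleton] at hs
    rcases hs with rfl | rfl <;> assumption
  obtain ⟨j, hji, hj, hset⟩ : ∃ j, j ≠ i ∧ j ∈ ({t₁, t₂} : Finset (Fin m)) ∧
      ∀ s ∈ ({t₁, t₂} : Finset (Fin m)), s = i ∨ s = j := by
    rw [Finset.mem_insert, Finset.mem_singleton] at hi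
    rcases hi with rfl | rfl
    · exact ⟨t₂, ht.symm, by simp, fun s hs => by simpa using hs⟩
    · exact ⟨t₁, ht, by simp, fun s hs => by simpa [or_comm] using hs⟩
  have hcoord : ∀ x ∈ (ψ i).source, ∀ t, e (σ x) t =
      if t = j then ψ i x i * ψ i x t else ψ i x t := by
    intro x hx t
    rw [(hψb x hx).2]
    simp only [blowMap]
    by_cases htj : t = j
    · subst htj
      rw [if_pos ⟨hj, hji⟩, if_pos rfl]
    · rw [if_neg htj, if_neg]
      rintro ⟨hs, hsi⟩
      exact (hset t hs).elim hsi htj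
  have hCx : ∀ x ∈ (ψ i).source, σ x ∈ S.H l₁ ∩ S.H l₂ ↔ ψ i x i = 0 := by
    intro x hx
    rw [hC _ (hψb x hx).1]
    constructor
    · intro h
      have := h i hi
      rwa [hcoord x hx, if_neg hji.symm] at this
    · intro h s hs
      rcases hset s hs with rfl | rfl
      · rw [hcoord x hx, if_neg hji.symm, h]
      · rw [hcoord x hx, if_pos rfl, h, zero_mul]
  have hHx : ∀ x ∈ (ψ i).source, ∀ t ∈ Tor, t ≠ i →
      (σ x ∈ S.H (lab t) \ (S.H l₁ ∩ S.H l₂) ↔ ψ i x t = 0 ∧ ψ i x i ≠ 0) := by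
    intro x hx t ht hti
    rw [Set.mem_sdiff, hCx x hx, T.mem t ht _ (hψb x hx).1, hcoord x hx]
    by_cases htj : t = j
    · rw [if_pos htj, mul_eq_zero]
      tauto
    · rw [if_neg htj]
  have hHi : ∀ x ∈ (ψ i).source, x ∉ strictSet σ (S.H l₁ ∩ S.H l₂) (S.H (lab i)) := by
    intro x hx hxc
    obtain ⟨z, hz, hzs⟩ :=
      (mem_closure_iff_frequently.1 hxc).and_eventually ((ψ i).open_source.mem_nhds hx) |>.exists
    refine hz.2 ((hCx z hzs).2 ?_)
    have := (T.mem i (hmem i hi) _ (hψb z hzs).1).1 hz.1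
    rwa [hcoord z hzs, if_neg hji.symm] at this
  have hinj : ∀ s ∈ Tor, ∀ t ∈ Tor, (if s = i then none else some (lab s)) =
      (if t = i then none else some (lab t)) → s = t := by
    intro s hs t ht h
    split_ifs at h with h1 h2 h2
    · rw [h1, h2]
    · exact T.inj s hs t ht (Option.some_injective _ h)
  refine ⟨ψ i, fun t => if t = i then none else some (lab t), hyi,
    T.blowup (S.Y.blowTransform N σ (S.H l₁ ∩ S.H l₂)) σ hψa hmem hi hψb
      (fun t _ hti => by simp only [if_neg hti, hρsome]) ?_ hinj ?_ ?_ hE (fun q => rfl), ?_⟩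
  · simp only [if_true, hρnone]
    rw [Finset.sum_pair ht, hl₁, hl₂]
  · intro t ht x hx
    by_cases hti : t = i
    · subst hti
      simp only [if_true, hnone]
      exact hCx x hx
    · simp only [if_neg hti, hsome]
      exact mem_strictSet_iff σ (ψ i) hti (fun x hx => hHx x hx t ht hti) hx
  · intro l hl x hx
    cases l with
    | none => exact absurd (if_pos rfl) (hl i (hmem i hi))
    | some l =>
      rw [hsome]
      by_cases hli : lab i = l
      · rw [← hli]
        exact hHi x hx
      · refine fun hxl => T.off l (fun t ht htl => ?_) _ (hψb x hx).1
          (strictSet_subset σ (S.closed l) hxl)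
        refine hl t ht ?_
        rw [if_neg, htl]
        rintro rfl
        exact hli htl
  · have key : ∀ t ∈ Tor, (if t = i then none else some (lab t)) ≠ some (lab i) := by
      intro t ht h
      split_ifs at h with h1
      exact h1 (T.inj t ht i (hmem i hi) (Option.some_injective _ h))
    rw [Finset.mem_insert, Finset.mem_singleton] at hi
    rcases hi with rfl | rfl
    · left
      rw [← hl₁]
      exact key
    · right
      rw [← hl₂]
      exact key

/-- Toric coordinates at the points of a blowing-up, off the centre. -/
theorem toricChart_off_center (S : Stage X e₀ Tor W v) {l₁ l₂ : S.ι}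
    {N : AnMfd.{u} 𝕜 m} (σ : AnMap N S.Y.M)
    (hσ : ∀ e ∈ IsManifold.maximalAtlas 𝓘(𝕜, Fin m → 𝕜) ω S.Y.M,
      (∀ x ∈ e.source, x ∉ S.H l₁ ∩ S.H l₂) →
        ∃ ψ ∈ IsManifold.maximalAtlas 𝓘(𝕜, Fin m → 𝕜) ω N, ψ.source = σ ⁻¹' e.source ∧
          ∀ y, ψ y = e (σ y))
    {H' : Option S.ι → Set N} (hnone : H' none = σ ⁻¹' (S.H l₁ ∩ S.H l₂))
    (hsome : ∀ l, H' (some l) = strictSet σ (S.H l₁ ∩ S.H l₂) (S.H l))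
    {ρ' : Option S.ι → Fin m → ℕ} (hρsome : ∀ l, ρ' (some l) = S.ρ l)
    {L : List (Option (Option S.ι))}
    (hE : (S.Y.blowTransform N σ (S.H l₁ ∩ S.H l₂)).E = L.map fun o => o.elim ∅ H')
    {y : N} (hy : σ y ∉ S.H l₁ ∩ S.H l₂) :
    ∃ e lab, y ∈ e.source ∧ IsToricChart (S.Y.blowTransform N σ (S.H l₁ ∩ S.H l₂))
      (fun y => e₀ (S.π (σ y))) H' ρ' Tor W e lab := by
  classical
  obtain ⟨e, lab, hqe, T⟩ := S.chart (σ y)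
  obtain ⟨e', he', hes, hev⟩ := exists_restrict T.atlas
    ((S.closed l₁).inter (S.closed l₂)).isOpen_compl
  have T' := T.restrict he' (hes ▸ inter_subset_left) hev
  have hoff : ∀ x ∈ e'.source, x ∉ S.H l₁ ∩ S.H l₂ := fun x hx => by
    rw [hes] at hx
    exact hx.2
  obtain ⟨ψ, hψ, hψs, hψv⟩ := hσ e' he' hoff
  have hmemψ : ∀ {x}, x ∈ ψ.source ↔ σ x ∈ e'.source := fun {x} => by rw [hψs]; rfl
  have hstrict : ∀ l, ∀ x ∈ ψ.source,
      x ∈ strictSet σ (S.H l₁ ∩ S.H l₂) (S.H l) ↔ σ x ∈ S.H l := fun l x hx =>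
    ⟨fun h => strictSet_subset σ (S.closed l) h,
      fun h => subset_closure ⟨h, hoff _ (hmemψ.1 hx)⟩⟩
  refine ⟨ψ, fun t => some (lab t), hmemψ.2 (by rw [hes]; exact ⟨hqe, hy⟩),
    T'.blowup (S := {v}) (i := v) (S.Y.blowTransform N σ (S.H l₁ ∩ S.H l₂)) σ hψ
      (by simpa using S.v_mem) (by simp) (fun x hx => ⟨hmemψ.1 hx, ?_⟩)
      (fun t _ _ => hρsome _) (by simp [hρsome])
      (fun s hs t ht h => T.inj s hs t ht (Option.some_injective _ h)) ?_ ?_ hE (fun q => rfl)⟩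
  · ext j
    have : ¬ (j ∈ ({v} : Finset (Fin m)) ∧ j ≠ v) := by simp
    simp only [blowMap, if_neg this]
    exact congrFun (hψv x).symm j
  · intro t ht x hx
    rw [hsome]
    refine (hstrict _ x hx).trans ?_
    refine (T'.mem t ht _ (hmemψ.1 hx)).trans ?_
    exact (iff_of_eq (congrArg (· = (0 : 𝕜)) (congrFun (hψv x) t))).symm
  · intro l hl x hx
    cases l with
    | none =>
      rw [hnone]
      exact hoff _ (hmemψ.1 hx)
    | some l =>
      rw [hsome]
      refine fun hxl => ?_
      have := (hstrict _ x hx).1 hxl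
      revert this
      exact T'.off l (fun t ht h => hl t ht (congrArg some h)) _ (hmemψ.1 hx)

theorem exists_step (S : Stage X e₀ Tor W v) {l₁ l₂ : S.ι} (hne : l₁ ≠ l₂) :
    ∃ (S' : Stage X e₀ Tor W v) (f : Option S.ι → S'.ι) (σ : S'.Y.M → S.Y.M),
      Function.Surjective f ∧ S'.ρ (f none) = S.ρ l₁ + S.ρ l₂ ∧
      (∀ l, S'.ρ (f (some l)) = S.ρ l) ∧
      (∀ a b, (S'.H (f (some a)) ∩ S'.H (f (some b))).Nonempty → (S.H a ∩ S.H b).Nonempty) ∧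
      ¬ (S'.H (f (some l₁)) ∩ S'.H (f (some l₂))).Nonempty ∧
      (∀ a, (S'.H (f none) ∩ S'.H (f (some a))).Nonempty →
        (S.H a ∩ S.H l₁).Nonempty ∧ (S.H a ∩ S.H l₂).Nonempty) ∧
      (∀ y, S'.π y = S.π (σ y)) ∧
      ∀ (Z : FolSub.{u} 𝕜 m) (τ : Z.M → S'.Y.M), CombSeq S'.Y (range S'.H) Z τ →
        CombSeq S.Y (range S.H) Z fun y => σ (τ y) := by
  classical
  have := S.ne
  have := S.finite
  have hclosed : IsClosed (S.H l₁ ∩ S.H l₂) := (S.closed l₁).inter (S.closed l₂)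
  obtain ⟨N, σ, hsurj, hoff, hon, hblow⟩ := exists_blowup (C := S.H l₁ ∩ S.H l₂) hclosed v
    fun y hy => by
      obtain ⟨e, lab, hqe, T, t₁, h₁, t₂, h₂, -, -, -, hC⟩ := S.exists_adapted hne hy
      exact ⟨e, T.atlas, hqe, {t₁, t₂}, by simp, hC⟩
  let H' : Option S.ι → Set N := fun o =>
    o.elim (σ ⁻¹' (S.H l₁ ∩ S.H l₂)) fun l => strictSet σ (S.H l₁ ∩ S.H l₂) (S.H l)
  let ρ' : Option S.ι → Fin m → ℕ := fun o => o.elim (S.ρ l₁ + S.ρ l₂) S.ρ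
  let L' : List (Option (Option S.ι)) := S.L.map (Option.map some) ++ [some none]
  have hE : (S.Y.blowTransform N σ (S.H l₁ ∩ S.H l₂)).E = L'.map fun o => o.elim ∅ H' := by
    change S.Y.E.map _ ++ _ = _
    rw [List.map_append, S.divisor, List.map_map, List.map_map]
    congr 1
    refine List.map_congr_left fun o _ => ?_
    cases o with
    | none =>
      change closure _ = ∅
      change closure (σ ⁻¹' (∅ \ _)) = ∅
      rw [empty_sdiff, preimage_empty, closure_empty]
    | some l => rfl
  have hchart : ∀ y : N, ∃ e lab, y ∈ e.source ∧
      IsToricChart (S.Y.blowTransform N σ (S.H l₁ ∩ S.H l₂))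
        (fun y => e₀ (S.π (σ y))) H' ρ' Tor W e lab := by
    intro y
    by_cases hy : σ y ∈ S.H l₁ ∩ S.H l₂
    · obtain ⟨e, lab, h1, h2, -⟩ := S.toricChart_over_center hne σ hon (H' := H') rfl
        (fun _ => rfl) (ρ' := ρ') rfl (fun _ => rfl) hE hy
      exact ⟨e, lab, h1, h2⟩
    · exact S.toricChart_off_center σ hoff (H' := H') rfl (fun _ => rfl) (ρ' := ρ')
        (fun _ => rfl) hE hy
  have hsub : ∀ l, H' (some l) ⊆ σ ⁻¹' (S.H l) := fun l => strictSet_subset σ (S.closed l)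
  let S' : Stage X e₀ Tor W v :=
    { Y := S.Y.blowTransform N σ (S.H l₁ ∩ S.H l₂)
      π := S.π.comp σ
      ne := hsurj.nonempty
      π_mem := fun y => S.π_mem _
      ι := Option S.ι
      finite := inferInstance
      H := H'
      ρ := ρ'
      dim := S.dim
      ring := fun q => by
        exact (congrArg (Subalgebra.map (pull σ q)) (S.ring (σ q))).trans
          (map_pull_comp S.π σ q _)
      L := L'
      divisor := hE
      pairwise := by
        rw [List.pairwise_append, List.pairwise_map]
        refine ⟨S.pairwise.imp fun {a b} h l ha hb => ?_, List.pairwise_singleton _ _,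
          fun a ha b hb l hal hbl => ?_⟩
        · obtain ⟨x, rfl, rfl⟩ := Option.map_eq_some_iff.1 ha
          obtain ⟨x', rfl, hx'⟩ := Option.map_eq_some_iff.1 hb
          exact h x rfl (by rw [Option.some_injective _ hx'])
        · rw [List.mem_singleton] at hb
          rw [List.mem_map] at ha
          obtain ⟨o, -, rfl⟩ := ha
          obtain ⟨x, -, rfl⟩ := Option.map_eq_some_iff.1 hal
          rw [hb] at hbl
          simp at hbl
      closed := by
        rintro (_ | l)
        · exact hclosed.preimage σ.contMDiff.continuous
        · exact isClosed_closure
      v_mem := S.v_mem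
      supp := by
        rintro (_ | l) i hi
        · change S.ρ l₁ i + S.ρ l₂ i = 0
          rw [S.supp _ i hi, S.supp _ i hi]
        · exact S.supp l i hi
      label := by
        rintro (_ | l) hl
        · left
          simp [L']
        · obtain ⟨y, hy⟩ := hl
          rcases S.label l ⟨σ y, hsub l hy⟩ with h | h
          · left
            rw [List.mem_append, List.mem_map]
            exact Or.inl ⟨_, h, rfl⟩
          · exact Or.inr h
      chart := hchart }
  refine ⟨S', id, σ, Function.surjective_id, rfl, fun l => rfl, ?_, ?_, ?_, fun y => rfl, ?_⟩
  · rintro a b ⟨y, ha, hb⟩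
    exact ⟨σ y, hsub a ha, hsub b hb⟩
  · rintro ⟨y, ha, hb⟩
    obtain ⟨e, lab, h1, h2, h3⟩ := S.toricChart_over_center hne σ hon (H' := H') rfl
        (fun _ => rfl) (ρ' := ρ') rfl (fun _ => rfl) hE (y := y) ⟨hsub _ ha, hsub _ hb⟩
    rcases h3 with h3 | h3
    · exact h2.off _ h3 y h1 ha
    · exact h2.off _ h3 y h1 hb
  · rintro a ⟨y, h0, ha⟩
    exact ⟨⟨σ y, hsub a ha, h0.1⟩, ⟨σ y, hsub a ha, h0.2⟩⟩
  · intro Z τ h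
    refine CombSeq.step S.Y (range S.H) (S.H l₁ ∩ S.H l₂) N σ Z τ ?_
      (S.isAdmissibleCenter hne) hblow ?_
    · exact ⟨{S.H l₁, S.H l₂}, by rintro _ (rfl | rfl) <;> exact mem_range_self _,
        Set.toFinite _, ⟨_, Or.inl rfl⟩, by simp⟩
    · convert! h using 1
      ext K
      constructor
      · rintro (⟨_, ⟨l, rfl⟩, rfl⟩ | rfl)
        · exact ⟨some l, rfl⟩
        · exact ⟨none, rfl⟩
      · rintro ⟨_ | l, rfl⟩
        · exact Or.inr rfl
        · exact Or.inl ⟨_, ⟨l, rfl⟩, rfl⟩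

end Stage

end StepExists

section Termination

variable {𝕜 : Type} [RCLike 𝕜] {m : ℕ} {X : FolSub.{u} 𝕜 m}
    {e₀ : OpenPartialHomeomorph X.M (Fin m → 𝕜)}
    {Tor : Finset (Fin m)} {W : Submodule ℚ (Fin m → ℚ)} {v : Fin m}

/-- The pairing of a ray and a difference of exponents. -/
def rayDot (r : Fin m → ℕ) (d : Fin m → ℤ) : ℤ := ∑ i, (r i : ℤ) * d i

theorem rayDot_add (r s : Fin m → ℕ) (d : Fin m → ℤ) :
    rayDot (r + s) d = rayDot r d + rayDot s d := by
  simp only [rayDot, Pi.add_apply, Nat.cast_add, add_mul, Finset.sum_add_distrib]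

namespace Stage

/-- At each point, the signs of `d` on the rays of the hypersurfaces through it agree. -/
def Good (S : Stage X e₀ Tor W v) (d : Fin m → ℤ) : Prop :=
  ∀ l l', (S.H l ∩ S.H l').Nonempty → 0 < rayDot (S.ρ l) d → 0 ≤ rayDot (S.ρ l') d

/-- The pairs violating `Good`. -/
def bad (S : Stage X e₀ Tor W v) (d : Fin m → ℤ) : Set (S.ι × S.ι) :=
  {x | (S.H x.1 ∩ S.H x.2).Nonempty ∧ 0 < rayDot (S.ρ x.1) d ∧ rayDot (S.ρ x.2) d < 0}

/-- The variation of `d` over a pair of rays. -/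
def gap (S : Stage X e₀ Tor W v) (d : Fin m → ℤ) (x : S.ι × S.ι) : ℤ :=
  rayDot (S.ρ x.1) d - rayDot (S.ρ x.2) d

theorem good_of_bad_eq_empty (S : Stage X e₀ Tor W v) {d : Fin m → ℤ} (h : S.bad d = ∅) :
    S.Good d := by
  intro l l' hl h1
  by_contra h2
  have : (l, l') ∈ S.bad d := ⟨hl, h1, not_le.1 h2⟩
  rw [h] at this
  exact this

/-- `S` has a total transform which is good for all `d ∈ Q`. -/
def Completes (S : Stage X e₀ Tor W v) (Q : Set (Fin m → ℤ)) : Prop :=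
  ∃ (S' : Stage X e₀ Tor W v) (τ : S'.Y.M → S.Y.M), CombSeq S.Y (range S.H) S'.Y τ ∧
    (∀ y, S'.π y = S.π (τ y)) ∧ ∀ d ∈ Q, S'.Good d

theorem exists_better (S : Stage X e₀ Tor W v) {d : Fin m → ℤ} {x : S.ι × S.ι}
    (hx : x ∈ S.bad d) (hmax : ∀ z ∈ S.bad d, S.gap d z ≤ S.gap d x) :
    ∃ S' : Stage X e₀ Tor W v, (∀ Q, S'.Completes Q → S.Completes Q) ∧
      (∀ d', S.Good d' → S'.Good d') ∧ (∀ z ∈ S'.bad d, S'.gap d z ≤ S.gap d x) ∧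
      {z ∈ S'.bad d | S'.gap d z = S.gap d x}.ncard < {z ∈ S.bad d | S.gap d z = S.gap d x}.ncard := by
  obtain ⟨l₁, l₂⟩ := x
  obtain ⟨hadj, hpos, hneg⟩ := hx
  simp only at hadj hpos hneg
  have hne : l₁ ≠ l₂ := by
    rintro rfl
    exact absurd hpos (not_lt.2 hneg.le)
  obtain ⟨S', f, σ, hf, hρ0, hρ, hss, h12, h0s, hπ, hcomb⟩ := S.exists_step hne
  have hd0 : ∀ d, rayDot (S'.ρ (f none)) d = rayDot (S.ρ l₁) d + rayDot (S.ρ l₂) d :=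
    fun d => by rw [hρ0, rayDot_add]
  have hds : ∀ d l, rayDot (S'.ρ (f (some l))) d = rayDot (S.ρ l) d := fun d l => by rw [hρ]
  have key : ∀ z ∈ S'.bad d, (∃ a b, z = (f (some a), f (some b)) ∧ (a, b) ∈ S.bad d ∧
      (a, b) ≠ (l₁, l₂)) ∨ S'.gap d z < S.gap d (l₁, l₂) := by
    rintro ⟨z₁, z₂⟩ ⟨h1, h2, h3⟩
    obtain ⟨o₁, rfl⟩ := hf z₁
    obtain ⟨o₂, rfl⟩ := hf z₂
    simp only at h1 h2 h3
    cases o₁ with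
    | none =>
      cases o₂ with
      | none => exact absurd h2 (not_lt.2 h3.le)
      | some b =>
        right
        obtain ⟨hb1, hb2⟩ := h0s b h1
        rw [hds] at h3
        have := hmax (l₁, b) ⟨by rwa [inter_comm], hpos, h3⟩
        simp only [gap, hds, hd0] at this ⊢
        omega
    | some a =>
      cases o₂ with
      | none =>
        right
        obtain ⟨hb1, hb2⟩ := h0s a (by rwa [inter_comm])
        rw [hds] at h2
        have := hmax (a, l₂) ⟨hb2, h2, hneg⟩
        simp only [gap, hds, hd0] at this ⊢
        omega
      | some b =>
        left
        rw [hds] at h2 h3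
        refine ⟨a, b, rfl, ⟨hss a b h1, h2, h3⟩, ?_⟩
        rintro ⟨⟩
        exact h12 h1
  refine ⟨S', ?_, ?_, ?_, ?_⟩
  · rintro Q ⟨S'', τ, h1, h2, h3⟩
    exact ⟨S'', fun y => σ (τ y), hcomb _ τ h1, fun y => by rw [h2, hπ], h3⟩
  · intro d' hg z₁ z₂ h1 h2
    obtain ⟨o₁, rfl⟩ := hf z₁
    obtain ⟨o₂, rfl⟩ := hf z₂
    cases o₁ with
    | none =>
      cases o₂ with
      | none => exact h2.le
      | some b =>
        obtain ⟨hb1, hb2⟩ := h0s b h1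
        rw [hd0] at h2
        rw [hds]
        by_cases h3 : 0 < rayDot (S.ρ l₁) d'
        · exact hg l₁ b (by rwa [inter_comm]) h3
        · exact hg l₂ b (by rwa [inter_comm]) (by omega)
    | some a =>
      rw [hds] at h2
      cases o₂ with
      | none =>
        obtain ⟨hb1, hb2⟩ := h0s a (by rwa [inter_comm])
        rw [hd0]
        exact add_nonneg (hg a l₁ hb1 h2) (hg a l₂ hb2 h2)
      | some b =>
        rw [hds]
        exact hg a b (hss a b h1) h2
  · intro z hz
    rcases key z hz with ⟨a, b, rfl, hab, -⟩ | h
    · have := hmax _ hab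
      simpa only [gap, hds] using this
    · exact h.le
  · have := S.finite
    have hsub : {z ∈ S'.bad d | S'.gap d z = S.gap d (l₁, l₂)} ⊆
        (fun z : S.ι × S.ι => (f (some z.1), f (some z.2))) ''
          ({z ∈ S.bad d | S.gap d z = S.gap d (l₁, l₂)} \ {(l₁, l₂)}) := by
      rintro z ⟨hz, hzg⟩
      rcases key z hz with ⟨a, b, rfl, hab, hne⟩ | h
      · refine ⟨(a, b), ⟨⟨hab, ?_⟩, hne⟩, rfl⟩
        simpa only [gap, hds] using hzg
      · exact absurd hzg h.ne
    refine (ncard_le_ncard hsub (toFinite _)).trans_lt ((ncard_image_le (toFinite _)).trans_lt ?_)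
    exact ncard_sdiff_singleton_lt_of_mem ⟨⟨hadj, hpos, hneg⟩, rfl⟩ (toFinite _)

theorem exists_completion (l : List (Fin m → ℤ)) : ∀ (Q : Set (Fin m → ℤ))
    (S : Stage X e₀ Tor W v), (∀ d ∈ Q, S.Good d) → S.Completes (Q ∪ {d | d ∈ l}) := by
  induction l with
  | nil =>
    intro Q S h
    refine ⟨S, id, CombSeq.refl _ _, fun y => rfl, fun d hd => h d ?_⟩
    simpa using hd
  | cons d l ih =>
    intro Q S hQ
    have main : ∀ B n : ℕ, ∀ S : Stage X e₀ Tor W v, (∀ d ∈ Q, S.Good d) →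
        (∀ z ∈ S.bad d, S.gap d z ≤ B) → {z ∈ S.bad d | S.gap d z = B}.ncard ≤ n →
        S.Completes (Q ∪ {d' | d' ∈ d :: l}) := by
      intro B
      have hgood : ∀ S : Stage X e₀ Tor W v, (∀ d ∈ Q, S.Good d) → S.bad d = ∅ →
          S.Completes (Q ∪ {d' | d' ∈ d :: l}) := by
        intro S hS hb
        have h1 := ih (insert d Q) S (by
          rintro d' (rfl | hd')
          · exact S.good_of_bad_eq_empty hb
          · exact hS d' hd')
        convert! h1 using 1
        ext d'
        simp only [mem_union, mem_insert_iff, mem_ofPred_eq, List.mem_cons]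
        tauto
      induction B with
      | zero =>
        intro n S hS hB _
        refine hgood S hS (eq_empty_of_forall_notMem fun z hz => ?_)
        have h1 := hB z hz
        obtain ⟨-, h2, h3⟩ := hz
        simp only [gap] at h1
        omega
      | succ B ihB =>
        intro n
        induction n with
        | zero =>
          intro S hS hB hn
          have := S.finite
          rw [Nat.le_zero, ncard_eq_zero (toFinite _)] at hn
          refine ihB _ S hS (fun z hz => ?_) le_rfl
          have h1 := hB z hz
          have h2 : S.gap d z ≠ (B + 1 : ℕ) := fun h => by
            have : z ∈ {z ∈ S.bad d | S.gap d z = (B + 1 : ℕ)} := ⟨hz, h⟩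
            rw [hn] at this
            exact this
          push_cast at h1 h2
          omega
        | succ n ihn =>
          intro S hS hB hn
          by_cases hex : ∃ x ∈ S.bad d, S.gap d x = (B + 1 : ℕ)
          · obtain ⟨x, hx, hxg⟩ := hex
            obtain ⟨S', h1, h2, h3, h4⟩ := S.exists_better hx (fun z hz => by
              rw [hxg]
              exact hB z hz)
            rw [hxg] at h3 h4
            exact h1 _ (ihn S' (fun d hd => h2 d (hS d hd)) h3 (by omega))
          · push Not at hex
            refine ihB _ S hS (fun z hz => ?_) le_rfl
            have h1 := hB z hz
            have h2 := hex z hz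
            push_cast at h1 h2
            omega
    have := S.finite
    obtain ⟨B, hB⟩ := ((S.bad d).toFinite.image (S.gap d)).bddAbove
    refine main B.toNat _ S hQ (fun z hz => ?_) le_rfl
    exact (hB ⟨z, hz, rfl⟩).trans (Int.self_le_toNat B)

end Stage

end Termination

section ExponentialCoordinates

/-- Reduced echelon form of a space of vectors, on a set of indices. -/
theorem exists_echelon {κ : Type*} [DecidableEq κ] (W : Submodule ℚ (κ → ℚ)) (I : Finset κ) :
    ∃ (R : Finset κ) (Y : κ → κ → ℚ), R ⊆ I ∧ (∀ r ∈ R, Y r ∈ W) ∧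
      (∀ r ∈ R, ∀ r' ∈ R, Y r r' = if r = r' then 1 else 0) ∧
      ∀ w ∈ W, (∀ r ∈ R, w r = 0) → ∀ t ∈ I, w t = 0 := by
  induction I using Finset.induction_on with
  | empty => exact ⟨∅, 0, by simp, by simp, by simp, by simp⟩
  | insert t I ht ih =>
    obtain ⟨R, Y, hR, hY, hδ, h0⟩ := ih
    by_cases h : ∀ w ∈ W, (∀ r ∈ R, w r = 0) → w t = 0
    · refine ⟨R, Y, hR.trans (Finset.subset_insert _ _), hY, hδ, fun w hw hwR s hs => ?_⟩
      rcases Finset.mem_insert.1 hs with rfl | hs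
      · exact h w hw hwR
      · exact h0 w hw hwR s hs
    · push Not at h
      obtain ⟨w₀, hw₀, hwR, hwt⟩ := h
      have htR : t ∉ R := fun h => ht (hR h)
      set w₁ : κ → ℚ := (w₀ t)⁻¹ • w₀ with hw₁
      have h1 : w₁ ∈ W := W.smul_mem _ hw₀
      have h1t : w₁ t = 1 := by simp [hw₁, hwt]
      have h1R : ∀ r ∈ R, w₁ r = 0 := fun r hr => by simp [hw₁, hwR r hr]
      refine ⟨insert t R, fun r => if r = t then w₁ else Y r - Y r t • w₁,
        Finset.insert_subset_insert _ hR, fun r hr => ?_, fun r hr r' hr' => ?_,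
        fun w hw hwR s hs => ?_⟩
      · by_cases hrt : r = t
        · simpa [hrt] using h1
        · simp only [if_neg hrt]
          exact sub_mem (hY r ((Finset.mem_insert.1 hr).resolve_left hrt)) (W.smul_mem _ h1)
      · by_cases hrt : r = t
        · subst hrt
          simp only [if_true]
          rcases Finset.mem_insert.1 hr' with rfl | hr'
          · simp [h1t]
          · rw [h1R _ hr', if_neg]
            rintro rfl
            exact htR hr'
        · simp only [if_neg hrt]
          have hrR := (Finset.mem_insert.1 hr).resolve_left hrt
          rcases Finset.mem_insert.1 hr' with rfl | hr'
          · simp [h1t, hrt]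
          · simp [h1R _ hr', hδ r hrR r' hr']
      · have h2 := h0 w hw fun r hr => hwR r (Finset.mem_insert_of_mem hr)
        rcases Finset.mem_insert.1 hs with rfl | hs
        · exact hwR _ (Finset.mem_insert_self _ _)
        · exact h2 s hs

variable {𝕜 : Type} [RCLike 𝕜] {m : ℕ}

theorem exists_chart_of_inverse {M : AnMfd.{u} 𝕜 m} {e : OpenPartialHomeomorph M (Fin m → 𝕜)}
    (he : e ∈ IsManifold.maximalAtlas 𝓘(𝕜, Fin m → 𝕜) ω M) {q : M} (hq : q ∈ e.source)
    {F : (Fin m → 𝕜) → Fin m → 𝕜} (hF : ContDiff 𝕜 ω F) (h0 : F 0 = e q)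
    (hinj : ∀ h, fderiv 𝕜 F 0 h = 0 → h = 0) :
    ∃ c : CenteredChart q, ∀ᶠ x in 𝓝 q, e x = F (c.e x) := by
  let f' : (Fin m → 𝕜) ≃L[𝕜] (Fin m → 𝕜) :=
    (LinearEquiv.ofInjectiveEndo (fderiv 𝕜 F 0 : (Fin m → 𝕜) →ₗ[𝕜] Fin m → 𝕜)
      ((injective_iff_map_eq_zero _).2 hinj)).toContinuousLinearEquiv
  have hf' : HasFDerivAt F (f' : (Fin m → 𝕜) →L[𝕜] (Fin m → 𝕜)) 0 := by
    have h1 := (hF.differentiable (by simp) 0).hasFDerivAt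
    convert! h1 using 1
  have hω : (ω : WithTop ℕ∞) ≠ 0 := by simp
  let G := hF.contDiffAt.toOpenPartialHomeomorph F hf' hω
  have hG0 : (0 : Fin m → 𝕜) ∈ G.source :=
    hF.contDiffAt.mem_toOpenPartialHomeomorph_source hf' hω
  have hGF : ∀ z, G z = F z := fun z => rfl
  have hqt : e q ∈ G.target := by
    rw [← h0, ← hGF]
    exact G.map_source hG0
  have hsymm : ContDiffAt 𝕜 ω G.symm (e q) := by
    rw [← h0]
    exact hF.contDiffAt.to_localInverse hf' hω
  obtain ⟨O, hO, hOo, hqO⟩ := eventually_nhds_iff.1 (hsymm.eventually (by simp))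
  have hU : IsOpen (e.source ∩ e ⁻¹' O) := e.isOpen_inter_preimage hOo
  let φ := (e.trans G.symm).restrOpen _ hU
  have hφs : φ.source = (e.source ∩ e ⁻¹' G.target) ∩ (e.source ∩ e ⁻¹' O) := rfl
  have hsub : φ.target ⊆ F ⁻¹' e.target := by
    intro z hz
    exact hz.1.2
  refine ⟨⟨φ, φ.mem_maximalAtlas_of_contMDiffOn ?_ ?_, ⟨⟨hq, hqt⟩, hq, hqO⟩, ?_⟩, ?_⟩
  · intro x hx
    rw [hφs] at hx
    exact (ContMDiffAt.comp x (g := G.symm) (hO _ hx.2.2).contMDiffAt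
      (contMDiffAt_of_mem_maximalAtlas he hx.1.1)).contMDiffWithinAt
  · intro z hz
    exact (ContMDiffAt.comp z (g := e.symm) (contMDiffAt_symm_of_mem_maximalAtlas he (hsub hz))
      hF.contMDiff.contMDiffAt).contMDiffWithinAt
  · change G.symm (e q) = 0
    rw [← h0, ← hGF, G.left_inv hG0]
  · filter_upwards [φ.open_source.mem_nhds (show q ∈ φ.source from ⟨⟨hq, hqt⟩, hq, hqO⟩)] with x hx
    exact (G.right_inv hx.1.2).symm

theorem isAnAt_comp_chart {M : AnMfd.{u} 𝕜 m} {q : M} (c : CenteredChart q)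
    {G : (Fin m → 𝕜) → 𝕜} (hG : ContDiff 𝕜 ω G) : IsAnAt (fun x => G (c.e x)) q :=
  ContMDiffAt.comp q (g := G) hG.contMDiff.contMDiffAt
    (contMDiffAt_of_mem_maximalAtlas c.mem_atlas c.mem_source)

theorem coordDer_comp_chart {M : AnMfd.{u} 𝕜 m} {q : M} (c : CenteredChart q)
    {G G' : (Fin m → 𝕜) → 𝕜} (hG : ContDiff 𝕜 ω G) (hG' : ContDiff 𝕜 ω G') (j : Fin m)
    (h : ∀ z, fderiv 𝕜 G z (Pi.single j 1) = G' z) :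
    coordDer c j (toGerm _ (isAnAt_comp_chart c hG)) = toGerm _ (isAnAt_comp_chart c hG') := by
  rw [coordDer_toGerm]
  refine Subtype.ext (Germ.coe_eq.2 ?_)
  filter_upwards [c.e.open_source.mem_nhds c.mem_source] with x hx
  simp only [partialFun]
  rw [← h]
  have h1 : (fun x => G (c.e x)) ∘ c.e.symm =ᶠ[𝓝 (c.e x)] G := by
    filter_upwards [c.e.open_target.mem_nhds (c.e.map_source hx)] with z hz
    simp [c.e.right_inv hz]
  rw [h1.fderiv_eq]

/-- Coordinates adapted to commuting diagonal vector fields: `Y r` becomes `∂ / ∂ z_r`. -/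
theorem exists_exp_chart {M : AnMfd.{u} 𝕜 m} {e : OpenPartialHomeomorph M (Fin m → 𝕜)}
    (he : e ∈ IsManifold.maximalAtlas 𝓘(𝕜, Fin m → 𝕜) ω M) {q : M} (hq : q ∈ e.source)
    {Tor J R : Finset (Fin m)} (hJ : J ⊆ Tor) (hR : R ⊆ Tor \ J) (hJ0 : ∀ t ∈ J, e q t = 0)
    (hT0 : ∀ t ∉ Tor, e q t = 0) (hI0 : ∀ t ∈ Tor, t ∉ J → e q t ≠ 0)
    (Y : Fin m → Fin m → ℚ) (hY : ∀ r ∈ R, ∀ r' ∈ R, Y r r' = if r = r' then 1 else 0) :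
    ∃ (c : CenteredChart q) (E : Fin m → AnGerm q),
      (∀ t ∈ J, chartGerm he hq t = coordGerm c t * E t) ∧
      (∀ t ∈ Tor, t ∉ J → chartGerm he hq t = E t) ∧
      (∀ t ∉ Tor, chartGerm he hq t = coordGerm c t) ∧
      (∀ t ∈ Tor, IsUnit (E t)) ∧
      (∀ r ∈ R, ∀ t ∈ Tor, coordDer c r (E t) = algebraMap 𝕜 _ (Y r t : 𝕜) * E t) ∧
      (∀ k, k ∈ J ∨ k ∉ Tor → ∀ t ∈ Tor, coordDer c k (E t) = 0) := by
  classical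
  let A : Fin m → Fin m → 𝕜 := fun t k =>
    if k ∈ R then (Y k t : 𝕜) else if k = t ∧ k ∈ Tor ∧ k ∉ J then 1 else 0
  let l : Fin m → (Fin m → 𝕜) →L[𝕜] 𝕜 := fun t =>
    ∑ k, A t k • (ContinuousLinearMap.proj k : (Fin m → 𝕜) →L[𝕜] 𝕜)
  have hl : ∀ t z, l t z = ∑ k, A t k * z k := fun t z => by
    simp [l]
  have hls : ∀ t k, l t (Pi.single k 1) = A t k := fun t k => by
    rw [hl, Finset.sum_eq_single k]
    · simp
    · intro b _ hb
      simp [hb]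
    · simp
  let a : Fin m → 𝕜 := fun t => if t ∈ J then 1 else e q t
  let Ef : Fin m → (Fin m → 𝕜) → 𝕜 := fun t z => a t * NormedSpace.exp (l t z)
  have hexp : ∀ t z, HasFDerivAt (Ef t) (Ef t z • l t) z := by
    intro t z
    have h1 : HasDerivAt (NormedSpace.exp : 𝕜 → 𝕜) (NormedSpace.exp (l t z)) (l t z) := hasDerivAt_exp
    have h2 := (h1.comp_hasFDerivAt z (l t).hasFDerivAt).const_mul (a t)
    rw [smul_smul] at h2
    exact h2
  have hexpC : ∀ t, ContDiff 𝕜 ω (Ef t) := fun t => by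
    have h1 : ContDiff 𝕜 ω (NormedSpace.exp : 𝕜 → 𝕜) := by
      rw [contDiff_iff_contDiffAt]
      exact fun x => (NormedSpace.exp_analytic (𝕂 := 𝕜) x).contDiffAt
    exact contDiff_const.mul (h1.comp (l t).contDiff)
  let F : (Fin m → 𝕜) → Fin m → 𝕜 := fun z t =>
    if t ∈ Tor then (if t ∈ J then z t * Ef t z else Ef t z) else z t
  have hFC : ContDiff 𝕜 ω F := by
    refine contDiff_pi.2 fun t => ?_
    by_cases ht : t ∈ Tor
    · by_cases htJ : t ∈ J
      · simp only [F, if_pos ht, if_pos htJ]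
        exact (contDiff_apply 𝕜 𝕜 t).mul (hexpC t)
      · simp only [F, if_pos ht, if_neg htJ]
        exact hexpC t
    · simp only [F, if_neg ht]
      exact contDiff_apply 𝕜 𝕜 t
  have hE0 : ∀ t, Ef t 0 = a t := fun t => by
    simp [Ef, NormedSpace.exp_zero]
  have hF0 : F 0 = e q := by
    ext t
    by_cases ht : t ∈ Tor
    · by_cases htJ : t ∈ J
      · simp [F, ht, htJ, hJ0 t htJ]
      · simp only [F, if_pos ht, if_neg htJ, hE0, a]
    · simp [F, ht, hT0 t ht]
  have ha : ∀ t ∈ Tor, a t ≠ 0 := by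
    intro t ht
    by_cases htJ : t ∈ J
    · simp [a, htJ]
    · simp only [a, if_neg htJ]
      exact hI0 t ht htJ
  have hpr : ∀ t, HasFDerivAt (fun z : Fin m → 𝕜 => z t)
      (ContinuousLinearMap.proj t : (Fin m → 𝕜) →L[𝕜] 𝕜) 0 := fun t =>
    (ContinuousLinearMap.proj t : (Fin m → 𝕜) →L[𝕜] 𝕜).hasFDerivAt
  have hinj : ∀ h, fderiv 𝕜 F 0 h = 0 → h = 0 := by
    intro h hh
    have hdiff : DifferentiableAt 𝕜 F 0 := hFC.differentiable (by simp) 0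
    have hcomp : ∀ t, fderiv 𝕜 (fun z => F z t) 0 h = 0 := fun t => by
      have h1 : HasFDerivAt (fun z => F z t)
          ((ContinuousLinearMap.proj t : (Fin m → 𝕜) →L[𝕜] 𝕜).comp (fderiv 𝕜 F 0)) 0 :=
        hasFDerivAt_pi'.1 hdiff.hasFDerivAt t
      rw [h1.fderiv]
      exact congrFun hh t
    have h1 : ∀ t, t ∈ J ∨ t ∉ Tor → h t = 0 := by
      intro t ht
      have h2 := hcomp t
      rcases ht with ht | ht
      · have h4 : (fun z => F z t) = (fun z => z t) * Ef t := by
          funext z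
          simp only [F, if_pos (hJ ht), if_pos ht, Pi.mul_apply]
        rw [h4, ((hpr t).mul (hexp t 0)).fderiv] at h2
        simpa [hE0, ha t (hJ ht)] using h2
      · have h4 : (fun z => F z t) = fun z => z t := by
          funext z
          simp only [F, if_neg ht]
        rw [h4, (hpr t).fderiv] at h2
        exact h2
    have h4 : ∀ t ∈ Tor, t ∉ J → ∑ k, A t k * h k = 0 := by
      intro t ht htJ
      have h2 := hcomp t
      have h5 : (fun z => F z t) = Ef t := by
        funext z
        simp only [F, if_pos ht, if_neg htJ]
      rw [h5, (hexp t 0).fderiv, _root_.smul_apply, hE0, smul_eq_mul, mul_eq_zero, hl] at h2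
      exact h2.resolve_left (ha t ht)
    have h5 : ∀ r ∈ R, h r = 0 := by
      intro r hr
      have hrT := hR hr
      rw [Finset.mem_sdiff] at hrT
      have h6 := h4 r hrT.1 hrT.2
      rw [Finset.sum_eq_single r] at h6
      · simpa [A, hr, hY r hr r hr] using h6
      · intro k _ hk
        by_cases hkR : k ∈ R
        · simp [A, hkR, hY k hkR r hr, hk]
        · simp [A, hkR, hk]
      · simp
    ext t
    by_cases ht : t ∈ J ∨ t ∉ Tor
    · exact h1 t ht
    · push Not at ht
      by_cases htR : t ∈ R
      · exact h5 t htR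
      · have h6 := h4 t ht.2 ht.1
        rw [Finset.sum_eq_single t] at h6
        · simpa [A, htR, ht] using h6
        · intro k _ hk
          by_cases hkR : k ∈ R
          · rw [h5 k hkR, mul_zero]
          · simp [A, hkR, hk]
        · simp
  obtain ⟨c, hc⟩ := exists_chart_of_inverse he hq hFC hF0 hinj
  have hfd : ∀ t k z, fderiv 𝕜 (Ef t) z (Pi.single k 1) = A t k * Ef t z := fun t k z => by
    rw [(hexp t z).fderiv, _root_.smul_apply, hls, smul_eq_mul, mul_comm]
  refine ⟨c, fun t => toGerm _ (isAnAt_comp_chart c (hexpC t)), fun t ht => ?_, fun t ht htJ => ?_,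
    fun t ht => ?_, fun t ht => ?_, fun r hr t ht => ?_, fun k hk t ht => ?_⟩
  · refine Subtype.ext (Germ.coe_eq.2 ?_)
    filter_upwards [hc] with x hx
    simp only [hx, F, if_pos (hJ ht), if_pos ht]
  · refine Subtype.ext (Germ.coe_eq.2 ?_)
    filter_upwards [hc] with x hx
    simp only [hx, F, if_pos ht, if_neg htJ]
  · refine Subtype.ext (Germ.coe_eq.2 ?_)
    filter_upwards [hc] with x hx
    simp only [hx, F, if_neg ht]
  · rw [isUnit_germ_iff, germEval_toGerm, c.map_center, hE0]
    exact ha t ht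
  · rw [coordDer_comp_chart c (hexpC t) (contDiff_const.mul (hexpC t)) r (hfd t r), algebraMap_germ]
    have : A t r = (Y r t : 𝕜) := by simp [A, hr]
    simp only [this]
    rfl
  · rw [coordDer_comp_chart c (hexpC t) (contDiff_const (c := (0 : 𝕜))) k fun z => ?_]
    · rfl
    · have hkR : k ∉ R := fun h => by
        have := Finset.mem_sdiff.1 (hR h)
        exact hk.elim this.2 fun h => h this.1
      rw [hfd]
      have : A t k = 0 := by
        simp only [A, if_neg hkR]
        rw [if_neg]
        rintro ⟨-, h1, h2⟩
        exact hk.elim h2 fun h => h h1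
      rw [this, zero_mul]

end ExponentialCoordinates

section MonomialPoint

variable {𝕜 : Type} [RCLike 𝕜] {m : ℕ}

theorem vfield_sum_apply {M : AnMfd.{u} 𝕜 m} {q : M} {κ : Type*} (S : Finset κ)
    (D : κ → VField q) (g : AnGerm q) : (∑ i ∈ S, D i) g = ∑ i ∈ S, D i g := by
  have := map_sum (Derivation.coeFnAddMonoidHom (R := 𝕜) (A := AnGerm q) (M := AnGerm q)) D S
  exact (congrFun this g).trans (Finset.sum_apply _ _ _)

/-- The diagonal vector field with exponents `w`. -/
noncomputable def diagField {M : AnMfd.{u} 𝕜 m} {q : M} (c : CenteredChart q)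
    (S : Finset (Fin m)) (w : Fin m → ℚ) : VField q :=
  ∑ j ∈ S, (w j : 𝕜) • coordGerm c j • coordDer c j

theorem diagField_apply {M : AnMfd.{u} 𝕜 m} {q : M} (c : CenteredChart q)
    (S : Finset (Fin m)) (w : Fin m → ℚ) (g : AnGerm q) :
    diagField c S w g = ∑ j ∈ S, algebraMap 𝕜 _ (w j : 𝕜) * (coordGerm c j * coordDer c j g) := by
  rw [diagField, vfield_sum_apply]
  refine Finset.sum_congr rfl fun j _ => ?_
  rw [Derivation.smul_apply, Derivation.smul_apply, Algebra.smul_def, smul_eq_mul]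

theorem diagField_coordGerm {M : AnMfd.{u} 𝕜 m} {q : M} (c : CenteredChart q)
    (S : Finset (Fin m)) (w : Fin m → ℚ) (hw : ∀ t ∉ S, w t = 0) (t : Fin m) :
    diagField c S w (coordGerm c t) = algebraMap 𝕜 _ (w t : 𝕜) * coordGerm c t := by
  classical
  rw [diagField_apply, Finset.sum_eq_single t]
  · rw [coordDer_coordGerm, if_pos rfl, mul_one]
  · intro j _ hj
    rw [coordDer_coordGerm, if_neg (Ne.symm hj), mul_zero, mul_zero]
  · intro ht
    rw [hw t ht, Rat.cast_zero, map_zero, zero_mul]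

/-- Exponential coordinates, see `exists_exp_chart`. -/
structure ExpCoord {M : AnMfd.{u} 𝕜 m} {e : OpenPartialHomeomorph M (Fin m → 𝕜)}
    (he : e ∈ IsManifold.maximalAtlas 𝓘(𝕜, Fin m → 𝕜) ω M) {q : M} (hq : q ∈ e.source)
    (Tor J R : Finset (Fin m)) (Y : Fin m → Fin m → ℚ) where
  c : CenteredChart q
  E : Fin m → AnGerm q
  subset_J : J ⊆ Tor
  subset_R : R ⊆ Tor \ J
  chart_J : ∀ t ∈ J, chartGerm he hq t = coordGerm c t * E t
  chart_I : ∀ t ∈ Tor, t ∉ J → chartGerm he hq t = E t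
  chart_off : ∀ t ∉ Tor, chartGerm he hq t = coordGerm c t
  unit : ∀ t ∈ Tor, IsUnit (E t)
  der : ∀ r ∈ R, ∀ t ∈ Tor, coordDer c r (E t) = algebraMap 𝕜 _ (Y r t : 𝕜) * E t
  der_other : ∀ k, k ∈ J ∨ k ∉ Tor → ∀ t ∈ Tor, coordDer c k (E t) = 0

/-- A space of exponents supported on `Tor`, with bases adapted to `J ⊆ Tor`. -/
structure EchelonPair (A : Submodule ℚ (Fin m → ℚ)) (Tor J R R₀ : Finset (Fin m))
    (Y Y₀ : Fin m → Fin m → ℚ) : Prop where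
  supp : ∀ w ∈ A, ∀ t ∉ Tor, w t = 0
  mem : ∀ r ∈ R, Y r ∈ A
  delta : ∀ r ∈ R, ∀ r' ∈ R, Y r r' = if r = r' then 1 else 0
  zero : ∀ w ∈ A, (∀ r ∈ R, w r = 0) → ∀ t ∉ J, w t = 0
  sub₀ : R₀ ⊆ J
  mem₀ : ∀ r ∈ R₀, Y₀ r ∈ A
  supp₀ : ∀ r ∈ R₀, ∀ t ∉ J, Y₀ r t = 0
  delta₀ : ∀ r ∈ R₀, ∀ r' ∈ R₀, Y₀ r r' = if r = r' then 1 else 0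
  zero₀ : ∀ w ∈ A, (∀ t ∉ J, w t = 0) → (∀ r ∈ R₀, w r = 0) → w = 0

theorem exists_echelonPair (A : Submodule ℚ (Fin m → ℚ)) (Tor J : Finset (Fin m))
    (supp : ∀ w ∈ A, ∀ t ∉ Tor, w t = 0) :
    ∃ R R₀ Y Y₀, R ⊆ Tor \ J ∧ EchelonPair A Tor J R R₀ Y Y₀ := by
  obtain ⟨R, Y, h1, h2, h3, h4⟩ := exists_echelon A (Tor \ J)
  let A₀ : Submodule ℚ (Fin m → ℚ) :=
    { carrier := {w | w ∈ A ∧ ∀ t ∉ J, w t = 0}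
      add_mem' := fun {a b} ha hb => ⟨add_mem ha.1 hb.1, fun t ht => by
        rw [Pi.add_apply, ha.2 t ht, hb.2 t ht, add_zero]⟩
      zero_mem' := ⟨zero_mem _, fun _ _ => rfl⟩
      smul_mem' := fun x a ha => ⟨A.smul_mem _ ha.1, fun t ht => by
        rw [Pi.smul_apply, ha.2 t ht, smul_zero]⟩ }
  obtain ⟨R₀, Y₀, h1', h2', h3', h4'⟩ := exists_echelon A₀ J
  refine ⟨R, R₀, Y, Y₀, h1, supp, h2, h3, fun w hw hwR t ht => ?_, h1', fun r hr => (h2' r hr).1,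
    fun r hr => (h2' r hr).2, h3', fun w hw hwJ hwR => ?_⟩
  · by_cases htT : t ∈ Tor
    · exact h4 w hw hwR t (Finset.mem_sdiff.2 ⟨htT, ht⟩)
    · exact supp w hw t htT
  · ext t
    by_cases ht : t ∈ J
    · exact h4' w ⟨hw, hwJ⟩ hwR t ht
    · exact hwJ t ht

theorem sum_delta {κ : Type*} [DecidableEq κ] (R : Finset κ) (Y : κ → κ → ℚ)
    (hδ : ∀ r ∈ R, ∀ r' ∈ R, Y r r' = if r = r' then 1 else 0) (x : κ → ℚ) {s : κ} (hs : s ∈ R) :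
    ∑ r ∈ R, x r * Y r s = x s := by
  rw [Finset.sum_eq_single s]
  · rw [hδ s hs s hs, if_pos rfl, mul_one]
  · intro r hr hrs
    rw [hδ r hr s hs, if_neg hrs, mul_zero]
  · exact fun h => absurd hs h

theorem EchelonPair.expand {A : Submodule ℚ (Fin m → ℚ)} {Tor J R R₀ : Finset (Fin m)}
    {Y Y₀ : Fin m → Fin m → ℚ} (h : EchelonPair A Tor J R R₀ Y Y₀) {w : Fin m → ℚ} (hw : w ∈ A) :
    ∃ x : Fin m → ℚ, ∀ t, w t = ∑ r ∈ R, w r * Y r t + ∑ r ∈ R₀, x r * Y₀ r t := by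
  have h1 : w - ∑ r ∈ R, w r • Y r ∈ A :=
    sub_mem hw (Submodule.sum_mem _ fun r hr => A.smul_mem _ (h.mem r hr))
  have h1t : ∀ t, (w - ∑ r ∈ R, w r • Y r) t = w t - ∑ r ∈ R, w r * Y r t := fun t => by
    simp [Finset.sum_apply]
  have h2 : ∀ t ∉ J, (w - ∑ r ∈ R, w r • Y r) t = 0 := by
    refine h.zero _ h1 fun r hr => ?_
    rw [h1t, sum_delta R Y h.delta w hr, sub_self]
  set x := w - ∑ r ∈ R, w r • Y r with hx
  have h3 : x - ∑ r ∈ R₀, x r • Y₀ r = 0 := by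
    refine h.zero₀ _ (sub_mem h1 (Submodule.sum_mem _ fun r hr => A.smul_mem _ (h.mem₀ r hr)))
      (fun t ht => ?_) fun r hr => ?_
    · simp only [Pi.sub_apply, Finset.sum_apply, Pi.smul_apply, smul_eq_mul]
      rw [h2 t ht, Finset.sum_eq_zero fun r hr => by rw [h.supp₀ r hr t ht, mul_zero], sub_zero]
    · simp only [Pi.sub_apply, Finset.sum_apply, Pi.smul_apply, smul_eq_mul]
      rw [sum_delta R₀ Y₀ h.delta₀ x hr, sub_self]
  refine ⟨x, fun t => ?_⟩
  have h4 := congrFun h3 t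
  simp only [Pi.sub_apply, Finset.sum_apply, Pi.smul_apply, smul_eq_mul, Pi.zero_apply] at h4
  rw [h1t t] at h4
  linarith

namespace ExpCoord

variable {M : AnMfd.{u} 𝕜 m} {e : OpenPartialHomeomorph M (Fin m → 𝕜)}
    {he : e ∈ IsManifold.maximalAtlas 𝓘(𝕜, Fin m → 𝕜) ω M} {q : M} {hq : q ∈ e.source}
    {Tor J R R₀ : Finset (Fin m)} {Y Y₀ : Fin m → Fin m → ℚ} {A : Submodule ℚ (Fin m → ℚ)}

/-- The regular coordinates. -/
def reg (_ : ExpCoord he hq Tor J R Y) : Finset (Fin m) := Torᶜ ∪ R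

theorem mem_reg (K : ExpCoord he hq Tor J R Y) {t : Fin m} : t ∈ K.reg ↔ t ∉ Tor ∨ t ∈ R := by
  simp [reg]

theorem notMem_reg_of_mem_J (K : ExpCoord he hq Tor J R Y) {t : Fin m} (ht : t ∈ J) :
    t ∉ K.reg := by
  rw [mem_reg, not_or, not_not]
  exact ⟨K.subset_J ht, fun h => (Finset.mem_sdiff.1 (K.subset_R h)).2 ht⟩

theorem mem_Tor_of_mem_R (K : ExpCoord he hq Tor J R Y) {t : Fin m} (ht : t ∈ R) : t ∈ Tor :=
  (Finset.mem_sdiff.1 (K.subset_R ht)).1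

theorem notMem_J_of_mem_R (K : ExpCoord he hq Tor J R Y) {t : Fin m} (ht : t ∈ R) : t ∉ J :=
  (Finset.mem_sdiff.1 (K.subset_R ht)).2

theorem coordDer_R_chart (K : ExpCoord he hq Tor J R Y) {r : Fin m} (hr : r ∈ R) {t : Fin m}
    (ht : t ∈ Tor) : coordDer K.c r (chartGerm he hq t) =
      algebraMap 𝕜 _ (Y r t : 𝕜) * chartGerm he hq t := by
  by_cases htJ : t ∈ J
  · rw [K.chart_J t htJ, Derivation.leibniz, K.der r hr t ht, coordDer_coordGerm, if_neg]
    · simp only [smul_eq_mul]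
      ring
    · rintro rfl
      exact K.notMem_J_of_mem_R hr htJ
  · rw [K.chart_I t ht htJ, K.der r hr t ht]

theorem coordDer_off_chart (K : ExpCoord he hq Tor J R Y) {k : Fin m} (hk : k ∉ Tor) {t : Fin m}
    (ht : t ∈ Tor) : coordDer K.c k (chartGerm he hq t) = 0 := by
  by_cases htJ : t ∈ J
  · rw [K.chart_J t htJ, Derivation.leibniz, K.der_other k (Or.inr hk) t ht, coordDer_coordGerm,
      if_neg]
    · simp
    · rintro rfl
      exact hk ht
  · rw [K.chart_I t ht htJ, K.der_other k (Or.inr hk) t ht]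

theorem diagField_E (K : ExpCoord he hq Tor J R Y) {w : Fin m → ℚ} (hw : ∀ t ∉ J, w t = 0)
    {t : Fin m} (ht : t ∈ Tor) : diagField K.c K.regᶜ w (K.E t) = 0 := by
  rw [diagField_apply]
  refine Finset.sum_eq_zero fun j _ => ?_
  by_cases hj : j ∈ J
  · rw [K.der_other j (Or.inl hj) t ht, mul_zero, mul_zero]
  · rw [hw j hj, Rat.cast_zero, map_zero, zero_mul]

theorem diagField_coord (K : ExpCoord he hq Tor J R Y) {w : Fin m → ℚ} (hw : ∀ t ∉ J, w t = 0)
    (t : Fin m) : diagField K.c K.regᶜ w (coordGerm K.c t) =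
      algebraMap 𝕜 _ (w t : 𝕜) * coordGerm K.c t := by
  refine diagField_coordGerm K.c _ w (fun t ht => hw t fun h => ?_) t
  exact ht (Finset.mem_compl.2 (K.notMem_reg_of_mem_J h))

theorem diagField_chart (K : ExpCoord he hq Tor J R Y) {w : Fin m → ℚ} (hw : ∀ t ∉ J, w t = 0)
    {t : Fin m} (ht : t ∈ Tor) : diagField K.c K.regᶜ w (chartGerm he hq t) =
      algebraMap 𝕜 _ (w t : 𝕜) * chartGerm he hq t := by
  by_cases htJ : t ∈ J
  · rw [K.chart_J t htJ, Derivation.leibniz, K.diagField_E hw ht, K.diagField_coord hw]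
    simp only [smul_eq_mul]
    ring
  · rw [K.chart_I t ht htJ, K.diagField_E hw ht, hw t htJ, Rat.cast_zero, map_zero, zero_mul]

/-- Toric vector fields in exponential coordinates. -/
theorem span_toricFields (K : ExpCoord he hq Tor J R Y) (hA : EchelonPair A Tor J R R₀ Y Y₀) :
    Submodule.span (AnGerm q) (toricFields he hq Tor (A : Set (Fin m → ℚ))) =
      Submodule.span (AnGerm q) ((fun j => coordDer K.c j) '' (K.reg : Set (Fin m)) ∪
        (fun r => diagField K.c K.regᶜ (Y₀ r)) '' (R₀ : Set (Fin m))) := by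
  classical
  apply le_antisymm
  · rw [Submodule.span_le]
    rintro D ⟨w, hw, hD, hD0⟩
    obtain ⟨x, hx⟩ := hA.expand hw
    choose k hk using fun t : {t // t ∉ Tor} => hD0 t t.2
    let k' : Fin m → 𝕜 := fun t => if ht : t ∉ Tor then k ⟨t, ht⟩ else 0
    have hk' : ∀ t ∉ Tor, D (chartGerm he hq t) = algebraMap 𝕜 _ (k' t) := fun t ht => by
      rw [hk ⟨t, ht⟩]
      simp only [k', dif_pos ht]
    have hsum : D = ∑ r ∈ R, algebraMap 𝕜 (AnGerm q) (w r : 𝕜) • coordDer K.c r +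
        ∑ t ∈ Torᶜ, algebraMap 𝕜 (AnGerm q) (k' t) • coordDer K.c t +
        ∑ r ∈ R₀, algebraMap 𝕜 (AnGerm q) (x r : 𝕜) • diagField K.c K.regᶜ (Y₀ r) := by
      refine vfield_ext he hq fun t => ?_
      rw [Derivation.add_apply, Derivation.add_apply, vfield_sum_apply, vfield_sum_apply,
        vfield_sum_apply]
      simp only [Derivation.smul_apply, smul_eq_mul]
      by_cases ht : t ∈ Tor
      · have h1 : ∑ r ∈ R, algebraMap 𝕜 (AnGerm q) (w r : 𝕜) * coordDer K.c r (chartGerm he hq t) =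
            ∑ r ∈ R, algebraMap 𝕜 (AnGerm q) (w r : 𝕜) *
              (algebraMap 𝕜 (AnGerm q) (Y r t : 𝕜) * chartGerm he hq t) :=
          Finset.sum_congr rfl fun r hr => by rw [K.coordDer_R_chart hr ht]
        have h2 : ∑ k ∈ Torᶜ, algebraMap 𝕜 (AnGerm q) (k' k) *
            coordDer K.c k (chartGerm he hq t) = 0 :=
          Finset.sum_eq_zero fun k hk => by
            rw [K.coordDer_off_chart (Finset.mem_compl.1 hk) ht, mul_zero]
        have h3 : ∑ r ∈ R₀, algebraMap 𝕜 (AnGerm q) (x r : 𝕜) *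
              diagField K.c K.regᶜ (Y₀ r) (chartGerm he hq t) =
            ∑ r ∈ R₀, algebraMap 𝕜 (AnGerm q) (x r : 𝕜) *
              (algebraMap 𝕜 (AnGerm q) (Y₀ r t : 𝕜) * chartGerm he hq t) :=
          Finset.sum_congr rfl fun r hr => by rw [K.diagField_chart (hA.supp₀ r hr) ht]
        rw [hD t ht, h1, h2, h3, hx t, Rat.cast_add, Rat.cast_sum, Rat.cast_sum]
        simp only [Rat.cast_mul, map_add, map_sum, map_mul, add_mul, Finset.sum_mul, add_zero,
          mul_assoc]
      · rw [hk' t ht, K.chart_off t ht]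
        rw [Finset.sum_eq_zero (s := R) fun r hr => by
            rw [coordDer_coordGerm, if_neg, mul_zero]
            rintro rfl
            exact ht (K.mem_Tor_of_mem_R hr),
          Finset.sum_eq_zero (s := R₀) fun r hr => by
            rw [K.diagField_coord (hA.supp₀ r hr), hA.supp₀ r hr t fun h => ht (K.subset_J h),
              Rat.cast_zero, map_zero, zero_mul, mul_zero],
          Finset.sum_eq_single t]
        · rw [coordDer_coordGerm, if_pos rfl, mul_one, zero_add, add_zero]
        · intro k _ hkt
          rw [coordDer_coordGerm, if_neg (Ne.symm hkt), mul_zero]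
        · intro h
          exact absurd (Finset.mem_compl.2 ht) h
    rw [hsum]
    refine add_mem (add_mem ?_ ?_) ?_
    · exact Submodule.sum_mem _ fun r hr => Submodule.smul_mem _ _
        (Submodule.subset_span (Or.inl ⟨r, K.mem_reg.2 (Or.inr hr), rfl⟩))
    · exact Submodule.sum_mem _ fun r hr => Submodule.smul_mem _ _
        (Submodule.subset_span (Or.inl ⟨r, K.mem_reg.2 (Or.inl (Finset.mem_compl.1 hr)), rfl⟩))
    · exact Submodule.sum_mem _ fun r hr => Submodule.smul_mem _ _
        (Submodule.subset_span (Or.inr ⟨r, hr, rfl⟩))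
  · refine Submodule.span_mono ?_
    rintro _ (⟨k, hk, rfl⟩ | ⟨r, hr, rfl⟩)
    · rcases K.mem_reg.1 hk with hk | hk
      · refine ⟨0, zero_mem _, fun t ht => ?_, fun t ht => ⟨if t = k then 1 else 0, ?_⟩⟩
        · beta_reduce
          rw [K.coordDer_off_chart hk ht]
          simp
        · beta_reduce
          rw [K.chart_off t ht, coordDer_coordGerm]
          split_ifs <;> simp
      · refine ⟨Y k, hA.mem k hk, fun t ht => K.coordDer_R_chart hk ht, fun t ht => ⟨0, ?_⟩⟩
        beta_reduce
        rw [K.chart_off t ht, coordDer_coordGerm, if_neg, map_zero]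
        rintro rfl
        exact ht (K.mem_Tor_of_mem_R hk)
    · refine ⟨Y₀ r, hA.mem₀ r hr, fun t ht => K.diagField_chart (hA.supp₀ r hr) ht,
        fun t ht => ⟨0, ?_⟩⟩
      beta_reduce
      rw [K.chart_off t ht, K.diagField_coord (hA.supp₀ r hr),
        hA.supp₀ r hr t fun h => ht (K.subset_J h), Rat.cast_zero, map_zero, zero_mul]

end ExpCoord

end MonomialPoint

section MonomialDistribution

variable {𝕜 : Type} [RCLike 𝕜] {m : ℕ}

theorem coordGerm_dvd_coordGerm_mul {M : AnMfd.{u} 𝕜 m} {q : M} (c : CenteredChart q)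
    {j l : Fin m} (h : l ≠ j) {g : AnGerm q} (hg : coordGerm c j ∣ coordGerm c l * g) :
    coordGerm c j ∣ g := by
  rw [coordGerm_dvd_iff] at hg ⊢
  intro a ha
  have h1 := hg (a + Finsupp.single l 1) (by simp [ha, h])
  rw [map_mul, taylor_coordGerm, add_comm, MvPowerSeries.X,
    MvPowerSeries.coeff_add_monomial_mul, one_mul] at h1
  exact h1

theorem coordGerm_dvd_prod_mul {M : AnMfd.{u} 𝕜 m} {q : M} (c : CenteredChart q)
    {j : Fin m} (S : Finset (Fin m)) (hS : j ∉ S) {g : AnGerm q}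
    (hg : coordGerm c j ∣ (∏ l ∈ S, coordGerm c l) * g) : coordGerm c j ∣ g := by
  classical
  induction S using Finset.induction_on with
  | empty => simpa using hg
  | insert l S hl ih =>
    rw [Finset.prod_insert hl, mul_assoc] at hg
    refine ih (fun h => hS (Finset.mem_insert_of_mem h)) (coordGerm_dvd_coordGerm_mul c ?_ hg)
    rintro rfl
    exact hS (Finset.mem_insert_self _ _)

theorem rank_vfield_le {M : AnMfd.{u} 𝕜 m} {q : M} (Θ : Submodule (AnGerm q) (VField q)) :
    Module.rank (AnGerm q) Θ ≤ m := by
  obtain ⟨c⟩ := exists_chart q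
  let φ : Θ →ₗ[AnGerm q] (Fin m → AnGerm q) :=
    { toFun := fun D j => (D : VField q) (coordGerm c j)
      map_add' := fun _ _ => rfl
      map_smul' := fun _ _ => rfl }
  have hφ : Function.Injective φ := fun D D' h =>
    Subtype.ext (vfield_ext_coord c fun j => congrFun h j)
  have h := LinearMap.rank_le_of_injective φ hφ
  rw [rank_fin_fun] at h
  exact h

theorem card_le_finrank_vfield {M : AnMfd.{u} 𝕜 m} {q : M} (Θ : Submodule (AnGerm q) (VField q))
    {κ : Type} [Fintype κ] (b : κ → VField q) (hb : ∀ i, b i ∈ Θ)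
    (hli : LinearIndependent (AnGerm q) b) :
    Fintype.card κ ≤ Module.finrank (AnGerm q) Θ := by
  have h1 : LinearIndependent (AnGerm q) (fun i => (⟨b i, hb i⟩ : Θ)) :=
    LinearIndependent.of_comp Θ.subtype hli
  have h2 := h1.cardinal_lift_le_rank
  rw [Cardinal.mk_fintype, Cardinal.lift_natCast] at h2
  have h3 : Module.rank (AnGerm q) Θ < Cardinal.aleph0 :=
    (rank_vfield_le Θ).trans_lt Cardinal.natCast_lt_aleph0
  rw [Module.finrank]
  have h4 : ((Fintype.card κ : ℕ) : Cardinal) ≤ Module.rank (AnGerm q) Θ := by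
    rw [← Cardinal.lift_le, Cardinal.lift_natCast]
    exact h2
  have := Cardinal.toNat_le_toNat h4 h3
  rwa [Cardinal.toNat_natCast] at this

/-- The distribution generated by the derivations `∂_k`, `k ∈ reg`, and by diagonal fields with
exponents `Y₀ r`, `r ∈ R₀`. -/
noncomputable def diagSpan {M : AnMfd.{u} 𝕜 m} {q : M} (c : CenteredChart q) (reg R₀ : Finset (Fin m))
    (Y₀ : Fin m → Fin m → ℚ) : Submodule (AnGerm q) (VField q) :=
  Submodule.span (AnGerm q) ((fun j => coordDer c j) '' (reg : Set (Fin m)) ∪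
    (fun r => diagField c regᶜ (Y₀ r)) '' (R₀ : Set (Fin m)))

theorem not_linearIndependent_vfield {M : AnMfd.{u} 𝕜 m} {q : M} (c : CenteredChart q)
    {S T : Finset (Fin m)} (Θ : Submodule (AnGerm q) (VField q))
    (hrank : Module.finrank (AnGerm q) Θ = S.card + T.card)
    (D : VField q) (B B₀ : Fin m → VField q) (hD : D ∈ Θ) (hB : ∀ k ∈ S, B k ∈ Θ)
    (hB₀ : ∀ r ∈ T, B₀ r ∈ Θ) : ¬ LinearIndependent (AnGerm q)
      (fun o : Option (S ⊕ T) => o.elim (fun j => D (coordGerm c j))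
        (Sum.elim (fun k j => B k (coordGerm c j)) fun r j => B₀ r (coordGerm c j))) := by
  intro h
  let b : Option (S ⊕ T) → VField q := fun o => o.elim D (Sum.elim (fun k => B k) fun r => B₀ r)
  let φ : VField q →ₗ[AnGerm q] (Fin m → AnGerm q) :=
    { toFun := fun D j => D (coordGerm c j)
      map_add' := fun _ _ => rfl
      map_smul' := fun _ _ => rfl }
  have hb : LinearIndependent (AnGerm q) b := by
    refine LinearIndependent.of_comp φ ?_
    convert! h using 1
    ext o : 1
    rcases o with _ | k | r <;> rfl
  have h1 := card_le_finrank_vfield Θ b (by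
    rintro (_ | k | r)
    · exact hD
    · exact hB k k.2
    · exact hB₀ r r.2) hb
  rw [Fintype.card_option, Fintype.card_sum, Fintype.card_coe, Fintype.card_coe, hrank] at h1
  omega

theorem exists_dependence_vfield {M : AnMfd.{u} 𝕜 m} {q : M} (c : CenteredChart q)
    {S T : Finset (Fin m)} (Θ : Submodule (AnGerm q) (VField q))
    (hrank : Module.finrank (AnGerm q) Θ = S.card + T.card)
    (D : VField q) (B B₀ : Fin m → VField q) (hD : D ∈ Θ) (hB : ∀ k ∈ S, B k ∈ Θ)
    (hB₀ : ∀ r ∈ T, B₀ r ∈ Θ) : ∃ (a : AnGerm q) (g g₀ : Fin m → AnGerm q),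
      (∀ k, a * D (coordGerm c k) + (∑ l ∈ S, g l * B l (coordGerm c k) +
        ∑ r ∈ T, g₀ r * B₀ r (coordGerm c k)) = 0) ∧
      (a = 0 → (∀ k ∈ S, g k = 0) → ∃ r ∈ T, g₀ r ≠ 0) := by
  classical
  have h := not_linearIndependent_vfield c Θ hrank D B B₀ hD hB hB₀
  rw [Fintype.linearIndependent_iffₛ] at h
  push Not at h
  obtain ⟨f, f', hff, i₀, hi₀⟩ := h
  let g : Option (S ⊕ T) → AnGerm q := fun o => f o - f' o
  refine ⟨g none, fun k => if hk : k ∈ S then g (some (Sum.inl ⟨k, hk⟩)) else 0,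
    fun k => if hk : k ∈ T then g (some (Sum.inr ⟨k, hk⟩)) else 0, fun k => ?_, fun ha hk => ?_⟩
  · have h1 := congrFun hff k
    rw [Finset.sum_apply, Finset.sum_apply, Fintype.sum_option, Fintype.sum_sum_type,
      Fintype.sum_option, Fintype.sum_sum_type] at h1
    have h2 : ∑ l ∈ S, (if hk : l ∈ S then g (some (Sum.inl ⟨l, hk⟩)) else 0) *
        B l (coordGerm c k) = ∑ l : S, f (some (Sum.inl l)) * B l (coordGerm c k) -
          ∑ l : S, f' (some (Sum.inl l)) * B l (coordGerm c k) := by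
      rw [← Finset.sum_coe_sort S, ← Finset.sum_sub_distrib]
      exact Finset.sum_congr rfl fun l _ => by rw [dif_pos l.2, ← sub_mul]
    have h3 : ∑ l ∈ T, (if hk : l ∈ T then g (some (Sum.inr ⟨l, hk⟩)) else 0) *
        B₀ l (coordGerm c k) = ∑ l : T, f (some (Sum.inr l)) * B₀ l (coordGerm c k) -
          ∑ l : T, f' (some (Sum.inr l)) * B₀ l (coordGerm c k) := by
      rw [← Finset.sum_coe_sort T, ← Finset.sum_sub_distrib]
      exact Finset.sum_congr rfl fun l _ => by rw [dif_pos l.2, ← sub_mul]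
    rw [h2, h3]
    have h4 : f none * D (coordGerm c k) + (∑ l : S, f (some (Sum.inl l)) * B l (coordGerm c k) +
        ∑ l : T, f (some (Sum.inr l)) * B₀ l (coordGerm c k)) = f' none * D (coordGerm c k) +
        (∑ l : S, f' (some (Sum.inl l)) * B l (coordGerm c k) +
        ∑ l : T, f' (some (Sum.inr l)) * B₀ l (coordGerm c k)) := h1
    change (f none - f' none) * _ + _ = 0
    linear_combination h4
  · rcases i₀ with _ | k | r
    · exact absurd (sub_eq_zero.1 ha) hi₀
    · have := hk k k.2
      beta_reduce at this
      rw [dif_pos k.2] at this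
      exact absurd (sub_eq_zero.1 this) hi₀
    · refine ⟨r, r.2, ?_⟩
      beta_reduce
      rw [dif_pos r.2]
      exact fun h => hi₀ (sub_eq_zero.1 h)

/-- Relations between the coefficients of the fields of an overdistribution
of the same rank. -/
theorem exists_relation {M : AnMfd.{u} 𝕜 m} {q : M} (c : CenteredChart q)
    {reg R₀ J : Finset (Fin m)} {Y₀ : Fin m → Fin m → ℚ} (hJ : J ⊆ regᶜ) (hR₀ : R₀ ⊆ J)
    (supp₀ : ∀ r ∈ R₀, ∀ t ∉ J, Y₀ r t = 0)
    (delta₀ : ∀ r ∈ R₀, ∀ r' ∈ R₀, Y₀ r r' = if r = r' then 1 else 0)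
    (Θ : Submodule (AnGerm q) (VField q)) (hθ : diagSpan c reg R₀ Y₀ ≤ Θ)
    (hrank : Module.finrank (AnGerm q) Θ = reg.card + R₀.card) {D : VField q} (hD : D ∈ Θ) :
    (∀ k ∉ J, k ∉ reg → D (coordGerm c k) = 0) ∧
    ∀ k ∈ J, D (coordGerm c k) * ∏ l ∈ R₀, coordGerm c l =
      ∑ r ∈ R₀, algebraMap 𝕜 _ (Y₀ r k : 𝕜) * D (coordGerm c r) * coordGerm c k *
        ∏ l ∈ R₀.erase r, coordGerm c l := by
  have hdiag : ∀ r ∈ R₀, ∀ k, diagField c regᶜ (Y₀ r) (coordGerm c k) =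
      algebraMap 𝕜 _ (Y₀ r k : 𝕜) * coordGerm c k := fun r hr k =>
    diagField_coordGerm c _ _ (fun t ht => supp₀ r hr t fun h => ht (hJ h)) k
  obtain ⟨a, g, g₀, hg, hne⟩ := exists_dependence_vfield c Θ hrank D (coordDer c)
    (fun r => diagField c regᶜ (Y₀ r)) hD
    (fun k hk => hθ (Submodule.subset_span (Or.inl ⟨k, hk, rfl⟩)))
    (fun r hr => hθ (Submodule.subset_span (Or.inr ⟨r, hr, rfl⟩)))
  have key : ∀ k, a * D (coordGerm c k) +
      (∑ l ∈ reg, g l * (if k = l then 1 else 0) +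
      ∑ r ∈ R₀, g₀ r * (algebraMap 𝕜 _ (Y₀ r k : 𝕜) * coordGerm c k)) = 0 := by
    intro k
    refine Eq.trans ?_ (hg k)
    refine congrArg₂ _ rfl (congrArg₂ _ ?_ ?_)
    · exact Finset.sum_congr rfl fun l _ => by rw [coordDer_coordGerm]
    · exact Finset.sum_congr rfl fun r hr => by rw [hdiag r hr]
  have hregk : ∀ k ∈ reg, a * D (coordGerm c k) + g k = 0 := by
    intro k hk
    have h1 := key k
    rw [Finset.sum_eq_single k, if_pos rfl, mul_one, Finset.sum_eq_zero, add_zero] at h1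
    · exact h1
    · intro r hr
      rw [supp₀ r hr k fun h => Finset.mem_compl.1 (hJ h) hk, Rat.cast_zero, map_zero, zero_mul,
        mul_zero]
    · intro l _ hl
      rw [if_neg hl.symm, mul_zero]
    · exact fun h => absurd hk h
  have hother : ∀ k ∉ reg, a * D (coordGerm c k) +
      ∑ r ∈ R₀, g₀ r * (algebraMap 𝕜 _ (Y₀ r k : 𝕜) * coordGerm c k) = 0 := by
    intro k hk
    have h1 := key k
    rwa [Finset.sum_eq_zero (s := reg), zero_add] at h1
    intro l hl
    rw [if_neg, mul_zero]
    rintro rfl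
    exact hk hl
  have hR₀k : ∀ k ∈ R₀, a * D (coordGerm c k) + g₀ k * coordGerm c k = 0 := by
    intro k hk
    have h1 := hother k (Finset.mem_compl.1 (hJ (hR₀ hk)))
    rw [Finset.sum_eq_single k, delta₀ k hk k hk, if_pos rfl, Rat.cast_one, map_one,
      one_mul] at h1
    · exact h1
    · intro r hr hrk
      rw [delta₀ r hr k hk, if_neg hrk, Rat.cast_zero, map_zero, zero_mul, mul_zero]
    · exact fun h => absurd hk h
  have ha : a ≠ 0 := by
    intro ha
    obtain ⟨r, hr, hr0⟩ := hne ha fun k hk => by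
      have := hregk k hk
      rwa [ha, zero_mul, zero_add] at this
    have := hR₀k r hr
    rw [ha, zero_mul, zero_add] at this
    exact hr0 ((mul_eq_zero.1 this).resolve_right (coordGerm_ne_zero c r))
  refine ⟨fun k hkJ hk => ?_, fun k hkJ => ?_⟩
  · have h1 := hother k hk
    rw [Finset.sum_eq_zero, add_zero] at h1
    · exact (mul_eq_zero.1 h1).resolve_left ha
    · intro r hr
      rw [supp₀ r hr k hkJ, Rat.cast_zero, map_zero, zero_mul, mul_zero]
  · refine mul_left_cancel₀ ha ?_
    have h1 := hother k (Finset.mem_compl.1 (hJ hkJ))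
    have h2 : (∑ r ∈ R₀, g₀ r * (algebraMap 𝕜 _ (Y₀ r k : 𝕜) * coordGerm c k)) *
        ∏ l ∈ R₀, coordGerm c l = - (a * ∑ r ∈ R₀, algebraMap 𝕜 _ (Y₀ r k : 𝕜) *
          D (coordGerm c r) * coordGerm c k * ∏ l ∈ R₀.erase r, coordGerm c l) := by
      rw [Finset.sum_mul, Finset.mul_sum, ← Finset.sum_neg_distrib]
      refine Finset.sum_congr rfl fun r hr => ?_
      rw [← Finset.mul_prod_erase R₀ _ hr]
      linear_combination ((algebraMap 𝕜 (AnGerm q) (Y₀ r k : 𝕜)) * coordGerm c k *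
        ∏ l ∈ R₀.erase r, coordGerm c l) * hR₀k r hr
    linear_combination (∏ l ∈ R₀, coordGerm c l) * h1 - h2

theorem diagSpan_maximal {M : AnMfd.{u} 𝕜 m} {q : M} (c : CenteredChart q)
    {reg R₀ J : Finset (Fin m)} {Y₀ : Fin m → Fin m → ℚ} (hJ : J ⊆ regᶜ) (hR₀ : R₀ ⊆ J)
    (supp₀ : ∀ r ∈ R₀, ∀ t ∉ J, Y₀ r t = 0)
    (delta₀ : ∀ r ∈ R₀, ∀ r' ∈ R₀, Y₀ r r' = if r = r' then 1 else 0)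
    (Θ : Submodule (AnGerm q) (VField q)) (hθ : diagSpan c reg R₀ Y₀ ≤ Θ)
    (hrank : Module.finrank (AnGerm q) Θ = reg.card + R₀.card)
    (hdiv : ∀ j ∈ J, (∀ D ∈ Θ, coordGerm c j ∣ D (coordGerm c j)) ∨
      ∀ r ∈ R₀, Y₀ r ≠ Pi.single j 1) : diagSpan c reg R₀ Y₀ = Θ := by
  classical
  refine le_antisymm hθ fun D hD => ?_
  obtain ⟨h0, hrel⟩ := exists_relation c hJ hR₀ supp₀ delta₀ Θ hθ hrank hD
  have hdvd : ∀ j ∈ J, coordGerm c j ∣ D (coordGerm c j) := by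
    intro j hj
    rcases hdiv j hj with h | h
    · exact h D hD
    by_cases hjR : j ∈ R₀
    · have h1 : ∃ k ≠ j, Y₀ j k ≠ 0 := by
        by_contra! hcon
        refine h j hjR (funext fun k => ?_)
        by_cases hk : k = j
        · subst hk
          rw [delta₀ k hjR k hjR, if_pos rfl, Pi.single_eq_same]
        · rw [hcon k hk, Pi.single_eq_of_ne hk]
      obtain ⟨k, hkj, hk⟩ := h1
      have hkJ : k ∈ J := by
        by_contra hkJ
        exact hk (supp₀ j hjR k hkJ)
      have h2 := hrel k hkJ
      rw [← Finset.add_sum_erase R₀ _ hjR] at h2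
      have h3 : coordGerm c j ∣ algebraMap 𝕜 _ (Y₀ j k : 𝕜) * D (coordGerm c j) * coordGerm c k *
          ∏ l ∈ R₀.erase j, coordGerm c l := by
        rw [← (eq_sub_of_add_eq h2.symm).symm]
        refine dvd_sub ?_ (Finset.dvd_sum fun r hr => ?_)
        · exact Dvd.dvd.mul_left (Finset.dvd_prod_of_mem _ hjR) _
        · refine Dvd.dvd.mul_left (Finset.dvd_prod_of_mem _ (Finset.mem_erase.2 ⟨?_, hjR⟩)) _
          exact (Finset.ne_of_mem_erase hr).symm
      have h4 : coordGerm c j ∣ (∏ l ∈ R₀.erase j, coordGerm c l) *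
          (coordGerm c k * D (coordGerm c j)) := by
        have hu : IsUnit (algebraMap 𝕜 (AnGerm q) (Y₀ j k : 𝕜)) :=
          (IsUnit.mk0 _ (Rat.cast_ne_zero.2 hk)).map _
        rw [← hu.dvd_mul_left]
        convert h3 using 1
        ring
      exact coordGerm_dvd_coordGerm_mul c hkj
        (coordGerm_dvd_prod_mul c _ (Finset.notMem_erase _ _) h4)
    · refine coordGerm_dvd_prod_mul c R₀ hjR ?_
      rw [mul_comm, hrel j hj]
      exact Finset.dvd_sum fun r _ => Dvd.dvd.mul_right (dvd_mul_left _ _) _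
  choose! h hh using hdvd
  have hrel' : ∀ k ∈ J, h k = ∑ r ∈ R₀, algebraMap 𝕜 _ (Y₀ r k : 𝕜) * h r := by
    intro k hk
    have hne : coordGerm c k * ∏ l ∈ R₀, coordGerm c l ≠ 0 :=
      mul_ne_zero (coordGerm_ne_zero c k) (Finset.prod_ne_zero_iff.2 fun l _ => coordGerm_ne_zero c l)
    refine mul_left_cancel₀ hne ?_
    have h1 := hrel k hk
    rw [Finset.mul_sum]
    rw [hh k hk] at h1
    calc _ = coordGerm c k * h k * ∏ l ∈ R₀, coordGerm c l := by ring
      _ = _ := h1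
      _ = _ := Finset.sum_congr rfl fun r hr => by
        rw [hh r (hR₀ hr), ← Finset.mul_prod_erase R₀ _ hr]
        ring
  have hsum : D = ∑ k ∈ reg, D (coordGerm c k) • coordDer c k +
      ∑ r ∈ R₀, h r • diagField c regᶜ (Y₀ r) := by
    refine vfield_ext_coord c fun k => ?_
    rw [Derivation.add_apply, vfield_sum_apply, vfield_sum_apply]
    simp only [Derivation.smul_apply, smul_eq_mul]
    have h2 : ∑ r ∈ R₀, h r * diagField c regᶜ (Y₀ r) (coordGerm c k) =
        ∑ r ∈ R₀, h r * (algebraMap 𝕜 _ (Y₀ r k : 𝕜) * coordGerm c k) :=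
      Finset.sum_congr rfl fun r hr => by
        rw [diagField_coordGerm c _ _ (fun t ht => supp₀ r hr t fun h => ht (hJ h)) k]
    rw [h2]
    by_cases hk : k ∈ reg
    · rw [Finset.sum_eq_single k, coordDer_coordGerm, if_pos rfl, mul_one, Finset.sum_eq_zero,
        add_zero]
      · intro r hr
        rw [supp₀ r hr k fun h => Finset.mem_compl.1 (hJ h) hk, Rat.cast_zero, map_zero, zero_mul,
          mul_zero]
      · intro l _ hl
        rw [coordDer_coordGerm, if_neg hl.symm, mul_zero]
      · exact fun h => absurd hk h
    · rw [Finset.sum_eq_zero (s := reg), zero_add]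
      · by_cases hkJ : k ∈ J
        · rw [hh k hkJ, hrel' k hkJ, Finset.mul_sum]
          exact Finset.sum_congr rfl fun r _ => by ring
        · rw [h0 k hkJ hk, Finset.sum_eq_zero]
          intro r hr
          rw [supp₀ r hr k hkJ, Rat.cast_zero, map_zero, zero_mul, mul_zero]
      · intro l hl
        rw [coordDer_coordGerm, if_neg, mul_zero]
        rintro rfl
        exact hk hl
  rw [hsum]
  refine add_mem ?_ ?_
  · exact Submodule.sum_mem _ fun k hk => Submodule.smul_mem _ _
      (Submodule.subset_span (Or.inl ⟨k, hk, rfl⟩))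
  · exact Submodule.sum_mem _ fun k hk => Submodule.smul_mem _ _
      (Submodule.subset_span (Or.inr ⟨k, hk, rfl⟩))

theorem coeff_taylor_mul_coordDer {M : AnMfd.{u} 𝕜 m} {q : M} (c : CenteredChart q) (j : Fin m)
    (g : AnGerm q) (a : Fin m →₀ ℕ) :
    (taylor c (coordGerm c j * coordDer c j g)).coeff a = a j * (taylor c g).coeff a := by
  classical
  rw [map_mul, taylor_coordGerm, taylor_coordDer]
  by_cases ha : a j = 0
  · rw [ha, Nat.cast_zero, zero_mul]
    exact (MvPowerSeries.X_dvd_iff.1 (dvd_mul_right _ _)) a ha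
  · have h1 : a = Finsupp.single j 1 + (a - Finsupp.single j 1) := by
      rw [add_tsub_cancel_of_le]
      rw [Finsupp.single_le_iff]
      omega
    have h2 : (a - Finsupp.single j 1 : Fin m →₀ ℕ) j + 1 = a j := by
      rw [Finsupp.tsub_apply, Finsupp.single_eq_same]
      omega
    rw [MvPowerSeries.X]
    conv_lhs => rw [h1]
    rw [MvPowerSeries.coeff_add_monomial_mul, one_mul, MvPowerSeries.coeff_pderiv, add_comm, ← h1,
      ← h2]
    push_cast
    ring

theorem coeff_taylor_diagField {M : AnMfd.{u} 𝕜 m} {q : M} (c : CenteredChart q)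
    (S : Finset (Fin m)) (w : Fin m → ℚ) (g : AnGerm q) (a : Fin m →₀ ℕ) :
    (taylor c (diagField c S w g)).coeff a =
      ((∑ j ∈ S, w j * a j : ℚ) : 𝕜) * (taylor c g).coeff a := by
  rw [diagField_apply, map_sum, map_sum, Rat.cast_sum, Finset.sum_mul]
  refine Finset.sum_congr rfl fun j _ => ?_
  have : algebraMap 𝕜 (AnGerm q) (w j : 𝕜) * (coordGerm c j * coordDer c j g) =
      (w j : 𝕜) • (coordGerm c j * coordDer c j g) := (Algebra.smul_def _ _).symm
  rw [this, map_smul, map_smul, coeff_taylor_mul_coordDer, smul_eq_mul]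
  push_cast
  ring

theorem coordDer_eq_zero_iff {M : AnMfd.{u} 𝕜 m} {q : M} (c : CenteredChart q) (j : Fin m)
    (g : AnGerm q) :
    coordDer c j g = 0 ↔ ∀ a : Fin m →₀ ℕ, (taylor c g).coeff a ≠ 0 → a j = 0 := by
  have h0 : coordDer c j g = 0 ↔ coordGerm c j * coordDer c j g = 0 := by
    rw [mul_eq_zero, or_iff_right (coordGerm_ne_zero c j)]
  rw [h0, ← (taylor_injective c).eq_iff, map_zero, MvPowerSeries.ext_iff]
  refine forall_congr' fun a => ?_
  rw [coeff_taylor_mul_coordDer, map_zero, mul_eq_zero, Nat.cast_eq_zero]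
  tauto

theorem diagField_eq_zero_iff {M : AnMfd.{u} 𝕜 m} {q : M} (c : CenteredChart q)
    (S : Finset (Fin m)) (w : Fin m → ℚ) (g : AnGerm q) :
    diagField c S w g = 0 ↔
      ∀ a : Fin m →₀ ℕ, (taylor c g).coeff a ≠ 0 → ∑ j ∈ S, w j * a j = 0 := by
  rw [← (taylor_injective c).eq_iff, map_zero, MvPowerSeries.ext_iff]
  refine forall_congr' fun a => ?_
  rw [coeff_taylor_diagField, map_zero, mul_eq_zero, Rat.cast_eq_zero]
  tauto

theorem forall_mem_span_apply_eq_zero_iff {M : AnMfd.{u} 𝕜 m} {q : M} (S : Set (VField q))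
    (g : AnGerm q) : (∀ D ∈ Submodule.span (AnGerm q) S, D g = 0) ↔ ∀ D ∈ S, D g = 0 := by
  refine ⟨fun h D hD => h D (Submodule.subset_span hD), fun h D hD => ?_⟩
  induction hD using Submodule.span_induction with
  | mem D hD => exact h D hD
  | zero => rfl
  | add D D' _ _ h1 h2 => rw [Derivation.add_apply, h1, h2, add_zero]
  | smul r D _ h1 => rw [Derivation.smul_apply, h1, smul_zero]

/-- The exponents of the monomial first integrals. -/
def integralExponents {κ : Type*} (reg : Finset (Fin m)) (α : κ → Fin m → ℚ) :
    Set (Fin m →₀ ℕ) :=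
  {a | (∀ j ∈ reg, a j = 0) ∧ ∀ i, ∑ j ∈ regᶜ, α i j * a j = 0}

theorem FolSub.isFirstIntegral_iff (X : FolSub.{u} 𝕜 m) {q : X.M} (c : CenteredChart q)
    (reg : Finset (Fin m)) {κ : Type*} (α : κ → Fin m → ℚ)
    (hθ : X.θ q = Submodule.span (AnGerm q) ((fun j => coordDer c j) '' (reg : Set (Fin m)) ∪
      Set.range fun i => diagField c regᶜ (α i))) (g : AnGerm q) :
    X.IsFirstIntegral g ↔
      ∀ a : Fin m →₀ ℕ, (taylor c g).coeff a ≠ 0 → a ∈ integralExponents reg α := by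
  rw [FolSub.IsFirstIntegral, hθ, forall_mem_span_apply_eq_zero_iff]
  constructor
  · intro h a ha
    refine ⟨fun j hj => ?_, fun i => ?_⟩
    · exact (coordDer_eq_zero_iff c j g).1 (h _ (Or.inl ⟨j, hj, rfl⟩)) a ha
    · exact (diagField_eq_zero_iff c _ _ g).1 (h _ (Or.inr ⟨i, rfl⟩)) a ha
  · rintro h _ (⟨j, hj, rfl⟩ | ⟨i, rfl⟩)
    · exact (coordDer_eq_zero_iff c j g).2 fun a ha => (h a ha).1 j hj
    · exact (diagField_eq_zero_iff c _ _ g).2 fun a ha => (h a ha).2 i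

theorem FolSub.isFirstIntegral_mono_iff (X : FolSub.{u} 𝕜 m) {q : X.M} (c : CenteredChart q)
    (reg : Finset (Fin m)) {κ : Type*} (α : κ → Fin m → ℚ)
    (hθ : X.θ q = Submodule.span (AnGerm q) ((fun j => coordDer c j) '' (reg : Set (Fin m)) ∪
      Set.range fun i => diagField c regᶜ (α i))) (a : Fin m → ℕ) :
    X.IsFirstIntegral (mono c a) ↔ toFs a ∈ integralExponents reg α := by
  classical
  rw [X.isFirstIntegral_iff c reg α hθ, taylor_mono]
  refine ⟨fun h => h _ ?_, fun h b hb => ?_⟩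
  · rw [MvPowerSeries.coeff_monomial_same]
    exact one_ne_zero
  · rw [MvPowerSeries.coeff_monomial] at hb
    rwa [(ite_ne_right_iff.1 hb).1]

/-- Monomial coordinates for a distribution in diagonal form. -/
theorem FolSub.isMonomialCoord_of_diagSpan (X : FolSub.{u} 𝕜 m) {q : X.M} (c : CenteredChart q)
    {reg R₀ J : Finset (Fin m)} {Y₀ : Fin m → Fin m → ℚ} (hJ : J ⊆ regᶜ) (hR₀ : R₀ ⊆ J)
    (supp₀ : ∀ r ∈ R₀, ∀ t ∉ J, Y₀ r t = 0)
    (delta₀ : ∀ r ∈ R₀, ∀ r' ∈ R₀, Y₀ r r' = if r = r' then 1 else 0)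
    (hθ : X.θ q = diagSpan c reg R₀ Y₀) (hcard : reg.card + R₀.card = X.leafDim)
    (divisor : ∃ exc ⊆ regᶜ, ∀ᶠ x in 𝓝 q, (∃ H ∈ X.E, x ∈ H) ↔ ∃ j ∈ exc, c.e x j = 0)
    (tangent : X.θ q ≤ derLog X.E q)
    (hdiv : ∀ j ∈ J, (∀ D ∈ derLog X.E q, coordGerm c j ∣ D (coordGerm c j)) ∨
      ∀ r ∈ R₀, Y₀ r ≠ Pi.single j 1) : X.IsMonomialCoord c reg where
  divisor := divisor
  tangent := tangent
  basis := by
    refine ⟨R₀.card, fun i => Y₀ (R₀.equivFin.symm i), hcard, ?_⟩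
    rw [hθ, diagSpan]
    congr 2
    ext D
    constructor
    · rintro ⟨r, hr, rfl⟩
      exact ⟨R₀.equivFin ⟨r, hr⟩, by simp [diagField]⟩
    · rintro ⟨i, rfl⟩
      exact ⟨R₀.equivFin.symm i, (R₀.equivFin.symm i).2, rfl⟩
  maximal := fun Θ hlog _ hrank hle => by
    rw [hθ] at hle ⊢
    exact diagSpan_maximal c hJ hR₀ supp₀ delta₀ Θ hle (hrank.trans hcard.symm) fun j hj =>
      (hdiv j hj).imp_left fun h D hD => h D (hlog hD)

end MonomialDistribution

section StagePoint

variable {𝕜 : Type} [RCLike 𝕜] {m : ℕ}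

/-- The linear map with matrix given by rays in the columns of `Tor`, and by the identity in the
others. -/
def rayMap (Tor : Finset (Fin m)) (ρ : Fin m → Fin m → ℕ) : (Fin m → ℚ) →ₗ[ℚ] (Fin m → ℚ) where
  toFun w := ∑ t ∈ Tor, w t • qray (ρ t) + ∑ t ∈ Torᶜ, w t • Pi.single t 1
  map_add' w w' := by
    simp only [Pi.add_apply, add_smul, Finset.sum_add_distrib]
    abel
  map_smul' x w := by
    simp only [Pi.smul_apply, smul_eq_mul, mul_smul, ← Finset.smul_sum, ← smul_add,
      RingHom.id_apply]

theorem rayMap_apply (Tor : Finset (Fin m)) (ρ : Fin m → Fin m → ℕ) (w : Fin m → ℚ) :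
    rayMap Tor ρ w = ∑ t ∈ Tor, w t • qray (ρ t) + ∑ t ∈ Torᶜ, w t • Pi.single t 1 := rfl

theorem rayMap_apply_off {Tor : Finset (Fin m)} {ρ : Fin m → Fin m → ℕ}
    (supp : ∀ t ∈ Tor, ∀ i ∉ Tor, ρ t i = 0) (w : Fin m → ℚ) {i : Fin m} (hi : i ∉ Tor) :
    rayMap Tor ρ w i = w i := by
  rw [rayMap_apply, Pi.add_apply, Finset.sum_apply, Finset.sum_apply,
    Finset.sum_eq_zero (s := Tor), zero_add, Finset.sum_eq_single i]
  · simp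
  · intro t _ ht
    simp [ht.symm]
  · exact fun h => absurd (Finset.mem_compl.2 hi) h
  · intro t ht
    simp [qray, supp t ht i hi]

theorem rayMap_apply_of_supp (Tor : Finset (Fin m)) (ρ : Fin m → Fin m → ℕ)
    {w : Fin m → ℚ} (hw : ∀ t ∉ Tor, w t = 0) : rayMap Tor ρ w = ∑ t ∈ Tor, w t • qray (ρ t) := by
  rw [rayMap_apply, Finset.sum_eq_zero (s := Torᶜ), add_zero]
  intro t ht
  rw [hw t (Finset.mem_compl.1 ht), zero_smul]

theorem rayMap_injective {Tor : Finset (Fin m)} {ρ : Fin m → Fin m → ℕ}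
    (supp : ∀ t ∈ Tor, ∀ i ∉ Tor, ρ t i = 0)
    (indep : ∀ w : Fin m → ℚ, ∑ t ∈ Tor, w t • qray (ρ t) = 0 → ∀ t ∈ Tor, w t = 0) :
    Function.Injective (rayMap Tor ρ) := by
  rw [injective_iff_map_eq_zero]
  intro w hw
  have h1 : ∀ t ∉ Tor, w t = 0 := fun t ht => by
    rw [← rayMap_apply_off supp w ht, hw, Pi.zero_apply]
  rw [rayMap_apply_of_supp Tor ρ h1] at hw
  ext t
  by_cases ht : t ∈ Tor
  · exact indep w hw t ht
  · exact h1 t ht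

theorem EchelonPair.card {A : Submodule ℚ (Fin m → ℚ)} {Tor J R R₀ : Finset (Fin m)}
    {Y Y₀ : Fin m → Fin m → ℚ} (h : EchelonPair A Tor J R R₀ Y Y₀) (hR : R ⊆ Tor \ J) :
    R.card + R₀.card = Module.finrank ℚ A := by
  classical
  have hspan : A = Submodule.span ℚ (Set.range (Sum.elim (fun r : R => Y r) fun r : R₀ => Y₀ r)) := by
    apply le_antisymm
    · intro w hw
      obtain ⟨x, hx⟩ := h.expand hw
      have h1 : w = ∑ r ∈ R, w r • Y r + ∑ r ∈ R₀, x r • Y₀ r := by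
        ext t
        rw [hx t]
        simp [Finset.sum_apply]
      rw [h1]
      refine add_mem ?_ ?_
      · exact Submodule.sum_mem _ fun r hr => Submodule.smul_mem _ _
          (Submodule.subset_span ⟨Sum.inl ⟨r, hr⟩, rfl⟩)
      · exact Submodule.sum_mem _ fun r hr => Submodule.smul_mem _ _
          (Submodule.subset_span ⟨Sum.inr ⟨r, hr⟩, rfl⟩)
    · rw [Submodule.span_le]
      rintro _ ⟨r | r, rfl⟩
      · exact h.mem r r.2
      · exact h.mem₀ r r.2
  have hli : LinearIndependent ℚ (Sum.elim (fun r : R => Y r) fun r : R₀ => Y₀ r) := by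
    rw [Fintype.linearIndependent_iff]
    intro g hg
    rw [Fintype.sum_sum_type] at hg
    have hgt : ∀ t, ∑ r : R, g (Sum.inl r) * Y r t + ∑ r : R₀, g (Sum.inr r) * Y₀ r t = 0 := by
      intro t
      have := congrFun hg t
      simpa [Finset.sum_apply] using this
    have h1 : ∀ r : R, g (Sum.inl r) = 0 := by
      intro r
      have h2 := hgt r
      rw [Finset.sum_eq_single r, h.delta r r.2 r r.2, if_pos rfl, mul_one, Finset.sum_eq_zero,
        add_zero] at h2
      · exact h2
      · intro r' _
        rw [h.supp₀ r' r'.2 r (Finset.mem_sdiff.1 (hR r.2)).2, mul_zero]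
      · intro r' _ hr'
        rw [h.delta r' r'.2 r r.2, if_neg (fun h => hr' (Subtype.ext h)), mul_zero]
      · exact fun h => absurd (Finset.mem_univ _) h
    rintro (r | r)
    · exact h1 r
    · have h2 := hgt r
      rw [Finset.sum_eq_zero (s := (Finset.univ : Finset R)), zero_add, Finset.sum_eq_single r,
        h.delta₀ r r.2 r r.2, if_pos rfl, mul_one] at h2
      · exact h2
      · intro r' _ hr'
        rw [h.delta₀ r' r'.2 r r.2, if_neg (fun h => hr' (Subtype.ext h)), mul_zero]
      · exact fun h => absurd (Finset.mem_univ _) h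
      · intro r' _
        rw [h1 r', zero_mul]
  have := finrank_span_eq_card hli
  rw [← hspan] at this
  rw [this]
  simp

/-- Toric and exponential coordinates at a point of a stage. -/
structure StagePoint {X : FolSub.{u} 𝕜 m} {e₀ : OpenPartialHomeomorph X.M (Fin m → 𝕜)}
    {Tor : Finset (Fin m)} {W : Submodule ℚ (Fin m → ℚ)} {v : Fin m} (S : Stage X e₀ Tor W v)
    (q : S.Y.M) where
  e : OpenPartialHomeomorph S.Y.M (Fin m → 𝕜)
  lab : Fin m → S.ι
  mem : q ∈ e.source
  chart : IsToricChart S.Y (fun y => e₀ (S.π y)) S.H S.ρ Tor W e lab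
  J : Finset (Fin m)
  mem_J : ∀ t, t ∈ J ↔ t ∈ Tor ∧ e q t = 0
  R : Finset (Fin m)
  R₀ : Finset (Fin m)
  Y : Fin m → Fin m → ℚ
  Y₀ : Fin m → Fin m → ℚ
  echelon : EchelonPair (W.comap (rayMap Tor fun t => S.ρ (lab t))) Tor J R R₀ Y Y₀
  K : ExpCoord chart.atlas mem Tor J R Y

variable {X : FolSub.{u} 𝕜 m} {e₀ : OpenPartialHomeomorph X.M (Fin m → 𝕜)}
    {Tor : Finset (Fin m)} {W : Submodule ℚ (Fin m → ℚ)} {v : Fin m} {S : Stage X e₀ Tor W v}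

theorem Stage.nonempty_stagePoint (S : Stage X e₀ Tor W v) (q : S.Y.M)
    (hW : ∀ w ∈ W, ∀ i ∉ Tor, w i = 0) (h0 : ∀ i ∉ Tor, e₀ (S.π q) i = 0) :
    Nonempty (StagePoint S q) := by
  classical
  obtain ⟨e, lab, hq, hT⟩ := S.chart q
  have hJ : ∀ t, t ∈ Tor.filter (fun t => e q t = 0) ↔ t ∈ Tor ∧ e q t = 0 := fun t =>
    Finset.mem_filter
  set J := Tor.filter fun t => e q t = 0 with hJdef
  obtain ⟨R, R₀, Y, Y₀, hR, hA⟩ := exists_echelonPair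
    (W.comap (rayMap Tor fun t => S.ρ (lab t))) Tor J (fun w hw t ht => by
      rw [← rayMap_apply_off (fun t _ => S.supp (lab t)) w ht]
      exact hW _ hw t ht)
  obtain ⟨c, E, h1, h2, h3, h4, h5, h6⟩ := exists_exp_chart hT.atlas hq
    (Finset.filter_subset _ _ : J ⊆ Tor) hR (fun t ht => ((hJ t).1 ht).2)
    (fun t ht => (hT.coord' q hq t ht).symm.trans (h0 t ht))
    (fun t ht htJ h => htJ ((hJ t).2 ⟨ht, h⟩)) Y hA.delta
  exact ⟨⟨e, lab, hq, hT, J, hJ, R, R₀, Y, Y₀, hA,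
    ⟨c, E, Finset.filter_subset _ _, hR, h1, h2, h3, h4, h5, h6⟩⟩⟩

namespace StagePoint

variable {q : S.Y.M}

theorem rayMap_injective (Q : StagePoint S q) :
    Function.Injective (rayMap Tor fun t => S.ρ (Q.lab t)) :=
  _root_.rayMap_injective (fun t _ => S.supp (Q.lab t)) Q.chart.indep

theorem toricFields_eq (Q : StagePoint S q) :
    toricFields Q.chart.atlas Q.mem Tor {w | ∑ t ∈ Tor, w t • qray (S.ρ (Q.lab t)) ∈ W} =
      toricFields Q.chart.atlas Q.mem Tor
        (W.comap (rayMap Tor fun t => S.ρ (Q.lab t)) : Set (Fin m → ℚ)) := by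
  classical
  ext D
  constructor
  · rintro ⟨w, hw, h1, h2⟩
    refine ⟨fun t => if t ∈ Tor then w t else 0, ?_, fun t ht => ?_, h2⟩
    · rw [SetLike.mem_coe, Submodule.mem_comap, rayMap_apply_of_supp _ _ fun t ht => if_neg ht]
      rw [Finset.sum_congr rfl fun t ht => by rw [if_pos ht]]
      exact hw
    · beta_reduce
      rw [h1 t ht, if_pos ht]
  · rintro ⟨w, hw, h⟩
    refine ⟨w, ?_, h⟩
    rw [SetLike.mem_coe, Submodule.mem_comap, rayMap_apply_of_supp _ _ (Q.echelon.supp w hw)] at hw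
    exact hw

theorem field_eq (Q : StagePoint S q) : S.Y.θ q = diagSpan Q.K.c Q.K.reg Q.R₀ Q.Y₀ := by
  rw [Q.chart.field q Q.mem, Q.toricFields_eq, Q.K.span_toricFields Q.echelon, diagSpan]

theorem field_eq_range (Q : StagePoint S q) : S.Y.θ q = Submodule.span (AnGerm q)
    ((fun j => coordDer Q.K.c j) '' (Q.K.reg : Set (Fin m)) ∪
      Set.range fun r : Q.R₀ => diagField Q.K.c Q.K.regᶜ (Q.Y₀ r)) := by
  rw [Q.field_eq, diagSpan]
  congr 2
  ext D
  constructor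
  · rintro ⟨r, hr, rfl⟩
    exact ⟨⟨r, hr⟩, rfl⟩
  · rintro ⟨r, rfl⟩
    exact ⟨r, r.2, rfl⟩

theorem card (Q : StagePoint S q)
    (hcard : Torᶜ.card + Module.finrank ℚ W = X.leafDim) :
    Q.K.reg.card + Q.R₀.card = S.Y.leafDim := by
  classical
  have h1 : Q.K.reg.card = Torᶜ.card + Q.R.card := by
    refine Finset.card_union_of_disjoint (Finset.disjoint_left.2 fun t ht htR => ?_)
    exact Finset.mem_compl.1 ht (Q.K.mem_Tor_of_mem_R htR)
  have h2 := Q.echelon.card Q.K.subset_R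
  have h3 : Module.finrank ℚ (W.comap (rayMap Tor fun t => S.ρ (Q.lab t))) =
      Module.finrank ℚ W := by
    let f := LinearEquiv.ofInjectiveEndo _ Q.rayMap_injective
    have h4 : W.comap (rayMap Tor fun t => S.ρ (Q.lab t)) = W.comap (f : (Fin m → ℚ) →ₗ[ℚ] _) :=
      rfl
    rw [h4, Submodule.comap_equiv_eq_map_symm]
    exact LinearEquiv.finrank_map_eq f.symm W
  rw [S.dim, ← hcard, h1, ← h3, ← h2, add_assoc]

theorem eventually_coord (Q : StagePoint S q) : ∀ᶠ y in 𝓝 q, ∀ t ∈ Tor,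
    (Q.e y t = 0 ↔ t ∈ Q.J ∧ Q.K.c.e y t = 0) := by
  rw [Filter.eventually_all_finset]
  intro t ht
  by_cases htJ : t ∈ Q.J
  · obtain ⟨f, hf, hfE⟩ : ∃ (f : S.Y.M → 𝕜) (hf : IsAnAt f q), toGerm f hf = Q.K.E t := by
      obtain ⟨f, hf, h⟩ := (Q.K.E t).2
      exact ⟨f, hf, Subtype.ext h⟩
    have h1 := Q.K.chart_J t htJ
    have hu := (isUnit_germ_iff _).1 (Q.K.unit t ht)
    rw [← hfE, coordGerm, toGerm_mul] at h1
    rw [← hfE, germEval_toGerm] at hu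
    have h2 : ∀ᶠ y in 𝓝 q, f y ≠ 0 := hf.continuousAt.eventually_ne hu
    filter_upwards [toGerm_eq_iff.1 h1, h2] with y hy hy2
    rw [hy, Pi.mul_apply, mul_eq_zero, or_iff_left hy2]
    exact (and_iff_right htJ).symm
  · have h1 : Q.e q t ≠ 0 := fun h => htJ ((Q.mem_J t).2 ⟨ht, h⟩)
    have h2 : ContinuousAt (fun y => Q.e y t) q :=
      (continuous_apply t).continuousAt.comp (Q.e.continuousAt Q.mem)
    filter_upwards [h2.eventually_ne h1] with y hy
    exact ⟨fun h => absurd h hy, fun h => absurd h.1 htJ⟩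

theorem mem_H (Q : StagePoint S q) {t : Fin m} (ht : t ∈ Q.J) : q ∈ S.H (Q.lab t) :=
  (Q.chart.mem t ((Q.mem_J t).1 ht).1 q Q.mem).2 ((Q.mem_J t).1 ht).2

theorem dvd_of_mem_derLog (Q : StagePoint S q) {t : Fin m} (ht : t ∈ Q.J)
    (hL : some (Q.lab t) ∈ S.L) {D : VField q} (hD : D ∈ derLog S.Y.E q) :
    coordGerm Q.K.c t ∣ D (coordGerm Q.K.c t) := by
  have htT := ((Q.mem_J t).1 ht).1
  have h1 := _root_.dvd_of_mem_derLog Q.chart.atlas Q.mem hD (H := S.H (Q.lab t)) (t := t) (by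
    rw [S.divisor, List.mem_map]
    exact ⟨_, hL, rfl⟩) (by
    filter_upwards [Q.e.open_source.mem_nhds Q.mem] with y hy
    exact Q.chart.mem t htT y hy)
  rw [Q.K.chart_J t ht, Derivation.leibniz, smul_eq_mul, smul_eq_mul] at h1
  have h2 := dvd_trans (dvd_mul_right _ _) h1
  rw [dvd_add_right (dvd_mul_right _ _)] at h2
  exact (Q.K.unit t htT).dvd_mul_left.1 h2

theorem isMonomialCoord (Q : StagePoint S q)
    (hcard : Torᶜ.card + Module.finrank ℚ W = X.leafDim) :
    S.Y.IsMonomialCoord Q.K.c Q.K.reg := by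
  classical
  refine S.Y.isMonomialCoord_of_diagSpan Q.K.c (J := Q.J)
    (fun t ht => Finset.mem_compl.2 (Q.K.notMem_reg_of_mem_J ht)) Q.echelon.sub₀ Q.echelon.supp₀
    Q.echelon.delta₀ Q.field_eq (Q.card hcard) ?_ ?_ fun j hj => ?_
  · refine ⟨Q.J.filter fun t => some (Q.lab t) ∈ S.L, fun t ht => Finset.mem_compl.2
      (Q.K.notMem_reg_of_mem_J (Finset.mem_filter.1 ht).1), ?_⟩
    filter_upwards [Q.eventually_coord, Q.e.open_source.mem_nhds Q.mem] with y hy hye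
    rw [S.divisor]
    constructor
    · rintro ⟨H, hH, hyH⟩
      obtain ⟨o, ho, rfl⟩ := List.mem_map.1 hH
      cases o with
      | none => exact absurd hyH (Set.notMem_empty _)
      | some l =>
        by_cases hl : ∃ t ∈ Tor, Q.lab t = l
        · obtain ⟨t, ht, rfl⟩ := hl
          have h1 := (hy t ht).1 ((Q.chart.mem t ht y hye).1 hyH)
          exact ⟨t, Finset.mem_filter.2 ⟨h1.1, ho⟩, h1.2⟩
        · push Not at hl
          exact absurd hyH (Q.chart.off l hl y hye)
    · rintro ⟨t, ht, hyt⟩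
      obtain ⟨htJ, htL⟩ := Finset.mem_filter.1 ht
      have htT := ((Q.mem_J t).1 htJ).1
      exact ⟨_, List.mem_map.2 ⟨_, htL, rfl⟩,
        (Q.chart.mem t htT y hye).2 ((hy t htT).2 ⟨htJ, hyt⟩)⟩
  · rw [Q.chart.field q Q.mem, Submodule.span_le]
    exact fun D hD => mem_derLog_of_toricChart Q.chart.atlas Q.chart.mem Q.chart.off S.divisor
      Q.mem hD
  · rcases S.label (Q.lab j) ⟨q, Q.mem_H hj⟩ with h | ⟨i, -, -, hρ, hi⟩
    · exact Or.inl fun D hD => Q.dvd_of_mem_derLog hj h hD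
    · refine Or.inr fun r hr h => hi ?_
      have h1 := Q.echelon.mem₀ r hr
      have hjT := ((Q.mem_J j).1 hj).1
      rw [h, Submodule.mem_comap, rayMap_apply_of_supp _ _ fun t ht => by
        rw [Pi.single_eq_of_ne]
        rintro rfl
        exact ht hjT, Finset.sum_eq_single j, Pi.single_eq_same, one_smul, hρ] at h1
      · convert! h1 using 1
        ext k
        by_cases hk : k = i
        · subst hk
          simp [qray]
        · simp [qray, hk]
      · intro t _ ht
        rw [Pi.single_eq_of_ne ht, zero_smul]
      · exact fun h => absurd hjT h

end StagePoint

end StagePoint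

section PullBack

variable {𝕜 : Type} [RCLike 𝕜] {m : ℕ}

theorem mono_add {M : AnMfd.{u} 𝕜 m} {p : M} (c : CenteredChart p) (a b : Fin m → ℕ) :
    mono c (a + b) = mono c a * mono c b := by
  rw [mono, mono, mono, ← Finset.prod_mul_distrib]
  exact Finset.prod_congr rfl fun j _ => pow_add _ _ _

theorem mono_zero {M : AnMfd.{u} 𝕜 m} {p : M} (c : CenteredChart p) :
    mono c (0 : Fin m → ℕ) = 1 := by
  rw [mono]
  exact Finset.prod_eq_one fun j _ => pow_zero _

theorem mono_single {M : AnMfd.{u} 𝕜 m} {p : M} (c : CenteredChart p) (j : Fin m) (k : ℕ) :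
    mono c (Pi.single j k) = coordGerm c j ^ k := by
  rw [mono, Finset.prod_eq_single j]
  · rw [Pi.single_eq_same]
  · intro i _ hi
    rw [Pi.single_eq_of_ne hi, pow_zero]
  · exact fun h => absurd (Finset.mem_univ _) h

theorem mono_ne_zero {M : AnMfd.{u} 𝕜 m} {p : M} (c : CenteredChart p) (a : Fin m → ℕ) :
    mono c a ≠ 0 :=
  Finset.prod_ne_zero_iff.2 fun j _ => pow_ne_zero _ (coordGerm_ne_zero c j)

theorem coe_prod_pow {M : AnMfd.{u} 𝕜 m} {p : M} {κ : Type*} (T : Finset κ) (f : κ → M → 𝕜)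
    (hf : ∀ t, IsAnAt (f t) p) (n : κ → ℕ) :
    ((∏ t ∈ T, toGerm (f t) (hf t) ^ n t : AnGerm p) : Germ (𝓝 p) 𝕜) =
      ((fun y => ∏ t ∈ T, f t y ^ n t : M → 𝕜) : Germ (𝓝 p) 𝕜) := by
  rw [SubmonoidClass.coe_finsetProd]
  simp only [SubmonoidClass.coe_pow]
  change ∏ t ∈ T, (f t : Germ (𝓝 p) 𝕜) ^ n t = _
  have h := map_prod (Germ.coeRingHom (𝓝 p) : (M → 𝕜) →+* Germ (𝓝 p) 𝕜) (fun t => f t ^ n t) T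
  simp only [map_pow] at h
  refine h.symm.trans ?_
  refine Germ.coe_eq.2 (Eventually.of_forall fun y => ?_)
  simp

/-- `g` is an eigenvector of `D`. -/
def IsEigen {M : AnMfd.{u} 𝕜 m} {q : M} (D : VField q) (x : 𝕜) (g : AnGerm q) : Prop :=
  D g = algebraMap 𝕜 _ x * g

theorem IsEigen.mul {M : AnMfd.{u} 𝕜 m} {q : M} {D : VField q} {x y : 𝕜} {f g : AnGerm q}
    (hf : IsEigen D x f) (hg : IsEigen D y g) : IsEigen D (x + y) (f * g) := by
  rw [IsEigen] at *
  rw [Derivation.leibniz, hf, hg, smul_eq_mul, smul_eq_mul, map_add]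
  ring

theorem isEigen_one {M : AnMfd.{u} 𝕜 m} {q : M} (D : VField q) : IsEigen D 0 1 := by
  rw [IsEigen, Derivation.map_one_eq_zero, map_zero, zero_mul]

theorem IsEigen.pow {M : AnMfd.{u} 𝕜 m} {q : M} {D : VField q} {x : 𝕜} {f : AnGerm q}
    (hf : IsEigen D x f) (n : ℕ) : IsEigen D (n * x) (f ^ n) := by
  induction n with
  | zero =>
    rw [Nat.cast_zero, zero_mul, pow_zero]
    exact isEigen_one D
  | succ n ih =>
    rw [pow_succ, Nat.cast_succ, add_mul, one_mul]
    exact ih.mul hf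

theorem IsEigen.prod {M : AnMfd.{u} 𝕜 m} {q : M} {D : VField q} {κ : Type*} (S : Finset κ)
    {x : κ → 𝕜} {f : κ → AnGerm q} (hf : ∀ s ∈ S, IsEigen D (x s) (f s)) :
    IsEigen D (∑ s ∈ S, x s) (∏ s ∈ S, f s) := by
  classical
  induction S using Finset.induction_on with
  | empty =>
    rw [Finset.sum_empty, Finset.prod_empty]
    exact isEigen_one D
  | insert s S hs ih =>
    rw [Finset.sum_insert hs, Finset.prod_insert hs]
    exact (hf s (Finset.mem_insert_self _ _)).mul
      (ih fun t ht => hf t (Finset.mem_insert_of_mem ht))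

variable {X : FolSub.{u} 𝕜 m} {e₀ : OpenPartialHomeomorph X.M (Fin m → 𝕜)}
    {Tor : Finset (Fin m)} {W : Submodule ℚ (Fin m → ℚ)} {v : Fin m} {S : Stage X e₀ Tor W v}

namespace StagePoint

variable {q : S.Y.M}

/-- The exponents, in the toric coordinates, of the pull-back of a monomial. -/
def exp (Q : StagePoint S q) (a : Fin m → ℕ) (t : Fin m) : ℕ := ∑ i, S.ρ (Q.lab t) i * a i

theorem exp_add (Q : StagePoint S q) (a b : Fin m → ℕ) : Q.exp (a + b) = Q.exp a + Q.exp b := by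
  ext t
  simp only [exp, Pi.add_apply, mul_add, Finset.sum_add_distrib]

/-- The exponents of the coordinates that vanish at the point. -/
def expJ (Q : StagePoint S q) (a : Fin m → ℕ) (t : Fin m) : ℕ := if t ∈ Q.J then Q.exp a t else 0

theorem expJ_add (Q : StagePoint S q) (a b : Fin m → ℕ) :
    Q.expJ (a + b) = Q.expJ a + Q.expJ b := by
  ext t
  rw [Pi.add_apply, expJ, expJ, expJ, exp_add]
  split_ifs <;> rfl

/-- The unit in the pull-back of a monomial. -/
noncomputable def unitPart (Q : StagePoint S q) (a : Fin m → ℕ) : AnGerm q :=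
  ∏ t ∈ Tor, Q.K.E t ^ Q.exp a t

theorem isUnit_unitPart (Q : StagePoint S q) (a : Fin m → ℕ) : IsUnit (Q.unitPart a) := by
  classical
  rw [unitPart]
  have : ∀ T ⊆ Tor, IsUnit (∏ t ∈ T, Q.K.E t ^ Q.exp a t) := by
    intro T
    induction T using Finset.induction_on with
    | empty => simp
    | insert t T ht ih =>
      intro hT
      rw [Finset.prod_insert ht]
      exact ((Q.K.unit t (hT (Finset.mem_insert_self _ _))).pow _).mul
        (ih fun s hs => hT (Finset.mem_insert_of_mem hs))
  exact this Tor subset_rfl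

theorem isEigen_unitPart (Q : StagePoint S q) (a : Fin m → ℕ) {r : Fin m} (hr : r ∈ Q.R) :
    IsEigen (coordDer Q.K.c r) ((∑ t ∈ Tor, Q.Y r t * Q.exp a t : ℚ) : 𝕜) (Q.unitPart a) := by
  rw [Rat.cast_sum]
  refine IsEigen.prod Tor fun t ht => ?_
  have h := IsEigen.pow (show IsEigen _ _ _ from Q.K.der r hr t ht) (Q.exp a t)
  convert! h using 1
  push_cast
  ring

/-- In the coordinates of a stage, the coordinates of the base are monomials. -/
theorem pull_coordGerm (Q : StagePoint S q) (c : CenteredChart (S.π q)) (hc : c.e = e₀)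
    {i : Fin m} (hi : i ∈ Tor) : pull S.π q (coordGerm c i) =
      ∏ t ∈ Tor, chartGerm Q.chart.atlas Q.mem t ^ S.ρ (Q.lab t) i := by
  refine Subtype.ext ?_
  refine Eq.trans ?_ (coe_prod_pow Tor (fun t y => Q.e y t) (fun t => contMDiffAt_pi_space.1
    (contMDiffAt_of_mem_maximalAtlas Q.chart.atlas Q.mem) t) fun t => S.ρ (Q.lab t) i).symm
  refine Germ.coe_eq.2 ?_
  filter_upwards [Q.e.open_source.mem_nhds Q.mem] with y hy
  change c.e (S.π y) i = _
  rw [hc]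
  exact Q.chart.coord y hy i hi

theorem pull_coordGerm_off (Q : StagePoint S q) (c : CenteredChart (S.π q)) (hc : c.e = e₀)
    {i : Fin m} (hi : i ∉ Tor) : pull S.π q (coordGerm c i) = coordGerm Q.K.c i := by
  rw [← Q.K.chart_off i hi]
  refine Subtype.ext (Germ.coe_eq.2 ?_)
  filter_upwards [Q.e.open_source.mem_nhds Q.mem] with y hy
  change c.e (S.π y) i = _
  rw [hc]
  exact Q.chart.coord' y hy i hi

theorem prod_chartGerm_pow (Q : StagePoint S q) (n : Fin m → ℕ) :
    ∏ t ∈ Tor, chartGerm Q.chart.atlas Q.mem t ^ n t =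
      mono Q.K.c (fun t => if t ∈ Q.J then n t else 0) * ∏ t ∈ Tor, Q.K.E t ^ n t := by
  classical
  have h1 : mono Q.K.c (fun t => if t ∈ Q.J then n t else 0) =
      ∏ t ∈ Tor, if t ∈ Q.J then coordGerm Q.K.c t ^ n t else 1 := by
    rw [mono]
    symm
    refine (Finset.prod_subset (Finset.subset_univ Tor) fun t _ ht => ?_).trans
      (Finset.prod_congr rfl fun t _ => ?_)
    · exact if_neg fun h => ht (Q.K.subset_J h)
    · split_ifs
      · rfl
      · rw [pow_zero]
  rw [h1, ← Finset.prod_mul_distrib]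
  refine Finset.prod_congr rfl fun t ht => ?_
  split_ifs with htJ
  · rw [Q.K.chart_J t htJ, mul_pow]
  · rw [Q.K.chart_I t ht htJ, one_mul]

theorem pull_mono (Q : StagePoint S q) (c : CenteredChart (S.π q)) (hc : c.e = e₀)
    {a : Fin m → ℕ} (ha : ∀ i ∉ Tor, a i = 0) :
    pull S.π q (mono c a) = mono Q.K.c (Q.expJ a) * Q.unitPart a := by
  have h1 : pull S.π q (mono c a) =
      ∏ i ∈ Tor, ∏ t ∈ Tor, chartGerm Q.chart.atlas Q.mem t ^ (S.ρ (Q.lab t) i * a i) := by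
    rw [mono, map_prod]
    symm
    refine (Finset.prod_congr rfl fun i hi => ?_).trans
      (Finset.prod_subset (Finset.subset_univ Tor) fun i _ hi => ?_)
    · rw [map_pow, Q.pull_coordGerm c hc hi, ← Finset.prod_pow]
      exact Finset.prod_congr rfl fun t _ => pow_mul _ _ _
    · rw [ha i hi, pow_zero, map_one]
  have h2 : ∀ t, ∑ i ∈ Tor, S.ρ (Q.lab t) i * a i = Q.exp a t := fun t =>
    Finset.sum_subset (Finset.subset_univ Tor) fun i _ hi => by rw [ha i hi, mul_zero]
  rw [h1, Finset.prod_comm, Finset.prod_congr rfl fun t _ => Finset.prod_pow_eq_pow_sum _ _ _,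
    Finset.prod_congr rfl fun t _ => by rw [h2 t], Q.prod_chartGerm_pow]
  rfl

/-- Duality between weights and exponents. -/
theorem sum_mul_exp (Q : StagePoint S q) {w : Fin m → ℚ} (hw : ∀ t ∉ Tor, w t = 0)
    (a : Fin m → ℕ) : ∑ t ∈ Tor, w t * Q.exp a t =
      ∑ i, (rayMap Tor fun t => S.ρ (Q.lab t)) w i * a i := by
  rw [rayMap_apply_of_supp _ _ hw]
  simp only [exp, Finset.sum_apply, Pi.smul_apply, smul_eq_mul, qray, Nat.cast_sum, Nat.cast_mul,
    Finset.mul_sum, Finset.sum_mul]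
  rw [Finset.sum_comm]
  exact Finset.sum_congr rfl fun i _ => Finset.sum_congr rfl fun t _ => by ring

theorem sum_mul_exp_eq_expJ (Q : StagePoint S q) {w : Fin m → ℚ} (hw : ∀ t ∉ Q.J, w t = 0)
    (a : Fin m → ℕ) : ∑ t ∈ Tor, w t * Q.exp a t = ∑ t, w t * Q.expJ a t := by
  refine (Finset.sum_subset (Finset.subset_univ Tor) fun t _ ht => ?_).trans
    (Finset.sum_congr rfl fun t _ => ?_)
  · rw [hw t fun h => ht (Q.K.subset_J h), zero_mul]
  · by_cases ht : t ∈ Q.J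
    · rw [expJ, if_pos ht]
    · rw [hw t ht, zero_mul, zero_mul]

/-- Toric vector fields are lifts of vector fields of the distribution. -/
theorem exists_isLift (Q : StagePoint S q) (c : CenteredChart (S.π q)) (hc : c.e = e₀)
    (hdiag : ∀ κ ∈ W, diagField c Tor κ ∈ X.θ (S.π q))
    (hoff : ∀ i ∉ Tor, coordDer c i ∈ X.θ (S.π q)) {D : VField q}
    (hD : D ∈ toricFields Q.chart.atlas Q.mem Tor
      {w | ∑ t ∈ Tor, w t • qray (S.ρ (Q.lab t)) ∈ W}) :
    ∃ D₀ ∈ X.θ (S.π q), IsLift S.π D D₀ := by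
  classical
  obtain ⟨w, hw, h1, h2⟩ := hD
  choose k hk using fun t : {t // t ∉ Tor} => h2 t t.2
  let k' : Fin m → 𝕜 := fun t => if ht : t ∉ Tor then k ⟨t, ht⟩ else 0
  have hk' : ∀ t ∉ Tor, D (chartGerm Q.chart.atlas Q.mem t) = algebraMap 𝕜 _ (k' t) :=
    fun t ht => by
      rw [hk ⟨t, ht⟩]
      simp only [k', dif_pos ht]
  set κ := ∑ t ∈ Tor, w t • qray (S.ρ (Q.lab t)) with hκ
  have hoffκ : ∀ i ∉ Tor, κ i = 0 := fun i hi => by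
    rw [hκ, Finset.sum_apply]
    refine Finset.sum_eq_zero fun t _ => ?_
    simp [qray, S.supp (Q.lab t) i hi]
  refine ⟨diagField c Tor κ + ∑ i ∈ Torᶜ, algebraMap 𝕜 (AnGerm (S.π q)) (k' i) • coordDer c i,
    add_mem (hdiag κ hw) (Submodule.sum_mem _ fun i hi => Submodule.smul_mem _ _
      (hoff i (Finset.mem_compl.1 hi))), ?_⟩
  refine isLift_of_chart S.π c.mem_atlas c.mem_source fun i => ?_
  rw [chartGerm_centered, Derivation.add_apply, vfield_sum_apply]
  simp only [Derivation.smul_apply, smul_eq_mul]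
  rw [diagField_coordGerm c Tor κ hoffκ]
  by_cases hi : i ∈ Tor
  · rw [Finset.sum_eq_zero (s := Torᶜ) fun j hj => by
      rw [coordDer_coordGerm, if_neg, mul_zero]
      rintro rfl
      exact Finset.mem_compl.1 hj hi, add_zero, map_mul, AlgHom.commutes, Q.pull_coordGerm c hc hi]
    have h3 := IsEigen.prod Tor (D := D)
      (x := fun t => (S.ρ (Q.lab t) i : 𝕜) * (w t : 𝕜)) fun t ht =>
      IsEigen.pow (show IsEigen D _ _ from h1 t ht) (S.ρ (Q.lab t) i)
    rw [IsEigen] at h3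
    rw [h3]
    congr 2
    rw [hκ, Finset.sum_apply, Rat.cast_sum]
    refine Finset.sum_congr rfl fun t _ => ?_
    simp [qray, mul_comm]
  · rw [hoffκ i hi, Rat.cast_zero, map_zero, zero_mul, zero_add, Finset.sum_eq_single i,
      coordDer_coordGerm, if_pos rfl, mul_one, AlgHom.commutes, Q.pull_coordGerm_off c hc hi,
      ← Q.K.chart_off i hi, hk' i hi]
    · intro j _ hj
      rw [coordDer_coordGerm, if_neg hj.symm, mul_zero]
    · exact fun h => absurd (Finset.mem_compl.2 hi) h

theorem isFirstIntegral_pull (Q : StagePoint S q) (c : CenteredChart (S.π q)) (hc : c.e = e₀)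
    (hdiag : ∀ κ ∈ W, diagField c Tor κ ∈ X.θ (S.π q))
    (hoff : ∀ i ∉ Tor, coordDer c i ∈ X.θ (S.π q)) {g : AnGerm (S.π q)}
    (hg : X.IsFirstIntegral g) : S.Y.IsFirstIntegral (pull S.π q g) := by
  rw [FolSub.IsFirstIntegral, Q.chart.field q Q.mem, forall_mem_span_apply_eq_zero_iff]
  intro D hD
  obtain ⟨D₀, hD₀, h⟩ := Q.exists_isLift c hc hdiag hoff hD
  rw [h g, hg D₀ hD₀, map_zero]

end StagePoint

end PullBack

section Slice

variable {𝕜 : Type} [RCLike 𝕜] {m : ℕ}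

theorem coeff_eq_zero_of_mem_span {M : AnMfd.{u} 𝕜 m} {q : M} (c : CenteredChart q)
    {I : Set (Fin m)} {f : AnGerm q} (hf : f ∈ Ideal.span (coordGerm c '' I))
    {a : Fin m →₀ ℕ} (ha : ∀ t ∈ I, a t = 0) : (taylor c f).coeff a = 0 := by
  classical
  induction hf using Submodule.span_induction generalizing a with
  | mem f hf =>
    obtain ⟨j, hj, rfl⟩ := hf
    rw [taylor_coordGerm, MvPowerSeries.coeff_X, if_neg]
    rintro rfl
    have := ha j hj
    simp at this
  | zero => rw [map_zero, map_zero]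
  | add f g _ _ h1 h2 => rw [map_add, map_add, h1 ha, h2 ha, add_zero]
  | smul g f _ h1 =>
    rw [smul_eq_mul, map_mul, MvPowerSeries.coeff_mul]
    refine Finset.sum_eq_zero fun b hb => ?_
    rw [Finset.HasAntidiagonal.mem_antidiagonal] at hb
    rw [h1, mul_zero]
    intro t ht
    have h2 : b.1 t + b.2 t = a t := by rw [← hb]; rfl
    rw [ha t ht] at h2
    omega

theorem germEval_eq_zero_of_mem_span {M : AnMfd.{u} 𝕜 m} {q : M} (c : CenteredChart q)
    {I : Set (Fin m)} {f : AnGerm q} (hf : f ∈ Ideal.span (coordGerm c '' I)) :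
    germEval q f = 0 := by
  have h := coeff_eq_zero_of_mem_span c hf (a := 0) fun _ _ => rfl
  rwa [MvPowerSeries.coeff_zero_eq_constantCoeff_apply, constantCoeff_taylor] at h

theorem derivation_mem_span {M : AnMfd.{u} 𝕜 m} {q : M} (c : CenteredChart q)
    {I : Set (Fin m)} {D : VField q} (hD : ∀ t ∈ I, D (coordGerm c t) = 0) {f : AnGerm q}
    (hf : f ∈ Ideal.span (coordGerm c '' I)) : D f ∈ Ideal.span (coordGerm c '' I) := by
  induction hf using Submodule.span_induction with
  | mem f hf =>
    obtain ⟨j, hj, rfl⟩ := hf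
    rw [hD j hj]
    exact zero_mem _
  | zero =>
    rw [map_zero]
    exact zero_mem _
  | add f g _ _ h1 h2 =>
    rw [map_add]
    exact add_mem h1 h2
  | smul g f hf h1 =>
    rw [smul_eq_mul, Derivation.leibniz]
    exact add_mem (Ideal.mul_mem_left _ _ h1) (Ideal.mul_mem_right _ _ hf)

/-- Directional derivatives. -/
noncomputable def dirDer {M : AnMfd.{u} 𝕜 m} {q : M} (c : CenteredChart q) (R : Finset (Fin m))
    (η : Fin m → ℚ) : VField q := ∑ r ∈ R, algebraMap 𝕜 (AnGerm q) (η r : 𝕜) • coordDer c r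

theorem dirDer_apply {M : AnMfd.{u} 𝕜 m} {q : M} (c : CenteredChart q) (R : Finset (Fin m))
    (η : Fin m → ℚ) (g : AnGerm q) :
    dirDer c R η g = ∑ r ∈ R, algebraMap 𝕜 (AnGerm q) (η r : 𝕜) * coordDer c r g := by
  rw [dirDer, vfield_sum_apply]
  rfl

theorem germEval_dirDer_iterate {M : AnMfd.{u} 𝕜 m} {q : M} (c : CenteredChart q)
    (R : Finset (Fin m)) (η : Fin m → ℚ) (k : ℕ) (F : AnGerm q)
    (hF : ∀ a : Fin m →₀ ℕ, (∀ t ∉ R, a t = 0) → a.degree = k → (taylor c F).coeff a = 0) :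
    germEval q ((dirDer c R η)^[k] F) = 0 := by
  induction k generalizing F with
  | zero =>
    have h := hF 0 (fun _ _ => rfl) (map_zero _)
    rwa [MvPowerSeries.coeff_zero_eq_constantCoeff_apply, constantCoeff_taylor] at h
  | succ k ih =>
    rw [Function.iterate_succ_apply]
    refine ih _ fun a ha hak => ?_
    rw [dirDer_apply, map_sum, map_sum]
    refine Finset.sum_eq_zero fun r hr => ?_
    have h1 : algebraMap 𝕜 (AnGerm q) (η r : 𝕜) * coordDer c r F = (η r : 𝕜) • coordDer c r F :=
      (Algebra.smul_def _ _).symm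
    rw [h1, map_smul, map_smul, taylor_coordDer, MvPowerSeries.coeff_pderiv, hF, zero_mul,
      smul_zero]
    · intro t ht
      rw [Finsupp.add_apply, ha t ht, Finsupp.single_eq_of_ne, add_zero]
      rintro rfl
      exact ht hr
    · rw [map_add, hak, Finsupp.degree_single]

theorem germEval_iterate_of_sub_mem {M : AnMfd.{u} 𝕜 m} {q : M} (c : CenteredChart q)
    {I : Set (Fin m)} {D : VField q} (hD : ∀ t ∈ I, D (coordGerm c t) = 0) {κ : Type*}
    (N : Finset κ) (U : κ → AnGerm q) (x : κ → 𝕜) (hU : ∀ k ∈ N, IsEigen D (x k) (U k))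
    (y : κ → 𝕜) (F : AnGerm q)
    (hF : F - ∑ k ∈ N, algebraMap 𝕜 _ (y k) * U k ∈ Ideal.span (coordGerm c '' I)) (l : ℕ) :
    germEval q (D^[l] F) = ∑ k ∈ N, x k ^ l * (y k * germEval q (U k)) := by
  induction l generalizing F y with
  | zero =>
    have h := germEval_eq_zero_of_mem_span c hF
    rw [map_sub, sub_eq_zero, map_sum] at h
    rw [Function.iterate_zero_apply, h]
    refine Finset.sum_congr rfl fun k _ => ?_
    rw [map_mul, AlgHom.commutes, pow_zero, one_mul]
    rfl
  | succ l ih =>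
    rw [Function.iterate_succ_apply, ih (fun k => x k * y k)]
    · exact Finset.sum_congr rfl fun k _ => by ring
    · have h := derivation_mem_span c hD hF
      rw [map_sub, map_sum] at h
      convert! h using 2
      refine Finset.sum_congr rfl fun k hk => ?_
      have h1 : D (U k) = _ := hU k hk
      rw [Derivation.leibniz, derivation_const, smul_zero, add_zero, h1, smul_eq_mul, map_mul]
      ring

/-- A non-degeneracy of Vandermonde type. -/
theorem exists_power_sum_ne_zero (N : Finset ℕ) (u : ℕ → 𝕜) (x : 𝕜) (ν : ℕ) {k₀ : ℕ}
    (hk₀ : k₀ ∈ N) (hu : u k₀ ≠ 0) (hN : N.card ≤ ν) (A : Prop)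
    (hA : A ∨ (x = 0 ∧ 0 ∈ N ∧ k₀ ≠ 0)) :
    ∃ l < ν, (l ≠ 0 ∨ A) ∧ ∑ k ∈ N, ((k : 𝕜) - x) ^ l * u k ≠ 0 := by
  classical
  by_contra! hcon
  let f : Polynomial 𝕜 := ∏ j ∈ N.erase k₀, (Polynomial.X - Polynomial.C ((j : 𝕜) - x))
  have hdeg : f.natDegree + 1 = N.card := by
    rw [Polynomial.natDegree_prod_of_monic _ _ fun j _ => Polynomial.monic_X_sub_C _,
      Finset.sum_congr rfl fun j _ => Polynomial.natDegree_X_sub_C _, Finset.sum_const, smul_eq_mul,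
      mul_one, Finset.card_erase_of_mem hk₀, Nat.sub_add_cancel]
    exact Finset.card_pos.2 ⟨k₀, hk₀⟩
  have heval : ∀ y, f.eval y = ∏ j ∈ N.erase k₀, (y - ((j : 𝕜) - x)) := fun y => by
    simp only [f, Polynomial.eval_prod, Polynomial.eval_sub, Polynomial.eval_X, Polynomial.eval_C]
  have h1 : ∑ k ∈ N, f.eval ((k : 𝕜) - x) * u k = f.eval ((k₀ : 𝕜) - x) * u k₀ := by
    refine Finset.sum_eq_single k₀ (fun k hk hkk => ?_) fun h => absurd hk₀ h
    rw [heval, Finset.prod_eq_zero (Finset.mem_erase.2 ⟨hkk, hk⟩) (sub_self _), zero_mul]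
  have h2 : f.eval ((k₀ : 𝕜) - x) ≠ 0 := by
    rw [heval, Finset.prod_ne_zero_iff]
    intro j hj h0
    rw [sub_sub_sub_cancel_right, sub_eq_zero] at h0
    exact Finset.ne_of_mem_erase hj (Nat.cast_injective h0).symm
  refine mul_ne_zero h2 hu ?_
  rw [← h1]
  have h3 : ∀ k : ℕ, f.eval ((k : 𝕜) - x) * u k =
      ∑ l ∈ Finset.range (f.natDegree + 1), f.coeff l * (((k : 𝕜) - x) ^ l * u k) := fun k => by
    rw [Polynomial.eval_eq_sum_range, Finset.sum_mul]
    exact Finset.sum_congr rfl fun l _ => mul_assoc _ _ _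
  rw [Finset.sum_congr rfl fun k _ => h3 k, Finset.sum_comm]
  refine Finset.sum_eq_zero fun l hl => ?_
  rw [← Finset.mul_sum]
  by_cases hlA : l ≠ 0 ∨ A
  · rw [hcon l (by have := Finset.mem_range.1 hl; omega) hlA, mul_zero]
  · push Not at hlA
    obtain ⟨rfl, hA'⟩ := hlA
    obtain ⟨rfl, h0, hk0⟩ := hA.resolve_left hA'
    rw [Polynomial.coeff_zero_eq_eval_zero, heval,
      Finset.prod_eq_zero (Finset.mem_erase.2 ⟨hk0.symm, h0⟩) (by simp), zero_mul]

end Slice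

section Drop

variable {𝕜 : Type} [RCLike 𝕜] {m : ℕ}

theorem coeff_restrictSeries_of_mem {A : Set (Fin m →₀ ℕ)} (φ : MvPowerSeries (Fin m) 𝕜)
    {a : Fin m →₀ ℕ} (h : a ∈ A) : (restrictSeries A φ).coeff a = φ.coeff a := by
  rw [coeff_restrictSeries, if_pos h]

theorem coeff_restrictSeries_of_notMem {A : Set (Fin m →₀ ℕ)} (φ : MvPowerSeries (Fin m) 𝕜)
    {a : Fin m →₀ ℕ} (h : a ∉ A) : (restrictSeries A φ).coeff a = 0 := by
  rw [coeff_restrictSeries, if_neg h]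

theorem mem_of_coeff_restrictSeries {A : Set (Fin m →₀ ℕ)} {φ : MvPowerSeries (Fin m) 𝕜}
    {a : Fin m →₀ ℕ} (h : (restrictSeries A φ).coeff a ≠ 0) : a ∈ A := by
  by_contra ha
  exact h (coeff_restrictSeries_of_notMem φ ha)

theorem coeff_taylor_mono_mul {M : AnMfd.{u} 𝕜 m} {p : M} (c : CenteredChart p)
    (a : Fin m → ℕ) (g : AnGerm p) (b : Fin m →₀ ℕ) :
    (taylor c (mono c a * g)).coeff (toFs a + b) = (taylor c g).coeff b := by
  rw [map_mul, taylor_mono, MvPowerSeries.coeff_add_monomial_mul, one_mul]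

theorem le_of_coeff_taylor_mono_mul {M : AnMfd.{u} 𝕜 m} {p : M} (c : CenteredChart p)
    (a : Fin m → ℕ) (g : AnGerm p) {b : Fin m →₀ ℕ}
    (h : (taylor c (mono c a * g)).coeff b ≠ 0) : toFs a ≤ b := by
  classical
  rw [map_mul, taylor_mono, MvPowerSeries.coeff_monomial_mul] at h
  exact (ite_ne_right_iff.1 h).1

theorem mono_mem_span {M : AnMfd.{u} 𝕜 m} {p : M} (c : CenteredChart p) {I : Set (Fin m)}
    {a : Fin m → ℕ} {t : Fin m} (ht : t ∈ I) (hat : a t ≠ 0) :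
    mono c a ∈ Ideal.span (coordGerm c '' I) := by
  have h1 : coordGerm c t ∣ mono c a :=
    (dvd_pow_self _ hat).trans (Finset.dvd_prod_of_mem _ (Finset.mem_univ t))
  exact Ideal.mem_of_dvd _ h1 (Ideal.subset_span ⟨t, ht, rfl⟩)

variable {X : FolSub.{u} 𝕜 m} {e₀ : OpenPartialHomeomorph X.M (Fin m → 𝕜)}
    {Tor : Finset (Fin m)} {W : Submodule ℚ (Fin m → ℚ)} {v : Fin m} {S : Stage X e₀ Tor W v}

namespace StagePoint

variable {q : S.Y.M}

/-- The monomial with exponents `γ` is not a first integral along the strata. -/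
def IsTransverse (Q : StagePoint S q) (γ : Fin m → ℕ) : Prop :=
  ∃ r ∈ Q.R₀, ∑ t, Q.Y₀ r t * γ t ≠ 0

/-- A bound for the tangency order. -/
theorem nu_le (Q : StagePoint S q) (hmon : S.Y.IsMonomialCoord Q.K.c Q.K.reg) {n : ℕ}
    (f g G : Fin n → AnGerm q) {γ : Fin m → ℕ} (hγ : ∀ t ∉ Q.J, γ t = 0)
    (gen : S.Y.IsGenSystem f) (hg : ∀ i, S.Y.IsFirstIntegral (g i))
    (eq : ∀ i, f i = g i + mono Q.K.c γ * G i) (i : Fin n) {b : Fin m →₀ ℕ}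
    (hb : ∀ t ∉ Q.K.reg, b t = 0) (hne : b ≠ 0 ∨ Q.IsTransverse γ)
    (hcoef : (taylor Q.K.c (G i)).coeff b ≠ 0) : S.Y.nu q ≤ (b.degree : ℕ∞) := by
  classical
  set A := integralExponents (m := m) Q.K.reg (fun r : Q.R₀ => Q.Y₀ r) with hA
  have hFI := S.Y.isFirstIntegral_iff Q.K.c Q.K.reg (fun r : Q.R₀ => Q.Y₀ r) Q.field_eq_range
  have hFIm := S.Y.isFirstIntegral_mono_iff Q.K.c Q.K.reg (fun r : Q.R₀ => Q.Y₀ r) Q.field_eq_range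
  have hγreg : ∀ t ∈ Q.K.reg, γ t = 0 := fun t ht =>
    hγ t fun h => Q.K.notMem_reg_of_mem_J h ht
  have hnot : toFs γ + b ∉ A := by
    rintro ⟨h1, h2⟩
    rcases hne with h | ⟨r, hr, h⟩
    · refine h (Finsupp.ext fun t => ?_)
      by_cases ht : t ∈ Q.K.reg
      · have := h1 t ht
        rw [Finsupp.add_apply] at this
        exact (Nat.add_eq_zero_iff.1 this).2
      · exact hb t ht
    · refine h ?_
      rw [← h2 ⟨r, hr⟩]
      symm
      refine (Finset.sum_subset (Finset.subset_univ _) fun t _ ht => ?_).trans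
        (Finset.sum_congr rfl fun t _ => ?_)
      · beta_reduce
        rw [Q.echelon.supp₀ r hr t fun h => ht (Finset.mem_compl.2 (Q.K.notMem_reg_of_mem_J h)),
          zero_mul]
      · by_cases ht : t ∈ Q.J
        · rw [Finsupp.add_apply, hb t (Q.K.notMem_reg_of_mem_J ht), add_zero, toFs_apply]
        · beta_reduce
          rw [Q.echelon.supp₀ r hr t ht, zero_mul, zero_mul]
  choose T hT using fun i => exists_taylor_restrict Q.K.c (G i) {b | toFs γ + b ∉ A}
  choose F hF using fun i => exists_taylor_restrict Q.K.c (G i) {b | toFs γ + b ∈ A}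
  have hTF : ∀ i, G i = F i + T i := fun i => by
    refine taylor_injective Q.K.c (MvPowerSeries.ext fun b => ?_)
    rw [map_add, map_add, hT, hF]
    by_cases h : toFs γ + b ∈ A
    · rw [coeff_restrictSeries_of_mem _ (show b ∈ {b | toFs γ + b ∈ A} from h),
        coeff_restrictSeries_of_notMem _ (show b ∉ {b | toFs γ + b ∉ A} from fun h' => h' h),
        add_zero]
    · rw [coeff_restrictSeries_of_notMem _ (show b ∉ {b | toFs γ + b ∈ A} from h),
        coeff_restrictSeries_of_mem _ (show b ∈ {b | toFs γ + b ∉ A} from h), zero_add]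
  have hFint : ∀ i, S.Y.IsFirstIntegral (mono Q.K.c γ * F i) := fun i => by
    rw [hFI]
    intro a ha
    obtain ⟨b, rfl⟩ := exists_add_of_le (le_of_coeff_taylor_mono_mul _ _ _ ha)
    rw [coeff_taylor_mono_mul, hF] at ha
    have h1 : b ∈ {b | toFs γ + b ∈ A} := mem_of_coeff_restrictSeries ha
    exact h1
  have hcT : (taylor Q.K.c (T i)).coeff b ≠ 0 := by
    rw [hT, coeff_restrictSeries_of_mem _ (show b ∈ {b | toFs γ + b ∉ A} from hnot)]
    exact hcoef
  have hdec : S.Y.IsDecomp Q.K.c Q.K.reg f (fun i => g i + mono Q.K.c γ * F i) T γ := by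
    refine ⟨hγreg, fun i => ?_, fun i D hD => ?_, fun i a ha h => ?_, fun δ' hδ' hdvd t => ?_⟩
    · rw [eq i, hTF i]
      ring
    · rw [map_add, hg i D hD, hFint i D hD, add_zero]
    · rw [occurs_iff] at ha
      rw [hFIm] at h
      obtain ⟨b, hb⟩ := exists_add_of_le (le_of_coeff_taylor_mono_mul _ _ _ ha)
      rw [hb, coeff_taylor_mono_mul, hT] at ha
      rw [hb] at h
      have h1 : b ∈ {b | toFs γ + b ∉ A} := mem_of_coeff_restrictSeries ha
      exact h1 h
    · have h1 := hdvd i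
      rw [eq i, hTF i] at h1
      have h2 : g i + mono Q.K.c γ * (F i + T i) - (g i + mono Q.K.c γ * F i) =
          mono Q.K.c γ * T i := by ring
      rw [h2] at h1
      obtain ⟨h, hh⟩ := h1
      have h3 : (taylor Q.K.c (mono Q.K.c γ * T i)).coeff (toFs γ + b) ≠ 0 := by
        rwa [coeff_taylor_mono_mul]
      rw [hh] at h3
      have h4 := le_of_coeff_taylor_mono_mul _ _ _ h3 t
      by_cases ht : t ∈ Q.K.reg
      · rw [hδ' t ht]
        exact Nat.zero_le _
      · rwa [Finsupp.add_apply, hb t ht, add_zero, toFs_apply, toFs_apply] at h4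
  refine sInf_le ⟨Q.K.c, Q.K.reg, hmon, n, f, _, T, γ, gen, hdec, i, fun j => b j, hb, ?_, ?_⟩
  · rw [isUnit_iterDer_iff, toFs_coe]
    exact hcT
  · rw [Finsupp.degree_eq_sum]

/-- The quotient, by a monomial, of the pull-back of a sum of terms. -/
noncomputable def quotient (Q : StagePoint S q) (ν : ℕ) (a : ℕ → Fin m → ℕ)
    (C : ℕ → AnGerm (S.π q)) (δ μ : Fin m → ℕ) : AnGerm q :=
  ∑ k ∈ Finset.range (ν + 1),
    mono Q.K.c (Q.expJ (a k) - Q.expJ μ) * Q.unitPart (δ + a k) * pull S.π q (C k)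

theorem expJ_le (Q : StagePoint S q) {μ a : Fin m → ℕ} (h : ∀ t ∈ Q.J, Q.exp μ t ≤ Q.exp a t) :
    Q.expJ μ ≤ Q.expJ a := by
  intro t
  rw [expJ, expJ]
  split_ifs with ht
  · exact h t ht
  · exact le_rfl

theorem pull_eq_quotient (Q : StagePoint S q) (c : CenteredChart (S.π q)) (hc : c.e = e₀) {ν : ℕ}
    {a : ℕ → Fin m → ℕ} {C : ℕ → AnGerm (S.π q)} {δ μ : Fin m → ℕ}
    (hδ : ∀ i ∉ Tor, δ i = 0) (ha : ∀ k, ∀ i ∉ Tor, a k i = 0)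
    (hμ : ∀ k ≤ ν, C k ≠ 0 → ∀ t ∈ Q.J, Q.exp μ t ≤ Q.exp (a k) t) :
    pull S.π q (mono c δ * ∑ k ∈ Finset.range (ν + 1), mono c (a k) * C k) =
      mono Q.K.c (Q.expJ (δ + μ)) * Q.quotient ν a C δ μ := by
  rw [quotient, Finset.mul_sum, Finset.mul_sum, map_sum]
  refine Finset.sum_congr rfl fun k hk => ?_
  by_cases hCk : C k = 0
  · rw [hCk, mul_zero, mul_zero, map_zero, mul_zero, mul_zero]
  · have h1 := Q.expJ_le (hμ k (Nat.lt_succ_iff.1 (Finset.mem_range.1 hk)) hCk)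
    rw [← mul_assoc, ← mono_add, map_mul, Q.pull_mono c hc fun i hi => by
      rw [Pi.add_apply, hδ i hi, ha k i hi]]
    have h2 : Q.expJ (δ + a k) = Q.expJ (δ + μ) + (Q.expJ (a k) - Q.expJ μ) := by
      rw [expJ_add, expJ_add, add_assoc, add_tsub_cancel_of_le h1]
    rw [h2, mono_add]
    ring

theorem pull_sub_mem (Q : StagePoint S q) (c : CenteredChart (S.π q)) (hc : c.e = e₀)
    (g : AnGerm (S.π q)) : pull S.π q g - algebraMap 𝕜 _ (germEval _ g) ∈
      Ideal.span (coordGerm Q.K.c '' {t | t ∈ Q.J ∨ t ∉ Tor}) := by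
  have h1 : Ideal.span (Set.range (coordGerm c)) ≤ Ideal.comap (pull S.π q)
      (Ideal.span (coordGerm Q.K.c '' {t | t ∈ Q.J ∨ t ∉ Tor})) := by
    rw [Ideal.span_le]
    rintro _ ⟨j, rfl⟩
    rw [SetLike.mem_coe, Ideal.mem_comap]
    by_cases hj : j ∈ Tor
    · have h2 := Q.pull_mono c hc (a := Pi.single j 1) fun i hi => by
        rw [Pi.single_eq_of_ne]
        rintro rfl
        exact hi hj
      rw [mono_single, pow_one] at h2
      rw [h2]
      by_cases h3 : ∃ t, Q.expJ (Pi.single j 1) t ≠ 0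
      · obtain ⟨t, ht⟩ := h3
        refine Ideal.mul_mem_right _ _ (mono_mem_span _ (t := t) (Or.inl ?_) ht)
        by_contra htJ
        exact ht (if_neg htJ)
      · push Not at h3
        have h4 : Q.expJ (Pi.single j 1) = 0 := funext h3
        rw [h4, mono_zero, one_mul] at h2
        have h5 := (isUnit_germ_iff _).1 (Q.isUnit_unitPart (Pi.single j 1))
        rw [← h2, germEval_pull, germEval_coordGerm] at h5
        exact absurd rfl h5
    · rw [Q.pull_coordGerm_off c hc hj]
      exact Ideal.subset_span ⟨j, Or.inr hj, rfl⟩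
  have h2 := h1 (sub_eval_mem_span c g)
  rw [Ideal.mem_comap, map_sub, AlgHom.commutes] at h2
  exact h2

theorem term_mem (Q : StagePoint S q) {ν : ℕ} {a : ℕ → Fin m → ℕ} {C : ℕ → AnGerm (S.π q)}
    {δ μ : Fin m → ℕ} (hμ : ∀ k ≤ ν, C k ≠ 0 → ∀ t ∈ Q.J, Q.exp μ t ≤ Q.exp (a k) t)
    {I : Set (Fin m)} (hI : ∀ t ∈ Q.J, t ∈ I) {k : ℕ} (hk : k ≤ ν)
    (h : C k = 0 ∨ Q.expJ (a k) ≠ Q.expJ μ) :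
    mono Q.K.c (Q.expJ (a k) - Q.expJ μ) * Q.unitPart (δ + a k) * pull S.π q (C k) ∈
      Ideal.span (coordGerm Q.K.c '' I) := by
  by_cases hC : C k = 0
  · rw [hC, map_zero, mul_zero]
    exact zero_mem _
  · have h1 := Q.expJ_le (hμ k hk hC)
    obtain ⟨t, ht⟩ := Function.ne_iff.1 (h.resolve_left hC)
    have htJ : t ∈ Q.J := by
      by_contra htJ
      exact ht ((if_neg htJ).trans (if_neg htJ).symm)
    refine Ideal.mul_mem_right _ _ (Ideal.mul_mem_right _ _ (mono_mem_span _ (hI t htJ) ?_))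
    have h2 : Q.expJ μ t ≤ Q.expJ (a k) t := h1 t
    rw [Pi.sub_apply]
    omega

theorem exists_coeff_of_power (Q : StagePoint S q) (c : CenteredChart (S.π q)) (hc : c.e = e₀)
    (hv : Pi.single v 1 ∈ W) {ν : ℕ}
    {a : ℕ → Fin m → ℕ} {C : ℕ → AnGerm (S.π q)} {δ μ : Fin m → ℕ}
    (hμ : ∀ k ≤ ν, C k ≠ 0 → ∀ t ∈ Q.J, Q.exp μ t ≤ Q.exp (a k) t)
    (hav : ∀ k ≤ ν, a k v = k) (hδv : δ v = 0) {N : Finset ℕ} (hN : N ⊆ Finset.range (ν + 1))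
    (hNC : ∀ k ≤ ν, k ∉ N → C k = 0 ∨ Q.expJ (a k) ≠ Q.expJ μ) {k₀ : ℕ} (hk₀ : k₀ ∈ N)
    (hCk₀ : IsUnit (C k₀)) (hak₀ : Q.expJ (a k₀) = Q.expJ μ) (hcard : N.card ≤ ν)
    (hA : Q.IsTransverse (Q.expJ (δ + μ)) ∨ (0 ∈ N ∧ k₀ ≠ 0)) :
    ∃ b : Fin m →₀ ℕ, (∀ t ∉ Q.K.reg, b t = 0) ∧ b.degree < ν ∧
      (b ≠ 0 ∨ Q.IsTransverse (Q.expJ (δ + μ))) ∧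
      (taylor Q.K.c (Q.quotient ν a C δ μ)).coeff b ≠ 0 := by
  classical
  obtain ⟨ε, hε⟩ := LinearMap.injective_iff_surjective.1 Q.rayMap_injective (Pi.single v 1)
  have hεA : ε ∈ W.comap (rayMap Tor fun t => S.ρ (Q.lab t)) := by
    rw [Submodule.mem_comap, hε]
    exact hv
  obtain ⟨x, hx⟩ := Q.echelon.expand hεA
  let ω₀ : Fin m → ℚ := fun t => ∑ r ∈ Q.R₀, x r * Q.Y₀ r t
  have hω₀ : ∀ t ∉ Q.J, ω₀ t = 0 := fun t ht =>
    Finset.sum_eq_zero fun r hr => by rw [Q.echelon.supp₀ r hr t ht, mul_zero]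
  let y : ℚ := ∑ t, ω₀ t * Q.expJ (δ + μ) t
  have hy : ¬ Q.IsTransverse (Q.expJ (δ + μ)) → y = 0 := by
    intro h
    simp only [IsTransverse, not_exists, not_and, not_not] at h
    simp only [y, ω₀, Finset.sum_mul]
    rw [Finset.sum_comm]
    refine Finset.sum_eq_zero fun r hr => ?_
    rw [← mul_zero (x r), ← h r hr, Finset.mul_sum]
    exact Finset.sum_congr rfl fun t _ => mul_assoc _ _ _
  let D := dirDer Q.K.c Q.R ε
  have hD0 : ∀ t ∈ {t | t ∈ Q.J ∨ t ∉ Tor}, D (coordGerm Q.K.c t) = 0 := by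
    intro t ht
    simp only [D]
    rw [dirDer_apply]
    refine Finset.sum_eq_zero fun r hr => ?_
    rw [coordDer_coordGerm, if_neg, mul_zero]
    rintro rfl
    rcases ht with ht | ht
    · exact Q.K.notMem_J_of_mem_R hr ht
    · exact ht (Q.K.mem_Tor_of_mem_R hr)
  let N' := (Finset.range (ν + 1)).filter fun k => k ∈ N ∧ Q.expJ (a k) = Q.expJ μ
  have hN' : ∀ k ∈ N', k ≤ ν ∧ k ∈ N ∧ Q.expJ (a k) = Q.expJ μ := fun k hk =>
    ⟨Nat.lt_succ_iff.1 (Finset.mem_range.1 (Finset.mem_filter.1 hk).1), (Finset.mem_filter.1 hk).2⟩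
  have heig : ∀ k ∈ N', IsEigen D ((k : 𝕜) - (y : 𝕜)) (Q.unitPart (δ + a k)) := by
    intro k hk
    obtain ⟨hkν, -, hka⟩ := hN' k hk
    have h1 : ∑ r ∈ Q.R, ε r * ∑ t ∈ Tor, Q.Y r t * Q.exp (δ + a k) t = (k : ℚ) - y := by
      have h2 : ∑ t ∈ Tor, ε t * Q.exp (δ + a k) t = k := by
        rw [Q.sum_mul_exp (Q.echelon.supp ε hεA), hε, Finset.sum_eq_single v, Pi.single_eq_same,
          one_mul, Pi.add_apply, hδv, hav k hkν, zero_add]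
        · intro t _ ht
          rw [Pi.single_eq_of_ne ht, zero_mul]
        · exact fun h => absurd (Finset.mem_univ _) h
      have h3 : ∑ t ∈ Tor, ω₀ t * Q.exp (δ + a k) t = y := by
        rw [Q.sum_mul_exp_eq_expJ hω₀, expJ_add, hka, ← expJ_add]
      rw [← h2, ← h3, ← Finset.sum_sub_distrib]
      simp only [Finset.mul_sum]
      rw [Finset.sum_comm]
      refine Finset.sum_congr rfl fun t _ => ?_
      rw [← sub_mul, hx t]
      simp only [ω₀, add_sub_cancel_right, Finset.sum_mul]
      exact Finset.sum_congr rfl fun r _ => (mul_assoc _ _ _).symm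
    have h4 : ((k : 𝕜) - (y : 𝕜)) =
        ∑ r ∈ Q.R, (ε r : 𝕜) * ((∑ t ∈ Tor, Q.Y r t * Q.exp (δ + a k) t : ℚ) : 𝕜) := by
      have h5 := congrArg (fun z : ℚ => (z : 𝕜)) h1
      beta_reduce at h5
      rw [Rat.cast_sub, Rat.cast_natCast] at h5
      rw [← h5, Rat.cast_sum]
      exact Finset.sum_congr rfl fun r _ => Rat.cast_mul _ _
    rw [h4, IsEigen, map_sum, Finset.sum_mul]
    simp only [D]
    rw [dirDer_apply]
    refine Finset.sum_congr rfl fun r hr => ?_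
    have h6 : coordDer Q.K.c r _ = _ := Q.isEigen_unitPart (δ + a k) hr
    rw [h6, map_mul, mul_assoc]
  have hF : Q.quotient ν a C δ μ - ∑ k ∈ N', algebraMap 𝕜 _ (germEval _ (C k)) *
      Q.unitPart (δ + a k) ∈ Ideal.span (coordGerm Q.K.c '' {t | t ∈ Q.J ∨ t ∉ Tor}) := by
    rw [quotient, Finset.sum_filter, ← Finset.sum_sub_distrib]
    refine Ideal.sum_mem _ fun k hk => ?_
    have hkν : k ≤ ν := Nat.lt_succ_iff.1 (Finset.mem_range.1 hk)
    split_ifs with h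
    · rw [h.2, tsub_self, mono_zero, one_mul, mul_comm, ← sub_mul]
      exact Ideal.mul_mem_right _ _ (Q.pull_sub_mem c hc (C k))
    · rw [sub_zero]
      refine Q.term_mem hμ (fun t ht => Or.inl ht) hkν ?_
      by_cases hkN : k ∈ N
      · exact Or.inr fun h' => h ⟨hkN, h'⟩
      · exact hNC k hkν hkN
  let u : ℕ → 𝕜 := fun k => if Q.expJ (a k) = Q.expJ μ then
    germEval _ (C k) * germEval q (Q.unitPart (δ + a k)) else 0
  have hu : u k₀ ≠ 0 := by
    simp only [u]
    rw [if_pos hak₀]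
    exact mul_ne_zero ((isUnit_germ_iff _).1 hCk₀) ((isUnit_germ_iff _).1 (Q.isUnit_unitPart _))
  obtain ⟨l, hl, hlA, hne⟩ := exists_power_sum_ne_zero N u (y : 𝕜) ν hk₀ hu hcard
    (Q.IsTransverse (Q.expJ (δ + μ))) (by
      by_cases h : Q.IsTransverse (Q.expJ (δ + μ))
      · exact Or.inl h
      · exact Or.inr ⟨by rw [hy h, Rat.cast_zero], hA.resolve_left h⟩)
  have h7 := germEval_iterate_of_sub_mem Q.K.c hD0 N' (fun k => Q.unitPart (δ + a k))
    (fun k => (k : 𝕜) - (y : 𝕜)) heig (fun k => germEval _ (C k)) _ hF l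
  have h8 : ∑ k ∈ N', ((k : 𝕜) - (y : 𝕜)) ^ l * (germEval _ (C k) *
      germEval q (Q.unitPart (δ + a k))) = ∑ k ∈ N, ((k : 𝕜) - (y : 𝕜)) ^ l * u k := by
    refine (Finset.sum_congr rfl fun k hk => ?_).trans
      (Finset.sum_subset (fun k hk => (hN' k hk).2.1) fun k hkN hk => ?_)
    · simp only [u]
      rw [if_pos (hN' k hk).2.2]
    · simp only [u]
      rw [if_neg, mul_zero]
      exact fun h => hk (Finset.mem_filter.2 ⟨hN hkN, hkN, h⟩)
  rw [h8] at h7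
  by_contra! hcon
  refine hne (h7.symm.trans (germEval_dirDer_iterate Q.K.c Q.R ε l _ fun b hb hbl => ?_))
  by_contra hbne
  refine hbne (hcon b (fun t ht => hb t fun h => ht (Q.K.mem_reg.2 (Or.inr h))) (hbl ▸ hl) ?_)
  refine hlA.imp_left ?_
  rintro hl0 rfl
  exact hl0 (hbl.symm.trans (map_zero _))

theorem exists_coeff_of_tail (Q : StagePoint S q) (c : CenteredChart (S.π q)) (hc : c.e = e₀)
    {ν : ℕ} (hν : 1 < ν) {a : ℕ → Fin m → ℕ} {C : ℕ → AnGerm (S.π q)} {δ μ : Fin m → ℕ}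
    (hμ : ∀ k ≤ ν, C k ≠ 0 → ∀ t ∈ Q.J, Q.exp μ t ≤ Q.exp (a k) t) (ha0 : a 0 = μ)
    (hC : ∀ k ≤ ν, k ≠ 0 → C k = 0 ∨ Q.expJ (a k) ≠ Q.expJ μ)
    (hC0 : (∃ w ∉ Tor, C 0 = coordGerm c w) ∨ (C 0 = 1 ∧ (Q.IsTransverse (Q.expJ (δ + μ)) ∨
      ∃ r ∈ Q.R, ∑ t ∈ Tor, Q.Y r t * Q.exp (δ + μ) t ≠ 0))) :
    ∃ b : Fin m →₀ ℕ, (∀ t ∉ Q.K.reg, b t = 0) ∧ b.degree < ν ∧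
      (b ≠ 0 ∨ Q.IsTransverse (Q.expJ (δ + μ))) ∧
      (taylor Q.K.c (Q.quotient ν a C δ μ)).coeff b ≠ 0 := by
  classical
  have h1 : Q.quotient ν a C δ μ - Q.unitPart (δ + μ) * pull S.π q (C 0) ∈
      Ideal.span (coordGerm Q.K.c '' {t | t ∈ Q.J}) := by
    rw [quotient, Finset.sum_range_succ', ha0, tsub_self, mono_zero, one_mul, add_sub_cancel_right]
    refine Ideal.sum_mem _ fun k hk => ?_
    have hk' : k + 1 ≤ ν := Finset.mem_range.1 hk
    exact Q.term_mem hμ (fun t ht => ht) hk' (hC _ hk' (Nat.succ_ne_zero k))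
  have h2 : ∀ b : Fin m →₀ ℕ, (∀ t ∉ Q.K.reg, b t = 0) →
      (taylor Q.K.c (Q.quotient ν a C δ μ)).coeff b =
        (taylor Q.K.c (Q.unitPart (δ + μ) * pull S.π q (C 0))).coeff b := by
    intro b hb
    have h3 := coeff_eq_zero_of_mem_span Q.K.c h1 fun t ht => hb t (Q.K.notMem_reg_of_mem_J ht)
    rwa [map_sub, map_sub, sub_eq_zero] at h3
  have hU : (taylor Q.K.c (Q.unitPart (δ + μ))).coeff 0 ≠ 0 := by
    rw [MvPowerSeries.coeff_zero_eq_constantCoeff_apply, constantCoeff_taylor]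
    exact (isUnit_germ_iff _).1 (Q.isUnit_unitPart _)
  have hs : ∀ w ∈ Q.K.reg, ∀ t ∉ Q.K.reg, (Finsupp.single w 1 : Fin m →₀ ℕ) t = 0 := by
    intro w hw t ht
    rw [Finsupp.single_eq_of_ne]
    rintro rfl
    exact ht hw
  have hs' : ∀ w : Fin m, (Finsupp.single w 1 : Fin m →₀ ℕ).degree < ν := fun w => by
    rw [Finsupp.degree_single]
    exact hν
  have hs0 : ∀ w : Fin m, (Finsupp.single w 1 : Fin m →₀ ℕ) ≠ 0 := fun w => by simp
  rcases hC0 with ⟨w, hw, hCw⟩ | ⟨hC1, hT | ⟨r, hr, hne⟩⟩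
  · have hwr : w ∈ Q.K.reg := Q.K.mem_reg.2 (Or.inl hw)
    refine ⟨Finsupp.single w 1, hs w hwr, hs' w, Or.inl (hs0 w), ?_⟩
    have h4 := MvPowerSeries.coeff_add_monomial_mul (R := 𝕜) (Finsupp.single w 1) 0
      (taylor Q.K.c (Q.unitPart (δ + μ))) 1
    rw [add_zero, one_mul] at h4
    rw [h2 _ (hs w hwr), hCw, Q.pull_coordGerm_off c hc hw, mul_comm, map_mul, taylor_coordGerm,
      MvPowerSeries.X, h4]
    exact hU
  · refine ⟨0, fun _ _ => rfl, by rw [map_zero]; omega, Or.inr hT, ?_⟩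
    rw [h2 _ fun _ _ => rfl, hC1, map_one, mul_one]
    exact hU
  · have hrr : r ∈ Q.K.reg := Q.K.mem_reg.2 (Or.inr hr)
    refine ⟨Finsupp.single r 1, hs r hrr, hs' r, Or.inl (hs0 r), ?_⟩
    rw [h2 _ (hs r hrr), hC1, map_one, mul_one]
    have h5 : coordDer Q.K.c r _ = _ := Q.isEigen_unitPart (δ + μ) hr
    have h6 := taylor_coordDer Q.K.c r (Q.unitPart (δ + μ))
    have h7 := congrArg (MvPowerSeries.coeff (0 : Fin m →₀ ℕ)) h6
    rw [MvPowerSeries.coeff_pderiv, zero_add, h5, ← Algebra.smul_def, map_smul, map_smul] at h7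
    intro h8
    rw [h8, zero_mul, smul_eq_mul] at h7
    exact mul_ne_zero (Rat.cast_ne_zero.2 hne) hU h7

end StagePoint

end Drop

section Conclusion

variable {𝕜 : Type} [RCLike 𝕜] {m : ℕ}

/-- The weights of the diagonal vector fields, in terms of a basis in monomial coordinates. -/
def weightSpace (reg : Finset (Fin m)) (v : Fin m) {s : ℕ} (α : Fin s → Fin m → ℚ) :
    Submodule ℚ (Fin m → ℚ) :=
  Submodule.span ℚ (insert (Pi.single v 1)
    (Set.range fun i j => if j ∈ reg then 0 else α i j))

theorem weightSpace_supp {reg : Finset (Fin m)} {v : Fin m} {s : ℕ}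
    {α : Fin s → Fin m → ℚ} {w : Fin m → ℚ} (hw : w ∈ weightSpace reg v α) {i : Fin m}
    (hi : i ∉ insert v regᶜ) : w i = 0 := by
  rw [Finset.mem_insert, not_or, Finset.mem_compl, not_not] at hi
  induction hw using Submodule.span_induction with
  | mem w hw =>
    rcases hw with rfl | ⟨k, rfl⟩
    · exact Pi.single_eq_of_ne hi.1 _
    · exact if_pos hi.2
  | zero => rfl
  | add w w' _ _ h h' => rw [Pi.add_apply, h, h', add_zero]
  | smul x w _ h => rw [Pi.smul_apply, h, smul_zero]

theorem diagField_add {M : AnMfd.{u} 𝕜 m} {p : M} (c : CenteredChart p) (T : Finset (Fin m))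
    (w w' : Fin m → ℚ) : diagField c T (w + w') = diagField c T w + diagField c T w' := by
  rw [diagField, diagField, diagField, ← Finset.sum_add_distrib]
  refine Finset.sum_congr rfl fun j _ => ?_
  rw [Pi.add_apply, Rat.cast_add, add_smul]

theorem diagField_smul {M : AnMfd.{u} 𝕜 m} {p : M} (c : CenteredChart p) (T : Finset (Fin m))
    (x : ℚ) (w : Fin m → ℚ) : diagField c T (x • w) = (x : 𝕜) • diagField c T w := by
  rw [diagField, diagField, Finset.smul_sum]
  refine Finset.sum_congr rfl fun j _ => ?_
  rw [Pi.smul_apply, smul_eq_mul, Rat.cast_mul, mul_smul]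

theorem diagField_mem_of_weightSpace {M : AnMfd.{u} 𝕜 m} {p : M} (c : CenteredChart p)
    (Θ : Submodule (AnGerm p) (VField p)) {reg : Finset (Fin m)} {v : Fin m} {s : ℕ}
    {α : Fin s → Fin m → ℚ} (hα : ∀ i, diagField c regᶜ (α i) ∈ Θ) (hv : coordDer c v ∈ Θ)
    {w : Fin m → ℚ} (hw : w ∈ weightSpace reg v α) : diagField c (insert v regᶜ) w ∈ Θ := by
  classical
  induction hw using Submodule.span_induction with
  | mem w hw =>
    rcases hw with rfl | ⟨k, rfl⟩
    · have h1 : diagField c (insert v regᶜ) (Pi.single v 1) = coordGerm c v • coordDer c v := by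
        rw [diagField, Finset.sum_eq_single v, Pi.single_eq_same, Rat.cast_one, one_smul]
        · intro j _ hj
          rw [Pi.single_eq_of_ne hj, Rat.cast_zero, zero_smul]
        · exact fun h => absurd (Finset.mem_insert_self _ _) h
      rw [h1]
      exact Θ.smul_mem _ hv
    · have h1 : diagField c (insert v regᶜ) (fun j => if j ∈ reg then 0 else α k j) =
          diagField c regᶜ (α k) := by
        rw [diagField, diagField]
        symm
        refine (Finset.sum_congr rfl fun j hj => ?_).trans
          (Finset.sum_subset (Finset.subset_insert v regᶜ) fun j _ hj => ?_)
        · rw [if_neg (Finset.mem_compl.1 hj)]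
        · rw [Finset.mem_compl, not_not] at hj
          rw [if_pos hj, Rat.cast_zero, zero_smul]
      rw [h1]
      exact hα k
  | zero =>
    have : diagField c (insert v regᶜ) (0 : Fin m → ℚ) = 0 :=
      Finset.sum_eq_zero fun j _ => by rw [Pi.zero_apply, Rat.cast_zero, zero_smul]
    rw [this]
    exact zero_mem _
  | add w w' _ _ h h' =>
    rw [diagField_add]
    exact add_mem h h'
  | smul x w _ h =>
    rw [diagField_smul, algebra_compatible_smul (AnGerm p)]
    exact Θ.smul_mem _ h

variable {X : FolSub.{u} 𝕜 m} {e₀ : OpenPartialHomeomorph X.M (Fin m → 𝕜)}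
    {Tor : Finset (Fin m)} {W : Submodule ℚ (Fin m → ℚ)} {v : Fin m}

/-- The difference of two exponents. -/
def expSub (a b : Fin m → ℕ) (i : Fin m) : ℤ := a i - b i

theorem Stage.exists_minimal (S : Stage X e₀ Tor W v) {q : S.Y.M} {lab : Fin m → S.ι}
    {J : Finset (Fin m)} (hJ : ∀ t ∈ J, q ∈ S.H (lab t)) {A : Set (Fin m → ℕ)} (hne : A.Nonempty)
    (good : ∀ a ∈ A, ∀ b ∈ A, S.Good (expSub a b)) :
    ∃ μ ∈ A, ∀ a ∈ A, ∀ t ∈ J, ∑ i, S.ρ (lab t) i * μ i ≤ ∑ i, S.ρ (lab t) i * a i := by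
  let n : (Fin m → ℕ) → Fin m → ℕ := fun a t => ∑ i, S.ρ (lab t) i * a i
  let N : (Fin m → ℕ) → ℕ := fun a => ∑ t ∈ J, n a t
  have hdot : ∀ a b t, rayDot (S.ρ (lab t)) (expSub a b) = (n a t : ℤ) - n b t := by
    intro a b t
    simp only [rayDot, expSub, n, mul_sub, Finset.sum_sub_distrib]
    push_cast
    rfl
  have hμA := Function.argminOn_mem N A hne
  have hmin : ∀ a ∈ A, N (Function.argminOn N A hne) ≤ N a := fun a ha =>
    Function.argminOn_le N A ha
  set μ := Function.argminOn N A hne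
  refine ⟨μ, hμA, fun a ha t ht => ?_⟩
  change n μ t ≤ n a t
  by_contra! hlt
  have h1 : ∀ t' ∈ J, n a t' ≤ n μ t' := fun t' ht' => by
    have h2 := good μ hμA a ha (lab t) (lab t') ⟨q, hJ t ht, hJ t' ht'⟩ (by
      rw [hdot]
      omega)
    rw [hdot] at h2
    omega
  have h3 := Finset.sum_lt_sum h1 ⟨t, ht, hlt⟩
  exact absurd (hmin a ha) (not_le.2 h3)

namespace FolSub.PreparedForm

variable {p : X.M} {ν : ℕ}

theorem exponents_supp (P : PreparedForm X p ν) {a : Fin m → ℕ} (ha : a ∈ P.exponents) :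
    ∀ i ∉ insert P.v P.regᶜ, a i = 0 := by
  intro i hi
  rw [Finset.mem_insert, not_or, Finset.mem_compl, not_not] at hi
  rcases ha with (rfl | ⟨j, k, -, -, -, rfl⟩) | ⟨h, -⟩
  · exact Pi.single_eq_of_ne hi.1 _
  · rw [Pi.add_apply, Pi.single_eq_of_ne hi.1, P.r_supp j k i hi.2]
  · exact h i hi.2

/-- The exponents of the terms of the normal form. -/
def termExp (P : PreparedForm X p ν) (β : Fin m → ℕ) (i : Fin P.n) (k : ℕ) : Fin m → ℕ :=
  if k = 0 then β else if k = ν then Pi.single P.v ν else Pi.single P.v k + P.r i k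

/-- The coefficients of the terms of the normal form. -/
noncomputable def termCoeff (P : PreparedForm X p ν) (h : Fin P.n → AnGerm p) (i : Fin P.n)
    (k : ℕ) : AnGerm p :=
  if k = 0 then h i else if k = ν then P.V i else P.b i k

theorem sum_terms (P : PreparedForm X p ν) (hν : 1 < ν) {β : Fin m → ℕ} {h : Fin P.n → AnGerm p}
    (hh : ∀ i, P.b i 0 = mono P.c β * h i) (i : Fin P.n) :
    P.T i = ∑ k ∈ Finset.range (ν + 1), mono P.c (P.termExp β i k) * P.termCoeff h i k := by
  have h0 := Finset.sum_eq_sum_Ico_succ_bot (show 0 < ν by omega)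
    fun k => mono P.c (P.termExp β i k) * P.termCoeff h i k
  rw [P.form i, Finset.sum_range_succ, Finset.range_eq_Ico, h0, hh i]
  have h1 : ν ≠ 0 := by omega
  have h2 : ∑ k ∈ Finset.Ico (0 + 1) ν, mono P.c (P.termExp β i k) * P.termCoeff h i k =
      ∑ k ∈ Finset.Ico 1 ν, coordGerm P.c P.v ^ k * mono P.c (P.r i k) * P.b i k := by
    refine Finset.sum_congr rfl fun k hk => ?_
    have hk' := Finset.mem_Ico.1 hk
    rw [termExp, termCoeff, if_neg (by omega), if_neg (by omega), if_neg (by omega),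
      if_neg (by omega), mono_add, mono_single]
  rw [h2, termExp, termExp, termCoeff, termCoeff, if_pos rfl, if_pos rfl, if_neg h1, if_pos rfl,
    if_neg h1, if_pos rfl, mono_single]
  ring

theorem termExp_apply_v (P : PreparedForm X p ν) {β : Fin m → ℕ} (hβ : ∀ j ∈ P.reg, β j = 0)
    (i : Fin P.n) (k : ℕ) : P.termExp β i k P.v = k := by
  rw [termExp]
  split_ifs with h1 h2
  · rw [hβ _ P.v_mem, h1]
  · rw [Pi.single_eq_same, h2]
  · rw [Pi.add_apply, Pi.single_eq_same, P.r_supp _ _ _ P.v_mem, add_zero]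

theorem termExp_supp (P : PreparedForm X p ν) {β : Fin m → ℕ} (hβ : ∀ j ∈ P.reg, β j = 0)
    (i : Fin P.n) (k : ℕ) : ∀ j ∉ insert P.v P.regᶜ, P.termExp β i k j = 0 := by
  intro j hj
  rw [Finset.mem_insert, not_or, Finset.mem_compl, not_not] at hj
  rw [termExp]
  split_ifs with h1 h2
  · exact hβ j hj.2
  · exact Pi.single_eq_of_ne hj.1 _
  · rw [Pi.add_apply, Pi.single_eq_of_ne hj.1, P.r_supp i k j hj.2]

theorem termExp_mem (P : PreparedForm X p ν) {β : Fin m → ℕ} {h : Fin P.n → AnGerm p}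
    (hβ : (∀ i, h i = 0) ∨ β ∈ P.exponents) (i : Fin P.n) {k : ℕ} (hk : k ≤ ν)
    (hC : P.termCoeff h i k ≠ 0) : P.termExp β i k ∈ P.exponents := by
  rw [termCoeff] at hC
  rw [termExp]
  split_ifs at hC ⊢ with h1 h2
  · exact hβ.resolve_left fun h => hC (h i)
  · exact Or.inl (Or.inl rfl)
  · exact Or.inl (Or.inr ⟨i, k, by omega, by omega, hC, rfl⟩)

theorem exists_tail (P : PreparedForm X p ν) (μ : Fin m → ℕ) :
    ∃ (β : Fin m → ℕ) (h : Fin P.n → AnGerm p), (∀ j ∈ P.reg, β j = 0) ∧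
      (∀ i, P.b i 0 = mono P.c β * h i) ∧ ((∀ i, h i = 0) ∨ β ∈ P.exponents) ∧
      (((∀ j ∈ P.reg, μ j = 0) ∧ (∃ i₀, P.b i₀ 0 = mono P.c μ ∨
        ∃ w ∈ P.reg, w ≠ P.v ∧ P.b i₀ 0 = mono P.c μ * coordGerm P.c w) ∧
        ∀ i, mono P.c μ ∣ P.b i 0) → β = μ) := by
  by_cases hμ : (∀ j ∈ P.reg, μ j = 0) ∧ (∃ i₀, P.b i₀ 0 = mono P.c μ ∨
      ∃ w ∈ P.reg, w ≠ P.v ∧ P.b i₀ 0 = mono P.c μ * coordGerm P.c w) ∧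
      ∀ i, mono P.c μ ∣ P.b i 0
  · choose h hh using hμ.2.2
    exact ⟨μ, h, hμ.1, hh, Or.inr (Or.inr hμ), fun _ => rfl⟩
  · rcases P.tail with h | ⟨β, h1, h2, h3⟩
    · exact ⟨0, 0, fun _ _ => rfl, fun i => by rw [h i, Pi.zero_apply, mul_zero],
        Or.inl fun _ => rfl, fun h => absurd h hμ⟩
    · choose h hh using id h3
      exact ⟨β, h, h1, hh, Or.inr (Or.inr ⟨h1, h2, h3⟩), fun h => absurd h hμ⟩

/-- The tangency order drops where the pulled back exponents have a minimum. -/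
theorem exists_coeff {S : Stage X e₀ Tor W v} {q : S.Y.M} (Q : StagePoint S q)
    (P : PreparedForm X (S.π q) ν) (hν : 1 < ν) (he : P.c.e = e₀) (hTor : Tor = insert P.v P.regᶜ)
    (hv : v = P.v) {s : ℕ} {α : Fin s → Fin m → ℚ} (hW : W = weightSpace P.reg P.v α)
    (hθ : X.θ (S.π q) = Submodule.span (AnGerm (S.π q))
      ((fun j => coordDer P.c j) '' (P.reg : Set (Fin m)) ∪
        Set.range fun i => diagField P.c P.regᶜ (α i)))
    {μ : Fin m → ℕ} (hμ : μ ∈ P.exponents)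
    (hmin : ∀ a ∈ P.exponents, ∀ t ∈ Q.J, Q.exp μ t ≤ Q.exp a t)
    {β : Fin m → ℕ} {h : Fin P.n → AnGerm (S.π q)} (hβreg : ∀ j ∈ P.reg, β j = 0)
    (hh : ∀ i, P.b i 0 = mono P.c β * h i) (hβ : (∀ i, h i = 0) ∨ β ∈ P.exponents)
    (hβμ : ((∀ j ∈ P.reg, μ j = 0) ∧ (∃ i₀, P.b i₀ 0 = mono P.c μ ∨
        ∃ w ∈ P.reg, w ≠ P.v ∧ P.b i₀ 0 = mono P.c μ * coordGerm P.c w) ∧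
        ∀ i, mono P.c μ ∣ P.b i 0) → β = μ) :
    ∃ (i : Fin P.n) (b : Fin m →₀ ℕ), (∀ t ∉ Q.K.reg, b t = 0) ∧ b.degree < ν ∧
      (b ≠ 0 ∨ Q.IsTransverse (Q.expJ (P.δ + μ))) ∧
      (taylor Q.K.c (Q.quotient ν (P.termExp β i) (P.termCoeff h i) P.δ μ)).coeff b ≠ 0 := by
  classical
  have hμ' : ∀ i, ∀ k ≤ ν, P.termCoeff h i k ≠ 0 →
      ∀ t ∈ Q.J, Q.exp μ t ≤ Q.exp (P.termExp β i k) t := fun i k hk hC =>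
    hmin _ (P.termExp_mem hβ i hk hC)
  have hWmem : ∀ w ∈ insert (Pi.single P.v 1)
      (Set.range fun i j => if j ∈ P.reg then 0 else α i j), w ∈ W := fun w hw =>
    hW.ge (Submodule.subset_span hw)
  have hvW : Pi.single v 1 ∈ W := (congrArg (fun x => Pi.single x (1 : ℚ) ∈ W) hv).mpr
    (hWmem _ (Set.mem_insert _ _))
  have hδv : P.δ v = 0 := (congrArg P.δ hv).trans (P.decomp.supp _ P.v_mem)
  have hav : ∀ i k, P.termExp β i k v = k := fun i k =>
    (congrArg (P.termExp β i k) hv).trans (P.termExp_apply_v hβreg i k)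
  have hν0 : ν ≠ 0 := by omega
  by_cases ha : Q.expJ (Pi.single P.v ν) = Q.expJ μ
  · refine ⟨P.i₁, Q.exists_coeff_of_power P.c he hvW (hμ' P.i₁)
      (fun k _ => hav P.i₁ k) hδv
      (N := (Finset.range (ν + 1)).erase (ν - 1)) (Finset.erase_subset _ _) (fun k hk hkN => ?_)
      (k₀ := ν) ?_ ?_ ?_ ?_ (Or.inr ⟨?_, hν0⟩)⟩
    · left
      have hk1 : k = ν - 1 := by
        by_contra h1
        exact hkN (Finset.mem_erase.2 ⟨h1, Finset.mem_range.2 (by omega)⟩)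
      rw [termCoeff, if_neg (by omega), if_neg (by omega)]
      exact P.no_term k (by omega) (by omega)
    · exact Finset.mem_erase.2 ⟨by omega, Finset.mem_range.2 (by omega)⟩
    · rw [termCoeff, if_neg hν0, if_pos rfl]
      exact P.isUnit
    · rw [termExp, if_neg hν0, if_pos rfl]
      exact ha
    · rw [Finset.card_erase_of_mem (Finset.mem_range.2 (by omega)), Finset.card_range]
      omega
    · exact Finset.mem_erase.2 ⟨by omega, Finset.mem_range.2 (by omega)⟩
  by_cases hb : ∃ i k, 1 ≤ k ∧ k < ν ∧ P.b i k ≠ 0 ∧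
      Q.expJ (Pi.single P.v k + P.r i k) = Q.expJ μ
  · obtain ⟨i, k, hk1, hkν, hbk, hk⟩ := hb
    refine ⟨i, Q.exists_coeff_of_power P.c he hvW (hμ' i)
      (fun k _ => hav i k) hδv (N := Finset.range ν)
      (Finset.range_subset_range.2 (Nat.le_succ ν)) (fun k hk hkN => ?_) (k₀ := k)
      (Finset.mem_range.2 hkν) ?_ ?_ (Finset.card_range ν).le
      (Or.inr ⟨Finset.mem_range.2 (by omega), by omega⟩)⟩
    · have hkν : k = ν := by
        by_contra h1
        exact hkN (Finset.mem_range.2 (by omega))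
      right
      rw [termExp, hkν, if_neg hν0, if_pos rfl]
      exact ha
    · rw [termCoeff, if_neg (by omega), if_neg (by omega)]
      exact ((P.coeff i k hk1 hkν).resolve_left hbk).1
    · rw [termExp, if_neg (by omega), if_neg (by omega)]
      exact hk
  have hμT : (∀ j ∈ P.reg, μ j = 0) ∧ (∃ i₀, P.b i₀ 0 = mono P.c μ ∨
        ∃ w ∈ P.reg, w ≠ P.v ∧ P.b i₀ 0 = mono P.c μ * coordGerm P.c w) ∧
        ∀ i, mono P.c μ ∣ P.b i 0 := by
    rcases hμ with (rfl | ⟨i, k, h1, h2, h3, rfl⟩) | h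
    · exact absurd rfl ha
    · exact absurd ⟨i, k, h1, h2, h3, rfl⟩ hb
    · exact h
  have hβμ' := hβμ hμT
  subst hβμ'
  obtain ⟨hβr, ⟨i₀, hi₀⟩, -⟩ := hμT
  have hC : ∀ k ≤ ν, k ≠ 0 → P.termCoeff h i₀ k = 0 ∨ Q.expJ (P.termExp β i₀ k) ≠ Q.expJ β := by
    intro k hk hk0
    rw [termCoeff, termExp, if_neg hk0, if_neg hk0]
    split_ifs with hkν
    · exact Or.inr ha
    · by_cases h0 : P.b i₀ k = 0
      · exact Or.inl h0
      · exact Or.inr fun h1 => hb ⟨i₀, k, by omega, by omega, h0, h1⟩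
  have hβ0 : P.termExp β i₀ 0 = β := if_pos rfl
  have hC0 : P.termCoeff h i₀ 0 = h i₀ := if_pos rfl
  rw [hh i₀] at hi₀
  refine ⟨i₀, Q.exists_coeff_of_tail P.c he hν (hμ' i₀) hβ0 hC ?_⟩
  rw [hC0]
  rcases hi₀ with h1 | ⟨w, hw, hwv, h1⟩
  · right
    have h2 : h i₀ = 1 := mul_left_cancel₀ (mono_ne_zero P.c β) (h1.trans (mul_one _).symm)
    refine ⟨h2, ?_⟩
    by_contra! hcon
    obtain ⟨hnt, hnr⟩ := hcon
    simp only [StagePoint.IsTransverse, not_exists, not_and, not_not] at hnt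
    have hA : ∀ w ∈ W.comap (rayMap Tor fun t => S.ρ (Q.lab t)),
        ∑ t ∈ Tor, w t * Q.exp (P.δ + β) t = 0 := by
      intro w hw
      obtain ⟨x, hx⟩ := Q.echelon.expand hw
      have h3 : ∑ t ∈ Tor, w t * Q.exp (P.δ + β) t =
          ∑ r ∈ Q.R, w r * ∑ t ∈ Tor, Q.Y r t * Q.exp (P.δ + β) t +
          ∑ r ∈ Q.R₀, x r * ∑ t ∈ Tor, Q.Y₀ r t * Q.exp (P.δ + β) t := by
        simp only [Finset.mul_sum]
        rw [Finset.sum_comm, Finset.sum_comm (s := Q.R₀), ← Finset.sum_add_distrib]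
        refine Finset.sum_congr rfl fun t _ => ?_
        rw [hx t, add_mul, Finset.sum_mul, Finset.sum_mul]
        simp only [mul_assoc]
      rw [h3, Finset.sum_eq_zero fun r hr => by rw [hnr r hr, mul_zero], zero_add]
      refine Finset.sum_eq_zero fun r hr => ?_
      rw [Q.sum_mul_exp_eq_expJ (Q.echelon.supp₀ r hr), hnt r hr, mul_zero]
    have hWz : ∀ κ ∈ W, ∑ i, κ i * (P.δ + β) i = 0 := by
      intro κ hκ
      obtain ⟨w, hw⟩ := LinearMap.injective_iff_surjective.1 Q.rayMap_injective κ
      have hwA : w ∈ W.comap (rayMap Tor fun t => S.ρ (Q.lab t)) := by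
        rw [Submodule.mem_comap, hw]
        exact hκ
      have h3 := hA w hwA
      rw [Q.sum_mul_exp (Q.echelon.supp w hwA), hw] at h3
      exact h3
    have hFI : X.IsFirstIntegral (mono P.c (P.δ + β)) := by
      rw [X.isFirstIntegral_mono_iff P.c P.reg α hθ]
      refine ⟨fun j hj => ?_, fun i => ?_⟩
      · rw [toFs_apply, Pi.add_apply, P.decomp.supp j hj, hβr j hj]
      · have h3 := hWz (fun j => if j ∈ P.reg then 0 else α i j) (hWmem _ (Or.inr ⟨i, rfl⟩))
        rw [← h3]
        refine (Finset.sum_congr rfl fun j hj => ?_).trans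
          (Finset.sum_subset (Finset.subset_univ P.regᶜ) fun j _ hj => ?_)
        · rw [if_neg (Finset.mem_compl.1 hj), toFs_apply]
        · rw [Finset.mem_compl, not_not] at hj
          rw [if_pos hj, zero_mul]
    refine P.decomp.not_integral i₀ (P.δ + β) ?_ hFI
    have h4 : toFs (P.δ + β) = toFs P.δ + toFs β := Finsupp.ext fun _ => rfl
    rw [occurs_iff, h4, coeff_taylor_mono_mul, P.sum_terms hν hh i₀, Finset.sum_range_succ', hβ0,
      hC0, h2, map_add, map_add, map_sum, map_sum, Finset.sum_eq_zero, zero_add]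
    · have h5 := coeff_taylor_mono_mul P.c β 1 0
      rw [add_zero] at h5
      rw [h5, map_one, MvPowerSeries.coeff_zero_one]
      exact one_ne_zero
    · intro k _
      by_contra h6
      have h7 := le_of_coeff_taylor_mono_mul _ _ _ h6 P.v
      rw [toFs_apply, toFs_apply, P.termExp_apply_v hβreg, hβr _ P.v_mem] at h7
      omega
  · left
    refine ⟨w, ?_, mul_left_cancel₀ (mono_ne_zero P.c β) h1⟩
    rw [hTor, Finset.mem_insert, not_or, Finset.mem_compl, not_not]
    exact ⟨hwv, hw⟩

end FolSub.PreparedForm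

end Conclusion

section Conclusion

variable {𝕜 : Type} [RCLike 𝕜] {m : ℕ}

variable {X : FolSub.{u} 𝕜 m} {e₀ : OpenPartialHomeomorph X.M (Fin m → 𝕜)}
    {Tor : Finset (Fin m)} {W : Submodule ℚ (Fin m → ℚ)} {v : Fin m} {p : X.M} {ν : ℕ}

/-- The tangency order drops at the points where the exponents are totally ordered. -/
theorem Stage.nu_lt (S : Stage X e₀ Tor W v) {q : S.Y.M} (hp : S.π q = p) (hν : 1 < ν)
    (P : FolSub.PreparedForm X p ν) (he : P.c.e = e₀) (hTor : Tor = insert P.v P.regᶜ)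
    (hv : v = P.v) {s : ℕ} {α : Fin s → Fin m → ℚ} (hW : W = weightSpace P.reg P.v α)
    (hθ : X.θ p = Submodule.span (AnGerm p)
      ((fun j => coordDer P.c j) '' (P.reg : Set (Fin m)) ∪
        Set.range fun i => diagField P.c P.regᶜ (α i)))
    (hcard : Torᶜ.card + Module.finrank ℚ W = X.leafDim)
    (good : ∀ a ∈ P.exponents, ∀ b ∈ P.exponents, S.Good (expSub a b)) :
    S.Y.nu q < (ν : ℕ∞) := by
  subst hp
  have hoffT : ∀ T, T = insert P.v P.regᶜ → ∀ i, i ∉ T → i ∉ insert P.v P.regᶜ := by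
    rintro _ rfl i hi
    exact hi
  have hdiag : ∀ T, T = insert P.v P.regᶜ → ∀ κ ∈ weightSpace P.reg P.v α,
      diagField P.c T κ ∈ X.θ (S.π q) := by
    rintro _ rfl κ hκ
    refine diagField_mem_of_weightSpace P.c _ (fun i => ?_) ?_ hκ
    · exact hθ.ge (Submodule.subset_span (Or.inr ⟨i, rfl⟩))
    · exact hθ.ge (Submodule.subset_span (Or.inl ⟨_, P.v_mem, rfl⟩))
  have hder : ∀ i ∉ Tor, coordDer P.c i ∈ X.θ (S.π q) := fun i hi => by
    have h1 := hoffT Tor hTor i hi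
    rw [Finset.mem_insert, not_or, Finset.mem_compl, not_not] at h1
    exact hθ.ge (Submodule.subset_span (Or.inl ⟨_, h1.2, rfl⟩))
  obtain ⟨Q⟩ := S.nonempty_stagePoint q
    (fun w hw i hi => weightSpace_supp (hW.le hw) (hoffT Tor hTor i hi)) fun i _ =>
    (congrArg (fun e : OpenPartialHomeomorph X.M (Fin m → 𝕜) => e (S.π q) i) he.symm).trans
      (congrFun P.c.map_center i)
  obtain ⟨μ, hμ, hmin⟩ := S.exists_minimal (lab := Q.lab) (J := Q.J) (fun t ht => Q.mem_H ht)
    (A := P.exponents) ⟨_, Or.inl (Or.inl rfl)⟩ good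
  obtain ⟨β, h, h1, h2, h3, h4⟩ := P.exists_tail μ
  obtain ⟨i, b, hb, hdeg, hne, hcoef⟩ :=
    P.exists_coeff Q hν he hTor hv hW hθ hμ hmin h1 h2 h3 h4
  refine (Q.nu_le (Q.isMonomialCoord hcard) (fun i => pull S.π q (P.f i))
    (fun i => pull S.π q (P.g i))
    (fun i => Q.quotient ν (P.termExp β i) (P.termCoeff h i) P.δ μ) (γ := Q.expJ (P.δ + μ))
    (fun t ht => if_neg ht) ?_ (fun i => ?_) (fun i => ?_) i hb hne hcoef).trans_lt
    (by exact_mod_cast hdeg)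
  · rw [FolSub.IsGenSystem, S.ring, ← P.gen, AlgHom.map_adjoin, ← Set.range_comp]
    rfl
  · exact Q.isFirstIntegral_pull P.c he (fun κ hκ => hdiag Tor hTor κ (hW.le hκ)) hder
      (P.decomp.integral i)
  · rw [P.decomp.eq i, map_add, P.sum_terms hν h2 i]
    refine congrArg _ (Q.pull_eq_quotient P.c he (fun j hj => ?_)
      (fun k j hj => P.termExp_supp h1 i k j (hoffT Tor hTor j hj)) fun k hk hC =>
        hmin _ (P.termExp_mem h3 i hk hC))
    have h5 := hoffT Tor hTor j hj
    rw [Finset.mem_insert, not_or, Finset.mem_compl, not_not] at h5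
    exact P.decomp.supp j h5.2

/-- The ideal of the exponents becomes principal, with support in the divisor. -/
theorem Stage.pulledIdeal_principal (S : Stage X e₀ Tor W v)
    (P : FolSub.PreparedForm X p ν) (he : P.c.e = e₀) (hTor : Tor = insert P.v P.regᶜ)
    (hv : v = P.v)
    (good : ∀ a ∈ P.exponents, ∀ b ∈ P.exponents, S.Good (expSub a b)) (q : S.Y.M) :
    (∃ φ : AnGerm q, P.pulledIdeal (fun y => S.π y) q = Ideal.span {φ}) ∧
      (P.pulledIdeal (fun y => S.π y) q ≠ ⊤ → ∃ H ∈ S.Y.E, q ∈ H) := by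
  classical
  obtain ⟨e, lab, hq, hT⟩ := S.chart q
  let n : (Fin m → ℕ) → Fin m → ℕ := fun a t => ∑ i, S.ρ (lab t) i * a i
  let φ : (Fin m → ℕ) → AnGerm q := fun a => ∏ t ∈ Tor, chartGerm hT.atlas hq t ^ n a t
  have hJ : ∀ t, t ∈ Tor.filter (fun t => e q t = 0) ↔ t ∈ Tor ∧ e q t = 0 := fun t =>
    Finset.mem_filter
  set J := Tor.filter fun t => e q t = 0 with hJdef
  obtain ⟨μ, hμ, hmin⟩ := S.exists_minimal (q := q) (lab := lab) (J := J)
    (fun t ht => (hT.mem t ((hJ t).1 ht).1 q hq).2 ((hJ t).1 ht).2)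
    (A := P.exponents) ⟨_, Or.inl (Or.inl rfl)⟩ good
  have hunit : ∀ t ∈ Tor, t ∉ J → IsUnit (chartGerm hT.atlas hq t) := fun t ht htJ => by
    rw [isUnit_germ_iff, germEval_chartGerm]
    exact fun h => htJ ((hJ t).2 ⟨ht, h⟩)
  have hφ : ∀ a ∈ P.exponents, (φ a).1 =
      ((fun y => ∏ j, P.c.e (S.π y) j ^ a j : S.Y.M → 𝕜) : Germ (𝓝 q) 𝕜) := by
    intro a ha
    refine (coe_prod_pow Tor (fun t y => e y t) (fun t => contMDiffAt_pi_space.1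
      (contMDiffAt_of_mem_maximalAtlas hT.atlas hq) t) (n a)).trans ?_
    refine Germ.coe_eq.2 ?_
    filter_upwards [e.open_source.mem_nhds hq] with y hy
    have h1 : ∀ j, P.c.e (S.π y) j ^ a j = ∏ t ∈ Tor, e y t ^ (S.ρ (lab t) j * a j) := by
      intro j
      by_cases hj : j ∈ Tor
      · have h2 : P.c.e (S.π y) j = ∏ t ∈ Tor, e y t ^ S.ρ (lab t) j :=
          (congrArg (fun e : OpenPartialHomeomorph X.M (Fin m → 𝕜) => e (S.π y) j) he).trans
            (hT.coord y hy j hj)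
        rw [h2, ← Finset.prod_pow]
        exact Finset.prod_congr rfl fun t _ => (pow_mul _ _ _).symm
      · have h2 : a j = 0 := P.exponents_supp ha j fun h => hj (hTor.ge h)
        rw [h2, pow_zero, Finset.prod_eq_one fun t _ => by rw [mul_zero, pow_zero]]
    rw [Finset.prod_congr rfl fun j _ => h1 j, Finset.prod_comm]
    exact Finset.prod_congr rfl fun t _ => (Finset.prod_pow_eq_pow_sum _ _ _).symm
  have hdvd : ∀ a ∈ P.exponents, φ μ ∣ φ a := fun a ha =>
    Finset.prod_dvd_prod_of_dvd _ _ fun t ht => by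
      by_cases htJ : t ∈ J
      · exact pow_dvd_pow _ (hmin a ha t htJ)
      · exact ((hunit t ht htJ).pow _).dvd
  have hspan : P.pulledIdeal (fun y => S.π y) q = Ideal.span {φ μ} := by
    refine le_antisymm (Ideal.span_le.2 ?_) (Ideal.span_le.2 ?_)
    · rintro h ⟨a, ha, hh⟩
      rw [SetLike.mem_coe, Ideal.mem_span_singleton,
        show h = φ a from Subtype.ext (hh.trans (hφ a ha).symm)]
      exact hdvd a ha
    · rintro _ rfl
      exact Ideal.subset_span ⟨μ, hμ, hφ μ hμ⟩
  refine ⟨⟨φ μ, hspan⟩, fun hne => ?_⟩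
  have h1 : ∃ t ∈ J, n μ t ≠ 0 := by
    by_contra! hcon
    refine hne (hspan.trans (Ideal.span_singleton_eq_top.2 (isUnit_of_dvd_one ?_)))
    refine (Finset.prod_dvd_prod_of_dvd _ (fun _ => (1 : AnGerm q)) fun t ht => ?_).trans
      (Finset.prod_const_one).dvd
    by_cases htJ : t ∈ J
    · rw [hcon t htJ, pow_zero]
    · exact ((hunit t ht htJ).pow _).dvd
  obtain ⟨t, ht, hnt⟩ := h1
  have hqH := (hT.mem t ((hJ t).1 ht).1 q hq).2 ((hJ t).1 ht).2
  have h2 := hmin (Pi.single P.v ν) (Or.inl (Or.inl rfl)) t ht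
  have h3 : ∑ i, S.ρ (lab t) i * (Pi.single P.v ν : Fin m → ℕ) i = S.ρ (lab t) P.v * ν := by
    rw [Finset.sum_eq_single_of_mem P.v (Finset.mem_univ _) fun i _ hi => by
      rw [Pi.single_eq_of_ne hi, mul_zero], Pi.single_eq_same]
  rw [h3] at h2
  rcases S.label (lab t) ⟨q, hqH⟩ with h | ⟨j, -, hjv, hρ, -⟩
  · exact ⟨S.H (lab t), S.divisor ▸ List.mem_map.2 ⟨_, h, rfl⟩, hqH⟩
  · refine absurd (Nat.le_zero.1 (h2.trans_eq ?_)) hnt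
    rw [hρ, Pi.single_eq_of_ne (fun h => hjv (h.symm.trans hv.symm)), zero_mul]

theorem FolSub.PreparedForm.finite_exponents (P : FolSub.PreparedForm X p ν) :
    P.exponents.Finite := by
  have hle : ∀ β β' : Fin m → ℕ, (∀ j ∈ P.reg, β' j = 0) →
      (∃ i₀, P.b i₀ 0 = mono P.c β ∨
        ∃ w ∈ P.reg, w ≠ P.v ∧ P.b i₀ 0 = mono P.c β * coordGerm P.c w) →
      (∀ i, mono P.c β' ∣ P.b i 0) → β' ≤ β := by
    rintro β β' h1 ⟨i, hi⟩ h2 j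
    by_cases hj : j ∈ P.reg
    · rw [h1 j hj]
      exact Nat.zero_le _
    obtain ⟨h, hh⟩ := h2 i
    rcases hi with hi | ⟨w, hw, -, hi⟩
    · have h3 := coeff_taylor_mono_mul P.c β 1 0
      rw [mul_one, ← hi, hh, add_zero, map_one, MvPowerSeries.coeff_zero_one] at h3
      have h4 := le_of_coeff_taylor_mono_mul _ _ _ (h3.trans_ne one_ne_zero) j
      rwa [toFs_apply, toFs_apply] at h4
    · have h3 := coeff_taylor_mono_mul P.c β (coordGerm P.c w) (Finsupp.single w 1)
      rw [← hi, hh, taylor_coordGerm, MvPowerSeries.coeff_X, if_pos rfl] at h3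
      have h4 := le_of_coeff_taylor_mono_mul _ _ _ (h3.trans_ne one_ne_zero) j
      rwa [Finsupp.add_apply, Finsupp.single_eq_of_ne (by
        rintro rfl
        exact hj hw), add_zero,
        toFs_apply, toFs_apply] at h4
  refine ((Set.finite_singleton _).union ?_).union (Set.Subsingleton.finite ?_)
  · refine ((Set.finite_univ (α := Fin P.n)).prod (Set.finite_lt_nat ν)).image
      (fun x => Pi.single P.v x.2 + P.r x.1 x.2) |>.subset ?_
    rintro _ ⟨i, k, -, hk, -, rfl⟩
    exact ⟨(i, k), ⟨Set.mem_univ _, hk⟩, rfl⟩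
  · rintro β ⟨h1, h2, h3⟩ β' ⟨h1', h2', h3'⟩
    exact le_antisymm (hle β' β h1 h2' h3) (hle β β' h1' h2 h3')

/-- Any stage has a total transform in which the ideal of exponents is principal and the tangency
order drops. -/
theorem Stage.exists_principal (S : Stage X e₀ Tor W v) (hν : 1 < ν)
    (P : FolSub.PreparedForm X p ν) (he : P.c.e = e₀) (hTor : Tor = insert P.v P.regᶜ)
    (hv : v = P.v) {s : ℕ} {α : Fin s → Fin m → ℚ} (hW : W = weightSpace P.reg P.v α)
    (hθ : X.θ p = Submodule.span (AnGerm p)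
      ((fun j => coordDer P.c j) '' (P.reg : Set (Fin m)) ∪
        Set.range fun i => diagField P.c P.regᶜ (α i)))
    (hcard : Torᶜ.card + Module.finrank ℚ W = X.leafDim) :
    ∃ (Y : FolSub.{u} 𝕜 m) (τ : Y.M → S.Y.M), CombSeq S.Y (Set.range S.H) Y τ ∧
      (∀ q : Y.M,
        (∃ φ : AnGerm q, P.pulledIdeal (fun y => S.π (τ y)) q = Ideal.span {φ}) ∧
        (P.pulledIdeal (fun y => S.π (τ y)) q ≠ ⊤ → ∃ H ∈ Y.E, q ∈ H)) ∧
      ∀ q : Y.M, S.π (τ q) = p → Y.nu q < (ν : ℕ∞) := by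
  obtain ⟨S', τ, h1, h2, h3⟩ := Stage.exists_completion
    ((P.finite_exponents.prod P.finite_exponents).image
      fun x => expSub x.1 x.2).toFinset.toList ∅ S fun d hd => absurd hd (Set.notMem_empty _)
  have good : ∀ a ∈ P.exponents, ∀ b ∈ P.exponents, S'.Good (expSub a b) := fun a ha b hb =>
    h3 _ (Or.inr (by
      rw [Set.mem_ofPred_eq, Finset.mem_toList, Set.Finite.mem_toFinset]
      exact ⟨(a, b), ⟨ha, hb⟩, rfl⟩))
  have h4 : (fun y => S.π (τ y)) = fun y => S'.π y := funext fun y => (h2 y).symm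
  refine ⟨S'.Y, τ, h1, fun q => ?_, fun q hq => ?_⟩
  · rw [h4]
    exact S'.pulledIdeal_principal P he hTor hv good q
  · exact S'.nu_lt ((h2 q).trans hq) hν P he hTor hv hW hθ hcard good

end Conclusion

section BaseCoordinates

variable {𝕜 : Type} [RCLike 𝕜] {m : ℕ}

/-- The restriction of a chart to an open submanifold. -/
theorem subtypeRestr_mem_maximalAtlas {M : AnMfd.{u} 𝕜 m}
    {e : OpenPartialHomeomorph M (Fin m → 𝕜)}
    (he : e ∈ IsManifold.maximalAtlas 𝓘(𝕜, Fin m → 𝕜) ω M) (U : TopologicalSpace.Opens M)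
    (hU : Nonempty U) :
    e.subtypeRestr hU ∈ IsManifold.maximalAtlas 𝓘(𝕜, Fin m → 𝕜) ω (M.openSub U) := by
  intro e' he'
  obtain ⟨x, rfl⟩ := TopologicalSpace.Opens.chart_eq hU he'
  have hx := IsManifold.chart_mem_maximalAtlas (I := 𝓘(𝕜, Fin m → 𝕜)) (n := ω) (x : M)
  have key : ∀ f f' : OpenPartialHomeomorph M (Fin m → 𝕜),
      f ∈ IsManifold.maximalAtlas 𝓘(𝕜, Fin m → 𝕜) ω M →
      f' ∈ IsManifold.maximalAtlas 𝓘(𝕜, Fin m → 𝕜) ω M →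
      (f.subtypeRestr hU).symm.trans (f'.subtypeRestr hU) ∈
        contDiffGroupoid ω 𝓘(𝕜, Fin m → 𝕜) := fun f f' hf hf' =>
    (contDiffGroupoid ω 𝓘(𝕜, Fin m → 𝕜)).mem_of_eqOnSource
      (closedUnderRestriction'
        (StructureGroupoid.compatible_of_mem_maximalAtlas hf hf')
        (f.isOpen_inter_preimage_symm U.2))
      (OpenPartialHomeomorph.subtypeRestr_symm_trans_subtypeRestr (s := U) hU f f')
  exact ⟨key _ _ he hx, key _ _ hx he⟩

theorem prime_coordGerm {M : AnMfd.{u} 𝕜 m} {p : M} (c : CenteredChart p) (j : Fin m) :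
    Prime (coordGerm c j) := by
  classical
  have hrest : ∀ g : AnGerm p, ∃ h : AnGerm p, coordDer c j h = 0 ∧ coordGerm c j ∣ g - h := by
    intro g
    obtain ⟨h, hh⟩ := exists_taylor_restrict c g {a | a j = 0}
    refine ⟨h, (coordDer_eq_zero_iff c j h).2 fun a ha => ?_,
      (coordGerm_dvd_iff c j _).2 fun a ha => ?_⟩
    · rw [hh] at ha
      exact mem_of_coeff_restrictSeries ha
    · rw [map_sub, map_sub, hh, sub_eq_zero]
      exact (coeff_restrictSeries_of_mem _ ha).symm
  have hzero : ∀ g : AnGerm p, coordDer c j g = 0 → coordGerm c j ∣ g → g = 0 := by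
    intro g h1 h2
    refine taylor_injective c (MvPowerSeries.ext fun a => ?_)
    rw [map_zero, map_zero]
    by_contra h3
    exact h3 ((coordGerm_dvd_iff c j g).1 h2 a ((coordDer_eq_zero_iff c j g).1 h1 a h3))
  refine ⟨coordGerm_ne_zero c j, fun h => (isUnit_germ_iff _).1 h (germEval_coordGerm c j),
    fun g g' hg => ?_⟩
  obtain ⟨h, h1, h2⟩ := hrest g
  obtain ⟨h', h1', h2'⟩ := hrest g'
  have h3 : coordGerm c j ∣ h * h' := by
    have h4 : h * h' = g * g' - (g - h) * g' - h * (g' - h') := by ring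
    rw [h4]
    exact dvd_sub (dvd_sub hg (h2.mul_right _)) (h2'.mul_left _)
  have h5 := hzero _ (by rw [Derivation.leibniz, h1, h1', smul_zero, smul_zero, add_zero]) h3
  rcases mul_eq_zero.1 h5 with rfl | rfl
  · rw [sub_zero] at h2
    exact Or.inl h2
  · rw [sub_zero] at h2'
    exact Or.inr h2'

theorem eq_of_coordGerm_dvd {M : AnMfd.{u} 𝕜 m} {p : M} (c : CenteredChart p) {j k : Fin m}
    (h : coordGerm c j ∣ coordGerm c k) : j = k := by
  classical
  by_contra hjk
  rw [coordGerm_dvd_iff] at h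
  have h1 := h (Finsupp.single k 1) (Finsupp.single_eq_of_ne hjk)
  rw [taylor_coordGerm, MvPowerSeries.coeff_X, if_pos rfl] at h1
  exact one_ne_zero h1

theorem eventually_zero_of_dvd {M : AnMfd.{u} 𝕜 m} {p : M} {f g : M → 𝕜} {hf : IsAnAt f p}
    {hg : IsAnAt g p} (h : toGerm f hf ∣ toGerm g hg) : ∀ᶠ x in 𝓝 p, f x = 0 → g x = 0 := by
  obtain ⟨k, hk⟩ := h
  induction k using germ_induction with
  | h k hk' =>
  rw [toGerm_mul] at hk
  filter_upwards [toGerm_eq_iff.1 hk] with x hx h0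
  rw [hx, Pi.mul_apply, h0, zero_mul]

theorem coordGerm_dvd_of_eventually {M : AnMfd.{u} 𝕜 m} {p : M} (c : CenteredChart p)
    (k : Fin m) {f : M → 𝕜} (hf : IsAnAt f p) (h : ∀ᶠ x in 𝓝 p, c.e x k = 0 → f x = 0) :
    coordGerm c k ∣ toGerm f hf := by
  have h1 := vanIdeal_eq_span_coord c {k} (C := {x | c.e x k = 0}) (by simp)
  have h2 := (toGerm_mem_vanIdeal (S := {x | c.e x k = 0}) hf).2 h
  rwa [h1, Finset.coe_singleton, Set.image_singleton, Ideal.mem_span_singleton] at h2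

/-- If a union of coordinate hyperplanes contains a coordinate hyperplane in other coordinates,
then this is one of them. -/
theorem exists_coordGerm_dvd {M : AnMfd.{u} 𝕜 m} {p : M} (c c' : CenteredChart p) (k : Fin m)
    {κ : Type} (T : Finset κ) (j : κ → Fin m)
    (h : ∀ᶠ x in 𝓝 p, c.e x k = 0 → ∃ i ∈ T, c'.e x (j i) = 0) :
    ∃ i ∈ T, coordGerm c k ∣ coordGerm c' (j i) := by
  have h1 : ∀ S : Finset κ, ∃ (hf : IsAnAt (fun x => ∏ i ∈ S, c'.e x (j i)) p),
      ∏ i ∈ S, coordGerm c' (j i) = toGerm (fun x => ∏ i ∈ S, c'.e x (j i)) hf := by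
    classical
    intro S
    induction S using Finset.induction_on with
    | empty =>
      refine ⟨by simpa using isAnAt_const 1, ?_⟩
      rw [Finset.prod_empty]
      simp only [Finset.prod_empty]
      rfl
    | insert i S hi ih =>
      obtain ⟨hf, ih⟩ := ih
      simp only [Finset.prod_insert hi]
      exact ⟨(isAnAt_coord c' (j i)).mul hf, by rw [ih]; rfl⟩
  obtain ⟨hf, h2⟩ := h1 T
  have h3 := coordGerm_dvd_of_eventually c k hf (by
    filter_upwards [h] with x hx h0
    obtain ⟨i, hi, h4⟩ := hx h0
    exact Finset.prod_eq_zero hi h4)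
  rw [← h2] at h3
  exact (prime_coordGerm c k).exists_mem_finset_dvd h3

/-- In monomial coordinates, the components of the divisor are coordinate hyperplanes. -/
theorem FolSub.IsMonomialCoord.exists_component {X : FolSub.{u} 𝕜 m} (hX : X.IsFoliatedSubring)
    {p : X.M} {c : CenteredChart p} {reg : Finset (Fin m)} (h : X.IsMonomialCoord c reg)
    (k₀ : Fin m) : ∃ k : Fin X.E.length → Fin m, (∀ i, p ∈ X.E.get i → k i ∉ reg) ∧
      (∀ i, p ∈ X.E.get i → ∀ᶠ x in 𝓝 p, x ∈ X.E.get i ↔ c.e x (k i) = 0) ∧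
      ∀ i i', p ∈ X.E.get i → p ∈ X.E.get i' → k i = k i' → i = i' := by
  classical
  obtain ⟨exc, hexc, hdiv⟩ := h.divisor
  obtain ⟨c', j, hj, hc'⟩ := hX.snc p
  have hsrc : ∀ᶠ x in 𝓝 p, x ∈ c'.e.source := c'.e.open_source.mem_nhds c'.mem_source
  have hfar : ∀ᶠ x in 𝓝 p, ∀ i, x ∈ X.E.get i → p ∈ X.E.get i := by
    rw [Filter.eventually_all]
    intro i
    by_cases hi : p ∈ X.E.get i
    · exact Eventually.of_forall fun _ _ => hi
    · filter_upwards [(hX.closed _ (List.get_mem _ _)).isOpen_compl.mem_nhds hi] with x hx h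
      exact absurd h hx
  have h1 : ∀ k ∈ exc, ∃ i, p ∈ X.E.get i ∧ coordGerm c k ∣ coordGerm c' (j i) := by
    intro k hk
    obtain ⟨i, hi, hd⟩ := exists_coordGerm_dvd c c' k
      (Finset.univ.filter fun i => p ∈ X.E.get i) j (by
        filter_upwards [hdiv, hsrc, hfar] with x hx hxs hxf h0
        obtain ⟨H, hH, hxH⟩ := hx.2 ⟨k, hk, h0⟩
        obtain ⟨i, rfl⟩ := List.get_of_mem hH
        exact ⟨i, Finset.mem_filter.2 ⟨Finset.mem_univ _, hxf i hxH⟩,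
          (hc' i (hxf i hxH) x hxs).1 hxH⟩)
    exact ⟨i, (Finset.mem_filter.1 hi).2, hd⟩
  have h2 : ∀ i, p ∈ X.E.get i → ∃ k ∈ exc, coordGerm c' (j i) ∣ coordGerm c k := by
    intro i hi
    refine exists_coordGerm_dvd c' c (j i) exc id ?_
    filter_upwards [hdiv, hsrc] with x hx hxs h0
    exact hx.1 ⟨_, List.get_mem _ _, (hc' i hi x hxs).2 h0⟩
  have h3 : ∀ i, ∃ k, p ∈ X.E.get i → k ∈ exc ∧ coordGerm c' (j i) ∣ coordGerm c k ∧
      coordGerm c k ∣ coordGerm c' (j i) := by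
    intro i
    by_cases hi : p ∈ X.E.get i
    · obtain ⟨k, hk, hd⟩ := h2 i hi
      obtain ⟨i', hi', hd'⟩ := h1 k hk
      refine ⟨k, fun _ => ⟨hk, hd, ?_⟩⟩
      rw [eq_of_coordGerm_dvd c' (hd.trans hd')]
      exact hd'
    · exact ⟨k₀, fun h => absurd h hi⟩
  choose k hk using h3
  refine ⟨k, fun i hi => Finset.mem_compl.1 (hexc (hk i hi).1), fun i hi => ?_,
    fun i i' hi hi' hii => hj i i' hi hi' ?_⟩
  · filter_upwards [hsrc, eventually_zero_of_dvd (hk i hi).2.1,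
      eventually_zero_of_dvd (hk i hi).2.2] with x hx h4 h5
    rw [hc' i hi x hx]
    exact ⟨h4, h5⟩
  · have h4 := (hk i' hi').2.2
    rw [← hii] at h4
    exact eq_of_coordGerm_dvd c' ((hk i hi).2.1.trans h4)

theorem smul_lie_vfield {M : AnMfd.{u} 𝕜 m} {p : M} (g : AnGerm p) (D D' : VField p) :
    ⁅g • D, D'⁆ = g • ⁅D, D'⁆ + (-D' g) • D := by
  ext f
  congr 1
  simp only [Derivation.commutator_apply, Derivation.smul_apply, Derivation.add_apply,
    Derivation.leibniz, smul_eq_mul]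
  ring

theorem add_lie_vfield {M : AnMfd.{u} 𝕜 m} {p : M} (D D₁ D' : VField p) :
    ⁅D + D₁, D'⁆ = ⁅D, D'⁆ + ⁅D₁, D'⁆ := by
  ext f
  congr 1
  simp only [Derivation.commutator_apply, Derivation.add_apply, map_add]
  ring

theorem lie_add_smul_vfield {M : AnMfd.{u} 𝕜 m} {p : M} (g g' : AnGerm p) (D D' B : VField p) :
    ⁅D + g • B, D' + g' • B⁆ = ⁅D, D'⁆ + (g' • ⁅D, B⁆ + (-g) • ⁅D', B⁆) +
      (D g' - D' g + g * B g' - g' * B g) • B := by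
  ext f
  congr 1
  simp only [Derivation.commutator_apply, Derivation.add_apply, Derivation.smul_apply, map_add,
    Derivation.leibniz, smul_eq_mul]
  ring

/-- Adding a vector field normalised by an involutive module yields an involutive module. -/
theorem IsInvolutive.sup_span {M : AnMfd.{u} 𝕜 m} {p : M}
    {Θ : Submodule (AnGerm p) (VField p)} (hΘ : IsInvolutive Θ) {S : Set (VField p)}
    (hS : Θ = Submodule.span _ S) {B : VField p}
    (hB : ∀ D ∈ S, ⁅D, B⁆ ∈ Θ ⊔ Submodule.span (AnGerm p) {B}) :
    IsInvolutive (Θ ⊔ Submodule.span (AnGerm p) {B}) := by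
  have hBm : B ∈ Θ ⊔ Submodule.span (AnGerm p) {B} :=
    Submodule.mem_sup_right (Submodule.mem_span_singleton_self B)
  have h1 : ∀ D ∈ Θ, ⁅D, B⁆ ∈ Θ ⊔ Submodule.span (AnGerm p) {B} := by
    intro D hD
    have hD' := hS.le hD
    clear hD
    induction hD' using Submodule.span_induction with
    | mem D hD => exact hB D hD
    | zero =>
      have h : ⁅(0 : VField p), B⁆ = 0 := by
        ext f
        congr 1
        rw [Derivation.commutator_apply, Derivation.zero_apply, Derivation.zero_apply, map_zero,
          sub_zero]
      rw [h]
      exact zero_mem _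
    | add D D' _ _ h h' =>
      rw [add_lie_vfield]
      exact add_mem h h'
    | smul g D hD h =>
      rw [smul_lie_vfield]
      exact add_mem (Submodule.smul_mem _ _ h)
        (Submodule.smul_mem _ _ (Submodule.mem_sup_left (hS.ge hD)))
  intro D hD D' hD'
  obtain ⟨D₁, h₁, _, h₂, rfl⟩ := Submodule.mem_sup.1 hD
  obtain ⟨D₁', h₁', _, h₂', rfl⟩ := Submodule.mem_sup.1 hD'
  obtain ⟨g, rfl⟩ := Submodule.mem_span_singleton.1 h₂
  obtain ⟨g', rfl⟩ := Submodule.mem_span_singleton.1 h₂'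
  rw [lie_add_smul_vfield]
  exact add_mem (add_mem (Submodule.mem_sup_left (hΘ _ h₁ _ h₁'))
    (add_mem (Submodule.smul_mem _ _ (h1 _ h₁)) (Submodule.smul_mem _ _ (h1 _ h₁'))))
    (Submodule.smul_mem _ _ hBm)

theorem finrank_vfield_le_of_smul {M : AnMfd.{u} 𝕜 m} {p : M}
    {Θ Θ' : Submodule (AnGerm p) (VField p)} {g : AnGerm p} (hg : g ≠ 0)
    (h : ∀ D ∈ Θ', g • D ∈ Θ) : Module.finrank (AnGerm p) Θ' ≤ Module.finrank (AnGerm p) Θ := by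
  let φ : Θ' →ₗ[AnGerm p] Θ :=
    { toFun := fun D => ⟨g • D.1, h D.1 D.2⟩
      map_add' := fun D D' => Subtype.ext (smul_add _ _ _)
      map_smul' := fun a D => Subtype.ext (smul_comm g a D.1) }
  have hφ : Function.Injective φ := fun D D' hD => by
    have h1 : g • D.1 = g • D'.1 := congrArg Subtype.val hD
    refine Subtype.ext (Derivation.ext fun f => ?_)
    have h2 := congrArg (fun E : VField p => E f) h1
    exact mul_left_cancel₀ hg h2
  exact Cardinal.toNat_le_toNat (LinearMap.rank_le_of_injective φ hφ)
    ((rank_vfield_le Θ).trans_lt Cardinal.natCast_lt_aleph0)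

variable {X : FolSub.{u} 𝕜 m} {p : X.M}

/-- Maximality excludes the vector fields `u_j ∂_j` with `{u_j = 0}` not in the divisor. -/
theorem FolSub.IsMonomialCoord.single_notMem_weightSpace (hX : X.IsFoliatedSubring)
    {c : CenteredChart p} {reg : Finset (Fin m)} (h : X.IsMonomialCoord c reg) {v : Fin m}
    (hv : v ∈ reg) {s : ℕ} {α : Fin s → Fin m → ℚ} (hα : ∀ i, ∀ j ∈ reg, α i j = 0)
    (hθ : X.θ p = Submodule.span (AnGerm p)
      ((fun j => coordDer c j) '' (reg : Set (Fin m)) ∪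
        Set.range fun i => diagField c regᶜ (α i))) {j : Fin m} (hj : j ∉ reg)
    (hE : ∀ H ∈ X.E, (∀ᶠ x in 𝓝 p, x ∉ H) ∨
      ∃ k, k ≠ j ∧ ∀ᶠ x in 𝓝 p, x ∈ H ↔ c.e x k = 0) :
    Pi.single j 1 ∉ weightSpace reg v α := by
  classical
  intro hmem
  have hvj : j ≠ v := fun h => hj (h ▸ hv)
  have h1 : coordGerm c j • coordDer c j ∈ X.θ p := by
    have h2 := diagField_mem_of_weightSpace c (X.θ p)
      (fun i => hθ.ge (Submodule.subset_span (Or.inr ⟨i, rfl⟩)))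
      (hθ.ge (Submodule.subset_span (Or.inl ⟨v, hv, rfl⟩))) hmem
    rw [diagField, Finset.sum_eq_single j, Pi.single_eq_same, Rat.cast_one, one_smul] at h2
    · exact h2
    · intro i _ hi
      rw [Pi.single_eq_of_ne hi, Rat.cast_zero, zero_smul]
    · exact fun h => absurd (Finset.mem_insert_of_mem (Finset.mem_compl.2 hj)) h
  have hdvd : ∀ D ∈ X.θ p, coordGerm c j ∣ D (coordGerm c j) := by
    intro D hD
    have hD' := hθ.le hD
    clear hD
    induction hD' using Submodule.span_induction with
    | mem D hD =>
      rcases hD with ⟨r, hr, rfl⟩ | ⟨i, rfl⟩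
      · beta_reduce
        rw [coordDer_coordGerm, if_neg]
        · exact dvd_zero _
        · rintro rfl
          exact hj hr
      · beta_reduce
        rw [diagField_coordGerm c _ _ fun t ht => hα i t (by simpa using ht)]
        exact dvd_mul_left _ _
    | zero => exact dvd_zero _
    | add D D' _ _ h h' =>
      rw [Derivation.add_apply]
      exact dvd_add h h'
    | smul g D _ h =>
      rw [Derivation.smul_apply, smul_eq_mul]
      exact h.mul_left _
  have hle : X.θ p ≤ X.θ p ⊔ Submodule.span (AnGerm p) {coordDer c j} := le_sup_left
  have hmax := h.maximal _ ?_ ?_ ?_ hle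
  · have h2 := hdvd (coordDer c j) (hmax.ge (Submodule.mem_sup_right
      (Submodule.mem_span_singleton_self _)))
    rw [coordDer_coordGerm, if_pos rfl] at h2
    exact (prime_coordGerm c j).not_isUnit (isUnit_of_dvd_one h2)
  · refine sup_le h.tangent ?_
    rw [Submodule.span_singleton_le_iff_mem]
    refine mem_derLog_of_chart c.mem_atlas c.mem_source fun H hH => ?_
    refine (hE H hH).imp_right fun ⟨k, hk, hk'⟩ => ⟨k, hk', ?_⟩
    rw [chartGerm_centered, coordDer_coordGerm, if_neg]
    · exact dvd_zero _
    · exact hk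
  · refine (hX.involutive p).sup_span hθ ?_
    rintro _ (⟨r, hr, rfl⟩ | ⟨i, rfl⟩)
    · have h2 : ⁅coordDer c r, coordDer c j⁆ = 0 := vfield_ext_coord c fun k => by
        rw [Derivation.commutator_apply, coordDer_coordGerm, coordDer_coordGerm]
        split_ifs <;> simp
      beta_reduce
      rw [h2]
      exact zero_mem _
    · have h2 : ⁅diagField c regᶜ (α i), coordDer c j⁆ =
          algebraMap 𝕜 (AnGerm p) (-(α i j : 𝕜)) • coordDer c j := vfield_ext_coord c fun k => by
        rw [Derivation.commutator_apply, coordDer_coordGerm,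
          diagField_coordGerm c _ _ fun t ht => hα i t (by simpa using ht),
          Derivation.smul_apply, Derivation.leibniz, derivation_const, coordDer_coordGerm]
        split_ifs with h3
        · subst h3
          simp
        · simp
      beta_reduce
      rw [h2]
      exact Submodule.smul_mem _ _ (Submodule.mem_sup_right
        (Submodule.mem_span_singleton_self _))
  · rw [← hX.rank p]
    refine le_antisymm (finrank_vfield_le_of_smul (coordGerm_ne_zero c j) ?_)
      (finrank_vfield_le_of_smul one_ne_zero fun D hD => ?_)
    · intro D hD
      obtain ⟨D₁, h₁, _, h₂, rfl⟩ := Submodule.mem_sup.1 hD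
      obtain ⟨g, rfl⟩ := Submodule.mem_span_singleton.1 h₂
      rw [smul_add, smul_comm]
      exact add_mem (Submodule.smul_mem _ _ h₁) (Submodule.smul_mem _ _ h1)
    · rw [one_smul]
      exact hle hD

theorem linearIndependent_of_finrank {c : CenteredChart p} {reg : Finset (Fin m)} {s : ℕ}
    {α : Fin s → Fin m → ℚ} (hrank : Module.finrank (AnGerm p) (X.θ p) = reg.card + s)
    (hθ : X.θ p = Submodule.span (AnGerm p)
      ((fun j => coordDer c j) '' (reg : Set (Fin m)) ∪
        Set.range fun i => diagField c regᶜ (α i))) : LinearIndependent ℚ α := by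
  classical
  rw [linearIndependent_iff_card_le_finrank_span, Fintype.card_fin]
  set V := Submodule.span ℚ (Set.range α) with hV
  change s ≤ Module.finrank ℚ V
  let b := Module.finBasis ℚ V
  let B : reg ⊕ Fin (Module.finrank ℚ V) → VField p :=
    Sum.elim (fun j => coordDer c j) fun i => diagField c regᶜ (b i : Fin m → ℚ)
  have h1 : ∀ w ∈ V, diagField c regᶜ w ∈ Submodule.span (AnGerm p) (Set.range B) := by
    intro w hw
    have h2 := b.sum_repr ⟨w, hw⟩
    have h3 : w = ∑ i, b.repr ⟨w, hw⟩ i • (b i : Fin m → ℚ) := by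
      have h4 := congrArg Subtype.val h2
      rw [AddSubmonoidClass.coe_finsetSum] at h4
      exact h4.symm
    have h5 : ∀ (T : Finset (Fin (Module.finrank ℚ V))) (x : Fin (Module.finrank ℚ V) → ℚ),
        diagField c regᶜ (∑ i ∈ T, x i • (b i : Fin m → ℚ)) ∈
          Submodule.span (AnGerm p) (Set.range B) := by
      intro T x
      induction T using Finset.induction_on with
      | empty =>
        have : diagField c regᶜ (0 : Fin m → ℚ) = 0 :=
          Finset.sum_eq_zero fun j _ => by rw [Pi.zero_apply, Rat.cast_zero, zero_smul]
        rw [Finset.sum_empty, this]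
        exact zero_mem _
      | insert i T hi ih =>
        rw [Finset.sum_insert hi, diagField_add, diagField_smul,
          algebra_compatible_smul (AnGerm p)]
        exact add_mem (Submodule.smul_mem _ _ (Submodule.subset_span ⟨Sum.inr i, rfl⟩)) ih
    rw [h3]
    exact h5 _ _
  have h2 : X.θ p ≤ Submodule.span (AnGerm p) (Set.range B) := by
    rw [hθ, Submodule.span_le]
    rintro _ (⟨j, hj, rfl⟩ | ⟨i, rfl⟩)
    · exact Submodule.subset_span ⟨Sum.inl ⟨j, hj⟩, rfl⟩
    · exact h1 _ (Submodule.subset_span ⟨i, rfl⟩)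
  have h3 := (finrank_vfield_le_of_smul (one_ne_zero (α := AnGerm p)) fun D hD => by
    rw [one_smul]
    exact h2 hD).trans (finrank_range_le_card (R := AnGerm p) B)
  rw [hrank, Fintype.card_sum, Fintype.card_coe, Fintype.card_fin] at h3
  omega

theorem finrank_weightSpace {reg : Finset (Fin m)} {v : Fin m} (hv : v ∈ reg) {s : ℕ}
    {α : Fin s → Fin m → ℚ} (hα : ∀ i, ∀ j ∈ reg, α i j = 0) (hli : LinearIndependent ℚ α) :
    Module.finrank ℚ (weightSpace reg v α) = s + 1 := by
  have h1 : (fun i j => if j ∈ reg then 0 else α i j) = α := by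
    ext i j
    split_ifs with h
    · exact (hα i j h).symm
    · rfl
  have h2 : LinearIndependent ℚ (Fin.cons (Pi.single v 1) α : Fin (s + 1) → Fin m → ℚ) := by
    rw [linearIndependent_finCons]
    refine ⟨hli, fun h => ?_⟩
    have h3 : ∀ w ∈ Submodule.span ℚ (Set.range α), w v = 0 := by
      intro w hw
      induction hw using Submodule.span_induction with
      | mem w hw =>
        obtain ⟨i, rfl⟩ := hw
        exact hα i v hv
      | zero => rfl
      | add w w' _ _ h h' => rw [Pi.add_apply, h, h', add_zero]
      | smul x w _ h => rw [Pi.smul_apply, h, smul_zero]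
    have h4 := h3 _ h
    rw [Pi.single_eq_same] at h4
    exact one_ne_zero h4
  have h3 := finrank_span_eq_card h2
  rw [Fin.range_cons, Fintype.card_fin] at h3
  rw [weightSpace, h1]
  exact h3

end BaseCoordinates

section Coherence

variable {𝕜 : Type} [RCLike 𝕜] {m : ℕ}

theorem sum_toGerm_mul {M : AnMfd.{u} 𝕜 m} {p : M} {κ : Type*} (T : Finset κ) (f g : κ → M → 𝕜)
    (hf : ∀ b, IsAnAt (f b) p) (hg : ∀ b, IsAnAt (g b) p) :
    ∃ h : IsAnAt (fun x => ∑ b ∈ T, f b x * g b x) p,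
      ∑ b ∈ T, toGerm (f b) (hf b) * toGerm (g b) (hg b) =
        toGerm (fun x => ∑ b ∈ T, f b x * g b x) h := by
  classical
  induction T using Finset.induction_on with
  | empty =>
    refine ⟨by simpa using isAnAt_const 0, ?_⟩
    rw [Finset.sum_empty]
    simp only [Finset.sum_empty]
    rfl
  | insert i S hi ih =>
    obtain ⟨h, ih⟩ := ih
    simp only [Finset.sum_insert hi]
    exact ⟨((hf i).mul (hg i)).add h, by rw [ih]; rfl⟩

/-- Membership in the span of a family of analytic vector fields is an open condition. -/
theorem eventually_mem_span {M : AnMfd.{u} 𝕜 m} {e : OpenPartialHomeomorph M (Fin m → 𝕜)}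
    (he : e ∈ IsManifold.maximalAtlas 𝓘(𝕜, Fin m → 𝕜) ω M) {V : Set M}
    (hVe : V ⊆ e.source) {κ : Type} [Fintype κ] {β : κ → Fin m → M → 𝕜}
    {hβ : ∀ b k, ∀ q ∈ V, IsAnAt (β b k) q} {B : ∀ q ∈ V, κ → VField q}
    (hB : ∀ q (hq : q ∈ V) b k,
      B q hq b (chartGerm he (hVe hq) k) = toGerm (β b k) (hβ b k q hq))
    {β' : Fin m → M → 𝕜} {hβ' : ∀ k, ∀ q ∈ V, IsAnAt (β' k) q} {B' : ∀ q ∈ V, VField q}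
    (hB' : ∀ q (hq : q ∈ V) k, B' q hq (chartGerm he (hVe hq) k) = toGerm (β' k) (hβ' k q hq))
    {p : M} (hp : p ∈ V) (h : B' p hp ∈ Submodule.span (AnGerm p) (Set.range (B p hp))) :
    ∀ᶠ q in 𝓝 p, ∀ hq : q ∈ V, B' q hq ∈ Submodule.span (AnGerm q) (Set.range (B q hq)) := by
  obtain ⟨φ, hφ⟩ := (Submodule.mem_span_range_iff_exists_fun _).1 h
  have h1 : ∀ b, ∃ (f : M → 𝕜) (hf : IsAnAt f p), toGerm f hf = φ b := fun b => by
    obtain ⟨f, hf, h⟩ := (φ b).2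
    exact ⟨f, hf, Subtype.ext h⟩
  choose f hf hfφ using h1
  have h2 : ∀ k, β' k =ᶠ[𝓝 p] fun x => ∑ b, f b x * β b k x := by
    intro k
    obtain ⟨h3, h4⟩ := sum_toGerm_mul Finset.univ f (fun b => β b k) hf fun b => hβ b k p hp
    have h5 := hB' p hp k
    rw [← hφ, vfield_sum_apply] at h5
    have h6 : ∀ b ∈ Finset.univ, (φ b • B p hp b) (chartGerm he (hVe hp) k) =
        toGerm (f b) (hf b) * toGerm (β b k) (hβ b k p hp) := fun b _ => by
      rw [Derivation.smul_apply, hB, smul_eq_mul, hfφ]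
    rw [Finset.sum_congr rfl h6, h4] at h5
    exact (toGerm_eq_iff.1 h5).symm
  have h3 : ∀ᶠ q in 𝓝 p, ∀ k, β' k =ᶠ[𝓝 q] fun x => ∑ b, f b x * β b k x :=
    Filter.eventually_all.2 fun k => eventually_eventually_nhds.2 (h2 k)
  have h4 : ∀ᶠ q in 𝓝 p, ∀ b, IsAnAt (f b) q :=
    Filter.eventually_all.2 fun b => AdaptedChart.IsAnAt.eventually (hf b)
  filter_upwards [h3, h4] with q h5 h6 hq
  have h7 : B' q hq = ∑ b, toGerm (f b) (h6 b) • B q hq b := by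
    refine vfield_ext he (hVe hq) fun k => ?_
    obtain ⟨h8, h9⟩ := sum_toGerm_mul Finset.univ f (fun b => β b k) h6 fun b => hβ b k q hq
    rw [hB', vfield_sum_apply]
    have h10 : ∀ b ∈ Finset.univ, (toGerm (f b) (h6 b) • B q hq b) (chartGerm he (hVe hq) k) =
        toGerm (f b) (h6 b) * toGerm (β b k) (hβ b k q hq) := fun b _ => by
      rw [Derivation.smul_apply, hB, smul_eq_mul]
    rw [Finset.sum_congr rfl h10, h9]
    exact toGerm_eq_iff.2 (h5 k)
  rw [h7]
  exact Submodule.sum_mem _ fun b _ => Submodule.smul_mem _ _ (Submodule.subset_span ⟨b, rfl⟩)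

/-- The vector fields with the coefficients `β b` in the coordinates `e`. -/
def chartFields {M : AnMfd.{u} 𝕜 m} {e : OpenPartialHomeomorph M (Fin m → 𝕜)}
    (he : e ∈ IsManifold.maximalAtlas 𝓘(𝕜, Fin m → 𝕜) ω M) {κ : Type} (β : κ → Fin m → M → 𝕜)
    (hβ : ∀ b k, ∀ q ∈ e.source, IsAnAt (β b k) q) {q : M} (hq : q ∈ e.source) :
    Set (VField q) :=
  {D | ∃ b, ∀ k, D (chartGerm he hq k) = toGerm (β b k) (hβ b k q hq)}

theorem exists_range_eq_chartFields {M : AnMfd.{u} 𝕜 m}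
    {e : OpenPartialHomeomorph M (Fin m → 𝕜)}
    (he : e ∈ IsManifold.maximalAtlas 𝓘(𝕜, Fin m → 𝕜) ω M) {κ : Type} (β : κ → Fin m → M → 𝕜)
    (hβ : ∀ b k, ∀ q ∈ e.source, IsAnAt (β b k) q) {q : M} (hq : q ∈ e.source) :
    ∃ B : κ → VField q, (∀ b k, B b (chartGerm he hq k) = toGerm (β b k) (hβ b k q hq)) ∧
      chartFields he β hβ hq = Set.range B := by
  choose B hB using fun b => exists_vfield he hq fun k => toGerm (β b k) (hβ b k q hq)
  refine ⟨B, hB, Set.Subset.antisymm ?_ ?_⟩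
  · rintro D ⟨b, hb⟩
    exact ⟨b, vfield_ext he hq fun k => (hB b k).trans (hb k).symm⟩
  · rintro _ ⟨b, rfl⟩
    exact ⟨b, hB b⟩

/-- Generators of a coherent sheaf of vector fields at a point generate it near the point. -/
theorem FolSub.IsFoliatedSubring.eventually_eq_span {X : FolSub.{u} 𝕜 m}
    (hX : X.IsFoliatedSubring) {e : OpenPartialHomeomorph X.M (Fin m → 𝕜)}
    (he : e ∈ IsManifold.maximalAtlas 𝓘(𝕜, Fin m → 𝕜) ω X.M) {κ : Type} [Fintype κ]
    (β : κ → Fin m → X.M → 𝕜) (hβ : ∀ b k, ∀ q ∈ e.source, IsAnAt (β b k) q) {p : X.M}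
    (hp : p ∈ e.source) (h : X.θ p = Submodule.span (AnGerm p) (chartFields he β hβ hp)) :
    ∀ᶠ q in 𝓝 p, ∀ hq : q ∈ e.source,
      X.θ q = Submodule.span (AnGerm q) (chartFields he β hβ hq) := by
  obtain ⟨U, hU, hpU, s, D, hD, hθ⟩ := hX.coherent p
  have hV : IsOpen (U ∩ e.source) := hU.inter e.open_source
  have hcoord : ∀ k, ∀ q ∈ U ∩ e.source, IsAnAt (fun y => e y k) q := fun k q hq =>
    contMDiffAt_pi_space.1 (contMDiffAt_of_mem_maximalAtlas he hq.2) k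
  choose g hg hgD using fun i k => hD i (U ∩ e.source) hV inter_subset_left (fun y => e y k)
    (hcoord k)
  choose B hB hBr using fun (q : X.M) (hq : q ∈ e.source) =>
    exists_range_eq_chartFields he β hβ hq
  have hpV : p ∈ U ∩ e.source := ⟨hpU, hp⟩
  have h1 : ∀ᶠ q in 𝓝 p, ∀ i, ∀ hq : q ∈ U ∩ e.source,
      D i q ∈ Submodule.span (AnGerm q) (Set.range (B q hq.2)) := by
    refine Filter.eventually_all.2 fun i => ?_
    refine eventually_mem_span he inter_subset_right (β := β)
      (hβ := fun b k q hq => hβ b k q hq.2) (B := fun q hq => B q hq.2)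
      (fun q hq b k => hB q hq.2 b k) (β' := g i) (hβ' := hg i) (B' := fun q _ => D i q)
      (fun q hq k => hgD i k q hq) hpV ?_
    rw [← hBr, ← h, hθ p hpU]
    exact Submodule.subset_span ⟨i, rfl⟩
  have h2 : ∀ᶠ q in 𝓝 p, ∀ b, ∀ hq : q ∈ U ∩ e.source,
      B q hq.2 b ∈ Submodule.span (AnGerm q) (Set.range fun i => D i q) := by
    refine Filter.eventually_all.2 fun b => ?_
    refine eventually_mem_span he inter_subset_right (β := g) (hβ := hg)
      (B := fun q _ i => D i q) (fun q hq i k => hgD i k q hq) (β' := β b)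
      (hβ' := fun k q hq => hβ b k q hq.2) (B' := fun q hq => B q hq.2 b)
      (fun q hq k => hB q hq.2 b k) hpV ?_
    rw [← hθ p hpU, h, hBr]
    exact Submodule.subset_span ⟨b, rfl⟩
  filter_upwards [h1, h2, hV.mem_nhds hpV] with q h3 h4 hqV hq
  rw [hθ q hqV.1, hBr]
  refine le_antisymm (Submodule.span_le.2 ?_) (Submodule.span_le.2 ?_)
  · rintro _ ⟨i, rfl⟩
    exact h3 i hqV
  · rintro _ ⟨b, rfl⟩
    exact h4 b hqV

theorem strictField_id {N : AnMfd.{u} 𝕜 m} (E' : List (Set N)) (q : N)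
    (Θ : Submodule (AnGerm q) (VField q)) :
    strictField (ContMDiffMap.id : AnMap N N) E' q Θ = derLog E' q ⊓ Θ := by
  have hid : ∀ f : AnGerm q, pull (ContMDiffMap.id : AnMap N N) q f = f := fun f => by
    induction f using germ_induction with
    | h f hf => rfl
  have key : ∀ φ ∈ Submodule.span (AnGerm q) {φ : AnGerm q → AnGerm q |
      ∃ D ∈ Θ, φ = fun f => pull (ContMDiffMap.id : AnMap N N) q (D f)}, ∃ D ∈ Θ, φ = D := by
    intro φ hφ
    induction hφ using Submodule.span_induction with
    | mem φ hφ =>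
      obtain ⟨D, hD, rfl⟩ := hφ
      exact ⟨D, hD, funext fun f => hid _⟩
    | zero => exact ⟨0, zero_mem _, rfl⟩
    | add φ₁ φ₂ _ _ ih₁ ih₂ =>
      obtain ⟨D₁, h₁, rfl⟩ := ih₁
      obtain ⟨D₂, h₂, rfl⟩ := ih₂
      exact ⟨D₁ + D₂, add_mem h₁ h₂, rfl⟩
    | smul a φ _ ih =>
      obtain ⟨D, h, rfl⟩ := ih
      exact ⟨a • D, Submodule.smul_mem _ _ h, rfl⟩
  apply le_antisymm
  · rintro D ⟨hD1, hD2⟩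
    refine ⟨hD1, ?_⟩
    obtain ⟨D', hD', h⟩ := key _ hD2
    have : D = D' := Derivation.ext fun f => by
      rw [← congrFun h f]
      exact congrArg D (hid f).symm
    rw [this]
    exact hD'
  · rintro D ⟨hD1, hD2⟩
    refine ⟨hD1, Submodule.subset_span ⟨D, hD2, funext fun f => ?_⟩⟩
    exact (congrArg D (hid f)).trans (hid _).symm

theorem det_mem_span_singleton {R : Type*} [CommRing R] {k : ℕ} (hk : 2 ≤ k) (x : R)
    (a b : Fin k → R) (c : Fin k → Fin k → R) :
    (Matrix.of fun i j => x * c i j + b j * a i).det ∈ Ideal.span {x} := by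
  have : Nontrivial (Fin k) := Fin.nontrivial_iff_two_le.2 hk
  rw [← Ideal.Quotient.eq_zero_iff_mem, RingHom.map_det]
  have h1 : (Ideal.Quotient.mk (Ideal.span {x})).mapMatrix
      (Matrix.of fun i j => x * c i j + b j * a i) =
      Matrix.vecMulVec (fun i => Ideal.Quotient.mk (Ideal.span {x}) (a i))
        fun j => Ideal.Quotient.mk (Ideal.span {x}) (b j) := by
    ext i j
    rw [RingHom.mapMatrix_apply, Matrix.map_apply, Matrix.of_apply, Matrix.vecMulVec_apply,
      map_add, map_mul, map_mul, Ideal.Quotient.eq_zero_iff_mem.2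
        (Ideal.mem_span_singleton_self x), zero_mul, zero_add, mul_comm]
  rw [h1, Matrix.det_vecMulVec]

theorem fitting_le_span_singleton {M : AnMfd.{u} 𝕜 m} {p : M}
    (Θ : Submodule (AnGerm p) (VField p)) {k : ℕ} (hk : 2 ≤ k) (x : AnGerm p) :
    fitting Θ k (Ideal.span {x}) ≤ Ideal.span {x} := by
  refine Ideal.span_le.2 ?_
  rintro _ ⟨D, f, -, hf, rfl⟩
  choose h hh using fun j => Ideal.mem_span_singleton.1 (hf j)
  have h1 : (Matrix.of fun i j => D i (f j)) =
      Matrix.of fun i j => x * D i (h j) + h j * D i x := by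
    ext i j
    rw [Matrix.of_apply, Matrix.of_apply, hh j, Derivation.leibniz, smul_eq_mul, smul_eq_mul]
  rw [h1]
  exact det_mem_span_singleton hk x _ _ _

/-- The coefficients of the coordinate fields with index in `reg`, and of the diagonal fields. -/
noncomputable def monoCoeff {M : AnMfd.{u} 𝕜 m} (e : OpenPartialHomeomorph M (Fin m → 𝕜))
    (reg : Finset (Fin m)) {s : ℕ} (α : Fin s → Fin m → ℚ) :
    reg ⊕ Fin s → Fin m → M → 𝕜 :=
  Sum.elim (fun j k _ => if k = j then 1 else 0) fun i k x => (α i k : 𝕜) * e x k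

theorem isAnAt_monoCoeff {M : AnMfd.{u} 𝕜 m} {e : OpenPartialHomeomorph M (Fin m → 𝕜)}
    (he : e ∈ IsManifold.maximalAtlas 𝓘(𝕜, Fin m → 𝕜) ω M) (reg : Finset (Fin m)) {s : ℕ}
    (α : Fin s → Fin m → ℚ) (b : reg ⊕ Fin s) (k : Fin m) (q : M) (hq : q ∈ e.source) :
    IsAnAt (monoCoeff e reg α b k) q := by
  rcases b with j | i
  · exact isAnAt_const _
  · exact (isAnAt_const _).mul
      (contMDiffAt_pi_space.1 (contMDiffAt_of_mem_maximalAtlas he hq) k)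

section

variable {M : AnMfd.{u} 𝕜 m} {e : OpenPartialHomeomorph M (Fin m → 𝕜)}
    (he : e ∈ IsManifold.maximalAtlas 𝓘(𝕜, Fin m → 𝕜) ω M) {reg : Finset (Fin m)} {s : ℕ}
    {α : Fin s → Fin m → ℚ} {q : M} (hq : q ∈ e.source)

theorem toGerm_monoCoeff_inl (j : reg) (k : Fin m) :
    toGerm (monoCoeff e reg α (Sum.inl j) k) (isAnAt_monoCoeff he reg α (Sum.inl j) k q hq) =
      if k = j then 1 else 0 := by
  refine Subtype.ext ?_
  change ((fun _ => if k = (j : Fin m) then 1 else 0 : M → 𝕜) : Germ (𝓝 q) 𝕜) = _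
  split_ifs <;> rfl

theorem toGerm_monoCoeff_inr (i : Fin s) (k : Fin m) :
    toGerm (monoCoeff e reg α (Sum.inr i) k) (isAnAt_monoCoeff he reg α (Sum.inr i) k q hq) =
      algebraMap 𝕜 _ (α i k : 𝕜) * chartGerm he hq k := by
  rw [algebraMap_germ]
  rfl

theorem span_chartFields_monoCoeff {p : M} (c : CenteredChart p)
    (hα : ∀ i, ∀ j ∈ reg, α i j = 0) :
    (fun j => coordDer c j) '' (reg : Set (Fin m)) ∪
        (Set.range fun i => diagField c regᶜ (α i)) =
      chartFields c.mem_atlas (monoCoeff c.e reg α) (isAnAt_monoCoeff c.mem_atlas reg α)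
        c.mem_source := by
  have h1 : ∀ (i : Fin s) (k : Fin m), diagField c regᶜ (α i) (coordGerm c k) =
      algebraMap 𝕜 _ (α i k : 𝕜) * coordGerm c k := fun i k =>
    diagField_coordGerm c _ _ (fun t ht => hα i t (by simpa using ht)) k
  refine Set.Subset.antisymm ?_ ?_
  · rintro _ (⟨j, hj, rfl⟩ | ⟨i, rfl⟩)
    · exact ⟨Sum.inl ⟨j, hj⟩, fun k => by
        rw [toGerm_monoCoeff_inl c.mem_atlas c.mem_source, chartGerm_centered]
        exact coordDer_coordGerm c j k⟩
    · exact ⟨Sum.inr i, fun k => by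
        rw [toGerm_monoCoeff_inr c.mem_atlas c.mem_source, chartGerm_centered]
        exact h1 i k⟩
  · rintro D ⟨j | i, hD⟩
    · refine Or.inl ⟨j, j.2, vfield_ext_coord c fun k => ?_⟩
      have h2 := hD k
      rw [toGerm_monoCoeff_inl c.mem_atlas c.mem_source, chartGerm_centered] at h2
      rw [h2]
      exact coordDer_coordGerm c j k
    · refine Or.inr ⟨i, vfield_ext_coord c fun k => ?_⟩
      have h2 := hD k
      rw [toGerm_monoCoeff_inr c.mem_atlas c.mem_source, chartGerm_centered] at h2
      rw [h2]
      exact h1 i k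

/-- The vector fields, among those with monomial coefficients, that are tangent to `{v = 0}`. -/
theorem derLog_inf_span_chartFields {v : Fin m} (hv : v ∈ reg)
    (hα : ∀ i, ∀ j ∈ reg, α i j = 0) {E : List (Set M)} {A : Set (Fin m → ℚ)}
    (hA : ∀ w, w ∈ A ↔ (fun t => if t ∈ insert v regᶜ then w t else 0) ∈ weightSpace reg v α)
    (hE1 : ∀ D ∈ toricFields he hq (insert v regᶜ) A, D ∈ derLog E q)
    (hE2 : ∀ D ∈ derLog E q, chartGerm he hq v ∣ D (chartGerm he hq v)) :
    derLog E q ⊓ Submodule.span (AnGerm q)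
        (chartFields he (monoCoeff e reg α) (isAnAt_monoCoeff he reg α) hq) =
      Submodule.span (AnGerm q) (toricFields he hq (insert v regᶜ) A) := by
  classical
  obtain ⟨B, hB, hBr⟩ := exists_range_eq_chartFields he (monoCoeff e reg α)
    (isAnAt_monoCoeff he reg α) hq
  rw [hBr]
  have hBl : ∀ j k, B (Sum.inl j) (chartGerm he hq k) = if k = (j : Fin m) then 1 else 0 :=
    fun j k => (hB _ k).trans (toGerm_monoCoeff_inl he hq j k)
  have hBi : ∀ i k, B (Sum.inr i) (chartGerm he hq k) =
      algebraMap 𝕜 _ (α i k : 𝕜) * chartGerm he hq k :=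
    fun i k => (hB _ k).trans (toGerm_monoCoeff_inr he hq i k)
  have hTor : ∀ t, t ∉ insert v regᶜ ↔ t ≠ v ∧ t ∈ reg := fun t => by
    rw [Finset.mem_insert, not_or, Finset.mem_compl, not_not]
  have hα' : ∀ i, (fun j => if j ∈ reg then 0 else α i j) = α i := fun i => funext fun j => by
    split_ifs with h
    · exact (hα i j h).symm
    · rfl
  have hαv : ∀ i, (fun t => if t ∈ insert v regᶜ then α i t else 0) = α i :=
    fun i => funext fun t => by
      split_ifs with h
      · rfl
      · exact (hα i t ((hTor t).1 h).2).symm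
  refine le_antisymm ?_ ?_
  · rintro D ⟨hD, hDs⟩
    obtain ⟨φ, rfl⟩ := (Submodule.mem_span_range_iff_exists_fun _).1 hDs
    obtain ⟨h, hh⟩ := hE2 _ hD
    have h1 : φ (Sum.inl ⟨v, hv⟩) = chartGerm he hq v * h := by
      rw [← hh, vfield_sum_apply, Finset.sum_eq_single (Sum.inl ⟨v, hv⟩)]
      · rw [Derivation.smul_apply, hBl, if_pos rfl, smul_eq_mul, mul_one]
      · rintro (j | i) _ hne
        · rw [Derivation.smul_apply, hBl, if_neg, smul_zero]
          rintro rfl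
          exact hne rfl
        · rw [Derivation.smul_apply, hBi, hα i v hv, Rat.cast_zero, map_zero, zero_mul, smul_zero]
      · exact fun h => absurd (Finset.mem_univ _) h
    refine Submodule.sum_mem _ ?_
    rintro (j | i) _
    · by_cases hj : (j : Fin m) = v
      · obtain rfl : j = ⟨v, hv⟩ := Subtype.ext hj
        rw [h1, mul_comm, mul_smul]
        refine Submodule.smul_mem _ _ (Submodule.subset_span
          ⟨Pi.single (M := fun _ => ℚ) v 1, ?_, ?_, ?_⟩)
        · rw [hA]
          refine Submodule.subset_span (Or.inl (funext fun t => ?_))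
          split_ifs with ht
          · rfl
          · exact (Pi.single_eq_of_ne (M := fun _ => ℚ) ((hTor t).1 ht).1 _).symm
        · intro t _
          rw [Derivation.smul_apply, hBl, smul_eq_mul]
          split_ifs with htv
          · change t = v at htv
            subst htv
            rw [Pi.single_eq_same, Rat.cast_one, map_one, mul_comm]
          · rw [Pi.single_eq_of_ne htv, Rat.cast_zero, map_zero, mul_zero, zero_mul]
        · intro t ht
          refine ⟨0, ?_⟩
          rw [Derivation.smul_apply, hBl, if_neg ((hTor t).1 ht).1, smul_zero, map_zero]
      · refine Submodule.smul_mem _ _ (Submodule.subset_span ⟨0, ?_, ?_, ?_⟩)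
        · rw [hA]
          convert! Submodule.zero_mem (weightSpace reg v α) using 1
          ext t
          split_ifs <;> rfl
        · intro t ht
          rw [hBl, if_neg, Pi.zero_apply, Rat.cast_zero, map_zero, zero_mul]
          rintro rfl
          rw [Finset.mem_insert, Finset.mem_compl] at ht
          exact ht.elim hj fun h => h j.2
        · intro t _
          rw [hBl]
          split_ifs
          · exact ⟨1, (map_one _).symm⟩
          · exact ⟨0, (map_zero _).symm⟩
    · refine Submodule.smul_mem _ _ (Submodule.subset_span ⟨α i, ?_, fun t _ => hBi i t, ?_⟩)
      · rw [hA, hαv]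
        exact Submodule.subset_span (Or.inr ⟨i, hα' i⟩)
      · intro t ht
        refine ⟨0, ?_⟩
        rw [hBi, hα i t ((hTor t).1 ht).2, Rat.cast_zero, map_zero, zero_mul]
  · rw [Submodule.span_le]
    intro D hD
    refine ⟨hE1 D hD, ?_⟩
    obtain ⟨w, hw, h1, h2⟩ := hD
    rw [hA] at hw
    have hdiag : ∀ w ∈ weightSpace reg v α, ∀ D : VField q,
        (∀ t, D (chartGerm he hq t) = algebraMap 𝕜 _ (w t : 𝕜) * chartGerm he hq t) →
        D ∈ Submodule.span (AnGerm q) (Set.range B) := by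
      intro w hw
      induction hw using Submodule.span_induction with
      | mem w hw =>
        intro D hD
        rcases hw with rfl | ⟨i, rfl⟩
        · have h3 : D = chartGerm he hq v • B (Sum.inl ⟨v, hv⟩) := vfield_ext he hq fun k => by
            rw [hD, Derivation.smul_apply, hBl, smul_eq_mul]
            split_ifs with hk
            · change k = v at hk
              subst hk
              rw [Pi.single_eq_same, Rat.cast_one, map_one, mul_comm]
            · rw [Pi.single_eq_of_ne hk, Rat.cast_zero, map_zero, mul_zero, zero_mul]
          rw [h3]
          exact Submodule.smul_mem _ _ (Submodule.subset_span ⟨_, rfl⟩)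
        · have h3 : D = B (Sum.inr i) := vfield_ext he hq fun k => by
            rw [hD, hBi]
            exact congrArg (fun w : Fin m → ℚ => algebraMap 𝕜 (AnGerm q) (w k : 𝕜) *
              chartGerm he hq k) (hα' i)
          rw [h3]
          exact Submodule.subset_span ⟨_, rfl⟩
      | zero =>
        intro D hD
        have h3 : D = 0 := vfield_ext he hq fun k => by
          rw [hD, Pi.zero_apply, Rat.cast_zero, map_zero, zero_mul]
          rfl
        rw [h3]
        exact zero_mem _
      | add w w' _ _ h h' =>
        intro D hD
        obtain ⟨D₁, hD₁⟩ := exists_vfield he hq fun t =>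
          algebraMap 𝕜 _ (w t : 𝕜) * chartGerm he hq t
        obtain ⟨D₂, hD₂⟩ := exists_vfield he hq fun t =>
          algebraMap 𝕜 _ (w' t : 𝕜) * chartGerm he hq t
        have h3 : D = D₁ + D₂ := vfield_ext he hq fun k => by
          rw [hD, Derivation.add_apply, hD₁, hD₂, Pi.add_apply, Rat.cast_add, map_add, add_mul]
        rw [h3]
        exact add_mem (h D₁ hD₁) (h' D₂ hD₂)
      | smul x w _ h =>
        intro D hD
        obtain ⟨D₁, hD₁⟩ := exists_vfield he hq fun t =>
          algebraMap 𝕜 _ (w t : 𝕜) * chartGerm he hq t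
        have h3 : D = algebraMap 𝕜 (AnGerm q) (x : 𝕜) • D₁ := vfield_ext he hq fun k => by
          rw [hD, Derivation.smul_apply, hD₁, Pi.smul_apply, smul_eq_mul, smul_eq_mul,
            Rat.cast_mul, map_mul, mul_assoc]
        rw [h3]
        exact Submodule.smul_mem _ _ (h D₁ hD₁)
    choose k hk using fun t : {t // t ∉ insert v regᶜ} => h2 t t.2
    let k' : Fin m → 𝕜 := fun t => if ht : t ∉ insert v regᶜ then k ⟨t, ht⟩ else 0
    have hk' : ∀ t (_ : t ∉ insert v regᶜ),
        D (chartGerm he hq t) = algebraMap 𝕜 _ (k' t) := fun t ht => by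
      rw [hk ⟨t, ht⟩]
      simp only [k', dif_pos ht]
    have hk0 : ∀ t ∈ insert v regᶜ, k' t = 0 := fun t ht => dif_neg (not_not.2 ht)
    obtain ⟨D₁, hD₁⟩ := exists_vfield he hq fun t => algebraMap 𝕜 _
      (((if t ∈ insert v regᶜ then w t else 0 : ℚ)) : 𝕜) * chartGerm he hq t
    have h3 : D = D₁ + ∑ j : reg, algebraMap 𝕜 (AnGerm q) (k' j) • B (Sum.inl j) :=
      vfield_ext he hq fun t => by
        rw [Derivation.add_apply, hD₁, vfield_sum_apply]
        by_cases ht : t ∈ insert v regᶜ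
        · rw [if_pos ht, h1 t ht, Finset.sum_eq_zero, add_zero]
          intro j _
          rw [Derivation.smul_apply, hBl]
          split_ifs with h3
          · rw [← h3, hk0 t ht, map_zero, zero_smul]
          · rw [smul_zero]
        · rw [if_neg ht, hk' t ht, Rat.cast_zero, map_zero, zero_mul, zero_add,
            Finset.sum_eq_single ⟨t, ((hTor t).1 ht).2⟩]
          · rw [Derivation.smul_apply, hBl, if_pos rfl, smul_eq_mul, mul_one]
          · intro j _ hj
            rw [Derivation.smul_apply, hBl, if_neg, smul_zero]
            rintro rfl
            exact hj rfl
          · exact fun h => absurd (Finset.mem_univ _) h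
    rw [SetLike.mem_coe, h3]
    exact add_mem (hdiag _ hw D₁ hD₁) (Submodule.sum_mem _ fun j _ =>
      Submodule.smul_mem _ _ (Submodule.subset_span ⟨_, rfl⟩))

end

end Coherence

section InitialStage

variable {𝕜 : Type} [RCLike 𝕜] {m : ℕ}

theorem restrict_field {X : FolSub.{u} 𝕜 m} {e : OpenPartialHomeomorph X.M (Fin m → 𝕜)}
    (he : e ∈ IsManifold.maximalAtlas 𝓘(𝕜, Fin m → 𝕜) ω X.M) {U : TopologicalSpace.Opens X.M}
    {ψ : OpenPartialHomeomorph (X.M.openSub U) (Fin m → 𝕜)}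
    (hψ : ψ ∈ IsManifold.maximalAtlas 𝓘(𝕜, Fin m → 𝕜) ω (X.M.openSub U))
    (hψe : ∀ y, ψ y = e y.1) {q : X.M.openSub U} (hq : q.1 ∈ e.source) (hq' : q ∈ ψ.source)
    {reg : Finset (Fin m)} {s : ℕ} {α : Fin s → Fin m → ℚ}
    (hθ : X.θ q.1 = Submodule.span (AnGerm q.1)
      (chartFields he (monoCoeff e reg α) (isAnAt_monoCoeff he reg α) hq))
    (hE : ∀ H ∈ X.E, (∀ y : X.M.openSub U, y.1 ∉ H) ∨
      ∃ t ∉ reg, ∀ y : X.M.openSub U, y.1 ∈ H ↔ ψ y t = 0) :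
    (X.restrict U).θ q = Submodule.span (AnGerm q)
      (chartFields hψ (monoCoeff ψ reg α) (isAnAt_monoCoeff hψ reg α) hq') := by
  have hpc : ∀ k, pull (X.M.incl U) q (chartGerm he (x := X.M.incl U q) hq k) =
      chartGerm hψ hq' k := fun k =>
    Subtype.ext (Germ.coe_eq.2 (Eventually.of_forall fun y => (congrFun (hψe y) k).symm))
  have hpm : ∀ b k, pull (X.M.incl U) q (toGerm (monoCoeff e reg α b k)
      (isAnAt_monoCoeff he reg α b k (X.M.incl U q) hq)) =
      toGerm (monoCoeff ψ reg α b k) (isAnAt_monoCoeff hψ reg α b k q hq') := fun b k =>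
    Subtype.ext (Germ.coe_eq.2 (Eventually.of_forall fun y => by
      rcases b with j | i
      · rfl
      · exact congrArg (fun z : Fin m → 𝕜 => (α i k : 𝕜) * z k) (hψe y).symm))
  have hlift : ∀ b (D : VField (X.M.incl U q)) (D' : VField q),
      (∀ k, D (chartGerm he (x := X.M.incl U q) hq k) = toGerm (monoCoeff e reg α b k)
        (isAnAt_monoCoeff he reg α b k (X.M.incl U q) hq)) →
      (∀ k, D' (chartGerm hψ hq' k) = toGerm (monoCoeff ψ reg α b k)
        (isAnAt_monoCoeff hψ reg α b k q hq')) → IsLift (X.M.incl U) D' D :=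
    fun b D D' hD hD' => isLift_of_chart (X.M.incl U) he hq fun k => by
      rw [hpc, hD', hD, hpm]
  change strictField (X.M.incl U) _ q (X.θ q.1) = _
  rw [hθ]
  refine strictField_span (X.M.incl U) _ q _ _ ?_ ?_ ?_ ?_
  · rintro D ⟨b, hb⟩
    obtain ⟨D', hD'⟩ := exists_vfield hψ hq' fun k => toGerm (monoCoeff ψ reg α b k)
      (isAnAt_monoCoeff hψ reg α b k q hq')
    exact ⟨D', ⟨b, hD'⟩, hlift b D D' hb hD'⟩
  · rintro D' ⟨b, hb⟩
    obtain ⟨D, hD⟩ := exists_vfield he (x := X.M.incl U q) hq fun k =>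
      toGerm (monoCoeff e reg α b k) (isAnAt_monoCoeff he reg α b k (X.M.incl U q) hq)
    exact ⟨D, ⟨b, hD⟩, hlift b D D' hD hb⟩
  · intro D' h
    refine vfield_ext hψ hq' fun k => ?_
    rw [← hpc, h]
    rfl
  · rintro D' ⟨b, hb⟩
    refine mem_derLog_of_chart hψ hq' fun H hH => ?_
    obtain ⟨H, hH', rfl⟩ := List.mem_map.1 hH
    refine (hE H hH').imp (fun h => Eventually.of_forall h) ?_
    rintro ⟨t, ht, h⟩
    refine ⟨t, Eventually.of_forall h, ?_⟩
    rw [hb]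
    rcases b with j | i
    · rw [toGerm_monoCoeff_inl hψ hq', if_neg fun h : t = j => ht (h ▸ j.2)]
      exact dvd_zero _
    · rw [toGerm_monoCoeff_inr hψ hq']
      exact dvd_mul_left _ _

theorem isBlowup_id {N : AnMfd.{u} 𝕜 m} {ψ : OpenPartialHomeomorph N (Fin m → 𝕜)}
    (hψ : ψ ∈ IsManifold.maximalAtlas 𝓘(𝕜, Fin m → 𝕜) ω N) (hs : ∀ y, y ∈ ψ.source)
    {v : Fin m} {C : Set N} (hC : ∀ y, y ∈ C ↔ ψ y v = 0) :
    IsBlowup (ContMDiffMap.id : AnMap N N) C := by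
  have hb : ∀ y : Fin m → 𝕜, blowMap {v} v y = y := fun y => funext fun j => if_neg fun h =>
    h.2 (Finset.mem_singleton.1 h.1)
  refine ⟨fun p _ => ⟨univ, isOpen_univ, mem_univ _, id, contMDiff_id.contMDiffOn,
    fun _ _ => rfl, fun _ _ => rfl⟩, fun p _ => ⟨ψ, hψ, hs p, {v}, ⟨v, Finset.mem_singleton_self v⟩,
    fun x _ => ?_, fun _ => ψ, fun i hi => ⟨hψ, fun y hy => ⟨hy, ?_⟩, ?_⟩, fun y hy => ⟨v,
      Finset.mem_singleton_self v, hy⟩⟩⟩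
  · rw [hC]
    simp
  · rw [Finset.mem_singleton.1 hi, hb]
    rfl
  · rw [Finset.mem_singleton.1 hi]
    ext y
    rw [mem_preimage, hb]

theorem isAdmissibleCenter_hyperplane {X : FolSub.{u} 𝕜 m}
    {ψ : OpenPartialHomeomorph X.M (Fin m → 𝕜)}
    (hψ : ψ ∈ IsManifold.maximalAtlas 𝓘(𝕜, Fin m → 𝕜) ω X.M) (hs : ∀ y, y ∈ ψ.source)
    {v : Fin m} {C : Set X.M} (hC : ∀ y, y ∈ C ↔ ψ y v = 0) {k : Fin X.E.length → Fin m}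
    (hk : ∀ i, (X.E.get i).Nonempty → ∀ y, y ∈ X.E.get i ↔ ψ y (k i) = 0)
    (hinj : ∀ i i', (X.E.get i).Nonempty → (X.E.get i').Nonempty → k i = k i' → i = i')
    (hd : 1 ≤ X.leafDim) (hD : ∀ q, ∃ D ∈ X.θ q, D (chartGerm hψ (hs q) v) = 1) :
    X.IsAdmissibleCenter C := by
  have hcont : Continuous fun y => ψ y v := (continuous_apply v).comp
    (continuousOn_univ.1 (ψ.continuousOn.mono fun y _ => hs y))
  have hv : ∀ q, vanIdeal C q = Ideal.span {chartGerm hψ (hs q) v} := fun q => by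
    have h := vanIdeal_eq_span hψ (hs q) {v} (C := C)
      (Eventually.of_forall fun y => by rw [hC]; simp)
    rwa [Finset.coe_singleton, Set.image_singleton] at h
  refine ⟨?_, fun q hq => ?_, 1, hd, fun q hq j _ => ⟨fun hj => ?_, fun hj => ?_⟩⟩
  · have h : C = {y | ψ y v = 0} := Set.ext hC
    rw [h]
    exact isClosed_eq hcont continuous_const
  · obtain ⟨c, h1, h2⟩ := exists_centeredChart hψ (hs q)
    refine ⟨c, {v}, k, ⟨v, Finset.mem_singleton_self v⟩, fun x _ => ?_,
      fun i i' hi hi' => hinj i i' ⟨q, hi⟩ ⟨q, hi'⟩, fun i hi x _ => ?_⟩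
    · simp only [Finset.mem_singleton, forall_eq]
      rw [h2, Pi.sub_apply, (hC q).1 hq, sub_zero, hC]
    · rw [h2, Pi.sub_apply, (hk i ⟨q, hi⟩ q).1 hi, sub_zero, hk i ⟨q, hi⟩]
  · obtain ⟨D, hD, hDv⟩ := hD q
    rw [Ideal.eq_top_iff_one]
    refine Ideal.subset_span ⟨fun _ => D, fun _ => chartGerm hψ (hs q) v, fun _ => hD,
      fun _ => ?_, ?_⟩
    · rw [hv]
      exact Ideal.mem_span_singleton_self _
    · obtain rfl | rfl : j = 0 ∨ j = 1 := by omega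
      · exact Matrix.det_isEmpty.symm
      · rw [Matrix.det_fin_one, Matrix.of_apply, hDv]
  · rw [hv]
    exact fitting_le_span_singleton _ hj _

end InitialStage

section InitialStage

variable {𝕜 : Type} [RCLike 𝕜] {m : ℕ} {X : FolSub.{u} 𝕜 m} {p : X.M}

/-- The conditions on the points of a neighbourhood on which monomial coordinates at `p` describe
the divisor and the distribution. -/
structure IsGoodPoint (c : CenteredChart p) (reg : Finset (Fin m)) {s : ℕ}
    (α : Fin s → Fin m → ℚ) (k : Fin X.E.length → Fin m) (q : X.M) : Prop where
  mem : q ∈ c.e.source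
  θ : ∀ hq, X.θ q = Submodule.span (AnGerm q)
    (chartFields c.mem_atlas (monoCoeff c.e reg α) (isAnAt_monoCoeff c.mem_atlas reg α) hq)
  near : ∀ i, q ∈ X.E.get i → p ∈ X.E.get i
  divisor : ∀ i, p ∈ X.E.get i → (q ∈ X.E.get i ↔ c.e q (k i) = 0)

theorem eventually_isGoodPoint (hX : X.IsFoliatedSubring) {c : CenteredChart p}
    {reg : Finset (Fin m)} {s : ℕ} {α : Fin s → Fin m → ℚ} (hα : ∀ i, ∀ j ∈ reg, α i j = 0)
    (hθ : X.θ p = Submodule.span (AnGerm p)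
      ((fun j => coordDer c j) '' (reg : Set (Fin m)) ∪
        Set.range fun i => diagField c regᶜ (α i)))
    {k : Fin X.E.length → Fin m}
    (hk : ∀ i, p ∈ X.E.get i → ∀ᶠ x in 𝓝 p, x ∈ X.E.get i ↔ c.e x (k i) = 0) :
    ∀ᶠ q in 𝓝 p, IsGoodPoint c reg α k q := by
  have h1 := hX.eventually_eq_span c.mem_atlas _ (isAnAt_monoCoeff c.mem_atlas reg α)
    c.mem_source (hθ.trans (congrArg _ (span_chartFields_monoCoeff c hα)))
  have h2 : ∀ᶠ q in 𝓝 p, ∀ i, q ∈ X.E.get i → p ∈ X.E.get i := by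
    rw [Filter.eventually_all]
    intro i
    by_cases hi : p ∈ X.E.get i
    · exact Eventually.of_forall fun _ _ => hi
    · filter_upwards [(hX.closed _ (List.get_mem _ _)).isOpen_compl.mem_nhds hi] with x hx h
      exact absurd h hx
  have h3 : ∀ᶠ q in 𝓝 p, ∀ i, p ∈ X.E.get i → (q ∈ X.E.get i ↔ c.e q (k i) = 0) := by
    rw [Filter.eventually_all]
    intro i
    by_cases hi : p ∈ X.E.get i
    · exact (hk i hi).mono fun x hx _ => hx
    · exact Eventually.of_forall fun _ h => absurd h hi
  filter_upwards [h1, h2, h3, c.e.open_source.mem_nhds c.mem_source] with q a1 a2 a3 a4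
  exact ⟨a4, a1, a2, a3⟩

/-- The hypersurfaces `{x_j = 0}`, and a second copy of `{x_v = 0}` in the place of the exceptional
divisor of the blowing-up of this hypersurface. -/
def hyperplane {N : AnMfd.{u} 𝕜 m} (ψ : OpenPartialHomeomorph N (Fin m → 𝕜))
    (Tor : Finset (Fin m)) (v : Fin m) (o : Option {j // j ∈ Tor}) : Set N :=
  o.elim ((ContMDiffMap.id : AnMap N N) ⁻¹' {x | ψ x v = 0}) fun j =>
    strictSet (ContMDiffMap.id : AnMap N N) {x | ψ x v = 0} {x | ψ x j = 0}

/-- The label of the hyperplane `{x_t = 0}`. -/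
def hyperplaneLabel (Tor : Finset (Fin m)) (v t : Fin m) : Option {j // j ∈ Tor} :=
  if h : t ∈ Tor ∧ t ≠ v then some ⟨t, h.1⟩ else none

/-- The ray of a hyperplane. -/
def hyperplaneRay (Tor : Finset (Fin m)) (v : Fin m) (o : Option {j // j ∈ Tor}) : Fin m → ℕ :=
  o.elim (Pi.single v 1) fun j => Pi.single j 1

section

variable {Tor : Finset (Fin m)} {v : Fin m}

theorem hyperplaneRay_label {t : Fin m} (ht : t ∈ Tor) :
    hyperplaneRay Tor v (hyperplaneLabel Tor v t) = Pi.single t 1 := by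
  rw [hyperplaneLabel]
  split_ifs with h
  · rfl
  · obtain rfl : t = v := by_contra fun h' => h ⟨ht, h'⟩
    rfl

theorem sum_smul_hyperplaneRay (w : Fin m → ℚ) :
    ∑ t ∈ Tor, w t • qray (hyperplaneRay Tor v (hyperplaneLabel Tor v t)) =
      fun t => if t ∈ Tor then w t else 0 := by
  rw [Finset.sum_congr rfl fun t ht => by rw [hyperplaneRay_label ht]]
  ext i
  rw [Finset.sum_apply]
  simp [qray, Pi.single_apply]

theorem strictSet_self {N M : AnMfd.{u} 𝕜 m} (σ : AnMap N M) (C : Set M) :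
    strictSet σ C C = ∅ := by
  rw [strictSet, Set.sdiff_self, Set.preimage_empty, closure_empty]

theorem strictSet_empty {N M : AnMfd.{u} 𝕜 m} (σ : AnMap N M) (C : Set M) :
    strictSet σ C ∅ = ∅ := by
  rw [strictSet, Set.empty_sdiff, Set.preimage_empty, closure_empty]

theorem mem_hyperplane_label {N : AnMfd.{u} 𝕜 m} (ψ : OpenPartialHomeomorph N (Fin m → 𝕜))
    {t : Fin m} (ht : t ∈ Tor) {y : N} (hy : y ∈ ψ.source) :
    y ∈ hyperplane ψ Tor v (hyperplaneLabel Tor v t) ↔ ψ y t = 0 := by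
  rw [hyperplaneLabel]
  split_ifs with h
  · exact mem_strictSet_iff _ ψ h.2 (fun _ _ => Iff.rfl) hy
  · obtain rfl : t = v := by_contra fun h' => h ⟨ht, h'⟩
    rfl

theorem notMem_hyperplane {N : AnMfd.{u} 𝕜 m} (ψ : OpenPartialHomeomorph N (Fin m → 𝕜))
    (hv : v ∈ Tor) {o : Option {j // j ∈ Tor}} (ho : ∀ t ∈ Tor, hyperplaneLabel Tor v t ≠ o)
    (y : N) : y ∉ hyperplane ψ Tor v o := by
  cases o with
  | none => exact absurd (dif_neg fun h => h.2 rfl) (ho v hv)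
  | some j =>
    by_cases hj : (j : Fin m) = v
    · change y ∉ strictSet _ _ {x | ψ x j = 0}
      rw [hj, strictSet_self]
      exact Set.notMem_empty _
    · exact absurd (dif_pos ⟨j.2, hj⟩) (ho j j.2)

theorem range_hyperplane {N : AnMfd.{u} 𝕜 m} (ψ : OpenPartialHomeomorph N (Fin m → 𝕜)) :
    Set.range (hyperplane ψ Tor v) =
      strictSet (ContMDiffMap.id : AnMap N N) {x | ψ x v = 0} ''
        {H | ∃ j ∈ Tor, H = {x | ψ x j = 0}} ∪
      {(ContMDiffMap.id : AnMap N N) ⁻¹' {x | ψ x v = 0}} := by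
  ext H
  constructor
  · rintro ⟨_ | j, rfl⟩
    · exact Or.inr rfl
    · exact Or.inl ⟨_, ⟨j, j.2, rfl⟩, rfl⟩
  · rintro (⟨_, ⟨j, hj, rfl⟩, rfl⟩ | rfl)
    · exact ⟨some ⟨j, hj⟩, rfl⟩
    · exact ⟨none, rfl⟩

end

theorem isToricChart_blowup_id {X : FolSub.{u} 𝕜 m} {ψ : OpenPartialHomeomorph X.M (Fin m → 𝕜)}
    (hψ : ψ ∈ IsManifold.maximalAtlas 𝓘(𝕜, Fin m → 𝕜) ω X.M) {reg : Finset (Fin m)} {v : Fin m}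
    (hv : v ∈ reg) {s : ℕ} {α : Fin s → Fin m → ℚ} (hα : ∀ i, ∀ j ∈ reg, α i j = 0)
    (hθ : ∀ q (hq : q ∈ ψ.source), X.θ q = Submodule.span (AnGerm q)
      (chartFields hψ (monoCoeff ψ reg α) (isAnAt_monoCoeff hψ reg α) hq))
    {L : List (Option (Option {j // j ∈ insert v regᶜ}))}
    (hE : (X.blowTransform X.M ContMDiffMap.id {x | ψ x v = 0}).E =
      L.map fun o => o.elim ∅ (hyperplane ψ (insert v regᶜ) v))
    {x : X.M → Fin m → 𝕜} (hx : ∀ y, ψ y = x y) :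
    IsToricChart (X.blowTransform X.M ContMDiffMap.id {x | ψ x v = 0}) x
      (hyperplane ψ (insert v regᶜ) v) (hyperplaneRay (insert v regᶜ) v) (insert v regᶜ)
      (weightSpace reg v α) ψ (hyperplaneLabel (insert v regᶜ) v) := by
  have hvT : v ∈ insert v regᶜ := Finset.mem_insert_self _ _
  refine
    { atlas := hψ
      inj := fun s hs t ht hst => ?_
      mem := fun t ht y hy => mem_hyperplane_label ψ ht hy
      off := fun l hl y _ => notMem_hyperplane ψ hvT hl y
      coord := fun y _ i hi => ?_
      coord' := fun y _ i _ => (congrFun (hx y) i).symm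
      indep := fun w hw t ht => ?_
      field := fun y hy => ?_ }
  · have h : (Pi.single s 1 : Fin m → ℕ) = Pi.single t 1 := by
      rw [← hyperplaneRay_label hs, hst, hyperplaneRay_label ht]
    by_contra hne
    have h1 := congrFun h s
    rw [Pi.single_eq_same, Pi.single_eq_of_ne hne] at h1
    exact one_ne_zero h1
  · rw [Finset.prod_congr rfl fun t ht => by rw [hyperplaneRay_label ht],
      Finset.prod_eq_single i]
    · rw [Pi.single_eq_same, pow_one]
      exact (congrFun (hx y) i).symm
    · intro t _ hti
      rw [Pi.single_eq_of_ne hti.symm, pow_zero]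
    · exact fun h => absurd hi h
  · rw [sum_smul_hyperplaneRay] at hw
    have h := congrFun hw t
    rwa [if_pos ht] at h
  · change strictField (ContMDiffMap.id : AnMap X.M X.M) _ y (X.θ y) = _
    refine ((strictField_id (N := X.M) _ _ _).trans
      (congrArg (fun Θ => derLog _ y ⊓ Θ) (hθ y hy))).trans ?_
    refine derLog_inf_span_chartFields hψ hy hv hα (fun w => ?_) (fun D hD => ?_) fun D hD => ?_
    · rw [Set.mem_ofPred_eq, sum_smul_hyperplaneRay]
    · exact mem_derLog_of_toricChart (Y := X.blowTransform X.M ContMDiffMap.id {x | ψ x v = 0})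
        hψ (fun t ht y hy => mem_hyperplane_label ψ ht hy)
        (fun l hl y _ => notMem_hyperplane ψ hvT hl y) hE hy hD
    · exact dvd_of_mem_derLog hψ hy hD (List.mem_append_right _ (List.mem_singleton_self _))
        (Eventually.of_forall fun _ => Iff.rfl)

end InitialStage

section InitialStage

variable {𝕜 : Type} [RCLike 𝕜] {m : ℕ} {X : FolSub.{u} 𝕜 m} {p : X.M}

/-- The blowing-up of the hypersurface `{v = 0}` of a small neighbourhood. -/
theorem exists_initial_stage (hX : X.IsFoliatedSubring) {c : CenteredChart p}
    {reg : Finset (Fin m)} (hc : X.IsMonomialCoord c reg) {v : Fin m} (hv : v ∈ reg) {s : ℕ}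
    {α : Fin s → Fin m → ℚ} (hα : ∀ i, ∀ j ∈ reg, α i j = 0) (hd : 1 ≤ X.leafDim)
    (hθ : X.θ p = Submodule.span (AnGerm p)
      ((fun j => coordDer c j) '' (reg : Set (Fin m)) ∪
        Set.range fun i => diagField c regᶜ (α i)))
    {k : Fin X.E.length → Fin m} (hk1 : ∀ i, p ∈ X.E.get i → k i ∉ reg)
    (hk2 : ∀ i, p ∈ X.E.get i → ∀ᶠ x in 𝓝 p, x ∈ X.E.get i ↔ c.e x (k i) = 0)
    (hk3 : ∀ i i', p ∈ X.E.get i → p ∈ X.E.get i' → k i = k i' → i = i')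
    {U : TopologicalSpace.Opens X.M} (hpU : p ∈ U) (hU : ∀ q ∈ U, IsGoodPoint c reg α k q) :
    ∃ (S : Stage X c.e (insert v regᶜ) (weightSpace reg v α) v)
      (τ₀ : S.Y.M → (X.restrict U).M), (∀ y, S.π y = (τ₀ y).1) ∧
      ∀ Z τ, CombSeq S.Y (Set.range S.H) Z τ →
        CombSeq (X.restrict U) {H | ∃ j, (j ∉ reg ∨ j = v) ∧ H = {x | c.e x.1 j = 0}} Z
          fun y => τ₀ (τ y) := by
  classical
  have hvT : v ∈ insert v regᶜ := Finset.mem_insert_self _ _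
  have hne : Nonempty U := ⟨⟨p, hpU⟩⟩
  obtain ⟨ψ, hψ, hs, hψe⟩ : ∃ ψ ∈ IsManifold.maximalAtlas 𝓘(𝕜, Fin m → 𝕜) ω (X.restrict U).M,
      (∀ y, y ∈ ψ.source) ∧ ∀ y, ψ y = c.e y.1 :=
    ⟨c.e.subtypeRestr hne, subtypeRestr_mem_maximalAtlas c.mem_atlas U hne, fun y => by
      rw [OpenPartialHomeomorph.subtypeRestr_source]
      exact (hU y.1 y.2).mem, fun y => rfl⟩
  have hset : ∀ j, {x : (X.restrict U).M | c.e x.1 j = 0} = {x | ψ x j = 0} := fun j =>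
    Set.ext fun x => by rw [Set.mem_ofPred_eq, Set.mem_ofPred_eq, hψe]
  have hin : ∀ i, p ∈ X.E.get i →
      X.M.incl U ⁻¹' X.E.get i = {x : X.M.openSub U | ψ x (k i) = 0} := fun i hi =>
    Set.ext fun y => ((hU y.1 y.2).divisor i hi).trans
      (iff_of_eq (congrArg (· = (0 : 𝕜)) (congrFun (hψe y) (k i)).symm))
  have hout : ∀ i, p ∉ X.E.get i → X.M.incl U ⁻¹' X.E.get i = ∅ := fun i hi =>
    Set.eq_empty_of_forall_notMem fun y hy => hi ((hU y.1 y.2).near i hy)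
  have hθU : ∀ q (hq : q ∈ ψ.source), (X.restrict U).θ q = Submodule.span (AnGerm q)
      (chartFields hψ (monoCoeff ψ reg α) (isAnAt_monoCoeff hψ reg α) hq) := fun q hq => by
    refine restrict_field c.mem_atlas hψ hψe (hU q.1 q.2).mem hq ((hU q.1 q.2).θ _)
      fun H hH => ?_
    obtain ⟨i, rfl⟩ := List.mem_iff_get.1 hH
    by_cases hi : p ∈ X.E.get i
    · exact Or.inr ⟨k i, hk1 i hi, fun y => Set.ext_iff.1 (hin i hi) y⟩
    · exact Or.inl fun y hy => hi ((hU y.1 y.2).near i hy)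
  let L : List (Option (Option {j // j ∈ insert v regᶜ})) :=
    (List.ofFn fun i => if h : p ∈ X.E.get i then
      some (some ⟨k i, Finset.mem_insert_of_mem (Finset.mem_compl.2 (hk1 i h))⟩) else none) ++
    [some none]
  have hL : ((X.restrict U).blowTransform (X.restrict U).M ContMDiffMap.id {x | ψ x v = 0}).E =
      L.map fun o => o.elim ∅ (hyperplane ψ (insert v regᶜ) v) := by
    rw [List.map_append, List.map_ofFn]
    refine congrArg (· ++ _) ?_
    have hmap : ∀ {A B C : Type u} (f : A → B) (g : B → C) (l : List A),
        (l.map f).map g = List.ofFn fun i => g (f (l.get i)) := fun f g l => by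
      conv_lhs => rw [← List.ofFn_get l, List.map_ofFn, List.map_ofFn]
      rfl
    refine (hmap _ _ _).trans (congrArg List.ofFn (funext fun i => ?_))
    simp only [Function.comp_apply]
    by_cases hi : p ∈ X.E.get i
    · rw [dif_pos hi, hin i hi]
      rfl
    · rw [dif_neg hi, hout i hi]
      exact strictSet_empty _ _
  have hmemL : ∀ i (hi : p ∈ X.E.get i),
      some (some ⟨k i, Finset.mem_insert_of_mem (Finset.mem_compl.2 (hk1 i hi))⟩) ∈ L :=
    fun i hi => List.mem_append_left _ (List.mem_ofFn.2 ⟨i, dif_pos hi⟩)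
  have hadm : (X.restrict U).IsAdmissibleCenter {x | ψ x v = 0} := by
    have hlen : (X.restrict U).E.length = X.E.length := List.length_map _
    have hget : ∀ i, (X.restrict U).E.get i = X.M.incl U ⁻¹' X.E.get (Fin.cast hlen i) :=
      fun i => List.getElem_map _
    have hp : ∀ i, ((X.restrict U).E.get i).Nonempty → p ∈ X.E.get (Fin.cast hlen i) :=
      fun i ⟨y, hy⟩ => by
        rw [hget] at hy
        exact (hU y.1 y.2).near _ hy
    refine isAdmissibleCenter_hyperplane hψ hs (fun y => Iff.rfl)
      (k := fun i => k (Fin.cast hlen i)) (fun i hi y => ?_) (fun i i' hi hi' h => ?_) hd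
      fun q => ?_
    · rw [hget, hin _ (hp i hi)]
      rfl
    · exact Fin.cast_injective hlen (hk3 _ _ (hp i hi) (hp i' hi') h)
    · obtain ⟨D, hD⟩ := exists_vfield hψ (hs q) fun k => toGerm
        (monoCoeff ψ reg α (Sum.inl ⟨v, hv⟩) k) (isAnAt_monoCoeff hψ reg α _ k q (hs q))
      refine ⟨D, ?_, ?_⟩
      · rw [hθU q (hs q)]
        exact Submodule.subset_span ⟨_, hD⟩
      · rw [hD, toGerm_monoCoeff_inl hψ (hs q), if_pos rfl]
  let S : Stage X c.e (insert v regᶜ) (weightSpace reg v α) v :=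
    { Y := (X.restrict U).blowTransform (X.restrict U).M ContMDiffMap.id {x | ψ x v = 0}
      π := (X.M.incl U).comp ContMDiffMap.id
      ne := hne
      π_mem := fun y => (hU y.1 y.2).mem
      ι := Option {j // j ∈ insert v regᶜ}
      finite := inferInstance
      H := hyperplane ψ (insert v regᶜ) v
      ρ := hyperplaneRay (insert v regᶜ) v
      dim := rfl
      ring := fun q => map_pull_comp (X.M.incl U) ContMDiffMap.id q _
      L := L
      divisor := hL
      pairwise := by
        refine List.pairwise_append.2 ⟨List.pairwise_ofFn.2 fun i i' hii' l h h' => ?_,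
          List.pairwise_singleton _ _, fun a ha b hb l h h' => ?_⟩
        · split_ifs at h h' with hi hi'
          rw [← h] at h'
          exact hii'.ne (hk3 i i' hi hi'
            (congrArg Subtype.val (Option.some.inj (Option.some.inj h'))).symm)
        · rw [List.mem_singleton.1 hb] at h'
          obtain ⟨i, rfl⟩ := List.mem_ofFn.1 ha
          split_ifs at h with hi
          rw [← h] at h'
          exact Option.some_ne_none _ (Option.some.inj h').symm
      closed := fun l => by
        cases l with
        | none => exact hadm.closed
        | some j => exact isClosed_closure
      v_mem := hvT
      supp := fun l i hi => by
        have h : ∀ j ∈ insert v regᶜ, (Pi.single j 1 : Fin m → ℕ) i = 0 := fun j hj =>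
          Pi.single_eq_of_ne (fun h : i = j => hi (h ▸ hj)) _
        cases l with
        | none => exact h v hvT
        | some j => exact h j j.2
      label := fun l hl => by
        rcases l with _ | ⟨j, hj⟩
        · exact Or.inl (List.mem_append_right _ (List.mem_singleton_self _))
        · by_cases hjv : j = v
          · subst hjv
            exact absurd (strictSet_self _ _) hl.ne_empty
          · have hjr : j ∉ reg := by
              rw [Finset.mem_insert, Finset.mem_compl] at hj
              exact hj.resolve_left hjv
            by_cases h : ∃ i, p ∈ X.E.get i ∧ k i = j
            · obtain ⟨i, hi, rfl⟩ := h
              exact Or.inl (hmemL i hi)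
            · push Not at h
              refine Or.inr ⟨j, hj, hjv, rfl, hc.single_notMem_weightSpace hX hv hα hθ hjr
                fun H hH => ?_⟩
              obtain ⟨i, rfl⟩ := List.mem_iff_get.1 hH
              by_cases hi : p ∈ X.E.get i
              · exact Or.inr ⟨k i, h i hi, hk2 i hi⟩
              · exact Or.inl ((hX.closed _ hH).isOpen_compl.mem_nhds hi)
      chart := fun q => ⟨ψ, hyperplaneLabel (insert v regᶜ) v, hs q,
        isToricChart_blowup_id hψ hv hα hθU hL hψe⟩ }
  refine ⟨S, fun y => y, fun y => rfl, fun Z τ hτ => ?_⟩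
  have hF : {H : Set (X.restrict U).M | ∃ j, (j ∉ reg ∨ j = v) ∧ H = {x | c.e x.1 j = 0}} =
      {H | ∃ j ∈ insert v regᶜ, H = {x | ψ x j = 0}} := by
    ext H
    refine exists_congr fun j => and_congr ?_ (by rw [hset])
    rw [Finset.mem_insert, Finset.mem_compl, or_comm]
  rw [hF]
  refine CombSeq.step (X.restrict U) _ {x | ψ x v = 0} (X.restrict U).M ContMDiffMap.id Z τ
    ⟨{{x | ψ x v = 0}}, ?_, Set.finite_singleton _, Set.singleton_nonempty _,
      (Set.sInter_singleton _).symm⟩ hadm (isBlowup_id hψ hs fun y => Iff.rfl) ?_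
  · exact Set.singleton_subset_iff.2 ⟨v, hvT, rfl⟩
  · exact (congrArg (fun F : Set (Set S.Y.M) => CombSeq S.Y F Z τ) (range_hyperplane ψ)).mp hτ

end InitialStage

theorem mainTheorem4 {𝕜 : Type} [RCLike 𝕜] {m : ℕ} (X : FolSub.{u} 𝕜 m)
    (hX : X.IsFoliatedSubring) (p : X.M) (ν : ℕ) (hν : 1 < ν)
    (P : FolSub.PreparedForm X p ν) :
    ∃ U : TopologicalSpace.Opens X.M, p ∈ U ∧ (U : Set X.M) ⊆ P.c.e.source ∧
      ∀ M₀ : TopologicalSpace.Opens X.M, p ∈ M₀ → M₀ ≤ U →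
        ∃ (Y : FolSub.{u} 𝕜 m) (τ : Y.M → (X.restrict M₀).M),
          CombSeq (X.restrict M₀) (P.components M₀) Y τ ∧
          (∀ q : Y.M,
            (∃ φ : AnGerm q, P.pulledIdeal (fun y => (τ y).1) q = Ideal.span {φ}) ∧
            (P.pulledIdeal (fun y => (τ y).1) q ≠ ⊤ → ∃ H ∈ Y.E, q ∈ H)) ∧
          ∀ q : Y.M, (τ q).1 = p → Y.nu q < X.nu p := by
  classical
  obtain ⟨s, α₀, hs, hθ₀⟩ := P.monomial.basis
  obtain ⟨α, hα, hθ⟩ : ∃ α : Fin s → Fin m → ℚ, (∀ i, ∀ j ∈ P.reg, α i j = 0) ∧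
      X.θ p = Submodule.span (AnGerm p) ((fun j => coordDer P.c j) '' (P.reg : Set (Fin m)) ∪
        Set.range fun i => diagField P.c P.regᶜ (α i)) := by
    refine ⟨fun i j => if j ∈ P.reg then 0 else α₀ i j, fun i j hj => if_pos hj, ?_⟩
    have h : (fun i => diagField P.c P.regᶜ fun j => if j ∈ P.reg then 0 else α₀ i j) =
        fun i => ∑ j ∈ P.regᶜ, (α₀ i j : 𝕜) • coordGerm P.c j • coordDer P.c j :=
      funext fun i => Finset.sum_congr rfl fun j hj => by
        beta_reduce
        rw [if_neg (Finset.mem_compl.1 hj)]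
    rw [hθ₀, h]
  have hcard : 1 ≤ P.reg.card := Finset.card_pos.2 ⟨P.v, P.v_mem⟩
  have hdim : (insert P.v P.regᶜ)ᶜ.card +
      Module.finrank ℚ (weightSpace P.reg P.v α) = X.leafDim := by
    rw [finrank_weightSpace P.v_mem hα (linearIndependent_of_finrank ((hX.rank p).trans hs.symm) hθ),
      Finset.compl_insert, compl_compl, Finset.card_erase_of_mem P.v_mem, ← hs]
    omega
  obtain ⟨k, hk1, hk2, hk3⟩ := P.monomial.exists_component hX P.v
  obtain ⟨V, hV, hVo, hpV⟩ := eventually_nhds_iff.1 (eventually_isGoodPoint hX hα hθ hk2)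
  refine ⟨⟨V, hVo⟩, hpV, fun q hq => (hV q hq).mem, fun M₀ hp hM₀ => ?_⟩
  obtain ⟨S, τ₀, h1, h2⟩ := exists_initial_stage hX P.monomial P.v_mem hα (by omega) hθ hk1 hk2 hk3
    hp fun q hq => hV q (hM₀ hq)
  obtain ⟨Y, τ, h3, h4, h5⟩ := S.exists_principal hν P rfl rfl rfl rfl hθ hdim
  simp only [h1] at h4 h5
  refine ⟨Y, fun y => τ₀ (τ y), h2 Y τ h3, h4, fun q hq => ?_⟩
  rw [P.nu_eq]
  exact h5 q hq
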